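/- Let $M^4$ be a connected smooth (immersed) submanifold of $\mathbb R^6$ with second fundamental form $\operatorname{II}$. For an orthonormal basis $e=(e_1,\dots,e_4)$ of $T_pM$ let $|\operatorname{II}_p|_e$ denote the linear space of the symmetric $4\times4$ matrices $\big(\nu\cdot\operatorname{II}(e_i,e_j)\big)_{ij}$, $\nu\in N_pM$. Assume: (1) $M$ is substantial (it lies in no proper affine subspace of $\mathbb R^6$) and austere (for every normal vector $\nu$ the eigenvalues of $\nu\cdot\operatorname{II}$, counted with multiplicity, are symmetric about $0$). (2) $M$ is 2-ruled: there is a smooth field $E$ of 2-planes $E_p\subset T_pM$ such that, for each $p$, a neighbourhood of $p$ in the affine plane $p+E_p$ lies in $M$ (through a continuous lift at $p$) and $E$ is constant along it. (3) For each $p\in M$ there is an orthonormal basis $e$ of $T_pM$ such that $|\operatorname{II}_p|_e$ is contained in $$\mathcal Q_B=\left\{\begin{pmatrix} m&0&b_1&b_2\\0&m&b_3&b_4\\b_1&b_3&-m&0\\b_2&b_4&0&-m\end{pmatrix}\right\}$$ (that is, $M$ is of Type B); the reflection $\mathsf R$ of $T_pM$ that fixes $e_1,e_2$ and reverses $e_3,e_4$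 satisfies $\mathsf R(E_p)=E_p$; and the quadratic form $\det$, restricted to the space $\mathcal B$ of the upper right $2\times2$ blocks of the matrices in $|\operatorname{II}_p|_e$, has rank $2$. Then there are 3-dimensional linear subspaces $V_1,V_2$ with $\mathbb R^6=V_1\oplus V_2$ (a direct sum, not necessarily orthogonal) and classical helicoids $H_\alpha\subset V_\alpha$ such that $M$ is congruent, by an isometry of $\mathbb R^6$, to an open subset of the Cartesian product $H_1\times H_2=\{y+z: y\in H_1,\ z\in H_2\}$ (if $M$ is only immersed, this is said of its image). Here a classical helicoid in $V_\alpha$ is a surface $\{s(\cos u\,r+\sin u\,r')+hu\,a : s,u\in\mathbb R\}$ with $(r,r',a)$ an orthonormal basis of $V_\alpha$ and $h\neq0$; its axis is $\mathbb R a$. Moreover the rulings of $H_1$ are orthogonal to the rulings of $H_2$, and each axis is orthogonal to the rulings of the other helicoid. The two axes need not be orthogonal to each other: there is an $M$ satisfying all the hypotheses such that in every such representation of $M$ the axes of $H_1$ and $H_2$ are not orthogonal. -/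

import Mathlib

open scoped Manifold ContDiff

noncomputable section

/-- Euclidean 4-space: the model of the coordinate charts of a 4-manifold. -/
abbrev E4 : Type := EuclideanSpace ℝ (Fin 4)

/-- Euclidean 6-space: the ambient space. -/
abbrev E6 : Type := EuclideanSpace ℝ (Fin 6)

/-! ### Second fundamental form of an immersed 4-manifold in 6-space -/

section Immersed

variable {X : Type*} [TopologicalSpace X] [ChartedSpace E4 X]

/-- The differential of `F` at `x`; the tangent space of `X` at `x` is identified with `E4` by the
preferred chart at `x`. -/
def tangentMap4 (F : X → E6) (x : X) : E4 →L[ℝ] E6 :=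
  mfderiv (𝓡 4) 𝓘(ℝ, E6) F x

/-- The tangent space of the immersed submanifold, as a linear subspace of 6-space. -/
def tangentPlane (F : X → E6) (x : X) : Submodule ℝ E6 :=
  LinearMap.range (tangentMap4 F x).toLinearMap

/-- The expression of `F` in the preferred chart at `x`. -/
def chartRep (F : X → E6) (x : X) : E4 → E6 :=
  F ∘ (chartAt E4 x).symm

/-- The second fundamental form `II (u, v)`: the normal component of the Euclidean derivative
along `u` of the coordinate vector field `v`. -/
def secondFF (F : X → E6) (x : X) (u v : E4) : E6 :=
  (tangentPlane F x)ᗮ.starProjection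
    (fderiv ℝ (fderiv ℝ (chartRep F x)) (chartAt E4 x x) u v)

/-- `e` represents an orthonormal basis of the tangent space at `x` (for the induced metric). -/
def IsOrthonormalFrame (F : X → E6) (x : X) (e : Fin 4 → E4) : Prop :=
  Orthonormal ℝ (fun i => tangentMap4 F x (e i))

/-- The matrix of the second fundamental form in the direction `ν`, in the frame `e`. -/
def shapeMatrix (F : X → E6) (x : X) (e : Fin 4 → E4) :
    E6 →ₗ[ℝ] Matrix (Fin 4) (Fin 4) ℝ where
  toFun ν := Matrix.of fun i j => inner ℝ ν (secondFF F x (e i) (e j))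
  map_add' ν μ := by ext i j; simp [inner_add_left]
  map_smul' c ν := by ext i j; simp [inner_smul_left]

/-- The space `|II|` at `x` of the second fundamental forms in the various normal directions,
as a space of symmetric matrices in the frame `e`. -/
def secondFFSpace (F : X → E6) (x : X) (e : Fin 4 → E4) :
    Submodule ℝ (Matrix (Fin 4) (Fin 4) ℝ) :=
  (tangentPlane F x)ᗮ.map (shapeMatrix F x e)

/-- Austere: in every normal direction the eigenvalues of the second fundamental form, counted with
multiplicity, are symmetrically arranged around zero. -/
def IsAustere (F : X → E6) : Prop :=
  ∀ (x : X) (e : Fin 4 → E4), IsOrthonormalFrame F x e →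
    ∀ S ∈ secondFFSpace F x e, S.charpoly.roots.map (fun t => -t) = S.charpoly.roots

/-- `F` is ruled by 2-planes tangent to `E`: `E` is a smooth field of tangent 2-planes, and through
each point there is a piece of the affine plane `F x + E x` lying in the submanifold, along which
the plane field is constant. -/
structure IsTwoRuled (F : X → E6) (E : X → Submodule ℝ E6) : Prop where
  finrank_eq : ∀ x, Module.finrank ℝ (E x) = 2
  le_tangent : ∀ x, E x ≤ tangentPlane F x
  smooth : ContMDiff (𝓡 4) 𝓘(ℝ, E6 →L[ℝ] E6) ∞ (fun x => (E x).starProjection)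
  leaf : ∀ x, ∃ ε > (0 : ℝ), ∃ σ : E x → X,
    ContinuousOn σ (Metric.ball 0 ε) ∧ σ 0 = x ∧
      ∀ v ∈ Metric.ball (0 : E x) ε, F (σ v) = F x + (v : E6) ∧ E (σ v) = E x

/-- The reflection `R` of the tangent space attached to the frame `e`: it fixes the first two frame
vectors and reverses the last two (extended by zero on the normal space). -/
def frameReflection (F : X → E6) (x : X) (e : Fin 4 → E4) : E6 →ₗ[ℝ] E6 where
  toFun w := ∑ i, ((![1, 1, -1, -1] : Fin 4 → ℝ) i * inner ℝ (tangentMap4 F x (e i)) w) •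
    tangentMap4 F x (e i)
  map_add' w z := by
    simp only [inner_add_right, mul_add, add_smul, Finset.sum_add_distrib]
  map_smul' c w := by
    simp only [inner_smul_right, Finset.smul_sum, smul_smul, RingHom.id_apply]
    refine Finset.sum_congr rfl fun i _ => ?_
    congr 1
    ring

end Immersed

/-! ### The maximal austere space of type B -/

/-- The maximal austere space `Q_B`. -/
def QB : Set (Matrix (Fin 4) (Fin 4) ℝ) :=
  {S | ∃ m b₁ b₂ b₃ b₄ : ℝ,
    S = !![m, 0, b₁, b₂; 0, m, b₃, b₄; b₁, b₃, -m, 0; b₂, b₄, 0, -m]}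

/-- The upper right 2×2 block of a 4×4 matrix. -/
def upperRightBlock : Matrix (Fin 4) (Fin 4) ℝ →ₗ[ℝ] Matrix (Fin 2) (Fin 2) ℝ where
  toFun S := S.submatrix ![0, 1] ![2, 3]
  map_add' _ _ := rfl
  map_smul' _ _ := rfl

/-- The polarization of the quadratic form `det` on 2×2 matrices:
`detPolar A B = det (A + B) - det A - det B`. -/
def detPolar : LinearMap.BilinForm ℝ (Matrix (Fin 2) (Fin 2) ℝ) :=
  LinearMap.mk₂ ℝ (fun A B => A 0 0 * B 1 1 + A 1 1 * B 0 0 - A 0 1 * B 1 0 - A 1 0 * B 0 1)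
    (by intro A A' B; simp only [Matrix.add_apply]; ring)
    (by intro c A B; simp only [Matrix.smul_apply, smul_eq_mul]; ring)
    (by intro A B B'; simp only [Matrix.add_apply]; ring)
    (by intro c A B; simp only [Matrix.smul_apply, smul_eq_mul]; ring)

theorem detPolar_eq (A B : Matrix (Fin 2) (Fin 2) ℝ) :
    detPolar A B = (A + B).det - A.det - B.det := by
  simp only [detPolar, LinearMap.mk₂_apply, Matrix.det_fin_two, Matrix.add_apply]
  ring

/-- The rank of the quadratic form `det` restricted to a space of 2×2 matrices. -/
def detRank (W : Submodule ℝ (Matrix (Fin 2) (Fin 2) ℝ)) : ℕ :=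
  Module.finrank ℝ (LinearMap.range (detPolar.domRestrict₁₂ W W))

section Immersed

variable {X : Type*} [TopologicalSpace X] [ChartedSpace E4 X]

/-- `F` is of type B (at each point `|II|` lies in `Q_B` for a suitable orthonormal basis of the
tangent space), the reflection `R` belonging to `Q_B` preserves the plane field `E`, and `det` has
rank 2 on the space of upper right blocks of `|II|`. -/
def IsTypeBWithInvariantRuling (F : X → E6) (E : X → Submodule ℝ E6) : Prop :=
  ∀ x, ∃ e : Fin 4 → E4, IsOrthonormalFrame F x e ∧
    (∀ S ∈ secondFFSpace F x e, S ∈ QB) ∧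
    (E x).map (frameReflection F x e) = E x ∧
    detRank ((secondFFSpace F x e).map upperRightBlock) = 2

/-- `F` is a smooth immersion of a 4-manifold in 6-space which is substantial, austere and ruled by
the 2-planes `E`, of type B with `E = R(E)`, and with `det` of rank 2 on the upper right blocks. -/
structure IsRuledAustereB (F : X → E6) (E : X → Submodule ℝ E6) : Prop where
  smooth : ContMDiff (𝓡 4) 𝓘(ℝ, E6) ∞ F
  immersion : ∀ x, Function.Injective (tangentMap4 F x)
  substantial : affineSpan ℝ (Set.range F) = ⊤
  austere : IsAustere F
  ruled : IsTwoRuled F E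
  typeB : IsTypeBWithInvariantRuling F E

end Immersed

/-! ### Products of helicoids -/

/-- A classical helicoid in a 3-dimensional linear subspace of 6-space, with axis through 0:
`r₁, r₂` span the plane of the directions of the rulings, and `ax` is the direction of the axis. -/
structure Helicoid where
  r₁ : E6
  r₂ : E6
  ax : E6
  pitch : ℝ
  orthonormal : Orthonormal ℝ ![r₁, r₂, ax]
  pitch_ne_zero : pitch ≠ 0

namespace Helicoid

/-- The direction of the ruling at the angle `u`. -/
def ruling (H : Helicoid) (u : ℝ) : E6 := Real.cos u • H.r₁ + Real.sin u • H.r₂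

/-- The points of the helicoid. -/
def carrier (H : Helicoid) : Set E6 :=
  {q | ∃ s u : ℝ, q = s • H.ruling u + (H.pitch * u) • H.ax}

/-- The 3-dimensional subspace that contains the helicoid. -/
def space (H : Helicoid) : Submodule ℝ E6 := Submodule.span ℝ {H.r₁, H.r₂, H.ax}

end Helicoid

/-- The Cartesian product of two helicoids inside the sum of their 3-spaces. -/
def helicoidProduct (H₁ H₂ : Helicoid) : Set E6 :=
  {q | ∃ y ∈ H₁.carrier, ∃ z ∈ H₂.carrier, q = y + z}

/-- 6-space is the direct sum of the two 3-spaces, the rulings of the helicoids are mutually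
orthogonal, and each axis is orthogonal to the rulings of the other helicoid; nothing is said about
the angle between the two axes. -/
structure HelicoidsSplit (H₁ H₂ : Helicoid) : Prop where
  compl : IsCompl H₁.space H₂.space
  rulings : ∀ u v : ℝ, inner ℝ (H₁.ruling u) (H₂.ruling v) = 0
  axis_left : ∀ v : ℝ, inner ℝ H₁.ax (H₂.ruling v) = 0
  axis_right : ∀ u : ℝ, inner ℝ (H₁.ruling u) H₂.ax = 0

/-- `S` is congruent (by a Euclidean isometry of 6-space) to an open subset of `T`. -/
def CongruentToOpenSubset (S T : Set E6) : Prop :=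
  ∃ Φ : E6 ≃ᵢ E6, ∃ O : Set E6, IsOpen O ∧ Φ '' S = O ∩ T

end

/-!
Let `E` be the ruling, `e₀`, `e₁` an orthonormal frame of it, and parametrize the submanifold near a
point by `(t, s) ↦ γ t + s₀ e₀ t + s₁ e₁ t` (`exists_ruledChart`). Along a leaf, the part of the
tangent space perpendicular to the ruling is the affine pencil `s ↦ C + s₀ D₀ + s₁ D₁` of the normal
derivatives of `γ` and of the `eᵢ`. The second fundamental form is given by the `Dᵢ` and by the
second covariant derivatives of `γ` and the `eᵢ`, which are affine in `s` too. That `det` has rank 2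
says that a hyperdeterminant of the `Dᵢ`, modulo the pencil, does not vanish (`Nondeg`).

*Pointwise.* The ruling is invariant under the reflection, so it is one of the two eigenspaces or it
contains a line of each. In the first case all second covariant derivatives lie in the plane of the
pencil; in the second there is a mixed frame, in which `D_g x` and `D_f y` lie in that plane, and the
second covariant derivatives in the directions `f`, `g` do (`TypeBPoint.alternative`).

*Flat leaves.* If the second covariant derivatives lie in the pencil for all small `s`, their
coefficients do not depend on `s` (`exists_const_coeff`), so that exchanging the order of third
derivatives gives an algebraic identity for `C` and `D` (`RulingFrame.curvatureTerm_eq`). Its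
solutions are the pencils of products of two ruled surfaces, `D_g x = 0 = D_f y` with orthogonal
remaining derivatives (`exists_splitPencil`).

*Mixed leaves.* If there is a mixed frame for all small `s`, the bivector `∑ᵢ D_f eᵢ ∧ D_g eᵢ`
vanishes modulo the pencil for all `s`, and this again makes the pencil split, with orthogonal axes
(`MixedFrame.splitPencil`).

*Integration.* In either case an adapted moving frame satisfies the structure equations of a product
of two helicoids (`SplitFrame.structure_equations`), and mixed leaves turn out to be flat. Since the
points that are not flat form an open set, which would consist of mixed points, all points are flat,
and the submanifold is locally a product of two helicoids (`RuledPatch.exists_helicoidPair`).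

*Globally.* A product of helicoids is a closed set, given by two analytic equations and parametrized
analytically; the identity theorem and the connectedness of the submanifold show that the local
products agree, and the image is relatively open in the product (`IsRuledAustereB.congruent`).

*Oblique axes.* Conversely, every product of two helicoids whose rulings are orthogonal to each other
and to both axes satisfies the hypotheses (`HelicoidPair.isRuledAustereB`). The translations that
preserve such a product form the lattice spanned by half a turn along each axis, which is determined
up to isometry by the product (`HelicoidPair.exists_same_value`). For the product
`HelicoidPair.oblique` its norms are the values of `4 k² + 4 k l + 5 l²`, up to a factor; the lattice is
not rectangular (`HelicoidPair.not_diagonal`), so the axes are oblique in every representation.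
-/

noncomputable section

/-! ### Pencils of normal derivatives along a leaf -/

/-- Cayley's hyperdeterminant of the `2 × 2 × 2` array with the two slices `A` and `B`, up to sign:
the discriminant of the quadratic form `det (x A + y B)`. -/
def hyperdet (A B : Fin 2 → Fin 2 → ℝ) : ℝ :=
  4 * (A 0 0 * A 1 1 - A 0 1 * A 1 0) * (B 0 0 * B 1 1 - B 0 1 * B 1 0) -
    (A 0 0 * B 1 1 + A 1 1 * B 0 0 - A 0 1 * B 1 0 - A 1 0 * B 0 1) ^ 2

section Algebra

variable {H : Type*} [AddCommGroup H] [Module ℝ H]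

/-- The vectors `D a i` are nondegenerate modulo the plane spanned by `M 0` and `M 1`: two
functionals that annihilate this plane turn `D` into an array with nonzero hyperdeterminant. -/
def Nondeg (D : Fin 2 → Fin 2 → H) (M : Fin 2 → H) : Prop :=
  ∃ ν : Fin 2 → (H →ₗ[ℝ] ℝ), (∀ k a, ν k (M a) = 0) ∧
    hyperdet (fun a i => ν 0 (D a i)) (fun a i => ν 1 (D a i)) ≠ 0

/-- The point of the pencil with coordinates `s` along the ruling. -/
def pencil (C : Fin 2 → H) (D : Fin 2 → Fin 2 → H) (s : Fin 2 → ℝ) (a : Fin 2) : H :=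
  C a + ∑ i, s i • D a i

/-- Along a ray on which the pencil is regular, an affine family of vectors inside the planes of
the pencil has constant coefficients: the normal components show that the coefficients do not
change along the ray, and they can then be read off at its origin. -/
theorem eq_zero_of_ray {C Dσ : Fin 2 → H} {Z : H} {ε : ℝ} (hε : 0 < ε)
    (hC : ∀ m : Fin 2 → ℝ, ∑ a, m a • C a = 0 → m = 0)
    (ν : Fin 2 → (H →ₗ[ℝ] ℝ)) (hν : ∀ k a, ν k (C a) = 0)
    (hq : ν 0 (Dσ 0) * ν 1 (Dσ 1) - ν 0 (Dσ 1) * ν 1 (Dσ 0) ≠ 0)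
    (h : ∀ τ : ℝ, |τ| ≤ ε → ∃ m : Fin 2 → ℝ, τ • Z = ∑ a, m a • (C a + τ • Dσ a)) : Z = 0 := by
  obtain ⟨m, hm⟩ := h ε (by rw [abs_of_pos hε])
  obtain ⟨n, hn⟩ := h (ε / 2) (by rw [abs_of_pos (by positivity)]; linarith)
  simp only [Fin.sum_univ_two] at hm hn hC
  have hm' : ∀ k, ν k Z = m 0 * ν k (Dσ 0) + m 1 * ν k (Dσ 1) := fun k => by
    have := congrArg (ν k) hm
    simp only [map_add, map_smul, hν, smul_eq_mul] at this
    have h2 : ε * (ν k Z - (m 0 * ν k (Dσ 0) + m 1 * ν k (Dσ 1))) = 0 := by linarith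
    rcases mul_eq_zero.1 h2 with h3 | h3 <;> linarith
  have hn' : ∀ k, ν k Z = n 0 * ν k (Dσ 0) + n 1 * ν k (Dσ 1) := fun k => by
    have := congrArg (ν k) hn
    simp only [map_add, map_smul, hν, smul_eq_mul] at this
    have h2 : ε * (ν k Z - (n 0 * ν k (Dσ 0) + n 1 * ν k (Dσ 1))) = 0 := by linarith
    rcases mul_eq_zero.1 h2 with h3 | h3 <;> linarith
  have e0 := (hm' 0).symm.trans (hn' 0)
  have e1 := (hm' 1).symm.trans (hn' 1)
  have d0 : m 0 = n 0 := by
    apply sub_eq_zero.1; apply (mul_eq_zero.1 (a := _) (b := _) _).resolve_left hq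
    linear_combination ν 1 (Dσ 1) * e0 - ν 0 (Dσ 1) * e1
  have d1 : m 1 = n 1 := by
    apply sub_eq_zero.1; apply (mul_eq_zero.1 (a := _) (b := _) _).resolve_left hq
    linear_combination -ν 1 (Dσ 0) * e0 + ν 0 (Dσ 0) * e1
  have hz : m = 0 := hC m (by
    rw [← d0, ← d1] at hn
    linear_combination (norm := module) hm - (2 : ℝ) • hn)
  rw [hz] at hm
  simp only [Pi.zero_apply, zero_smul, add_zero] at hm
  exact (smul_eq_zero.1 hm).resolve_left hε.ne'

/-- If an affine family of vectors lies in the planes of a nondegenerate pencil, its coefficients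
with respect to the pencil are constant. -/
theorem exists_const_coeff {C : Fin 2 → H} {D : Fin 2 → Fin 2 → H} {Y₀ : H} {Y : Fin 2 → H}
    {ε : ℝ} (hε : 0 < ε) (hC : ∀ m : Fin 2 → ℝ, ∑ a, m a • C a = 0 → m = 0) (hD : Nondeg D C)
    (h : ∀ s : Fin 2 → ℝ, (∀ i, |s i| ≤ ε) →
      ∃ l : Fin 2 → ℝ, Y₀ + ∑ i, s i • Y i = ∑ a, l a • pencil C D s a) :
    ∃ l : Fin 2 → ℝ, Y₀ = ∑ a, l a • C a ∧ ∀ i, Y i = ∑ a, l a • D a i := by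
  obtain ⟨ν, hν, hd⟩ := hD
  obtain ⟨l, hl⟩ := h 0 (by simpa using hε.le)
  simp only [pencil, Pi.zero_apply, zero_smul, Finset.sum_const_zero, add_zero] at hl
  refine ⟨l, hl, ?_⟩
  set Z : Fin 2 → H := fun i => Y i - ∑ a, l a • D a i with hZ
  suffices hZ0 : ∀ i, Z i = 0 from fun i => sub_eq_zero.1 (hZ0 i)
  -- the quadratic form that detects the rays on which the pencil is regular
  set q : ℝ → ℝ → ℝ := fun x y =>
    ν 0 (x • D 0 0 + y • D 0 1) * ν 1 (x • D 1 0 + y • D 1 1) -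
      ν 0 (x • D 1 0 + y • D 1 1) * ν 1 (x • D 0 0 + y • D 0 1) with hqd
  have key : ∀ x y : ℝ, |x| ≤ 1 → |y| ≤ 1 → q x y ≠ 0 → x • Z 0 + y • Z 1 = 0 := by
    intro x y hx hy hq
    refine eq_zero_of_ray (C := C) (Dσ := fun a => x • D a 0 + y • D a 1) hε hC ν hν hq ?_
    intro τ hτ
    obtain ⟨m, hm⟩ := h ![τ * x, τ * y] (by
      intro i
      fin_cases i
      · simpa [abs_mul] using (mul_le_of_le_one_right (abs_nonneg τ) hx).trans hτ
      · simpa [abs_mul] using (mul_le_of_le_one_right (abs_nonneg τ) hy).trans hτ)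
    refine ⟨m - l, ?_⟩
    simp only [pencil, Fin.sum_univ_two, Matrix.cons_val_zero, Matrix.cons_val_one, hZ,
      Pi.sub_apply] at hm hl ⊢
    linear_combination (norm := module) hm - hl
  have q10 := key 1 0 (by norm_num) (by norm_num)
  have q01 := key 0 1 (by norm_num) (by norm_num)
  have q11 := key 1 1 (by norm_num) (by norm_num)
  have q1m := key 1 (-1) (by norm_num) (by norm_num)
  simp only [one_smul, zero_smul, add_zero, zero_add, neg_smul] at q10 q01 q11 q1m
  -- of the four directions, at least two independent ones are regular, since the discriminant of
  -- `q` does not vanish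
  by_cases a0 : q 1 0 = 0 <;> by_cases a1 : q 0 1 = 0
  · have b : q 1 1 ≠ 0 := by
      intro b
      apply hd
      simp only [hqd, map_add, map_smul, one_smul, zero_smul, add_zero, zero_add] at a0 a1 b
      simp only [hyperdet]
      grind
    have b' : q 1 (-1) ≠ 0 := by
      intro b
      apply hd
      simp only [hqd, map_add, map_smul, one_smul, zero_smul, add_zero, zero_add, neg_smul]
        at a0 a1 b
      simp only [hyperdet]
      grind
    have c := q11 b
    have c' := q1m b'
    have z0 : Z 0 = 0 := by
      have : (2 : ℝ) • Z 0 = 0 := by linear_combination (norm := module) c + c'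
      simpa using this
    intro i; fin_cases i
    · exact z0
    · simpa [z0] using c
  · have z1 := q01 a1
    have : q 1 1 ≠ 0 ∨ q 1 (-1) ≠ 0 := by
      by_contra hcon
      push Not at hcon
      apply a1
      simp only [hqd, map_add, map_smul, one_smul, zero_smul, add_zero, zero_add, neg_smul]
        at a0 hcon ⊢
      grind
    have z0 : Z 0 = 0 := by
      rcases this with b | b
      · simpa [z1] using q11 b
      · simpa [z1] using q1m b
    intro i; fin_cases i
    exacts [z0, z1]
  · have z0 := q10 a0
    have : q 1 1 ≠ 0 ∨ q 1 (-1) ≠ 0 := by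
      by_contra hcon
      push Not at hcon
      apply a0
      simp only [hqd, map_add, map_smul, one_smul, zero_smul, add_zero, zero_add, neg_smul]
        at a1 hcon ⊢
      grind
    have z1 : Z 1 = 0 := by
      rcases this with b | b
      · simpa [z0] using q11 b
      · simpa [z0] using q1m b
    intro i; fin_cases i
    exacts [z0, z1]
  · intro i; fin_cases i
    exacts [q10 a0, q01 a1]

end Algebra

section KAlgebra

/-- A real symmetric `2 × 2` matrix is diagonalized by a rotation. -/
theorem exists_rotation_diagonalizing (α β δ : ℝ) :
    ∃ c s : ℝ, c ^ 2 + s ^ 2 = 1 ∧ β * (c ^ 2 - s ^ 2) + (δ - α) * (c * s) = 0 := by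
  set h : ℝ → ℝ := fun θ => β * (Real.cos θ ^ 2 - Real.sin θ ^ 2) +
    (δ - α) * (Real.cos θ * Real.sin θ) with hh
  have hc : ContinuousOn h (Set.uIcc 0 (Real.pi / 2)) := by
    apply Continuous.continuousOn; rw [hh]; fun_prop
  have h0 : (0 : ℝ) ∈ Set.uIcc (h 0) (h (Real.pi / 2)) := by
    simp only [hh, Real.cos_zero, Real.sin_zero, Real.cos_pi_div_two, Real.sin_pi_div_two,
      Set.mem_uIcc]
    rcases le_total 0 β with h | h
    · right; constructor <;> nlinarith
    · left; constructor <;> nlinarith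
  obtain ⟨θ, -, hθ⟩ := intermediate_value_uIcc hc h0
  exact ⟨Real.cos θ, Real.sin θ, by rw [add_comm]; exact Real.sin_sq_add_cos_sq θ, hθ⟩

theorem hyperdet_eq_minors (A B : Fin 2 → Fin 2 → ℝ) :
    hyperdet A B =
      2 * (A 0 0 * B 1 0 - A 1 0 * B 0 0) * (A 0 1 * B 1 1 - A 1 1 * B 0 1) +
      2 * (A 0 0 * B 0 1 - A 0 1 * B 0 0) * (A 1 0 * B 1 1 - A 1 1 * B 1 0) -
      (A 0 0 * B 1 1 - A 1 1 * B 0 0) ^ 2 - (A 0 1 * B 1 0 - A 1 0 * B 0 1) ^ 2 := by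
  simp only [hyperdet]; ring

section Module
variable {H : Type*} [AddCommGroup H] [Module ℝ H]

/-- The value of the ruling derivative in the direction `f` at the vector of the ruling with
coordinates `x`. -/
def evalD (D : Fin 2 → Fin 2 → H) (f x : Fin 2 → ℝ) : H := ∑ a, ∑ i, (f a * x i) • D a i

/-- The value of a linear family of vectors in the direction `f`. -/
def evalC (C : Fin 2 → H) (f : Fin 2 → ℝ) : H := ∑ a, f a • C a

/-- In no direction is the ruling stationary. -/
theorem Nondeg.coeff_eq_zero {C : Fin 2 → H} {D : Fin 2 → Fin 2 → H} (h : Nondeg D C)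
    {c : Fin 2 → ℝ} (hc : ∀ i, c 0 • D 0 i + c 1 • D 1 i = 0) : c = 0 := by
  obtain ⟨ν, -, hd⟩ := h
  have e : ∀ k i, c 0 * ν k (D 0 i) + c 1 * ν k (D 1 i) = 0 := fun k i => by
    simpa using congrArg (ν k) (hc i)
  by_contra hne
  apply hd
  have : c 0 ≠ 0 ∨ c 1 ≠ 0 := by
    by_contra hcon
    push Not at hcon
    exact hne (by ext i; fin_cases i; exacts [hcon.1, hcon.2])
  have e00 := e 0 0
  have e01 := e 0 1
  have e10 := e 1 0
  have e11 := e 1 1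
  simp only [hyperdet]
  rcases this with h0 | h1
  · have r : ∀ k i, ν k (D 0 i) = -(c 1 / c 0) * ν k (D 1 i) := fun k i => by
      field_simp; linarith [e k i]
    rw [r, r, r, r]; ring
  · have r : ∀ k i, ν k (D 1 i) = -(c 0 / c 1) * ν k (D 0 i) := fun k i => by
      field_simp; linarith [e k i]
    rw [r, r, r, r]; ring

/-- A nondegenerate pencil vanishes at most at the origin of the leaf. -/
theorem Nondeg.ruling_eq_zero {C : Fin 2 → H} {D : Fin 2 → Fin 2 → H} (h : Nondeg D C)
    {m : Fin 2 → ℝ} (hm : ∀ a, C a = m 0 • D a 0 + m 1 • D a 1) : m = 0 := by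
  obtain ⟨ν, hν, hd⟩ := h
  have e : ∀ k a, m 0 * ν k (D a 0) + m 1 * ν k (D a 1) = 0 := fun k a => by
    have := hν k a
    rw [hm] at this
    simpa using this
  by_contra hne
  apply hd
  have : m 0 ≠ 0 ∨ m 1 ≠ 0 := by
    by_contra hcon
    push Not at hcon
    exact hne (by ext i; fin_cases i; exacts [hcon.1, hcon.2])
  simp only [hyperdet]
  rcases this with h0 | h1
  · have r : ∀ k a, ν k (D a 0) = -(m 1 / m 0) * ν k (D a 1) := fun k i => by
      field_simp; linarith [e k i]
    rw [r, r, r, r]; ring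
  · have r : ∀ k a, ν k (D a 1) = -(m 0 / m 1) * ν k (D a 0) := fun k i => by
      field_simp; linarith [e k i]
    rw [r, r, r, r]; ring

theorem linearIndependent_of_functionals {C : Fin 2 → H} {n₀ n₁ : H}
    (hC : ∀ m : Fin 2 → ℝ, ∑ a, m a • C a = 0 → m = 0)
    {ν : Fin 2 → (H →ₗ[ℝ] ℝ)} (hν : ∀ k a, ν k (C a) = 0)
    (hd : ν 0 n₀ * ν 1 n₁ - ν 0 n₁ * ν 1 n₀ ≠ 0) : LinearIndependent ℝ ![n₀, n₁, C 0, C 1] := by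
  rw [Fintype.linearIndependent_iff]
  intro g hg
  simp only [Fin.sum_univ_four] at hg
  change g 0 • n₀ + g 1 • n₁ + g 2 • C 0 + g 3 • C 1 = 0 at hg
  have e : ∀ k, g 0 * ν k n₀ + g 1 * ν k n₁ = 0 := fun k => by
    simpa [hν] using congrArg (ν k) hg
  have e0 := e 0
  have e1 := e 1
  have g0 : g 0 = 0 := (mul_eq_zero.1 (show g 0 * _ = 0 by
    linear_combination ν 1 n₁ * e0 - ν 0 n₁ * e1)).resolve_right hd
  have g1 : g 1 = 0 := (mul_eq_zero.1 (show g 1 * _ = 0 by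
    linear_combination ν 0 n₀ * e1 - ν 1 n₀ * e0)).resolve_right hd
  have := hC ![g 2, g 3] (by simpa [g0, g1] using hg)
  intro i; fin_cases i
  exacts [g0, g1, congrFun this 0, congrFun this 1]

/-- A nondegenerate pencil fills its ambient space, up to dimension: two of the vectors `D a i` are
independent modulo the plane of the pencil. -/
theorem Nondeg.exists_minor {C : Fin 2 → H} {D : Fin 2 → Fin 2 → H} (h : Nondeg D C)
    (hC : ∀ m : Fin 2 → ℝ, ∑ a, m a • C a = 0 → m = 0) :
    ∃ a i b j, LinearIndependent ℝ ![D a i, D b j, C 0, C 1] := by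
  obtain ⟨ν, hν, hd⟩ := h
  by_contra hcon
  push Not at hcon
  have z : ∀ a i b j, ν 0 (D a i) * ν 1 (D b j) - ν 0 (D b j) * ν 1 (D a i) = 0 := by
    intro a i b j
    by_contra hne
    exact hcon a i b j (linearIndependent_of_functionals hC hν hne)
  apply hd
  rw [hyperdet_eq_minors, z 0 0 1 0, z 0 0 0 1, z 0 0 1 1, z 0 1 1 0]
  ring

end Module

variable {H : Type*} [NormedAddCommGroup H] [InnerProductSpace ℝ H]

/-- The commutator expression: the action of the curvatures of the ruling and of its orthogonal
complement on a parallel family `Z`, when `D` is the second fundamental form of the ruling. -/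
def curvatureTerm (D : Fin 2 → Fin 2 → H) (Z : Fin 2 → H) (a : Fin 2) : H :=
  ∑ i, ((inner ℝ (Z 1) (D 0 i) - inner ℝ (Z 0) (D 1 i)) • D a i -
    (inner ℝ (Z a) (D 1 i) : ℝ) • D 0 i + (inner ℝ (Z a) (D 0 i) : ℝ) • D 1 i)

/-- The pencil splits as in a product of two helicoids: in the orthonormal basis `x`, `y` of the
ruling and the basis `f`, `g` of directions the ruling derivative is diagonal, and the two factors
are orthogonal up to their axes. -/
structure SplitPencil (C : Fin 2 → H) (D : Fin 2 → Fin 2 → H) (x y f g : Fin 2 → ℝ) : Prop where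
  norm_x : x 0 ^ 2 + x 1 ^ 2 = 1
  norm_y : y 0 ^ 2 + y 1 ^ 2 = 1
  orth : x 0 * y 0 + x 1 * y 1 = 0
  gx : evalD D g x = 0
  fy : evalD D f y = 0
  fx_gy : inner ℝ (evalD D f x) (evalD D g y) = 0
  fx_g : inner ℝ (evalD D f x) (evalC C g) = 0
  gy_f : inner ℝ (evalD D g y) (evalC C f) = 0
  indep : LinearIndependent ℝ ![evalD D f x, evalD D g y, evalC C f, evalC C g]

/-- If the vectors `D a i` are independent, the curvature identity forces the pencil to be a cone,
which is degenerate. -/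
theorem false_of_curvature_of_linearIndependent {C : Fin 2 → H} {D : Fin 2 → Fin 2 → H}
    (hD : ∀ a b c d : ℝ, a • D 0 0 + b • D 0 1 + c • D 1 0 + d • D 1 1 = 0 →
      a = 0 ∧ b = 0 ∧ c = 0 ∧ d = 0)
    (hC : ∀ m : Fin 2 → ℝ, ∑ a, m a • C a = 0 → m = 0) (hN : Nondeg D C)
    (hspan : ∀ a, ∃ m : Fin 2 → Fin 2 → ℝ,
      C a = m 0 0 • D 0 0 + m 0 1 • D 0 1 + m 1 0 • D 1 0 + m 1 1 • D 1 1)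
    {L : Fin 2 → Fin 2 → ℝ} (hLC : ∀ a, curvatureTerm D C a = ∑ d, L a d • C d)
    (hLD : ∀ j a, curvatureTerm D (fun b => D b j) a = ∑ d, L a d • D d j) : False := by
  choose m hm using hspan
  have hsym : ∀ a i b j, (inner ℝ (D a i) (D b j) : ℝ) = inner ℝ (D b j) (D a i) :=
    fun a i b j => real_inner_comm _ _
  simp only [curvatureTerm, Fin.sum_univ_two] at hLC hLD
  have d00 := hLD 0 0
  have d01 := hLD 0 1
  have d10 := hLD 1 0
  have d11 := hLD 1 1
  -- the coefficients of the independent vectors `D a i` in the curvature identity for the ruling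
  have E00 := hD
    (inner ℝ (D 1 0) (D 0 0) - 2 * inner ℝ (D 0 0) (D 1 0) - L 0 0)
    (inner ℝ (D 1 0) (D 0 1) - 2 * inner ℝ (D 0 0) (D 1 1))
    (inner ℝ (D 0 0) (D 0 0) - L 0 1) (inner ℝ (D 0 0) (D 0 1))
    (by linear_combination (norm := module) d00)
  have E10 := hD
    (inner ℝ (D 1 1) (D 0 0) - 2 * inner ℝ (D 0 1) (D 1 0))
    (inner ℝ (D 1 1) (D 0 1) - 2 * inner ℝ (D 0 1) (D 1 1) - L 0 0)
    (inner ℝ (D 0 1) (D 0 0)) (inner ℝ (D 0 1) (D 0 1) - L 0 1)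
    (by linear_combination (norm := module) d10)
  have E01 := hD (-inner ℝ (D 1 0) (D 1 0) - L 1 0) (-inner ℝ (D 1 0) (D 1 1))
    (2 * inner ℝ (D 1 0) (D 0 0) - inner ℝ (D 0 0) (D 1 0) - L 1 1)
    (2 * inner ℝ (D 1 0) (D 0 1) - inner ℝ (D 0 0) (D 1 1))
    (by linear_combination (norm := module) d01)
  have E11 := hD (-inner ℝ (D 1 1) (D 1 0)) (-inner ℝ (D 1 1) (D 1 1) - L 1 0)
    (2 * inner ℝ (D 1 1) (D 0 0) - inner ℝ (D 0 1) (D 1 0))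
    (2 * inner ℝ (D 1 1) (D 0 1) - inner ℝ (D 0 1) (D 1 1) - L 1 1)
    (by linear_combination (norm := module) d11)
  rw [hsym 1 0 0 0, hsym 1 0 0 1] at E00
  rw [hsym 1 1 0 0, hsym 1 1 0 1, hsym 0 1 0 0] at E10
  rw [hsym 1 0 0 0, hsym 1 0 0 1] at E01
  rw [hsym 1 1 0 0, hsym 1 1 0 1, hsym 1 1 1 0] at E11
  set k := (inner ℝ (D 0 0) (D 0 0) : ℝ) with hk
  set l := (inner ℝ (D 0 0) (D 1 0) : ℝ) with hl
  set n := (inner ℝ (D 1 0) (D 1 0) : ℝ) with hn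
  obtain ⟨e1, e2, e3, e4⟩ := E00
  obtain ⟨e5, e6, e7, e8⟩ := E10
  obtain ⟨e9, e10, e11, e12⟩ := E01
  obtain ⟨e13, e14, e15, e16⟩ := E11
  -- they show that `D a 0` and `D a 1` span orthogonal planes with equal Gram matrices
  have i00 : L 0 1 = k := by linarith
  have i1 : L 0 0 = -l := by linarith
  have i2 : L 1 0 = -n := by linarith
  have i3 : L 1 1 = l := by linarith
  have o1 : (inner ℝ (D 0 1) (D 0 1) : ℝ) = k := by linarith
  have o2 : (inner ℝ (D 1 1) (D 1 1) : ℝ) = n := by linarith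
  have o3 : (inner ℝ (D 0 1) (D 1 1) : ℝ) = l := by linarith
  have o4 : (inner ℝ (D 0 0) (D 1 1) : ℝ) = 0 := by linarith
  have o5 : (inner ℝ (D 0 1) (D 1 0) : ℝ) = 0 := by linarith
  have o6 : (inner ℝ (D 1 0) (D 1 1) : ℝ) = 0 := by linarith
  have hdet : k * n - l ^ 2 ≠ 0 := by
    intro h0
    -- equality in the Cauchy–Schwarz inequality contradicts the independence of the `D a 0`
    have hk0 : k ≠ 0 := fun h => by
      have : D 0 0 = 0 := inner_self_eq_zero.1 (hk.symm.trans h)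
      have := (hD 1 0 0 0 (by simp [this])).1
      norm_num at this
    have hz : k • D 1 0 - l • D 0 0 = 0 := by
      rw [← inner_self_eq_zero (𝕜 := ℝ)]
      simp only [inner_sub_left, inner_sub_right, real_inner_smul_left, real_inner_smul_right]
      rw [hsym 1 0 0 0, ← hk, ← hl, ← hn]
      linear_combination k * h0
    exact hk0 (hD (-l) 0 k 0 (by linear_combination (norm := module) hz)).2.2.1
  have c0 := hLC 0
  have c1 := hLC 1
  have ip : ∀ a b i, (inner ℝ (C a) (D b i) : ℝ) = m a 0 0 * inner ℝ (D 0 0) (D b i) +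
      m a 0 1 * inner ℝ (D 0 1) (D b i) + m a 1 0 * inner ℝ (D 1 0) (D b i) +
      m a 1 1 * inner ℝ (D 1 1) (D b i) := fun a b i => by
    rw [hm a]; simp only [inner_add_left, real_inner_smul_left]
  have p00 : ∀ a, (inner ℝ (C a) (D 0 0) : ℝ) = m a 0 0 * k + m a 1 0 * l := fun a => by
    rw [ip, hsym 0 1 0 0, hsym 1 0 0 0, hsym 1 1 0 0, o4, ← hk, ← hl]; linear_combination m a 0 1 * e4
  have p01 : ∀ a, (inner ℝ (C a) (D 0 1) : ℝ) = m a 0 1 * k + m a 1 1 * l := fun a => by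
    rw [ip, hsym 1 0 0 1, hsym 1 1 0 1, o5, o1, o3]; linear_combination m a 0 0 * e4
  have p10 : ∀ a, (inner ℝ (C a) (D 1 0) : ℝ) = m a 0 0 * l + m a 1 0 * n := fun a => by
    rw [ip, hsym 1 1 1 0, o6, o5, ← hl, ← hn]; ring
  have p11 : ∀ a, (inner ℝ (C a) (D 1 1) : ℝ) = m a 0 1 * l + m a 1 1 * n := fun a => by
    rw [ip, o4, o3, o6, o2]; ring
  simp only [p00, p01, p10, p11, i00, i1, i2, i3] at c0 c1
  -- the coefficients of the `D a i` in the curvature identity for the base point: the matrices `m a`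
  -- are those of a translation along the ruling
  have F0 := hD
    (m 1 0 0 * k + m 1 1 0 * l - 2 * (m 0 0 0 * l + m 0 1 0 * n) + l * m 0 0 0 - k * m 1 0 0)
    (m 1 0 1 * k + m 1 1 1 * l - 2 * (m 0 0 1 * l + m 0 1 1 * n) + l * m 0 0 1 - k * m 1 0 1)
    (m 0 0 0 * k + m 0 1 0 * l + l * m 0 1 0 - k * m 1 1 0)
    (m 0 0 1 * k + m 0 1 1 * l + l * m 0 1 1 - k * m 1 1 1)
    (by linear_combination (norm := module) c0 - l • (hm 0) + k • (hm 1))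
  have F1 := hD
    (-(m 1 0 0 * l + m 1 1 0 * n) + n * m 0 0 0 - l * m 1 0 0)
    (-(m 1 0 1 * l + m 1 1 1 * n) + n * m 0 0 1 - l * m 1 0 1)
    (2 * (m 1 0 0 * k + m 1 1 0 * l) - (m 0 0 0 * l + m 0 1 0 * n) + n * m 0 1 0 - l * m 1 1 0)
    (2 * (m 1 0 1 * k + m 1 1 1 * l) - (m 0 0 1 * l + m 0 1 1 * n) + n * m 0 1 1 - l * m 1 1 1)
    (by linear_combination (norm := module) c1 - n • (hm 0) + l • (hm 1))
  obtain ⟨f1, f2, f3, f4⟩ := F0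
  obtain ⟨g1, g2, g3, g4⟩ := F1
  have cr : ∀ X Y : ℝ, k * X + l * Y = 0 → l * X + n * Y = 0 → X = 0 ∧ Y = 0 := fun X Y h h' =>
    ⟨(mul_eq_zero.1 (show (k * n - l ^ 2) * X = 0 by linear_combination n * h - l * h')).resolve_left
      hdet, (mul_eq_zero.1 (show (k * n - l ^ 2) * Y = 0 by
        linear_combination k * h' - l * h)).resolve_left hdet⟩
  obtain ⟨x0, y0⟩ := cr (m 0 0 0 - m 1 1 0) (2 * m 0 1 0) (by linear_combination f3)
    (by linear_combination -f1)
  obtain ⟨x1, y1⟩ := cr (m 0 0 1 - m 1 1 1) (2 * m 0 1 1) (by linear_combination f4)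
    (by linear_combination -f2)
  obtain ⟨-, z0⟩ := cr (2 * m 1 0 0) (m 1 1 0 - m 0 0 0) (by linear_combination g3)
    (by linear_combination -g1)
  obtain ⟨w0, -⟩ := cr (2 * m 1 0 0) (m 1 1 0 - m 0 0 0) (by linear_combination g3)
    (by linear_combination -g1)
  obtain ⟨w1, -⟩ := cr (2 * m 1 0 1) (m 1 1 1 - m 0 0 1) (by linear_combination g4)
    (by linear_combination -g2)
  have q0 : m 0 1 0 = 0 := by linarith
  have q1 : m 0 1 1 = 0 := by linarith
  have q2 : m 1 0 0 = 0 := by linarith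
  have q3 : m 1 0 1 = 0 := by linarith
  have hmz : ![m 0 0 0, m 0 0 1] = 0 := hN.ruling_eq_zero (fun a => by
    fin_cases a
    · have := hm 0; rw [q0, q1] at this
      simpa using this
    · have := hm 1; rw [q2, q3, ← sub_eq_zero.1 x0, ← sub_eq_zero.1 x1] at this
      simpa using this)
  have hm0 : m 0 0 0 = 0 := congrFun hmz 0
  have hm1 : m 0 0 1 = 0 := congrFun hmz 1
  have hz : C 0 = 0 := by rw [hm 0, q0, q1, hm0, hm1]; simp
  have := congrFun (hC ![1, 0] (by simp [hz])) 0
  simp at this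

end KAlgebra

section KAlgebraSplit

variable {H : Type*} [NormedAddCommGroup H] [InnerProductSpace ℝ H]

/-- If some vector is orthogonal to all `D a i` but not to the pencil, the curvature coefficients
vanish: they are skew with respect to the trace metric and have a common null vector. -/
theorem curvature_coeff_eq_zero {C : Fin 2 → H} {D : Fin 2 → Fin 2 → H}
    (hN : Nondeg D C) {w : H} (hw : ∀ a i, inner ℝ w (D a i) = 0)
    (hwC : inner ℝ w (C 0) ≠ 0 ∨ inner ℝ w (C 1) ≠ 0)
    {L : Fin 2 → Fin 2 → ℝ} (hLC : ∀ a, curvatureTerm D C a = ∑ d, L a d • C d)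
    (hLD : ∀ j a, curvatureTerm D (fun b => D b j) a = ∑ d, L a d • D d j) : L = 0 := by
  simp only [curvatureTerm, Fin.sum_univ_two] at hLC hLD
  have hy : ∀ a, L a 0 * inner ℝ w (C 0) + L a 1 * inner ℝ w (C 1) = 0 := fun a => by
    have := congrArg (inner ℝ w) (hLC a)
    simp only [inner_add_right, inner_sub_right, real_inner_smul_right, hw] at this
    linarith
  have hsym : ∀ a i b j, (inner ℝ (D a i) (D b j) : ℝ) = inner ℝ (D b j) (D a i) :=
    fun a i b j => real_inner_comm _ _
  -- the trace metric on the space of directions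
  set k : ℝ := inner ℝ (D 0 0) (D 0 0) + inner ℝ (D 0 1) (D 0 1) with hk
  set l : ℝ := inner ℝ (D 0 0) (D 1 0) + inner ℝ (D 0 1) (D 1 1) with hl
  set n : ℝ := inner ℝ (D 1 0) (D 1 0) + inner ℝ (D 1 1) (D 1 1) with hn
  have ip : ∀ j a b, (inner ℝ (L a 0 • D 0 j + L a 1 • D 1 j) (D b j) : ℝ) =
      L a 0 * inner ℝ (D 0 j) (D b j) + L a 1 * inner ℝ (D 1 j) (D b j) := fun j a b => by
    simp only [inner_add_left, real_inner_smul_left]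
  have A00 : L 0 0 * k + L 0 1 * l = 0 := by
    have h0 := ip 0 0 0
    have h1 := ip 1 0 0
    rw [← hLD] at h0 h1
    simp only [inner_add_left, inner_sub_left, real_inner_smul_left] at h0 h1
    simp only [hsym 1 0 0 0, hsym 1 0 0 1, hsym 1 1 0 0, hsym 1 1 0 1, hsym 0 1 0 0] at h0 h1
    rw [hk, hl]; linear_combination -h0 - h1
  have A11 : L 1 0 * l + L 1 1 * n = 0 := by
    have h0 := ip 0 1 1
    have h1 := ip 1 1 1
    rw [← hLD] at h0 h1
    simp only [inner_add_left, inner_sub_left, real_inner_smul_left] at h0 h1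
    simp only [hsym 1 0 0 0, hsym 1 0 0 1, hsym 1 1 0 0, hsym 1 1 0 1,
      hsym 1 1 1 0] at h0 h1
    rw [hn, hl]; linear_combination -h0 - h1
  have A01 : L 0 0 * l + L 0 1 * n + L 1 0 * k + L 1 1 * l = 0 := by
    have h0 := ip 0 0 1
    have h1 := ip 1 0 1
    have h2 := ip 0 1 0
    have h3 := ip 1 1 0
    rw [← hLD] at h0 h1 h2 h3
    simp only [inner_add_left, inner_sub_left, real_inner_smul_left] at h0 h1 h2 h3
    simp only [hsym 1 0 0 0, hsym 1 0 0 1, hsym 1 1 0 0, hsym 1 1 0 1, hsym 0 1 0 0,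
      hsym 1 1 1 0] at h0 h1 h2 h3
    rw [hn, hl, hk]; linear_combination -h0 - h1 - h2 - h3
  have hpos : ∀ X Y : ℝ, k * X ^ 2 + 2 * l * (X * Y) + n * Y ^ 2 = 0 → X = 0 ∧ Y = 0 := by
    intro X Y h
    have e : ‖X • D 0 0 + Y • D 1 0‖ ^ 2 + ‖X • D 0 1 + Y • D 1 1‖ ^ 2 = 0 := by
      rw [← real_inner_self_eq_norm_sq, ← real_inner_self_eq_norm_sq]
      simp only [inner_add_left, inner_add_right, real_inner_smul_left, real_inner_smul_right]
      simp only [hsym 1 0 0 0, hsym 1 1 0 1]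
      rw [hk, hl, hn] at h; linear_combination h
    have e0 : X • D 0 0 + Y • D 1 0 = 0 := by
      have : ‖X • D 0 0 + Y • D 1 0‖ ^ 2 = 0 := by 
        linarith [sq_nonneg (‖X • D 0 0 + Y • D 1 0‖), sq_nonneg (‖X • D 0 1 + Y • D 1 1‖)]
      simpa using this
    have e1 : X • D 0 1 + Y • D 1 1 = 0 := by
      have : ‖X • D 0 1 + Y • D 1 1‖ ^ 2 = 0 := by 
        linarith [sq_nonneg (‖X • D 0 0 + Y • D 1 0‖), sq_nonneg (‖X • D 0 1 + Y • D 1 1‖)]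
      simpa using this
    have := hN.coeff_eq_zero (c := ![X, Y]) (fun i => by fin_cases i; exacts [e0, e1])
    exact ⟨congrFun this 0, congrFun this 1⟩
  have hkp : k ≠ 0 := fun h => by
    have := (hpos 1 0 (by simp [h])).1
    norm_num at this
  have hdet : k * n - l ^ 2 ≠ 0 := fun h => by
    have := (hpos l (-k) (by linear_combination k * h)).2
    exact hkp (by linarith)
  have y0 := hy 0
  have y1 := hy 1
  set a := (inner ℝ w (C 0) : ℝ)
  set b := (inner ℝ w (C 1) : ℝ)
  -- row `d` of `L` is proportional to `(-b, a)`
  obtain ⟨α, ha0, ha1⟩ : ∃ α, L 0 0 = -α * b ∧ L 0 1 = α * a := by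
    by_cases ha : a = 0
    · have hb : b ≠ 0 := hwC.resolve_left (not_not.2 ha)
      refine ⟨-L 0 0 / b, by field_simp, ?_⟩
      rw [ha] at y0 ⊢
      have : L 0 1 * b = 0 := by linarith
      simpa [hb] using this
    · refine ⟨L 0 1 / a, ?_, by field_simp⟩
      field_simp; linarith
  obtain ⟨β, hb0, hb1⟩ : ∃ β, L 1 0 = -β * b ∧ L 1 1 = β * a := by
    by_cases ha : a = 0
    · have hb : b ≠ 0 := hwC.resolve_left (not_not.2 ha)
      refine ⟨-L 1 0 / b, by field_simp, ?_⟩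
      rw [ha] at y1 ⊢
      have : L 1 1 * b = 0 := by linarith
      simpa [hb] using this
    · refine ⟨L 1 1 / a, ?_, by field_simp⟩
      field_simp; linarith
  rw [ha0, ha1] at A00
  rw [hb0, hb1] at A11
  rw [ha0, ha1, hb0, hb1] at A01
  have hab : ∀ t : ℝ, t * a = 0 → t * b = 0 → t = 0 := fun t h h' => by
    rcases hwC with h1 | h1
    · exact (mul_eq_zero.1 h).resolve_right h1
    · exact (mul_eq_zero.1 h').resolve_right h1
  have hα : α = 0 := by
    by_contra hα
    have h1 : a * l - b * k = 0 := by
      apply (mul_eq_zero.1 (show α * (a * l - b * k) = 0 by linear_combination A00)).resolve_left hα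
    have h2 : α * (a * n - b * l) = 0 := by linear_combination A01 - β * h1
    have h2 := (mul_eq_zero.1 h2).resolve_left hα
    have h3 : (k * n - l ^ 2) * a = 0 := by linear_combination k * h2 - l * h1
    have h4 : (k * n - l ^ 2) * b = 0 := by linear_combination l * h2 - n * h1
    exact hdet (hab _ h3 h4)
  have hβ : β = 0 := by
    by_contra hβ
    have h1 : a * n - b * l = 0 := by
      apply (mul_eq_zero.1 (show β * (a * n - b * l) = 0 by linear_combination A11)).resolve_left hβ
    have h2 : β * (a * l - b * k) = 0 := by linear_combination A01 - α * h1
    have h2 := (mul_eq_zero.1 h2).resolve_left hβ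
    have h3 : (k * n - l ^ 2) * a = 0 := by linear_combination k * h1 - l * h2
    have h4 : (k * n - l ^ 2) * b = 0 := by linear_combination l * h1 - n * h2
    exact hdet (hab _ h3 h4)
  ext i j
  fin_cases i <;> fin_cases j <;> simp [ha0, ha1, hb0, hb1, hα, hβ]

/-- A flat pencil with `D 0` injective splits: `D 1 = D 0 ∘ A` with `A` symmetric, and the
eigenvectors of `A` give the two helicoids. -/
theorem exists_splitPencil_of_flat {C : Fin 2 → H} {D : Fin 2 → Fin 2 → H}
    (hC : ∀ m : Fin 2 → ℝ, ∑ a, m a • C a = 0 → m = 0) (hN : Nondeg D C)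
    (hG : ∀ a b : ℝ, a • D 0 0 + b • D 0 1 = 0 → a = 0 ∧ b = 0)
    (hLC : curvatureTerm D C 0 = 0)
    (hLD : ∀ j, curvatureTerm D (fun b => D b j) 0 = 0) :
    ∃ x y f g, SplitPencil C D x y f g := by
  simp only [curvatureTerm, Fin.sum_univ_two] at hLC hLD
  have l0 := hLD 0
  have l1 := hLD 1
  have hsym : ∀ a i b j, (inner ℝ (D a i) (D b j) : ℝ) = inner ℝ (D b j) (D a i) :=
    fun a i b j => real_inner_comm _ _
  simp only [hsym 1 0 0 0, hsym 1 0 0 1, hsym 1 1 0 0, hsym 1 1 0 1, hsym 0 1 0 0] at l0 l1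
  set G0 := (inner ℝ (D 0 0) (D 0 0) : ℝ) with hG0
  set G1 := (inner ℝ (D 0 0) (D 0 1) : ℝ) with hG1
  set G2 := (inner ℝ (D 0 1) (D 0 1) : ℝ) with hG2
  have hpos : ∀ X Y : ℝ, G0 * X ^ 2 + 2 * G1 * (X * Y) + G2 * Y ^ 2 = 0 → X = 0 ∧ Y = 0 := by
    intro X Y h
    apply hG
    rw [← inner_self_eq_zero (𝕜 := ℝ)]
    simp only [inner_add_left, inner_add_right, real_inner_smul_left, real_inner_smul_right]
    rw [hsym 0 1 0 0, ← hG0, ← hG1, ← hG2]; linear_combination h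
  have hG00 : 0 < G0 := by
    refine lt_of_le_of_ne real_inner_self_nonneg fun h => ?_
    have := (hpos 1 0 (by simp [← h])).1
    norm_num at this
  have hG22 : 0 < G2 := by
    refine lt_of_le_of_ne real_inner_self_nonneg fun h => ?_
    have := (hpos 0 1 (by simp [← h])).2
    norm_num at this
  have hdet : G0 * G2 - G1 ^ 2 ≠ 0 := fun h => by
    have := (hpos G1 (-G0) (by linear_combination G0 * h)).2
    linarith
  -- `D 1 = D 0 ∘ A`, obtained by inverting the Gram matrix of `D 0`
  obtain ⟨α, β, hA0⟩ : ∃ α β : ℝ, D 1 0 = α • D 0 0 + β • D 0 1 := by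
    refine ⟨(G0 * G2 - G1 ^ 2)⁻¹ * (G2 * inner ℝ (D 0 0) (D 1 0) -
        G1 * (2 * inner ℝ (D 0 1) (D 1 0) - inner ℝ (D 0 0) (D 1 1))),
      (G0 * G2 - G1 ^ 2)⁻¹ * (G2 * (2 * inner ℝ (D 0 0) (D 1 1) - inner ℝ (D 0 1) (D 1 0)) -
        G1 * inner ℝ (D 0 1) (D 1 1)), ?_⟩
    have : (G0 * G2 - G1 ^ 2) • D 1 0 = (G2 * inner ℝ (D 0 0) (D 1 0) -
        G1 * (2 * inner ℝ (D 0 1) (D 1 0) - inner ℝ (D 0 0) (D 1 1))) • D 0 0 +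
      (G2 * (2 * inner ℝ (D 0 0) (D 1 1) - inner ℝ (D 0 1) (D 1 0)) -
        G1 * inner ℝ (D 0 1) (D 1 1)) • D 0 1 := by
      linear_combination (norm := module) G2 • l0 - G1 • l1
    rw [mul_smul, mul_smul, ← smul_add, ← this, smul_smul, inv_mul_cancel₀ hdet, one_smul]
  obtain ⟨γ, δ, hA1⟩ : ∃ γ δ : ℝ, D 1 1 = γ • D 0 0 + δ • D 0 1 := by
    refine ⟨(G0 * G2 - G1 ^ 2)⁻¹ * (G0 * (2 * inner ℝ (D 0 1) (D 1 0) - inner ℝ (D 0 0) (D 1 1)) -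
        G1 * inner ℝ (D 0 0) (D 1 0)),
      (G0 * G2 - G1 ^ 2)⁻¹ * (G0 * inner ℝ (D 0 1) (D 1 1) -
        G1 * (2 * inner ℝ (D 0 0) (D 1 1) - inner ℝ (D 0 1) (D 1 0))), ?_⟩
    have : (G0 * G2 - G1 ^ 2) • D 1 1 =
        (G0 * (2 * inner ℝ (D 0 1) (D 1 0) - inner ℝ (D 0 0) (D 1 1)) -
        G1 * inner ℝ (D 0 0) (D 1 0)) • D 0 0 +
      (G0 * inner ℝ (D 0 1) (D 1 1) -
        G1 * (2 * inner ℝ (D 0 0) (D 1 1) - inner ℝ (D 0 1) (D 1 0))) • D 0 1 := by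
      linear_combination (norm := module) G0 • l1 - G1 • l0
    rw [mul_smul, mul_smul, ← smul_add, ← this, smul_smul, inv_mul_cancel₀ hdet, one_smul]
  have x00 : (inner ℝ (D 0 0) (D 1 0) : ℝ) = α * G0 + β * G1 := by
    rw [hA0]; simp only [inner_add_right, real_inner_smul_right, hG0, hG1]
  have x01 : (inner ℝ (D 0 0) (D 1 1) : ℝ) = γ * G0 + δ * G1 := by
    rw [hA1]; simp only [inner_add_right, real_inner_smul_right, hG0, hG1]
  have x10 : (inner ℝ (D 0 1) (D 1 0) : ℝ) = α * G1 + β * G2 := by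
    rw [hA0, inner_add_right, real_inner_smul_right, real_inner_smul_right, hsym 0 1 0 0]
  have x11 : (inner ℝ (D 0 1) (D 1 1) : ℝ) = γ * G1 + δ * G2 := by
    rw [hA1, inner_add_right, real_inner_smul_right, real_inner_smul_right, hsym 0 1 0 0]
  -- the curvature identity for the ruling relates `A`, its transpose and the Gram matrix of `D 0`,
  -- and forces `A` to be symmetric
  have hβγ : β = γ := by
    rw [x00, x01, x10, hA0, hA1] at l0
    rw [x11, x01, x10, hA0, hA1] at l1
    obtain ⟨r1, r2⟩ := hG
      (G0 * α + G1 * γ - (α * G0 + β * G1))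
      (G0 * β + G1 * δ - (2 * (γ * G0 + δ * G1) - (α * G1 + β * G2)))
      (by linear_combination (norm := module) l0)
    obtain ⟨r3, r4⟩ := hG
      (G1 * α + G2 * γ - (2 * (α * G1 + β * G2) - (γ * G0 + δ * G1)))
      (G1 * β + G2 * δ - (γ * G1 + δ * G2))
      (by linear_combination (norm := module) l1)
    by_contra hne
    have hG1z : G1 = 0 := by
      apply (mul_eq_zero.1 (show (γ - β) * G1 = 0 by linear_combination r1)).resolve_left
      exact sub_ne_zero.2 (Ne.symm hne)
    rw [hG1z] at r2 r3
    have s2 : (G0 + G2) * β = 2 * G0 * γ := by linear_combination r2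
    have s3 : (G0 + G2) * γ = 2 * G2 * β := by linear_combination r3
    have hβ0 : β ≠ 0 := fun h => by
      rw [h] at s3 hne
      have : γ = 0 := (mul_eq_zero.1 (show (G0 + G2) * γ = 0 by linarith)).resolve_left
        (by positivity)
      exact hne this.symm
    have : (G0 - G2) ^ 2 * β = 0 := by
      linear_combination (G0 + G2) * s2 + 2 * G0 * s3
    have hEq : G0 = G2 := sub_eq_zero.1 (pow_eq_zero_iff two_ne_zero |>.1
      ((mul_eq_zero.1 this).resolve_right hβ0))
    rw [← hEq] at s2
    have : 2 * G0 * (β - γ) = 0 := by linear_combination s2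
    exact hne (sub_eq_zero.1 ((mul_eq_zero.1 this).resolve_left (by positivity)))
  subst hβγ
  have hXs : (inner ℝ (D 0 0) (D 1 1) : ℝ) = inner ℝ (D 0 1) (D 1 0) := by
    rw [x00, x01, x10, hA0, hA1] at l0
    obtain ⟨-, r2⟩ := hG
      (G0 * α + G1 * β - (α * G0 + β * G1))
      (G0 * β + G1 * δ - (2 * (β * G0 + δ * G1) - (α * G1 + β * G2)))
      (by linear_combination (norm := module) l0)
    rw [x01, x10]; linarith
  -- the images `q`, `v` under `D 0` of the eigenvectors of `A`, with the eigenvalues `μ`, `κ`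
  obtain ⟨c, s, hcs, hrot⟩ := exists_rotation_diagonalizing α β δ
  set μ := α * c ^ 2 + 2 * β * (c * s) + δ * s ^ 2 with hμ
  set κ := α * s ^ 2 - 2 * β * (c * s) + δ * c ^ 2 with hκ
  set q := c • D 0 0 + s • D 0 1 with hq
  set v := (-s) • D 0 0 + c • D 0 1 with hv
  have hDq : c • D 1 0 + s • D 1 1 = μ • q := by
    rw [hA0, hA1, hq, hμ]
    match_scalars
    · linear_combination (-(α * c + β * s)) * hcs - s * hrot
    · linear_combination (-(β * c + δ * s)) * hcs + c * hrot
  have hDv : (-s) • D 1 0 + c • D 1 1 = κ • v := by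
    rw [hA0, hA1, hv, hκ]
    match_scalars
    · linear_combination (-(β * c - α * s)) * hcs + c * hrot
    · linear_combination (-(δ * c - β * s)) * hcs + s * hrot
  -- equal eigenvalues would make `D 1` a multiple of `D 0`
  have hμκ : μ - κ ≠ 0 := by
    intro h
    have hμκ : μ = κ := sub_eq_zero.1 h
    have := hN.coeff_eq_zero (c := ![-μ, 1]) (fun i => by
      have d0 : D 1 0 = μ • D 0 0 := by
        have : (c ^ 2 + s ^ 2) • D 1 0 = (c ^ 2 + s ^ 2) • μ • D 0 0 := by
          rw [← hμκ] at hDv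
          linear_combination (norm := module) c • hDq - s • hDv
        simpa [hcs] using this
      have d1 : D 1 1 = μ • D 0 1 := by
        have : (c ^ 2 + s ^ 2) • D 1 1 = (c ^ 2 + s ^ 2) • μ • D 0 1 := by
          rw [← hμκ] at hDv
          linear_combination (norm := module) s • hDq + c • hDv
        simpa [hcs] using this
      fin_cases i
      · simp [d0]
      · simp [d1])
    have := congrFun this 1
    simp at this
  -- eigenvectors of a symmetric map with different eigenvalues are orthogonal
  have hqv : (inner ℝ q v : ℝ) = 0 := by
    have e : (inner ℝ q (κ • v) : ℝ) = inner ℝ v (μ • q) := by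
      rw [← hDq, ← hDv, hq, hv]
      simp only [inner_add_left, inner_add_right, real_inner_smul_left, real_inner_smul_right]
      linear_combination (c ^ 2 + s ^ 2) * hXs
    rw [real_inner_smul_right, real_inner_smul_right, real_inner_comm] at e
    exact (mul_eq_zero.1 (show (μ - κ) * inner ℝ v q = 0 by linear_combination -e)).resolve_left hμκ
      |> fun h => (real_inner_comm _ _).trans h
  -- the part of the curvature identity that involves the pencil itself
  have hCw : (inner ℝ (C 1) (D 0 0) : ℝ) = inner ℝ (C 0) (D 1 0) ∧
      (inner ℝ (C 1) (D 0 1) : ℝ) = inner ℝ (C 0) (D 1 1) := by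
    have e0 : (inner ℝ (C 0) (D 1 0) : ℝ) = α * inner ℝ (C 0) (D 0 0) + β * inner ℝ (C 0) (D 0 1) := by
      rw [hA0, inner_add_right, real_inner_smul_right, real_inner_smul_right]
    have e1 : (inner ℝ (C 0) (D 1 1) : ℝ) = β * inner ℝ (C 0) (D 0 0) + δ * inner ℝ (C 0) (D 0 1) := by
      rw [hA1, inner_add_right, real_inner_smul_right, real_inner_smul_right]
    obtain ⟨r1, r2⟩ := hG
      (inner ℝ (C 1) (D 0 0) - inner ℝ (C 0) (D 1 0))
      (inner ℝ (C 1) (D 0 1) - inner ℝ (C 0) (D 1 1)) (by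
        linear_combination (norm := module) hLC + e0 • D 0 0 + e1 • D 0 1
          - (inner ℝ (C 0) (D 0 0) : ℝ) • hA0 - (inner ℝ (C 0) (D 0 1) : ℝ) • hA1)
    exact ⟨sub_eq_zero.1 r1, sub_eq_zero.1 r2⟩
  have c1q : (inner ℝ (C 1) q : ℝ) = μ * inner ℝ (C 0) q := by
    rw [← real_inner_smul_right, ← hDq, hq]
    simp only [inner_add_right, real_inner_smul_right, hCw.1, hCw.2]
  have c1v : (inner ℝ (C 1) v : ℝ) = κ * inner ℝ (C 0) v := by
    rw [← real_inner_smul_right, ← hDv, hv]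
    simp only [inner_add_right, real_inner_smul_right, hCw.1, hCw.2]
  have ev : ∀ f x : Fin 2 → ℝ, evalD D f x =
      f 0 • (x 0 • D 0 0 + x 1 • D 0 1) + f 1 • (x 0 • D 1 0 + x 1 • D 1 1) := fun f x => by
    simp only [evalD, Fin.sum_univ_two]; module
  have efx : evalD D ![-κ, 1] ![c, s] = (μ - κ) • q := by
    rw [ev]
    change (-κ) • q + (1 : ℝ) • (c • D 1 0 + s • D 1 1) = _
    rw [hDq]; module
  have egy : evalD D ![-μ, 1] ![-s, c] = (κ - μ) • v := by
    rw [ev]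
    change (-μ) • v + (1 : ℝ) • ((-s) • D 1 0 + c • D 1 1) = _
    rw [hDv]; module
  have ecf : evalC C ![-κ, 1] = (-κ) • C 0 + (1 : ℝ) • C 1 := by
    simp [evalC, Fin.sum_univ_two]
  have ecg : evalC C ![-μ, 1] = (-μ) • C 0 + (1 : ℝ) • C 1 := by
    simp [evalC, Fin.sum_univ_two]
  refine ⟨![c, s], ![-s, c], ![-κ, 1], ![-μ, 1], ⟨?_, ?_, ?_, ?_, ?_, ?_, ?_, ?_, ?_⟩⟩
  · simpa using hcs
  · simpa [add_comm] using hcs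
  · simp; ring
  · rw [ev]
    change (-μ) • q + (1 : ℝ) • (c • D 1 0 + s • D 1 1) = _
    rw [hDq]; module
  · rw [ev]
    change (-κ) • v + (1 : ℝ) • ((-s) • D 1 0 + c • D 1 1) = _
    rw [hDv]; module
  · rw [efx, egy, real_inner_smul_left, real_inner_smul_right, hqv]; ring
  · rw [efx, ecg, real_inner_smul_left, real_inner_comm, inner_add_left, real_inner_smul_left,
      real_inner_smul_left, c1q]; ring
  · rw [egy, ecf, real_inner_smul_left, real_inner_comm, inner_add_left, real_inner_smul_left,
      real_inner_smul_left, c1v]; ring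
  · have hC' : ∀ m : Fin 2 → ℝ, ∑ a, m a • (![evalC C ![-κ, 1], evalC C ![-μ, 1]] a) = 0 → m = 0 := by
      intro m hm
      simp only [Fin.sum_univ_two, Matrix.cons_val_zero, Matrix.cons_val_one, ecf, ecg] at hm
      have := hC ![-(m 0 * κ) - m 1 * μ, m 0 + m 1] (by
        simp only [Fin.sum_univ_two, Matrix.cons_val_zero, Matrix.cons_val_one]
        linear_combination (norm := module) hm)
      have h0 : -(m 0 * κ) - m 1 * μ = 0 := congrFun this 0
      have h1 : m 0 + m 1 = 0 := congrFun this 1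
      have h2 : (μ - κ) * m 0 = 0 := by linear_combination h0 + μ * h1
      have h3 := (mul_eq_zero.1 h2).resolve_left hμκ
      ext i; fin_cases i
      · exact h3
      · simpa [h3] using h1
    obtain ⟨ν, hν, hd⟩ := hN
    have := linearIndependent_of_functionals (n₀ := evalD D ![-κ, 1] ![c, s])
      (n₁ := evalD D ![-μ, 1] ![-s, c]) hC' (ν := ν) (fun k a => by
        fin_cases a
        · simp [ecf, hν]
        · simp [ecg, hν]) (by
        intro h0
        apply hd
        rw [efx, egy] at h0
        have h1 : (μ - κ) ^ 2 * (ν 0 q * ν 1 v - ν 0 v * ν 1 q) = 0 := by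
          simp only [map_smul, smul_eq_mul] at h0
          linear_combination -h0
        have h2 := (mul_eq_zero.1 h1).resolve_left (pow_ne_zero 2 hμκ)
        simp only [hq, hv, map_add, map_smul, smul_eq_mul] at h2
        have h3 : ν 0 (D 0 0) * ν 1 (D 0 1) - ν 0 (D 0 1) * ν 1 (D 0 0) = 0 := by
          linear_combination h2 - (ν 0 (D 0 0) * ν 1 (D 0 1) - ν 0 (D 0 1) * ν 1 (D 0 0)) * hcs
        simp only [hyperdet_eq_minors, hA0, hA1, map_add, map_smul, smul_eq_mul]
        linear_combination (2 * β * β * (-1) * (ν 0 (D 0 0) * ν 1 (D 0 1) - ν 0 (D 0 1) * ν 1 (D 0 0)) + 2 * (α * δ - β * β) * (ν 0 (D 0 0) * ν 1 (D 0 1) - ν 0 (D 0 1) * ν 1 (D 0 0)) - (δ ^ 2 + α ^ 2) * (ν 0 (D 0 0) * ν 1 (D 0 1) - ν 0 (D 0 1) * ν 1 (D 0 0))) * h3)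
    simpa using this

/-- A nondegenerate pencil that satisfies the curvature identity splits. -/
theorem exists_splitPencil_of_curvature {C : Fin 2 → H} {D : Fin 2 → Fin 2 → H}
    {W : Submodule ℝ H} (hW : Module.finrank ℝ W = 4) (hCW : ∀ a, C a ∈ W)
    (hDW : ∀ a i, D a i ∈ W)
    (hC : ∀ m : Fin 2 → ℝ, ∑ a, m a • C a = 0 → m = 0) (hN : Nondeg D C)
    (hG : ∀ a b : ℝ, a • D 0 0 + b • D 0 1 = 0 → a = 0 ∧ b = 0)
    {L : Fin 2 → Fin 2 → ℝ} (hLC : ∀ a, curvatureTerm D C a = ∑ d, L a d • C d)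
    (hLD : ∀ j a, curvatureTerm D (fun b => D b j) a = ∑ d, L a d • D d j) :
    ∃ x y f g, SplitPencil C D x y f g := by
  have : FiniteDimensional ℝ W := Module.finite_of_finrank_pos (by omega)
  have hspan : ∀ b : Fin 4 → H, LinearIndependent ℝ b → (∀ i, b i ∈ W) →
      Submodule.span ℝ (Set.range b) = W := fun b hb hbW =>
    Submodule.eq_of_le_of_finrank_eq (Submodule.span_le.2 (Set.range_subset_iff.2 hbW))
      (by rw [finrank_span_eq_card hb, hW]; rfl)
  set b : Fin 4 → H := ![D 0 0, D 0 1, D 1 0, D 1 1] with hb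
  have hbW : ∀ i, b i ∈ W := fun i => by fin_cases i <;> exact hDW _ _
  -- independent `D a i` would span `W`, and the pencil would be a cone
  by_cases hLI : LinearIndependent ℝ b
  · refine (false_of_curvature_of_linearIndependent (fun x y z w h => ?_) hC hN
      (fun a => ?_) hLC hLD).elim
    · have := Fintype.linearIndependent_iff.1 hLI ![x, y, z, w]
        (by simpa [Fin.sum_univ_four, hb] using h)
      exact ⟨this 0, this 1, this 2, this 3⟩
    · have hmem : C a ∈ Submodule.span ℝ (Set.range b) := by rw [hspan b hLI hbW]; exact hCW a
      obtain ⟨c, hc⟩ := (Submodule.mem_span_range_iff_exists_fun ℝ).1 hmem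
      refine ⟨![![c 0, c 1], ![c 2, c 3]], ?_⟩
      rw [← hc, Fin.sum_univ_four]
      rfl
  · -- a vector orthogonal to all `D a i`
    have hlt : Module.finrank ℝ (Submodule.span ℝ (Set.range b)) < 4 := by
      have h1 := finrank_range_le_card (R := ℝ) b
      rw [Set.finrank] at h1
      simp only [Fintype.card_fin] at h1
      refine lt_of_le_of_ne h1 fun h => hLI ?_
      rw [linearIndependent_iff_card_eq_finrank_span, Set.finrank, h]; rfl
    have hle : Submodule.span ℝ (Set.range b) ≤ W :=
      Submodule.span_le.2 (Set.range_subset_iff.2 hbW)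
    obtain ⟨w, hwW, hwb⟩ : ∃ w ∈ W ⊓ (Submodule.span ℝ (Set.range b))ᗮ, w ≠ 0 := by
      by_contra hcon
      push Not at hcon
      have h0 : W ⊓ (Submodule.span ℝ (Set.range b))ᗮ = ⊥ := (Submodule.eq_bot_iff _).2 hcon
      have hfd : FiniteDimensional ℝ (Submodule.span ℝ (Set.range b)) :=
        FiniteDimensional.span_of_finite ℝ (Set.finite_range b)
      have h1 := Submodule.sup_orthogonal_inf_of_hasOrthogonalProjection hle
      rw [inf_comm, h0, sup_bot_eq] at h1
      rw [h1, hW] at hlt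
      exact lt_irrefl _ hlt
    have hwD : ∀ a i, (inner ℝ w (D a i) : ℝ) = 0 := fun a i => by
      rw [real_inner_comm]
      refine (Submodule.mem_orthogonal _ _).1 hwW.2 _ (Submodule.subset_span ?_)
      fin_cases a <;> fin_cases i
      exacts [⟨0, rfl⟩, ⟨1, rfl⟩, ⟨2, rfl⟩, ⟨3, rfl⟩]
    have hwC : (inner ℝ w (C 0) : ℝ) ≠ 0 ∨ (inner ℝ w (C 1) : ℝ) ≠ 0 := by
      by_contra hcon
      push Not at hcon
      obtain ⟨a, i, a', j, hI⟩ := hN.exists_minor hC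
      have hs := hspan _ hI (fun k => by
        fin_cases k
        exacts [hDW _ _, hDW _ _, hCW _, hCW _])
      have hw' : w ∈ Submodule.span ℝ (Set.range ![D a i, D a' j, C 0, C 1]) := by
        rw [hs]; exact hwW.1
      have : w ∈ (Submodule.span ℝ (Set.range ![D a i, D a' j, C 0, C 1]))ᗮ := by
        rw [Submodule.mem_orthogonal]
        intro u hu
        induction hu using Submodule.span_induction with
        | mem x hx =>
          obtain ⟨k, rfl⟩ := hx
          rw [real_inner_comm]
          fin_cases k
          exacts [hwD _ _, hwD _ _, hcon.1, hcon.2]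
        | zero => simp
        | add x y _ _ hx hy => rw [inner_add_left, hx, hy, add_zero]
        | smul c x _ hx => rw [inner_smul_left, hx]; simp
      exact hwb (inner_self_eq_zero.1 ((Submodule.mem_orthogonal _ _).1 this w hw'))
    have hL := curvature_coeff_eq_zero hN hwD hwC hLC hLD
    subst hL
    exact exists_splitPencil_of_flat hC hN hG (by simpa using hLC 0)
      (fun j => by simpa using hLD j 0)

end KAlgebraSplit

/-! ### Pencils with a mixed frame at every point -/

section PlaneAlgebra

/-- An orthonormal basis of the plane is a rotated one up to orientation. -/
theorem eq_smul_rot_of_orthonormal {x y : Fin 2 → ℝ} (hx : x 0 ^ 2 + x 1 ^ 2 = 1)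
    (hy : y 0 ^ 2 + y 1 ^ 2 = 1) (hxy : x 0 * y 0 + x 1 * y 1 = 0) :
    ∃ σ : ℝ, σ ^ 2 = 1 ∧ y 0 = -σ * x 1 ∧ y 1 = σ * x 0 := by
  have h0 : y 0 = -(x 0 * y 1 - x 1 * y 0) * x 1 := by linear_combination x 0 * hxy - y 0 * hx
  have h1 : y 1 = (x 0 * y 1 - x 1 * y 0) * x 0 := by linear_combination x 1 * hxy - y 1 * hx
  refine ⟨x 0 * y 1 - x 1 * y 0, ?_, h0, h1⟩
  linear_combination hy + (y 0 ^ 2 + y 1 ^ 2) * hx - hy - (x 0 * y 0 + x 1 * y 1) * hxy + hy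

theorem exists_coords_of_orthonormal {x y : Fin 2 → ℝ} (hx : x 0 ^ 2 + x 1 ^ 2 = 1)
    (hy : y 0 ^ 2 + y 1 ^ 2 = 1) (hxy : x 0 * y 0 + x 1 * y 1 = 0) (z : Fin 2 → ℝ) :
    ∃ ξ η : ℝ, z = ξ • x + η • y := by
  obtain ⟨σ, hσ, h0, h1⟩ := eq_smul_rot_of_orthonormal hx hy hxy
  refine ⟨z 0 * x 0 + z 1 * x 1, z 0 * y 0 + z 1 * y 1, ?_⟩
  ext i
  fin_cases i
  · change z 0 = (z 0 * x 0 + z 1 * x 1) * x 0 + (z 0 * y 0 + z 1 * y 1) * y 0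
    rw [h0, h1]; linear_combination (-z 0) * hx + (-z 0 * x 1 ^ 2 + z 1 * x 0 * x 1) * hσ
  · change z 1 = (z 0 * x 0 + z 1 * x 1) * x 1 + (z 0 * y 0 + z 1 * y 1) * y 1
    rw [h0, h1]; linear_combination (-z 1) * hx + (z 0 * x 1 * x 0 - z 1 * x 0 ^ 2) * hσ

theorem exists_coords_of_det {f g : Fin 2 → ℝ} (h : f 0 * g 1 - f 1 * g 0 ≠ 0) (z : Fin 2 → ℝ) :
    ∃ α β : ℝ, z = α • f + β • g := by
  refine ⟨(z 0 * g 1 - z 1 * g 0) / (f 0 * g 1 - f 1 * g 0),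
    (f 0 * z 1 - f 1 * z 0) / (f 0 * g 1 - f 1 * g 0), ?_⟩
  ext i
  fin_cases i
  · change z 0 = _ / _ * f 0 + _ / _ * g 0
    rw [div_mul_eq_mul_div, div_mul_eq_mul_div, ← add_div, eq_div_iff h]; ring
  · change z 1 = _ / _ * f 1 + _ / _ * g 1
    rw [div_mul_eq_mul_div, div_mul_eq_mul_div, ← add_div, eq_div_iff h]; ring

end PlaneAlgebra

section TypeBMixed

variable {H : Type*}

theorem LinearIndependent.exists_functional [AddCommGroup H] [Module ℝ H] {ι : Type*} {b : ι → H}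
    (hb : LinearIndependent ℝ b) (c : ι → ℝ) : ∃ φ : H →ₗ[ℝ] ℝ, ∀ i, φ (b i) = c i := by
  obtain ⟨φ, hφ⟩ := LinearMap.exists_extend ((Module.Basis.span hb).constr ℝ c)
  refine ⟨φ, fun i => ?_⟩
  have := LinearMap.congr_fun hφ (Module.Basis.span hb i)
  rw [Module.Basis.constr_basis] at this
  rw [← this]
  simp [Module.Basis.span_apply hb]

section Module

variable [AddCommGroup H] [Module ℝ H]

theorem evalC_add_smul (C : Fin 2 → H) (α β : ℝ) (f g : Fin 2 → ℝ) :
    evalC C (α • f + β • g) = α • evalC C f + β • evalC C g := by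
  simp only [evalC, Fin.sum_univ_two, Pi.add_apply, Pi.smul_apply, smul_eq_mul]; module

theorem evalD_add_smul_left (D : Fin 2 → Fin 2 → H) (α β : ℝ) (f g x : Fin 2 → ℝ) :
    evalD D (α • f + β • g) x = α • evalD D f x + β • evalD D g x := by
  simp only [evalD, Fin.sum_univ_two, Pi.add_apply, Pi.smul_apply, smul_eq_mul]; module

theorem evalD_add_smul_right (D : Fin 2 → Fin 2 → H) (α β : ℝ) (f x y : Fin 2 → ℝ) :
    evalD D f (α • x + β • y) = α • evalD D f x + β • evalD D f y := by
  simp only [evalD, Fin.sum_univ_two, Pi.add_apply, Pi.smul_apply, smul_eq_mul]; module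

theorem evalC_pencil (C : Fin 2 → H) (D : Fin 2 → Fin 2 → H) (s f : Fin 2 → ℝ) :
    evalC (pencil C D s) f = evalC C f + evalD D f s := by
  simp only [evalC, evalD, pencil, Fin.sum_univ_two]; module

theorem det_ne_zero_of_linearIndependent {C : Fin 2 → H} {q v : H} {f g : Fin 2 → ℝ}
    (h : LinearIndependent ℝ ![q, v, evalC C f, evalC C g]) : f 0 * g 1 - f 1 * g 0 ≠ 0 := by
  intro hdet
  rw [Fintype.linearIndependent_iff] at h
  have key : ∀ α β : ℝ, α • f + β • g = 0 → α = 0 ∧ β = 0 := fun α β hab => by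
    have e := evalC_add_smul C α β f g
    rw [hab] at e
    have := h ![0, 0, α, β] (by
      simp only [Fin.sum_univ_four]
      change (0 : ℝ) • q + (0 : ℝ) • v + α • evalC C f + β • evalC C g = 0
      rw [zero_smul, zero_smul, add_zero, zero_add, ← e]; simp [evalC])
    exact ⟨this 2, this 3⟩
  have h0 := key (g 0) (-f 0) (by
    ext i; fin_cases i
    · change g 0 * f 0 + -f 0 * g 0 = 0; ring
    · change g 0 * f 1 + -f 0 * g 1 = 0; linarith)
  have h1 := key (g 1) (-f 1) (by
    ext i; fin_cases i
    · change g 1 * f 0 + -f 1 * g 0 = 0; linarith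
    · change g 1 * f 1 + -f 1 * g 1 = 0; ring)
  have := (key 1 0 (by
    ext i; fin_cases i
    · simpa using h0.2
    · simpa using h1.2)).1
  norm_num at this

end Module

variable [NormedAddCommGroup H] [InnerProductSpace ℝ H]

/-- The second fundamental form at a point where the ruling contains one vector from each
eigenspace of the reflection: `x`, `y` are the coordinates of these two vectors in the ruling, and
`g`, `f` are the directions of the orthogonal complements of the ruling in the two eigenspaces. -/
structure MixedFrame (M : Fin 2 → H) (D : Fin 2 → Fin 2 → H) (x y f g : Fin 2 → ℝ) : Prop where
  norm_x : x 0 ^ 2 + x 1 ^ 2 = 1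
  norm_y : y 0 ^ 2 + y 1 ^ 2 = 1
  orth : x 0 * y 0 + x 1 * y 1 = 0
  gx : ∃ l, evalD D g x = evalC M l
  fy : ∃ l, evalD D f y = evalC M l
  f_g : inner ℝ (evalC M f) (evalC M g) = 0
  indep : LinearIndependent ℝ ![evalD D f x, evalD D g y, evalC M f, evalC M g]

theorem MixedFrame.swap {M : Fin 2 → H} {D : Fin 2 → Fin 2 → H} {x y f g : Fin 2 → ℝ}
    (h : MixedFrame M D x y f g) : MixedFrame M D y x g f where
  norm_x := h.norm_y
  norm_y := h.norm_x
  orth := by linarith [h.orth]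
  gx := h.fy
  fy := h.gx
  f_g := by rw [real_inner_comm]; exact h.f_g
  indep := by
    have := h.indep.comp ![1, 0, 3, 2] (by decide)
    convert this using 1
    ext i; fin_cases i <;> rfl

/-- The bivector `∑ᵢ D_f eᵢ ∧ D_g eᵢ`, which does not depend on the orthonormal basis `eᵢ` of the
ruling, vanishes on the normal space at a point with a mixed frame. -/
theorem MixedFrame.bivector_eq_zero {M : Fin 2 → H} {D : Fin 2 → Fin 2 → H}
    {x y f g x' y' f' g' : Fin 2 → ℝ} (hx : x 0 ^ 2 + x 1 ^ 2 = 1)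
    (hy : y 0 ^ 2 + y 1 ^ 2 = 1) (hxy : x 0 * y 0 + x 1 * y 1 = 0)
    (h : MixedFrame M D x' y' f' g')
    (ν μ : H →ₗ[ℝ] ℝ) (hν : ∀ l, ν (evalC M l) = 0) (hμ : ∀ l, μ (evalC M l) = 0) :
    ν (evalD D f x) * μ (evalD D g x) - μ (evalD D f x) * ν (evalD D g x) +
      (ν (evalD D f y) * μ (evalD D g y) - μ (evalD D f y) * ν (evalD D g y)) = 0 := by
  obtain ⟨σ, hσ, h0, h1⟩ := eq_smul_rot_of_orthonormal hx hy hxy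
  obtain ⟨σ', hσ', h0', h1'⟩ := eq_smul_rot_of_orthonormal h.norm_x h.norm_y h.orth
  have hd := det_ne_zero_of_linearIndependent h.indep
  obtain ⟨l, hl⟩ := h.gx
  obtain ⟨l', hl'⟩ := h.fy
  have a1 := hν l
  have a2 := hμ l
  have a3 := hν l'
  have a4 := hμ l'
  have hn := h.norm_x
  rw [← hl] at a1 a2
  rw [← hl'] at a3 a4
  simp only [evalD, Fin.sum_univ_two, map_add, map_smul, smul_eq_mul, h0, h1, h0', h1'] at *
  have hσ0 : σ' ≠ 0 := fun h => by rw [h] at hσ'; norm_num at hσ'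
  generalize ν (D 0 0) = n00 at *
  generalize ν (D 0 1) = n01 at *
  generalize ν (D 1 0) = n10 at *
  generalize ν (D 1 1) = n11 at *
  generalize μ (D 0 0) = m00 at *
  generalize μ (D 0 1) = m01 at *
  generalize μ (D 1 0) = m10 at *
  generalize μ (D 1 1) = m11 at *
  have b3 : f' 0 * -x' 1 * n00 + f' 0 * x' 0 * n01 + (f' 1 * -x' 1 * n10 + f' 1 * x' 0 * n11) = 0 :=
    (mul_eq_zero.1 (show σ' * _ = 0 by linear_combination a3)).resolve_left hσ0
  have b4 : f' 0 * -x' 1 * m00 + f' 0 * x' 0 * m01 + (f' 1 * -x' 1 * m10 + f' 1 * x' 0 * m11) = 0 :=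
    (mul_eq_zero.1 (show σ' * _ = 0 by linear_combination a4)).resolve_left hσ0
  -- the bivector in the coordinate basis
  have key : n00 * m10 - m00 * n10 + (n01 * m11 - m01 * n11) = 0 := by
    apply (mul_eq_zero.1 (show (f' 0 * g' 1 - f' 1 * g' 0) * _ = 0 from ?_)).resolve_left hd
    linear_combination (-(f' 0 * g' 1 - f' 1 * g' 0) *
      (n00 * m10 - m00 * n10 + (n01 * m11 - m01 * n11))) * hn
      + (f' 0 * x' 0 * n00 + f' 0 * x' 1 * n01 + (f' 1 * x' 0 * n10 + f' 1 * x' 1 * n11)) * a2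
      - (f' 0 * x' 0 * m00 + f' 0 * x' 1 * m01 + (f' 1 * x' 0 * m10 + f' 1 * x' 1 * m11)) * a1
      + (g' 0 * -x' 1 * m00 + g' 0 * x' 0 * m01 + (g' 1 * -x' 1 * m10 + g' 1 * x' 0 * m11)) * b3
      - (g' 0 * -x' 1 * n00 + g' 0 * x' 0 * n01 + (g' 1 * -x' 1 * n10 + g' 1 * x' 0 * n11)) * b4
  linear_combination (f 0 * g 1 - f 1 * g 0) * key +
    (f 0 * g 1 - f 1 * g 0) * (n00 * m10 - m00 * n10 + (n01 * m11 - m01 * n11)) * (hx)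
    + (f 0 * g 1 - f 1 * g 0) * ((n00 * m10 - m00 * n10) * x 1 ^ 2 + (n01 * m11 - m01 * n11) * x 0 ^ 2 - (n00 * m11 + n01 * m10 - m00 * n11 - m01 * n10) * x 0 * x 1) * hσ

end TypeBMixed

section TypeBMixed2

variable {H : Type*} [NormedAddCommGroup H] [InnerProductSpace ℝ H]

/-- The two directions of degeneracy of a pencil in which only `D g x` has a component along the
pencil. -/
theorem MixedFrame.directions {C : Fin 2 → H} {D : Fin 2 → Fin 2 → H} {x y f g : Fin 2 → ℝ}
    (h : MixedFrame C D x y f g) {c : ℝ} (hgx : evalD D g x = c • evalC C f)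
    (hfy : evalD D f y = 0) {s₁ s₂ : ℝ} {x' y' f' g' : Fin 2 → ℝ}
    (h' : MixedFrame (pencil C D (s₁ • x + s₂ • y)) D x' y' f' g') :
    (∃ α β : ℝ, f' = α • f ∧ g' = β • (g + (c * s₁) • f)) ∨
      (∃ α β : ℝ, g' = α • f ∧ f' = β • (g + (c * s₁) • f)) := by
  have hd := det_ne_zero_of_linearIndependent h.indep
  have hd' := det_ne_zero_of_linearIndependent h'.indep
  -- the solutions `(a, z)` of `D a z ∈ span M` at the point with coordinates `s₁`, `s₂`
  have key : ∀ a z l : Fin 2 → ℝ, evalD D a z = evalC (pencil C D (s₁ • x + s₂ • y)) l →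
      ∃ α β ξ η : ℝ, a = α • f + β • g ∧ z = ξ • x + η • y ∧ β * η = 0 ∧
        α * ξ = s₁ * c * (β * ξ) := by
    intro a z l hl
    obtain ⟨α, β, rfl⟩ := exists_coords_of_det hd a
    obtain ⟨κ, κ', rfl⟩ := exists_coords_of_det hd l
    obtain ⟨ξ, η, rfl⟩ := exists_coords_of_orthonormal h.norm_x h.norm_y h.orth z
    rw [evalC_add_smul, evalC_pencil, evalC_pencil] at hl
    simp only [evalD_add_smul_left, evalD_add_smul_right, hgx, hfy] at hl
    have hI := Fintype.linearIndependent_iff.1 h.indep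
      ![α * ξ - κ * s₁, β * η - κ' * s₂, β * ξ * c - κ - κ' * s₁ * c, -κ'] (by
        simp only [Fin.sum_univ_four]
        change (α * ξ - κ * s₁) • evalD D f x + (β * η - κ' * s₂) • evalD D g y +
          (β * ξ * c - κ - κ' * s₁ * c) • evalC C f + (-κ') • evalC C g = 0
        linear_combination (norm := module) hl)
    have h0 : α * ξ - κ * s₁ = 0 := hI 0
    have h1 : β * η - κ' * s₂ = 0 := hI 1
    have h2 : β * ξ * c - κ - κ' * s₁ * c = 0 := hI 2
    have h3 : -κ' = 0 := hI 3
    refine ⟨α, β, ξ, η, rfl, rfl, ?_, ?_⟩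
    · linear_combination h1 - s₂ * h3
    · linear_combination h0 - s₁ * h2 + s₁ * s₁ * c * h3
  obtain ⟨l, hl⟩ := h'.gx
  obtain ⟨l', hl'⟩ := h'.fy
  obtain ⟨α, β, ξ, η, hg, hx, e1, e2⟩ := key _ _ _ hl
  obtain ⟨α', β', ξ', η', hf, hy, e1', e2'⟩ := key _ _ _ hl'
  have hdxy : x' 0 * y' 1 - x' 1 * y' 0 ≠ 0 := by
    obtain ⟨σ, hσ, h0, h1⟩ := eq_smul_rot_of_orthonormal h'.norm_x h'.norm_y h'.orth
    rw [h0, h1]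
    have : x' 0 * (σ * x' 0) - x' 1 * (-σ * x' 1) = σ := by linear_combination σ * h'.norm_x
    rw [this]
    intro h; rw [h] at hσ; norm_num at hσ
  have hdet1 : ξ * η' - η * ξ' ≠ 0 := by
    intro h0
    apply hdxy
    rw [hx, hy]
    simp only [Pi.add_apply, Pi.smul_apply, smul_eq_mul]
    linear_combination (x 0 * y 1 - x 1 * y 0) * h0
  have hdet2 : α' * β - β' * α ≠ 0 := by
    intro h0
    apply hd'
    rw [hf, hg]
    simp only [Pi.add_apply, Pi.smul_apply, smul_eq_mul]
    linear_combination (f 0 * g 1 - f 1 * g 0) * h0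
  by_cases hη : η = 0
  · -- `x'` is proportional to `x`
    have hξ : ξ ≠ 0 := fun h0 => hdet1 (by rw [h0, hη]; ring)
    have hη' : η' ≠ 0 := fun h0 => hdet1 (by rw [h0, hη]; ring)
    have hβ' : β' = 0 := (mul_eq_zero.1 e1').resolve_right hη'
    have hα : α = s₁ * c * β := by
      have : ξ * (α - s₁ * c * β) = 0 := by linear_combination e2
      exact sub_eq_zero.1 ((mul_eq_zero.1 this).resolve_left hξ)
    refine Or.inl ⟨α', β, ?_, ?_⟩
    · rw [hf, hβ']; simp
    · rw [hg, hα]; module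
  · have hβ : β = 0 := (mul_eq_zero.1 e1).resolve_right hη
    have hβ' : β' ≠ 0 := fun h0 => hdet2 (by rw [h0, hβ]; ring)
    have hα0 : α ≠ 0 := fun h0 => hdet2 (by rw [h0, hβ]; ring)
    have hξ : ξ = 0 := by
      rw [hβ] at e2
      have : α * ξ = 0 := by linear_combination e2
      exact (mul_eq_zero.1 this).resolve_left hα0
    have hξ' : ξ' ≠ 0 := fun h0 => hdet1 (by rw [h0, hξ]; ring)
    have hα' : α' = s₁ * c * β' := by
      have : ξ' * (α' - s₁ * c * β') = 0 := by linear_combination e2'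
      exact sub_eq_zero.1 ((mul_eq_zero.1 this).resolve_left hξ')
    refine Or.inr ⟨α, β', ?_, ?_⟩
    · rw [hg, hβ]; simp
    · rw [hf, hα']; module

theorem MixedFrame.evalC_ne_zero {M : Fin 2 → H} {D : Fin 2 → Fin 2 → H} {x y f g : Fin 2 → ℝ}
    (h : MixedFrame M D x y f g) : evalC M f ≠ 0 ∧ evalC M g ≠ 0 :=
  ⟨h.indep.ne_zero 2, h.indep.ne_zero 3⟩

/-- In a pencil in which only `D g x` has a component along the pencil, the two distinguished
directions of the points of the pencil stay orthogonal. -/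
theorem MixedFrame.inner_pencil_eq_zero {C : Fin 2 → H} {D : Fin 2 → Fin 2 → H}
    {x y f g : Fin 2 → ℝ} (h : MixedFrame C D x y f g) {c : ℝ}
    (hgx : evalD D g x = c • evalC C f) (hfy : evalD D f y = 0) {s₁ s₂ : ℝ} {x' y' f' g' : Fin 2 → ℝ}
    (h' : MixedFrame (pencil C D (s₁ • x + s₂ • y)) D x' y' f' g') :
    inner ℝ (evalC C f + s₁ • evalD D f x)
      (evalC C g + (2 * c * s₁) • evalC C f + s₂ • evalD D g y + (c * s₁ ^ 2) • evalD D f x) =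
        (0 : ℝ) := by
  set M := pencil C D (s₁ • x + s₂ • y) with hM
  have e1 : evalC M f = evalC C f + s₁ • evalD D f x := by
    rw [hM, evalC_pencil, evalD_add_smul_right, hfy]; simp
  have e2 : evalC M (g + (c * s₁) • f) =
      evalC C g + (2 * c * s₁) • evalC C f + s₂ • evalD D g y + (c * s₁ ^ 2) • evalD D f x := by
    have := evalC_add_smul M 1 (c * s₁) g f
    rw [one_smul, one_smul] at this
    rw [this, e1, hM, evalC_pencil, evalD_add_smul_right, hgx]; module
  rw [← e1, ← e2]
  have hsm : ∀ (t : ℝ) (a : Fin 2 → ℝ), evalC M (t • a) = t • evalC M a := fun t a => by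
    simpa using evalC_add_smul M t 0 a a
  have h0 := h'.f_g
  obtain ⟨n1, n2⟩ := h'.evalC_ne_zero
  rcases h.directions hgx hfy h' with ⟨α, β, hf, hg⟩ | ⟨α, β, hg, hf⟩
  · rw [hf, hsm] at h0 n1
    rw [hg, hsm] at h0 n2
    rw [real_inner_smul_left, real_inner_smul_right] at h0
    have hα : α ≠ 0 := fun h => n1 (by rw [h, zero_smul])
    have hβ : β ≠ 0 := fun h => n2 (by rw [h, zero_smul])
    simpa [hα, hβ] using h0
  · rw [hf, hsm] at h0 n1
    rw [hg, hsm] at h0 n2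
    rw [real_inner_smul_left, real_inner_smul_right, real_inner_comm] at h0
    have hα : α ≠ 0 := fun h => n2 (by rw [h, zero_smul])
    have hβ : β ≠ 0 := fun h => n1 (by rw [h, zero_smul])
    simpa [hα, hβ] using h0

theorem abs_coord_le {x y : Fin 2 → ℝ} (hx : x 0 ^ 2 + x 1 ^ 2 = 1) (hy : y 0 ^ 2 + y 1 ^ 2 = 1)
    {ε s₁ s₂ : ℝ} (h₁ : |s₁| ≤ ε / 2) (h₂ : |s₂| ≤ ε / 2) (i : Fin 2) :
    |(s₁ • x + s₂ • y) i| ≤ ε := by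
  have hx1 : |x i| ≤ 1 := by
    rw [abs_le_one_iff_mul_self_le_one]; fin_cases i
    · change x 0 * x 0 ≤ 1; nlinarith
    · change x 1 * x 1 ≤ 1; nlinarith
  have hy1 : |y i| ≤ 1 := by
    rw [abs_le_one_iff_mul_self_le_one]; fin_cases i
    · change y 0 * y 0 ≤ 1; nlinarith
    · change y 1 * y 1 ≤ 1; nlinarith
  calc |(s₁ • x + s₂ • y) i| ≤ |s₁ * x i| + |s₂ * y i| := abs_add_le _ _
    _ ≤ |s₁| + |s₂| := by
      rw [abs_mul, abs_mul]
      exact add_le_add (mul_le_of_le_one_right (abs_nonneg _) hx1)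
        (mul_le_of_le_one_right (abs_nonneg _) hy1)
    _ ≤ ε := by linarith

/-- The component of `D g x` along the pencil vanishes, since the orthogonality of the two directions
at all points is an identity between polynomials. -/
theorem MixedFrame.coeff_eq_zero {C : Fin 2 → H} {D : Fin 2 → Fin 2 → H}
    {x y f g : Fin 2 → ℝ} (h : MixedFrame C D x y f g) {c : ℝ}
    (hgx : evalD D g x = c • evalC C f) (hfy : evalD D f y = 0) {ε : ℝ} (hε : 0 < ε)
    (hs : ∀ s : Fin 2 → ℝ, (∀ i, |s i| ≤ ε) →
      ∃ x' y' f' g', MixedFrame (pencil C D s) D x' y' f' g') : c = 0 := by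
  have key : ∀ t : ℝ, |t| ≤ ε / 2 → inner ℝ (evalC C f + t • evalD D f x)
      (evalC C g + (2 * c * t) • evalC C f + (0 : ℝ) • evalD D g y +
        (c * t ^ 2) • evalD D f x) = (0 : ℝ) := fun t ht => by
    obtain ⟨x', y', f', g', h'⟩ := hs (t • x + (0 : ℝ) • y)
      (abs_coord_le h.norm_x h.norm_y ht (by simp; positivity))
    exact h.inner_pencil_eq_zero hgx hfy h'
  -- the third difference of a cubic polynomial that vanishes near the origin
  have k1 := key (ε / 4) (by rw [abs_of_pos (by positivity)]; linarith)
  have k2 := key (-(ε / 4)) (by rw [abs_neg, abs_of_pos (by positivity)]; linarith)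
  have k3 := key (ε / 2) (by rw [abs_of_pos (by positivity)])
  have k4 := key (-(ε / 2)) (by rw [abs_neg, abs_of_pos (by positivity)])
  simp only [inner_add_left, inner_add_right, real_inner_smul_left, real_inner_smul_right]
    at k1 k2 k3 k4
  have hq : 0 < inner ℝ (evalD D f x) (evalD D f x) := by
    rw [real_inner_self_eq_norm_sq]
    have := h.indep.ne_zero 0
    have : 0 < ‖evalD D f x‖ := norm_pos_iff.2 this
    positivity
  have : c * (ε ^ 3 * inner ℝ (evalD D f x) (evalD D f x)) = 0 := by
    linear_combination (16 / 3) * (k3 - k4) - (32 / 3) * (k1 - k2)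
  exact (mul_eq_zero.1 this).resolve_right (by positivity)

/-- If all points of the pencil near the origin have a mixed frame, the pencil splits, and the axes
of the two factors are orthogonal. -/
theorem MixedFrame.splitPencil {C : Fin 2 → H} {D : Fin 2 → Fin 2 → H}
    {x y f g : Fin 2 → ℝ} (h : MixedFrame C D x y f g) {ε : ℝ} (hε : 0 < ε)
    (hs : ∀ s : Fin 2 → ℝ, (∀ i, |s i| ≤ ε) →
      ∃ x' y' f' g', MixedFrame (pencil C D s) D x' y' f' g') :
    SplitPencil C D x y f g := by
  have hd := det_ne_zero_of_linearIndependent h.indep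
  obtain ⟨l, hl⟩ := h.gx
  obtain ⟨l', hl'⟩ := h.fy
  obtain ⟨c, d, rfl⟩ := exists_coords_of_det hd l
  obtain ⟨a, b, rfl⟩ := exists_coords_of_det hd l'
  rw [evalC_add_smul] at hl hl'
  -- the bivector is evaluated on the two functionals that vanish on the plane of the pencil at `s`
  have hσ : ∀ {s₁ s₂ : ℝ}, s₁ ≠ 0 → s₂ ≠ 0 → |s₁| ≤ ε / 2 → |s₂| ≤ ε / 2 →
      (b * c - a * d) * (s₁ ^ 2 + s₂ ^ 2) = d * s₂ + a * s₁ := by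
    intro s₁ s₂ h1 h2 hs1 hs2
    obtain ⟨x', y', f', g', h'⟩ := hs (s₁ • x + s₂ • y) (abs_coord_le h.norm_x h.norm_y hs1 hs2)
    obtain ⟨ν, hν⟩ := h.indep.exists_functional ![-(1 + a * s₂) / s₁, -(c * s₁) / s₂, 1, 0]
    obtain ⟨μ, hμ⟩ := h.indep.exists_functional ![-(b * s₂) / s₁, -(1 + d * s₁) / s₂, 0, 1]
    have n0 : ν (evalD D f x) = -(1 + a * s₂) / s₁ := hν 0
    have n1 : ν (evalD D g y) = -(c * s₁) / s₂ := hν 1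
    have n2 : ν (evalC C f) = 1 := hν 2
    have n3 : ν (evalC C g) = 0 := hν 3
    have m0 : μ (evalD D f x) = -(b * s₂) / s₁ := hμ 0
    have m1 : μ (evalD D g y) = -(1 + d * s₁) / s₂ := hμ 1
    have m2 : μ (evalC C f) = 0 := hμ 2
    have m3 : μ (evalC C g) = 1 := hμ 3
    have := h'.bivector_eq_zero h.norm_x h.norm_y h.orth (f := f) (g := g) ν μ (fun m => by
      obtain ⟨κ, κ', rfl⟩ := exists_coords_of_det hd m
      rw [evalC_add_smul, evalC_pencil, evalC_pencil, evalD_add_smul_right, evalD_add_smul_right,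
        hl, hl']
      simp only [map_add, map_smul, smul_eq_mul, n0, n1, n2, n3]
      field_simp; ring) (fun m => by
      obtain ⟨κ, κ', rfl⟩ := exists_coords_of_det hd m
      rw [evalC_add_smul, evalC_pencil, evalC_pencil, evalD_add_smul_right, evalD_add_smul_right,
        hl, hl']
      simp only [map_add, map_smul, smul_eq_mul, m0, m1, m2, m3]
      field_simp; ring)
    rw [hl, hl'] at this
    simp only [map_add, map_smul, smul_eq_mul, n0, n1, n2, n3, m0, m1, m2, m3] at this
    field_simp at this
    linear_combination this
  have hε4 : (0 : ℝ) < ε / 2 := by positivity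
  have p1 := hσ hε4.ne' hε4.ne' (abs_of_pos hε4).le (abs_of_pos hε4).le
  have p2 := hσ (neg_ne_zero.2 hε4.ne') (neg_ne_zero.2 hε4.ne')
    (by rw [abs_neg]; exact (abs_of_pos hε4).le) (by rw [abs_neg]; exact (abs_of_pos hε4).le)
  have p3 := hσ hε4.ne' (neg_ne_zero.2 hε4.ne') (abs_of_pos hε4).le
    (by rw [abs_neg]; exact (abs_of_pos hε4).le)
  have hk : b * c - a * d = 0 := by
    have : (b * c - a * d) * ε ^ 2 = 0 := by linear_combination p1 + p2
    exact (mul_eq_zero.1 this).resolve_right (by positivity)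
  rw [hk] at p1 p3
  have ha : a = 0 := by
    have : a * ε = 0 := by linear_combination -p1 - p3
    exact (mul_eq_zero.1 this).resolve_right hε.ne'
  have hd0 : d = 0 := by
    have : d * ε = 0 := by linear_combination p3 - p1
    exact (mul_eq_zero.1 this).resolve_right hε.ne'
  subst ha; subst hd0
  have hbc : b * c = 0 := by linear_combination hk
  rw [zero_smul, add_zero] at hl
  rw [zero_smul, zero_add] at hl'
  have hb : b = 0 ∧ c = 0 := by
    rcases mul_eq_zero.1 hbc with hb | hc
    · refine ⟨hb, h.coeff_eq_zero hl (by rw [hl', hb, zero_smul]) hε hs⟩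
    · refine ⟨h.swap.coeff_eq_zero hl' (by rw [hl, hc, zero_smul]) hε fun s hs' => ?_, hc⟩
      obtain ⟨x', y', f', g', h'⟩ := hs s hs'
      exact ⟨_, _, _, _, h'.swap⟩
  obtain ⟨rfl, rfl⟩ := hb
  have hgx : evalD D g x = 0 := by rw [hl, zero_smul]
  have hfy : evalD D f y = 0 := by rw [hl', zero_smul]
  have key : ∀ t u : ℝ, |t| ≤ ε / 2 → |u| ≤ ε / 2 →
      inner ℝ (evalC C f) (evalC C g) + t * inner ℝ (evalD D f x) (evalC C g) +
        u * inner ℝ (evalC C f) (evalD D g y) +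
        t * u * inner ℝ (evalD D f x) (evalD D g y) = (0 : ℝ) := fun t u ht hu => by
    obtain ⟨x', y', f', g', h'⟩ := hs (t • x + u • y) (abs_coord_le h.norm_x h.norm_y ht hu)
    have := h.inner_pencil_eq_zero hl hfy h'
    simp only [mul_zero, zero_mul, zero_smul, add_zero, inner_add_left, inner_add_right,
      real_inner_smul_left, real_inner_smul_right] at this
    linear_combination this
  have h0 : |(0 : ℝ)| ≤ ε / 2 := by rw [abs_zero]; positivity
  have k1 := key (ε / 2) 0 (abs_of_pos hε4).le h0
  have k2 := key 0 (ε / 2) h0 (abs_of_pos hε4).le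
  have k3 := key (ε / 2) (ε / 2) (abs_of_pos hε4).le (abs_of_pos hε4).le
  rw [h.f_g] at k1 k2 k3
  have z : ∀ w : ℝ, ε * w = 0 → w = 0 := fun w hw => (mul_eq_zero.1 hw).resolve_left hε.ne'
  have r1 := z _ (by linear_combination 2 * k1 : ε * inner ℝ (evalD D f x) (evalC C g) = 0)
  have r2 := z _ (by linear_combination 2 * k2 : ε * inner ℝ (evalC C f) (evalD D g y) = 0)
  have r3 := z _ (z _ (by linear_combination 4 * k3 - 2 * ε * r1 - 2 * ε * r2 :
    ε * (ε * inner ℝ (evalD D f x) (evalD D g y)) = 0))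
  exact ⟨h.norm_x, h.norm_y, h.orth, hgx, hfy, r3, r1, by rw [real_inner_comm]; exact r2, h.indep⟩

/-- In a pencil that splits, the mixed frames of its points all have the same directions. -/
theorem SplitPencil.directions {C : Fin 2 → H} {D : Fin 2 → Fin 2 → H}
    {x y f g : Fin 2 → ℝ} (h : SplitPencil C D x y f g) (hfg : inner ℝ (evalC C f) (evalC C g) = (0 : ℝ))
    {s x' y' f' g' : Fin 2 → ℝ} (h' : MixedFrame (pencil C D s) D x' y' f' g') :
    ((∃ α : ℝ, f' = α • f) ∧ ∃ β : ℝ, g' = β • g) ∨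
      ((∃ α : ℝ, g' = α • f) ∧ ∃ β : ℝ, f' = β • g) := by
  have hm : MixedFrame C D x y f g :=
    ⟨h.norm_x, h.norm_y, h.orth, ⟨0, by rw [h.gx]; simp [evalC]⟩, ⟨0, by rw [h.fy]; simp [evalC]⟩,
      hfg, h.indep⟩
  obtain ⟨s₁, s₂, rfl⟩ := exists_coords_of_orthonormal h.norm_x h.norm_y h.orth s
  rcases hm.directions (c := 0) (by rw [h.gx, zero_smul]) h.fy h' with ⟨α, β, h1, h2⟩ | ⟨α, β, h1, h2⟩
  · exact Or.inl ⟨⟨α, h1⟩, β, by simpa using h2⟩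
  · exact Or.inr ⟨⟨α, h1⟩, β, by simpa using h2⟩

end TypeBMixed2

/-! ### Normal derivatives of sections of a ruling -/

section Calculus

/-- The space of leaf parameters. -/
abbrev R2 : Type := Fin 2 → ℝ

variable {G : Type*} [NormedAddCommGroup G] [NormedSpace ℝ G]

/-- The derivative of `f` in the direction `v`. -/
def pd (v : R2) (f : R2 → G) (t : R2) : G := fderiv ℝ f t v

variable {U : Set R2} {v w : R2} {f g : R2 → G} {x : R2 → ℝ} {t : R2}

theorem SmoothOn.differentiableAt (hU : IsOpen U) (hf : ContDiffOn ℝ ∞ f U) (ht : t ∈ U) :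
    DifferentiableAt ℝ f t :=
  (hf.contDiffAt (hU.mem_nhds ht)).differentiableAt (by simp)

theorem SmoothOn.pd (hU : IsOpen U) (hf : ContDiffOn ℝ ∞ f U) : ContDiffOn ℝ ∞ (pd v f) U :=
  (hf.fderiv_of_isOpen hU (m := ∞) (by simp)).clm_apply contDiffOn_const

theorem pd_comm (hU : IsOpen U) (hf : ContDiffOn ℝ ∞ f U) (ht : t ∈ U) :
    pd v (pd w f) t = pd w (pd v f) t := by
  have h2 : ContDiffAt ℝ ∞ f t := hf.contDiffAt (hU.mem_nhds ht)
  have hs := (h2.isSymmSndFDerivAt (by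
    rw [minSmoothness_of_isRCLikeNormedField]; exact WithTop.coe_le_coe.2 le_top)) v w
  have hd : DifferentiableAt ℝ (fderiv ℝ f) t :=
    (h2.fderiv_right (m := ∞) (by simp)).differentiableAt (by simp)
  have e : ∀ v w : R2, pd v (pd w f) t = fderiv ℝ (fderiv ℝ f) t v w := fun v w => by
    change fderiv ℝ (fun t => fderiv ℝ f t w) t v = _
    rw [fderiv_clm_apply hd (differentiableAt_const w)]
    simp
  rw [e, e, hs]

theorem pd_congr (hU : IsOpen U) (h : ∀ t ∈ U, f t = g t) (ht : t ∈ U) : pd v f t = pd v g t := by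
  simp only [pd]
  rw [Filter.EventuallyEq.fderiv_eq (Filter.eventually_of_mem (hU.mem_nhds ht) h)]

theorem pd_add (hf : DifferentiableAt ℝ f t) (hg : DifferentiableAt ℝ g t) :
    pd v (fun t => f t + g t) t = pd v f t + pd v g t := by
  simp only [pd]
  rw [fderiv_fun_add hf hg]; rfl

theorem pd_sub (hf : DifferentiableAt ℝ f t) (hg : DifferentiableAt ℝ g t) :
    pd v (fun t => f t - g t) t = pd v f t - pd v g t := by
  simp only [pd]
  rw [fderiv_fun_sub hf hg]; rfl

theorem pd_smul (hx : DifferentiableAt ℝ x t) (hf : DifferentiableAt ℝ f t) :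
    pd v (fun t => x t • f t) t = pd v x t • f t + x t • pd v f t := by
  simp only [pd]
  rw [fderiv_fun_smul hx hf]; simp [add_comm]

theorem pd_mul {y : R2 → ℝ} (hx : DifferentiableAt ℝ x t) (hy : DifferentiableAt ℝ y t) :
    pd v (fun t => x t * y t) t = pd v x t * y t + x t * pd v y t := pd_smul hx hy

theorem pd_const (c : G) : pd v (fun _ => c) t = 0 := by simp [pd]

theorem pd_add_smul_dir (α β : ℝ) : pd (α • v + β • w) f t = α • pd v f t + β • pd w f t := by
  simp [pd]

variable {H : Type*} [NormedAddCommGroup H] [InnerProductSpace ℝ H]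

theorem pd_inner {f g : R2 → H} (hf : DifferentiableAt ℝ f t) (hg : DifferentiableAt ℝ g t) :
    pd v (fun t => (inner ℝ (f t) (g t) : ℝ)) t =
      inner ℝ (pd v f t) (g t) + inner ℝ (f t) (pd v g t) := by
  simp only [pd]
  rw [fderiv_inner_apply ℝ hf hg, add_comm]

end Calculus

section Ruling

variable {H : Type*} [NormedAddCommGroup H] [InnerProductSpace ℝ H]

/-- The derivative of `g` in the direction `v`, modulo the ruling onto which `P` projects. -/
def nd (P : R2 → H →L[ℝ] H) (v : R2) (g : R2 → H) (t : R2) : H :=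
  pd v g t - P t (pd v g t)

/-- The second covariant derivative, modulo the ruling, of the family of affine planes spanned by
the ruling through `g` (or of the ruling itself, if `g` is one of its sections). It does not see
the choice of the section, see `sd_smul`. -/
def sd (P : R2 → H →L[ℝ] H) (v w : R2) (g : R2 → H) (t : R2) : H :=
  (pd w (pd v g) t - pd w (fun t => P t (pd v g t)) t - pd v (fun t => P t (pd w g t)) t) -
    P t (pd w (pd v g) t - pd w (fun t => P t (pd v g t)) t - pd v (fun t => P t (pd w g t)) t)

/-- `e` is a smooth orthonormal frame, over the open set `U`, of the planes onto which `P`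
projects. -/
structure RulingFrame (U : Set R2) (P : R2 → H →L[ℝ] H) (e : Fin 2 → R2 → H) : Prop where
  isOpen : IsOpen U
  smooth : ∀ i, ContDiffOn ℝ ∞ (e i) U
  norm : ∀ i, ∀ t ∈ U, inner ℝ (e i t) (e i t) = (1 : ℝ)
  orth : ∀ t ∈ U, inner ℝ (e 0 t) (e 1 t) = (0 : ℝ)
  proj : ∀ t ∈ U, ∀ w, P t w = (inner ℝ (e 0 t) w : ℝ) • e 0 t + (inner ℝ (e 1 t) w : ℝ) • e 1 t
  smooth_proj : ContDiffOn ℝ ∞ P U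

namespace RulingFrame

variable {U : Set R2} {P : R2 → H →L[ℝ] H} {e : Fin 2 → R2 → H} {g h : R2 → H} {v w t : R2}

theorem orth' (hR : RulingFrame U P e) (ht : t ∈ U) : inner ℝ (e 1 t) (e 0 t) = (0 : ℝ) := by
  rw [real_inner_comm]; exact hR.orth t ht

theorem diff (hR : RulingFrame U P e) (ht : t ∈ U) (i : Fin 2) : DifferentiableAt ℝ (e i) t :=
  SmoothOn.differentiableAt hR.isOpen (hR.smooth i) ht

theorem proj_e (hR : RulingFrame U P e) (ht : t ∈ U) (i : Fin 2) : P t (e i t) = e i t := by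
  rw [hR.proj t ht]
  fin_cases i
  · change (inner ℝ (e 0 t) (e 0 t) : ℝ) • e 0 t + (inner ℝ (e 1 t) (e 0 t) : ℝ) • e 1 t = e 0 t
    rw [hR.norm 0 t ht, hR.orth' ht]; simp
  · change (inner ℝ (e 0 t) (e 1 t) : ℝ) • e 0 t + (inner ℝ (e 1 t) (e 1 t) : ℝ) • e 1 t = e 1 t
    rw [hR.norm 1 t ht, hR.orth t ht]; simp

theorem inner_proj (hR : RulingFrame U P e) (ht : t ∈ U) (i : Fin 2) (u : H) :
    (inner ℝ (e i t) (P t u) : ℝ) = inner ℝ (e i t) u := by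
  rw [hR.proj t ht]
  fin_cases i
  · change inner ℝ (e 0 t) (_ : H) = (inner ℝ (e 0 t) u : ℝ)
    rw [inner_add_right, real_inner_smul_right, real_inner_smul_right, hR.norm 0 t ht,
      hR.orth t ht]; ring
  · change inner ℝ (e 1 t) (_ : H) = (inner ℝ (e 1 t) u : ℝ)
    rw [inner_add_right, real_inner_smul_right, real_inner_smul_right, hR.norm 1 t ht,
      hR.orth' ht]; ring

theorem proj_proj (hR : RulingFrame U P e) (ht : t ∈ U) (u : H) : P t (P t u) = P t u := by
  rw [hR.proj t ht (P t u), hR.inner_proj ht, hR.inner_proj ht, ← hR.proj t ht]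

theorem inner_nd (hR : RulingFrame U P e) (ht : t ∈ U) (i : Fin 2) :
    (inner ℝ (e i t) (nd P v g t) : ℝ) = 0 := by
  rw [nd, inner_sub_right, hR.inner_proj ht, sub_self]

theorem proj_eq_zero (hR : RulingFrame U P e) (ht : t ∈ U) {u : H}
    (hu : ∀ i, (inner ℝ (e i t) u : ℝ) = 0) : P t u = 0 := by
  rw [hR.proj t ht, hu, hu]; simp

theorem proj_nd (hR : RulingFrame U P e) (ht : t ∈ U) : P t (nd P v g t) = 0 :=
  hR.proj_eq_zero ht fun i => hR.inner_nd ht i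

theorem inner_sd (hR : RulingFrame U P e) (ht : t ∈ U) (i : Fin 2) :
    (inner ℝ (e i t) (sd P v w g t) : ℝ) = 0 := by
  rw [sd, inner_sub_right, hR.inner_proj ht, sub_self]

theorem smooth_nd (hR : RulingFrame U P e) (hg : ContDiffOn ℝ ∞ g U) :
    ContDiffOn ℝ ∞ (nd P v g) U :=
  (SmoothOn.pd hR.isOpen hg).sub (hR.smooth_proj.clm_apply (SmoothOn.pd hR.isOpen hg))

theorem smooth_projpd (hR : RulingFrame U P e) (hg : ContDiffOn ℝ ∞ g U) :
    ContDiffOn ℝ ∞ (fun t => P t (pd v g t)) U :=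
  hR.smooth_proj.clm_apply (SmoothOn.pd hR.isOpen hg)

theorem sd_comm (hR : RulingFrame U P e) (hg : ContDiffOn ℝ ∞ g U) (ht : t ∈ U) :
    sd P v w g t = sd P w v g t := by
  rw [sd, sd, pd_comm hR.isOpen hg ht]
  congr 1
  · abel
  · congr 1; abel

/-- The decomposition of the derivative of a section. -/
theorem pd_eq (hR : RulingFrame U P e) (ht : t ∈ U) :
    pd v g t = (inner ℝ (e 0 t) (pd v g t) : ℝ) • e 0 t + (inner ℝ (e 1 t) (pd v g t) : ℝ) • e 1 t +
      nd P v g t := by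
  rw [nd, ← hR.proj t ht]; abel

theorem nd_add (hg : DifferentiableAt ℝ g t) (hh : DifferentiableAt ℝ h t) :
    nd P v (fun t => g t + h t) t = nd P v g t + nd P v h t := by
  rw [nd, nd, nd, pd_add hg hh, map_add]; abel

theorem nd_smul (hR : RulingFrame U P e) {x : R2 → ℝ} (hx : DifferentiableAt ℝ x t)
    (ht : t ∈ U) (i : Fin 2) : nd P v (fun t => x t • e i t) t = x t • nd P v (e i) t := by
  rw [nd, nd, pd_smul hx (hR.diff ht i), map_add, map_smul, map_smul, hR.proj_e ht]; module

theorem sd_add (hR : RulingFrame U P e) (hg : ContDiffOn ℝ ∞ g U) (hh : ContDiffOn ℝ ∞ h U)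
    (ht : t ∈ U) : sd P v w (fun t => g t + h t) t = sd P v w g t + sd P v w h t := by
  have hU := hR.isOpen
  have d : ∀ {k : R2 → H}, ContDiffOn ℝ ∞ k U → ∀ t ∈ U, DifferentiableAt ℝ k t :=
    fun hk t ht => SmoothOn.differentiableAt hU hk ht
  have e1 : ∀ v, ∀ t ∈ U, pd v (fun t => g t + h t) t = pd v g t + pd v h t := fun v t ht =>
    pd_add (d hg t ht) (d hh t ht)
  have e2 : pd w (pd v fun t => g t + h t) t = pd w (pd v g) t + pd w (pd v h) t := by
    rw [pd_congr hU (e1 v) ht, pd_add (d (SmoothOn.pd hU hg) t ht) (d (SmoothOn.pd hU hh) t ht)]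
  have e3 : ∀ v w, pd w (fun t' => P t' (pd v (fun t => g t + h t) t')) t =
      pd w (fun t => P t (pd v g t)) t + pd w (fun t => P t (pd v h t)) t := fun v w => by
    rw [← pd_add (d (hR.smooth_projpd hg) t ht) (d (hR.smooth_projpd hh) t ht)]
    exact pd_congr hU (fun t ht => by rw [e1 v t ht, map_add]) ht
  rw [sd, sd, sd, e2, e3, e3]
  simp only [map_sub, map_add]; abel

/-- The second covariant derivative is linear over functions on sections of the ruling. -/
theorem sd_smul (hR : RulingFrame U P e) {x : R2 → ℝ} (hx : ContDiffOn ℝ ∞ x U)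
    (ht : t ∈ U) (i : Fin 2) : sd P v w (fun t => x t • e i t) t = x t • sd P v w (e i) t := by
  have hU := hR.isOpen
  have d : ∀ {k : R2 → H}, ContDiffOn ℝ ∞ k U → ∀ t ∈ U, DifferentiableAt ℝ k t :=
    fun hk t ht => SmoothOn.differentiableAt hU hk ht
  have dx : ∀ {k : R2 → ℝ}, ContDiffOn ℝ ∞ k U → ∀ t ∈ U, DifferentiableAt ℝ k t :=
    fun hk t ht => SmoothOn.differentiableAt hU hk ht
  have dsm : ∀ {y : R2 → ℝ} {k : R2 → H}, ContDiffOn ℝ ∞ y U → ContDiffOn ℝ ∞ k U →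
      ∀ t ∈ U, DifferentiableAt ℝ (fun t => y t • k t) t :=
    fun hy hk t ht => SmoothOn.differentiableAt hU (hy.smul hk) ht
  have hpx : ∀ v, ContDiffOn ℝ ∞ (pd v x) U := fun v => SmoothOn.pd hU hx
  have hpe : ∀ v, ContDiffOn ℝ ∞ (pd v (e i)) U := fun v => SmoothOn.pd hU (hR.smooth i)
  have e1 : ∀ v, ∀ t ∈ U, pd v (fun t => x t • e i t) t = pd v x t • e i t + x t • pd v (e i) t :=
    fun v t ht => pd_smul (dx hx t ht) (hR.diff ht i)
  have e2 : pd w (pd v fun t => x t • e i t) t =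
      (pd w (pd v x) t • e i t + pd v x t • pd w (e i) t) +
      (pd w x t • pd v (e i) t + x t • pd w (pd v (e i)) t) := by
    rw [pd_congr hU (e1 v) ht, pd_add (dsm (hpx v) (hR.smooth i) t ht)
      (dsm hx (hpe v) t ht), pd_smul (dx (hpx v) t ht) (hR.diff ht i),
      pd_smul (dx hx t ht) (d (hpe v) t ht)]
  have e3 : ∀ v w, pd w (fun t' => P t' (pd v (fun t => x t • e i t) t')) t =
      (pd w (pd v x) t • e i t + pd v x t • pd w (e i) t) +
      (pd w x t • P t (pd v (e i) t) + x t • pd w (fun t => P t (pd v (e i) t)) t) := fun v w => by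
    rw [← pd_smul (dx (hpx v) t ht) (hR.diff ht i),
      ← pd_smul (dx hx t ht) (d (hR.smooth_projpd (hR.smooth i)) t ht),
      ← pd_add (dsm (hpx v) (hR.smooth i) t ht)
      (dsm hx (hR.smooth_projpd (hR.smooth i)) t ht)]
    exact pd_congr hU (fun t ht => by
      rw [e1 v t ht, map_add, map_smul, map_smul, hR.proj_e ht]) ht
  rw [sd, sd, e2, e3, e3]
  simp only [map_sub, map_add, map_smul, hR.proj_e ht, hR.proj_proj ht]
  module

/-- The derivative of a normal derivative, in terms of the second covariant derivative. -/
theorem pd_nd (hR : RulingFrame U P e) (hg : ContDiffOn ℝ ∞ g U) (ht : t ∈ U) :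
    pd w (nd P v g) t = (inner ℝ (e 0 t) (pd w g t) : ℝ) • nd P v (e 0) t +
      (inner ℝ (e 1 t) (pd w g t) : ℝ) • nd P v (e 1) t + sd P v w g t -
      (inner ℝ (nd P w (e 0) t) (nd P v g t) : ℝ) • e 0 t -
      (inner ℝ (nd P w (e 1) t) (nd P v g t) : ℝ) • e 1 t := by
  have hU := hR.isOpen
  have d : ∀ {k : R2 → H}, ContDiffOn ℝ ∞ k U → ∀ t ∈ U, DifferentiableAt ℝ k t :=
    fun hk t ht => SmoothOn.differentiableAt hU hk ht
  have dsm : ∀ {y : R2 → ℝ} {k : R2 → H}, ContDiffOn ℝ ∞ y U → ContDiffOn ℝ ∞ k U →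
      ∀ t ∈ U, DifferentiableAt ℝ (fun t => y t • k t) t :=
    fun hy hk t ht => SmoothOn.differentiableAt hU (hy.smul hk) ht
  -- the tangential part
  have hT : ∀ i, (inner ℝ (e i t) (pd w (nd P v g) t) : ℝ) =
      -inner ℝ (nd P w (e i) t) (nd P v g t) := fun i => by
    have h0 : pd w (fun t => (inner ℝ (e i t) (nd P v g t) : ℝ)) t = 0 := by
      rw [pd_congr hU (g := fun _ => (0 : ℝ)) (fun t ht => hR.inner_nd ht i) ht, pd_const]
    rw [pd_inner (hR.diff ht i) (d (hR.smooth_nd hg) t ht)] at h0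
    have h1 : (inner ℝ (pd w (e i) t) (nd P v g t) : ℝ) =
        inner ℝ (nd P w (e i) t) (nd P v g t) := by
      rw [hR.pd_eq ht (g := e i)]
      simp only [inner_add_left, real_inner_smul_left, hR.inner_nd ht]; ring
    linarith
  have hPpd : P t (pd w (nd P v g) t) = -(inner ℝ (nd P w (e 0) t) (nd P v g t) : ℝ) • e 0 t -
      (inner ℝ (nd P w (e 1) t) (nd P v g t) : ℝ) • e 1 t := by
    rw [hR.proj t ht, hT, hT]; module
  -- the normal part
  have hs : ∀ i : Fin 2, ContDiffOn ℝ ∞ (fun t => (inner ℝ (e i t) (pd w g t) : ℝ)) U := fun i =>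
    (hR.smooth i).inner ℝ (SmoothOn.pd hU hg)
  have dx : ∀ {k : R2 → ℝ}, ContDiffOn ℝ ∞ k U → ∀ t ∈ U, DifferentiableAt ℝ k t :=
    fun hk t ht => SmoothOn.differentiableAt hU hk ht
  have hA : pd v (fun t => P t (pd w g t)) t - P t (pd v (fun t => P t (pd w g t)) t) =
      (inner ℝ (e 0 t) (pd w g t) : ℝ) • nd P v (e 0) t +
      (inner ℝ (e 1 t) (pd w g t) : ℝ) • nd P v (e 1) t := by
    change nd P v (fun t => P t (pd w g t)) t = _
    have : nd P v (fun t => P t (pd w g t)) t = nd P v (fun t =>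
        (inner ℝ (e 0 t) (pd w g t) : ℝ) • e 0 t + (inner ℝ (e 1 t) (pd w g t) : ℝ) • e 1 t) t := by
      rw [nd, nd, pd_congr hU (fun t ht => hR.proj t ht (pd w g t)) ht]
    rw [this, nd_add (dsm (hs 0) (hR.smooth 0) t ht) (dsm (hs 1) (hR.smooth 1) t ht),
      hR.nd_smul (dx (hs 0) t ht) ht, hR.nd_smul (dx (hs 1) t ht) ht]
  have hB : pd w (nd P v g) t = pd w (pd v g) t - pd w (fun t => P t (pd v g t)) t :=
    pd_sub (d (SmoothOn.pd hU hg) t ht) (d (hR.smooth_projpd hg) t ht)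
  rw [hB] at hPpd ⊢
  rw [sd]
  simp only [map_sub] at hPpd ⊢
  linear_combination (norm := module) hPpd + hA

end RulingFrame

end Ruling

/-! ### The curvature identity and the splitting of the pencil -/

section Directions

variable {H : Type*} [NormedAddCommGroup H] [InnerProductSpace ℝ H]

theorem R2.eq_single (v : R2) :
    v = v 0 • (Pi.single 0 1 : R2) + v 1 • (Pi.single 1 1 : R2) := by
  ext i; fin_cases i <;> simp

/-- The normal derivatives of `γ` in the coordinate directions. -/
def ndC (P : R2 → H →L[ℝ] H) (γ : R2 → H) (t : R2) (a : Fin 2) : H := nd P (Pi.single a 1) γ t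

/-- The normal derivatives of the ruling in the coordinate directions. -/
def ndD (P : R2 → H →L[ℝ] H) (e : Fin 2 → R2 → H) (t : R2) (a i : Fin 2) : H :=
  nd P (Pi.single a 1) (e i) t

theorem nd_add_smul_dir (P : R2 → H →L[ℝ] H) (g : R2 → H) (t : R2) (α β : ℝ) (v w : R2) :
    nd P (α • v + β • w) g t = α • nd P v g t + β • nd P w g t := by
  rw [nd, nd, nd, pd_add_smul_dir, map_add, map_smul, map_smul]; module

theorem evalC_ndC (P : R2 → H →L[ℝ] H) (γ : R2 → H) (t v : R2) :
    evalC (ndC P γ t) v = nd P v γ t := by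
  conv_rhs => rw [R2.eq_single v, nd_add_smul_dir]
  simp [evalC, ndC]

theorem evalD_ndD (P : R2 → H →L[ℝ] H) (e : Fin 2 → R2 → H) (t v x : R2) :
    evalD (ndD P e t) v x = x 0 • nd P v (e 0) t + x 1 • nd P v (e 1) t := by
  conv_rhs => rw [R2.eq_single v, nd_add_smul_dir, nd_add_smul_dir]
  simp only [evalD, ndD, Fin.sum_univ_two]; module

namespace RulingFrame

variable {U : Set R2} {P : R2 → H →L[ℝ] H} {e : Fin 2 → R2 → H} {g h : R2 → H} {v w t : R2}

theorem sd_add_smul_dir (hR : RulingFrame U P e) (hg : ContDiffOn ℝ ∞ g U) (ht : t ∈ U)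
    (α β : ℝ) (v v' w : R2) :
    sd P (α • v + β • v') w g t = α • sd P v w g t + β • sd P v' w g t := by
  have hU := hR.isOpen
  have dsm : ∀ {y : R2 → ℝ} {k : R2 → H}, ContDiffOn ℝ ∞ y U → ContDiffOn ℝ ∞ k U →
      ∀ t ∈ U, DifferentiableAt ℝ (fun t => y t • k t) t :=
    fun hy hk t ht => SmoothOn.differentiableAt hU (hy.smul hk) ht
  have d : ∀ {k : R2 → H}, ContDiffOn ℝ ∞ k U → DifferentiableAt ℝ k t :=
    fun hk => SmoothOn.differentiableAt hU hk ht
  have cc : ∀ c : ℝ, ContDiffOn ℝ ∞ (fun _ : R2 => c) U := fun c => contDiffOn_const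
  have key : ∀ {k k' : R2 → H}, ContDiffOn ℝ ∞ k U → ContDiffOn ℝ ∞ k' U →
      pd w (fun t => α • k t + β • k' t) t = α • pd w k t + β • pd w k' t := fun hk hk' => by
    rw [pd_add (dsm (cc α) hk t ht) (dsm (cc β) hk' t ht),
      pd_smul (differentiableAt_const α) (d hk), pd_smul (differentiableAt_const β) (d hk'),
      pd_const, pd_const]
    simp
  have e1 : pd w (pd (α • v + β • v') g) t = α • pd w (pd v g) t + β • pd w (pd v' g) t := by
    rw [← key (SmoothOn.pd hU hg) (SmoothOn.pd hU hg)]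
    exact pd_congr hU (fun t _ => pd_add_smul_dir α β) ht
  have e2 : pd w (fun t => P t (pd (α • v + β • v') g t)) t =
      α • pd w (fun t => P t (pd v g t)) t + β • pd w (fun t => P t (pd v' g t)) t := by
    rw [← key (hR.smooth_projpd hg) (hR.smooth_projpd hg)]
    exact pd_congr hU (fun t _ => by rw [pd_add_smul_dir, map_add, map_smul, map_smul]) ht
  rw [sd, sd, sd, e1, e2, pd_add_smul_dir]
  simp only [map_sub, map_add, map_smul]
  module

theorem sd_add_smul_dir' (hR : RulingFrame U P e) (hg : ContDiffOn ℝ ∞ g U) (ht : t ∈ U)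
    (α β : ℝ) (v w w' : R2) :
    sd P v (α • w + β • w') g t = α • sd P v w g t + β • sd P v w' g t := by
  rw [hR.sd_comm hg ht, hR.sd_add_smul_dir hg ht, hR.sd_comm hg ht, hR.sd_comm hg ht (w := v)]

theorem nd_smul_add (hR : RulingFrame U P e) {x : R2 → ℝ} {k : R2 → H}
    (hx : ContDiffOn ℝ ∞ x U) (hk : ContDiffOn ℝ ∞ k U) (hh : ContDiffOn ℝ ∞ h U) (ht : t ∈ U) :
    nd P v (fun t => x t • k t + h t) t =
      pd v x t • (k t - P t (k t)) + x t • nd P v k t + nd P v h t := by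
  have hU := hR.isOpen
  rw [nd_add (SmoothOn.differentiableAt hU (hx.smul hk) ht :
    DifferentiableAt ℝ (fun t => x t • k t) t) (SmoothOn.differentiableAt hU hh ht)]
  simp only [nd]
  rw [pd_smul (SmoothOn.differentiableAt hU hx ht) (SmoothOn.differentiableAt hU hk ht), map_add,
    map_smul, map_smul]
  module

theorem nd_congr (hR : RulingFrame U P e) (hgh : ∀ t ∈ U, g t = h t) (ht : t ∈ U) :
    nd P v g t = nd P v h t := by
  rw [nd, nd, pd_congr hR.isOpen hgh ht]

/-- The normal part of the second derivatives of a normal derivative, when the second covariant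
derivatives are combinations of the normal derivatives with coefficients `l v w`. -/
theorem nd_pd_nd (hR : RulingFrame U P e) (hg : ContDiffOn ℝ ∞ g U) {l : R2 → R2 → Fin 2 → R2 → ℝ}
    (hl : ∀ v w d, ContDiffOn ℝ ∞ (l v w d) U)
    (hsg : ∀ v w, ∀ t ∈ U, sd P v w g t =
      l v w 0 t • nd P (Pi.single 0 1) g t + l v w 1 t • nd P (Pi.single 1 1) g t)
    (hse : ∀ v w i, ∀ t ∈ U, sd P v w (e i) t =
      l v w 0 t • nd P (Pi.single 0 1) (e i) t + l v w 1 t • nd P (Pi.single 1 1) (e i) t)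
    (ht : t ∈ U) (a c c' : R2) :
    nd P c' (pd c (nd P a g)) t =
      ∑ i, (pd c' (fun t => (inner ℝ (e i t) (pd c g t) : ℝ)) t • nd P a (e i) t +
        (inner ℝ (e i t) (pd c g t) : ℝ) • (∑ j, (inner ℝ (e j t) (pd c' (e i) t) : ℝ) • nd P a (e j) t +
          ∑ d, l a c' d t • nd P (Pi.single d 1) (e i) t)) +
      ∑ d, (pd c' (l a c d) t • nd P (Pi.single d 1) g t +
        l a c d t • (∑ i, (inner ℝ (e i t) (pd c' g t) : ℝ) • nd P (Pi.single d 1) (e i) t +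
          ∑ k, l (Pi.single d 1) c' k t • nd P (Pi.single k 1) g t)) -
      ∑ i, (inner ℝ (nd P c (e i) t) (nd P a g t) : ℝ) • nd P c' (e i) t := by
  have hU := hR.isOpen
  have hin : ∀ i, ContDiffOn ℝ ∞ (fun t => (inner ℝ (e i t) (pd c g t) : ℝ)) U := fun i =>
    (hR.smooth i).inner ℝ (SmoothOn.pd hU hg)
  have hnn : ∀ i, ContDiffOn ℝ ∞ (fun t => -(inner ℝ (nd P c (e i) t) (nd P a g t) : ℝ)) U :=
    fun i => ((hR.smooth_nd (hR.smooth i)).inner ℝ (hR.smooth_nd hg)).neg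
  have hnd : ∀ {k} v, ContDiffOn ℝ ∞ k U → ContDiffOn ℝ ∞ (nd P v k) U := fun v hk =>
    hR.smooth_nd hk
  have hsm : ∀ {y : R2 → ℝ} {k : R2 → H}, ContDiffOn ℝ ∞ y U → ContDiffOn ℝ ∞ k U →
      ContDiffOn ℝ ∞ (fun t => y t • k t) U := fun hy hk => hy.smul hk
  have had : ∀ {h k : R2 → H}, ContDiffOn ℝ ∞ h U → ContDiffOn ℝ ∞ k U →
      ContDiffOn ℝ ∞ (fun t => h t + k t) U := fun hy hk => hy.add hk
  have hnnd : ∀ {k}, ContDiffOn ℝ ∞ k U → ∀ a c', nd P c' (nd P a k) t = pd c' (nd P a k) t -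
      P t (pd c' (nd P a k) t) := fun _ _ _ => rfl
  have second : ∀ {k} a c', ContDiffOn ℝ ∞ k U → (∀ v w, ∀ t ∈ U, sd P v w k t =
      l v w 0 t • nd P (Pi.single 0 1) k t + l v w 1 t • nd P (Pi.single 1 1) k t) →
      nd P c' (nd P a k) t = ∑ i, (inner ℝ (e i t) (pd c' k t) : ℝ) • nd P a (e i) t +
        ∑ d, l a c' d t • nd P (Pi.single d 1) k t := fun {k} a c' hk hsk => by
    rw [hnnd hk, hR.pd_nd hk ht, hsk a c' t ht]
    simp only [map_add, map_sub, map_smul, hR.proj_nd ht, hR.proj_e ht, Fin.sum_univ_two]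
    module
  rw [hR.nd_congr (h := fun t =>
    (inner ℝ (e 0 t) (pd c g t) : ℝ) • nd P a (e 0) t +
    ((inner ℝ (e 1 t) (pd c g t) : ℝ) • nd P a (e 1) t +
    (l a c 0 t • nd P (Pi.single 0 1) g t + (l a c 1 t • nd P (Pi.single 1 1) g t +
    ((-(inner ℝ (nd P c (e 0) t) (nd P a g t) : ℝ)) • e 0 t +
    ((-(inner ℝ (nd P c (e 1) t) (nd P a g t) : ℝ)) • e 1 t + 0)))))) (fun t ht => by
      rw [hR.pd_nd hg ht, hsg a c t ht]; module) ht]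
  have s0 : ContDiffOn ℝ ∞ (fun _ : R2 => (0 : H)) U := contDiffOn_const
  have s1 := had (hsm (hnn 1) (hR.smooth 1)) s0
  have s2 := had (hsm (hnn 0) (hR.smooth 0)) s1
  have s3 := had (hsm (hl a c 1) (hnd (Pi.single 1 1) hg)) s2
  have s4 := had (hsm (hl a c 0) (hnd (Pi.single 0 1) hg)) s3
  have s5 := had (hsm (hin 1) (hnd a (hR.smooth 1))) s4
  rw [hR.nd_smul_add (hin 0) (hnd a (hR.smooth 0)) s5 ht,
    hR.nd_smul_add (hin 1) (hnd a (hR.smooth 1)) s4 ht,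
    hR.nd_smul_add (hl a c 0) (hnd (Pi.single 0 1) hg) s3 ht,
    hR.nd_smul_add (hl a c 1) (hnd (Pi.single 1 1) hg) s2 ht,
    hR.nd_smul_add (hnn 0) (hR.smooth 0) s1 ht, hR.nd_smul_add (hnn 1) (hR.smooth 1) s0 ht]
  have z : nd P c' (fun _ : R2 => (0 : H)) t = 0 := by rw [nd, pd_const]; simp
  rw [second a c' (hR.smooth 0) (fun v w => hse v w 0), second a c' (hR.smooth 1) (fun v w => hse v w 1),
    second (Pi.single 0 1) c' hg hsg, second (Pi.single 1 1) c' hg hsg, z]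
  simp only [hR.proj_nd ht, hR.proj_e ht, Fin.sum_univ_two]
  module

/-- The curvature identity. -/
theorem curvatureTerm_eq (hR : RulingFrame U P e) (hg : ContDiffOn ℝ ∞ g U)
    {l : R2 → R2 → Fin 2 → R2 → ℝ} (hl : ∀ v w d, ContDiffOn ℝ ∞ (l v w d) U)
    (hsg : ∀ v w, ∀ t ∈ U, sd P v w g t =
      l v w 0 t • nd P (Pi.single 0 1) g t + l v w 1 t • nd P (Pi.single 1 1) g t)
    (hse : ∀ v w i, ∀ t ∈ U, sd P v w (e i) t =
      l v w 0 t • nd P (Pi.single 0 1) (e i) t + l v w 1 t • nd P (Pi.single 1 1) (e i) t)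
    (ht : t ∈ U) (a : Fin 2) :
    curvatureTerm (ndD P e t) (ndC P g t) a = ∑ d,
      (pd (Pi.single 1 1) (l (Pi.single a 1) (Pi.single 0 1) d) t -
        pd (Pi.single 0 1) (l (Pi.single a 1) (Pi.single 1 1) d) t +
        ∑ k, (l (Pi.single a 1) (Pi.single 0 1) k t * l (Pi.single k 1) (Pi.single 1 1) d t -
          l (Pi.single a 1) (Pi.single 1 1) k t * l (Pi.single k 1) (Pi.single 0 1) d t)) •
        ndC P g t d := by
  have hU := hR.isOpen
  have h1 := hR.nd_pd_nd hg hl hsg hse ht (Pi.single a 1) (Pi.single 0 1) (Pi.single 1 1)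
  have h2 := hR.nd_pd_nd hg hl hsg hse ht (Pi.single a 1) (Pi.single 1 1) (Pi.single 0 1)
  have h12 : nd P (Pi.single 1 1) (pd (Pi.single 0 1) (nd P (Pi.single a 1) g)) t =
      nd P (Pi.single 0 1) (pd (Pi.single 1 1) (nd P (Pi.single a 1) g)) t := by
    rw [nd, nd, pd_comm hU (hR.smooth_nd hg) ht]
  have d : ∀ {k : R2 → H}, ContDiffOn ℝ ∞ k U → DifferentiableAt ℝ k t :=
    fun hk => SmoothOn.differentiableAt hU hk ht
  -- the two orders of the third derivatives of `g` agree; `kap` is the contribution of the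
  -- components of `g` along the ruling
  have kap : ∀ i, pd (Pi.single 1 1) (fun t => (inner ℝ (e i t) (pd (Pi.single 0 1) g t) : ℝ)) t -
      pd (Pi.single 0 1) (fun t => (inner ℝ (e i t) (pd (Pi.single 1 1) g t) : ℝ)) t =
      inner ℝ (pd (Pi.single 1 1) (e i) t) (pd (Pi.single 0 1) g t) -
      inner ℝ (pd (Pi.single 0 1) (e i) t) (pd (Pi.single 1 1) g t) := fun i => by
    rw [pd_inner (hR.diff ht i) (d (SmoothOn.pd hU hg)),
      pd_inner (hR.diff ht i) (d (SmoothOn.pd hU hg)), pd_comm hU hg ht]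
    ring
  have skew : ∀ v i j, (inner ℝ (e i t) (pd v (e j) t) : ℝ) = -inner ℝ (e j t) (pd v (e i) t) :=
    fun v i j => by
    have h0 : pd v (fun t => (inner ℝ (e i t) (e j t) : ℝ)) t = 0 := by
      have : ∃ c : ℝ, ∀ t ∈ U, (inner ℝ (e i t) (e j t) : ℝ) = c := by
        fin_cases i <;> fin_cases j
        exacts [⟨1, hR.norm 0⟩, ⟨0, hR.orth⟩, ⟨0, fun t ht => hR.orth' ht⟩, ⟨1, hR.norm 1⟩]
      obtain ⟨c, hc⟩ := this
      rw [pd_congr hU hc ht, pd_const]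
    rw [pd_inner (hR.diff ht i) (hR.diff ht j), real_inner_comm] at h0
    linarith
  have split : ∀ v w i, (inner ℝ (pd v (e i) t) (pd w g t) : ℝ) =
      ∑ j, inner ℝ (e j t) (pd v (e i) t) * inner ℝ (e j t) (pd w g t) +
        inner ℝ (nd P v (e i) t) (nd P w g t) := fun v w i => by
    have hn : ∀ j, (inner ℝ (nd P v (e i) t) (e j t) : ℝ) = 0 := fun j => by
      rw [real_inner_comm]; exact hR.inner_nd ht j
    conv_lhs => rw [hR.pd_eq ht (g := e i), hR.pd_eq ht (g := g)]
    simp only [inner_add_left, inner_add_right, real_inner_smul_left, real_inner_smul_right,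
      hR.inner_nd ht, hn, hR.norm _ t ht, hR.orth t ht, hR.orth' ht, Fin.sum_univ_two]
    ring
  have kap2 : ∀ i, pd (Pi.single 1 1) (fun t => (inner ℝ (e i t) (pd (Pi.single 0 1) g t) : ℝ)) t -
      pd (Pi.single 0 1) (fun t => (inner ℝ (e i t) (pd (Pi.single 1 1) g t) : ℝ)) t =
      ∑ j, inner ℝ (e j t) (pd (Pi.single 1 1) (e i) t) * inner ℝ (e j t) (pd (Pi.single 0 1) g t) +
        inner ℝ (nd P (Pi.single 1 1) (e i) t) (nd P (Pi.single 0 1) g t) -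
      (∑ j, inner ℝ (e j t) (pd (Pi.single 0 1) (e i) t) * inner ℝ (e j t) (pd (Pi.single 1 1) g t) +
        inner ℝ (nd P (Pi.single 0 1) (e i) t) (nd P (Pi.single 1 1) g t)) := fun i => by
    rw [kap, split, split]
  have k0 := kap2 0
  have k1 := kap2 1
  rw [← h12] at h2
  have key := h1.symm.trans h2
  have z00 : ∀ v, (inner ℝ (e 0 t) (pd v (e 0) t) : ℝ) = 0 := fun v => by linarith [skew v 0 0]
  have z11 : ∀ v, (inner ℝ (e 1 t) (pd v (e 1) t) : ℝ) = 0 := fun v => by linarith [skew v 1 1]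
  simp only [Fin.sum_univ_two, z00, z11, skew _ 1 0] at key k0 k1
  have k0' := eq_add_of_sub_eq k0
  have k1' := eq_add_of_sub_eq k1
  rw [k0', k1'] at key
  simp only [curvatureTerm, ndC, ndD, Fin.sum_univ_two]
  simp only [real_inner_comm (nd P _ (e _) t) (nd P _ g t)]
  linear_combination (norm := module) -key

end RulingFrame
end Directions

section BaseChange

variable {H : Type*} [NormedAddCommGroup H] [InnerProductSpace ℝ H]

theorem SplitPencil.of_change_directions {C : Fin 2 → H} {D : Fin 2 → Fin 2 → H}
    {m : Fin 2 → Fin 2 → ℝ} {x y f g : Fin 2 → ℝ}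
    (h : SplitPencil (fun a => m a 0 • C 0 + m a 1 • C 1)
      (fun a i => m a 0 • D 0 i + m a 1 • D 1 i) x y f g) :
    SplitPencil C D x y (fun b => f 0 * m 0 b + f 1 * m 1 b) (fun b => g 0 * m 0 b + g 1 * m 1 b) := by
  have eD : ∀ f x : Fin 2 → ℝ, evalD (fun a i => m a 0 • D 0 i + m a 1 • D 1 i) f x =
      evalD D (fun b => f 0 * m 0 b + f 1 * m 1 b) x := fun f x => by
    simp only [evalD, Fin.sum_univ_two]; module
  have eC : ∀ f : Fin 2 → ℝ, evalC (fun a => m a 0 • C 0 + m a 1 • C 1) f =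
      evalC C (fun b => f 0 * m 0 b + f 1 * m 1 b) := fun f => by
    simp only [evalC, Fin.sum_univ_two]; module
  constructor
  · exact h.norm_x
  · exact h.norm_y
  · exact h.orth
  · rw [← eD]; exact h.gx
  · rw [← eD]; exact h.fy
  · rw [← eD, ← eD]; exact h.fx_gy
  · rw [← eD, ← eC]; exact h.fx_g
  · rw [← eD, ← eC]; exact h.gy_f
  · rw [← eD, ← eD, ← eC, ← eC]; exact h.indep

/-- A nondegenerate pencil that satisfies the curvature identity splits, whatever the basis of
directions. -/
theorem exists_splitPencil {C : Fin 2 → H} {D : Fin 2 → Fin 2 → H}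
    {W : Submodule ℝ H} (hW : Module.finrank ℝ W = 4) (hCW : ∀ a, C a ∈ W)
    (hDW : ∀ a i, D a i ∈ W)
    (hC : ∀ m : Fin 2 → ℝ, ∑ a, m a • C a = 0 → m = 0) (hN : Nondeg D C)
    {L : Fin 2 → Fin 2 → ℝ} (hLC : ∀ a, curvatureTerm D C a = ∑ d, L a d • C d)
    (hLD : ∀ j a, curvatureTerm D (fun b => D b j) a = ∑ d, L a d • D d j) :
    ∃ x y f g, SplitPencil C D x y f g := by
  obtain ⟨ν, hν, hd⟩ := hN
  -- a direction in which the ruling derivative is injective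
  obtain ⟨m, hm, hq⟩ : ∃ m : Fin 2 → Fin 2 → ℝ, m 0 0 * m 1 1 - m 0 1 * m 1 0 ≠ 0 ∧
      (m 0 0 * ν 0 (D 0 0) + m 0 1 * ν 0 (D 1 0)) * (m 0 0 * ν 1 (D 0 1) + m 0 1 * ν 1 (D 1 1)) -
      (m 0 0 * ν 0 (D 0 1) + m 0 1 * ν 0 (D 1 1)) * (m 0 0 * ν 1 (D 0 0) + m 0 1 * ν 1 (D 1 0)) ≠
        0 := by
    by_contra hcon
    push Not at hcon
    have h1 := hcon ![![1, 0], ![0, 1]] (by simp)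
    have h2 := hcon ![![0, 1], ![1, 0]] (by simp)
    have h3 := hcon ![![1, 1], ![0, 1]] (by simp)
    simp at h1 h2 h3
    apply hd
    simp only [hyperdet]
    grind
  set Δ := m 0 0 * m 1 1 - m 0 1 * m 1 0 with hΔ
  set C' : Fin 2 → H := fun a => m a 0 • C 0 + m a 1 • C 1 with hC'
  set D' : Fin 2 → Fin 2 → H := fun a i => m a 0 • D 0 i + m a 1 • D 1 i with hD'
  -- the transformation of the curvature identity
  have trans : ∀ Z : Fin 2 → H, (∀ a, curvatureTerm D Z a = ∑ d, L a d • Z d) → ∀ a,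
      curvatureTerm D' (fun b => m b 0 • Z 0 + m b 1 • Z 1) a =
      ∑ d, (fun a d => ∑ b, ∑ c, m a b * L b c *
        ((![![m 1 1, -m 0 1], ![-m 1 0, m 0 0]] : Fin 2 → Fin 2 → ℝ) c d)) a d •
        (m d 0 • Z 0 + m d 1 • Z 1) := fun Z hZ a => by
    have e0 := hZ 0
    have e1 := hZ 1
    simp only [curvatureTerm, Fin.sum_univ_two, hD', inner_add_left, inner_add_right,
      real_inner_smul_left, real_inner_smul_right] at e0 e1 ⊢
    simp only [Matrix.cons_val_zero, Matrix.cons_val_one]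
    linear_combination (norm := module) (Δ * m a 0) • e0 + (Δ * m a 1) • e1
  have hspl : ∃ x y f g, SplitPencil C' D' x y f g := by
    refine exists_splitPencil_of_curvature hW (fun a => ?_) (fun a i => ?_) (fun c hc => ?_) ?_
      (fun a b hab => ?_) (trans C hLC) (fun j a => trans (fun b => D b j) (hLD j) a)
    · exact W.add_mem (W.smul_mem _ (hCW 0)) (W.smul_mem _ (hCW 1))
    · exact W.add_mem (W.smul_mem _ (hDW 0 i)) (W.smul_mem _ (hDW 1 i))
    · have := hC ![c 0 * m 0 0 + c 1 * m 1 0, c 0 * m 0 1 + c 1 * m 1 1] (by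
        simp only [Fin.sum_univ_two, hC'] at hc ⊢
        simp only [Matrix.cons_val_zero, Matrix.cons_val_one]
        linear_combination (norm := module) hc)
      have h0 := congrFun this 0
      have h1 := congrFun this 1
      simp only [Matrix.cons_val_zero, Matrix.cons_val_one, Pi.zero_apply] at h0 h1
      have c0 : Δ * c 0 = 0 := by rw [hΔ]; linear_combination m 1 1 * h0 - m 1 0 * h1
      have c1 : Δ * c 1 = 0 := by rw [hΔ]; linear_combination m 0 0 * h1 - m 0 1 * h0
      ext i; fin_cases i
      exacts [(mul_eq_zero.1 c0).resolve_left hm, (mul_eq_zero.1 c1).resolve_left hm]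
    · refine ⟨ν, fun k a => by simp [hC', hν], ?_⟩
      have : hyperdet (fun a i => ν 0 (D' a i)) (fun a i => ν 1 (D' a i)) =
          Δ ^ 2 * hyperdet (fun a i => ν 0 (D a i)) (fun a i => ν 1 (D a i)) := by
        simp only [hyperdet, hD', map_add, map_smul, smul_eq_mul, hΔ]; ring
      rw [this]
      exact mul_ne_zero (pow_ne_zero 2 hm) hd
    · have e : ∀ k, a * (m 0 0 * ν k (D 0 0) + m 0 1 * ν k (D 1 0)) +
          b * (m 0 0 * ν k (D 0 1) + m 0 1 * ν k (D 1 1)) = 0 := fun k => by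
        have := congrArg (ν k) hab
        simp only [hD', map_add, map_smul, smul_eq_mul, map_zero] at this
        linarith
      have e0 := e 0
      have e1 := e 1
      constructor
      · apply (mul_eq_zero.1 _).resolve_right hq
        linear_combination (m 0 0 * ν 1 (D 0 1) + m 0 1 * ν 1 (D 1 1)) * e0 -
          (m 0 0 * ν 0 (D 0 1) + m 0 1 * ν 0 (D 1 1)) * e1
      · apply (mul_eq_zero.1 _).resolve_right hq
        linear_combination (m 0 0 * ν 0 (D 0 0) + m 0 1 * ν 0 (D 1 0)) * e1 -
          (m 0 0 * ν 1 (D 0 0) + m 0 1 * ν 1 (D 1 0)) * e0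
  obtain ⟨x, y, f, g, h⟩ := hspl
  exact ⟨x, y, _, _, h.of_change_directions⟩

end BaseChange

section Patch

variable {H : Type*} [NormedAddCommGroup H] [InnerProductSpace ℝ H]

/-- The second covariant derivative in the directions `v`, `w` is a normal derivative in some
direction, the same for the sections of the ruling as for the base curve `γ`. -/
def CoeffAt (P : R2 → H →L[ℝ] H) (e : Fin 2 → R2 → H) (γ : R2 → H) (t v w : R2) : Prop :=
  ∃ l : R2, sd P v w γ t = nd P l γ t ∧ ∀ i, sd P v w (e i) t = nd P l (e i) t

/-- The second covariant derivative at the point of the leaf with coordinates `s`. -/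
def sdAt (P : R2 → H →L[ℝ] H) (e : Fin 2 → R2 → H) (γ : R2 → H) (t s v w : R2) : H :=
  sd P v w γ t + ∑ i, s i • sd P v w (e i) t

/-- Near `γ t`, `t ∈ U`, the affine planes through `γ t` spanned by the ruling form an immersed
submanifold whose second fundamental form is nondegenerate. -/
structure RuledPatch (U : Set R2) (P : R2 → H →L[ℝ] H) (e : Fin 2 → R2 → H) (γ : R2 → H)
    (ε : ℝ) : Prop extends RulingFrame U P e where
  smooth_base : ContDiffOn ℝ ∞ γ U
  pos : 0 < ε
  indep : ∀ t ∈ U, ∀ s : R2, (∀ i, |s i| ≤ ε) →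
    ∀ m : Fin 2 → ℝ, ∑ a, m a • pencil (ndC P γ t) (ndD P e t) s a = 0 → m = 0
  nondeg : ∀ t ∈ U, ∀ s : R2, (∀ i, |s i| ≤ ε) →
    Nondeg (ndD P e t) (pencil (ndC P γ t) (ndD P e t) s)

theorem pencil_zero (C : Fin 2 → H) (D : Fin 2 → Fin 2 → H) : pencil C D 0 = C := by
  ext a; simp [pencil]

theorem evalC_single (C : Fin 2 → H) (a : Fin 2) : evalC C (Pi.single a 1) = C a := by
  simp [evalC, Pi.single_apply]

namespace RuledPatch

variable {U : Set R2} {P : R2 → H →L[ℝ] H} {e : Fin 2 → R2 → H} {γ : R2 → H} {ε : ℝ} {v w t : R2}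

/-- A second covariant derivative that lies in the pencil at all points of a leaf has constant
coefficients along the leaf. -/
theorem coeffAt_of_mem_span (hR : RuledPatch U P e γ ε) (ht : t ∈ U)
    (h : ∀ s : R2, (∀ i, |s i| ≤ ε) →
      ∃ l, sdAt P e γ t s v w = evalC (pencil (ndC P γ t) (ndD P e t) s) l) :
    CoeffAt P e γ t v w := by
  have h0 : ∀ i, |(0 : R2) i| ≤ ε := fun i => by simpa using hR.pos.le
  obtain ⟨l, hl, hl'⟩ := exists_const_coeff (C := ndC P γ t) (D := ndD P e t) hR.pos
    (by simpa only [pencil_zero] using hR.indep t ht 0 h0)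
    (by simpa only [pencil_zero] using hR.nondeg t ht 0 h0) (fun s hs => h s hs)
  refine ⟨l, by rw [hl, ← evalC_ndC]; rfl, fun i => ?_⟩
  rw [hl' i]
  conv_rhs => rw [R2.eq_single l, nd_add_smul_dir]
  simp [ndD]

theorem smooth_sd (hR : RulingFrame U P e) {g : R2 → H} (hg : ContDiffOn ℝ ∞ g U) :
    ContDiffOn ℝ ∞ (sd P v w g) U := by
  have hU := hR.isOpen
  have h : ContDiffOn ℝ ∞ (fun t => pd w (pd v g) t - pd w (fun t => P t (pd v g t)) t -
      pd v (fun t => P t (pd w g t)) t) U :=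
    ((SmoothOn.pd hU (SmoothOn.pd hU hg)).sub (SmoothOn.pd hU (hR.smooth_projpd hg))).sub
      (SmoothOn.pd hU (hR.smooth_projpd hg))
  exact h.sub (hR.smooth_proj.clm_apply h)

/-- The coefficients of the second covariant derivatives can be chosen smoothly, since they are
determined by the derivatives of the ruling. -/
theorem exists_smooth_coeff (hR : RuledPatch U P e γ ε) (h : ∀ t ∈ U, CoeffAt P e γ t v w) :
    ∃ l : Fin 2 → R2 → ℝ, (∀ d, ContDiffOn ℝ ∞ (l d) U) ∧
      (∀ t ∈ U, sd P v w γ t =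
        l 0 t • nd P (Pi.single 0 1) γ t + l 1 t • nd P (Pi.single 1 1) γ t) ∧
      ∀ i, ∀ t ∈ U, sd P v w (e i) t =
        l 0 t • nd P (Pi.single 0 1) (e i) t + l 1 t • nd P (Pi.single 1 1) (e i) t := by
  -- Cramer's rule for the normal equations of the two sections of the ruling
  set k : Fin 2 → Fin 2 → R2 → ℝ := fun c d t => ∑ i, inner ℝ (ndD P e t c i) (ndD P e t d i) with hk
  set r : Fin 2 → R2 → ℝ := fun c t => ∑ i, inner ℝ (ndD P e t c i) (sd P v w (e i) t) with hr
  have hsD : ∀ a i, ContDiffOn ℝ ∞ (fun t => ndD P e t a i) U := fun a i =>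
    hR.smooth_nd (hR.smooth i)
  have hsk : ∀ c d, ContDiffOn ℝ ∞ (k c d) U := fun c d =>
    ContDiffOn.sum fun i _ => (hsD c i).inner ℝ (hsD d i)
  have hsr : ∀ c, ContDiffOn ℝ ∞ (r c) U := fun c =>
    ContDiffOn.sum fun i _ => (hsD c i).inner ℝ (smooth_sd hR.toRulingFrame (hR.smooth i))
  have hdet : ∀ t ∈ U, k 0 0 t * k 1 1 t - k 0 1 t * k 0 1 t ≠ 0 := by
    intro t ht hz
    have hN := hR.nondeg t ht 0 (fun i => by simpa using hR.pos.le)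
    have hv : ∀ c : Fin 2 → ℝ, c 0 ^ 2 * k 0 0 t + 2 * (c 0 * c 1 * k 0 1 t) + c 1 ^ 2 * k 1 1 t = 0 →
        c = 0 := fun c hc => by
      have hs : ∑ i, inner ℝ (c 0 • ndD P e t 0 i + c 1 • ndD P e t 1 i)
          (c 0 • ndD P e t 0 i + c 1 • ndD P e t 1 i) = (0 : ℝ) := by
        rw [← hc]
        simp only [hk, Fin.sum_univ_two, inner_add_left, inner_add_right, real_inner_smul_left,
          real_inner_smul_right, real_inner_comm (ndD P e t 0 _) (ndD P e t 1 _)]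
        ring
      rw [Finset.sum_eq_zero_iff_of_nonneg fun i _ => real_inner_self_nonneg] at hs
      exact hN.coeff_eq_zero fun i => inner_self_eq_zero.1 (hs i (Finset.mem_univ i))
    have h1 := hv ![k 1 1 t, -k 0 1 t] (by
      simp only [Matrix.cons_val_zero, Matrix.cons_val_one]
      linear_combination k 1 1 t * hz)
    have h11 : k 1 1 t = 0 := congrFun h1 0
    have h2 := congrFun (hv ![0, 1] (by simp [h11])) 1
    simp at h2
  set Δ : R2 → ℝ := fun t => k 0 0 t * k 1 1 t - k 0 1 t * k 0 1 t with hΔ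
  have hsΔ : ContDiffOn ℝ ∞ Δ U := ((hsk 0 0).mul (hsk 1 1)).sub ((hsk 0 1).mul (hsk 0 1))
  refine ⟨![fun t => (k 1 1 t * r 0 t - k 0 1 t * r 1 t) / Δ t,
    fun t => (k 0 0 t * r 1 t - k 0 1 t * r 0 t) / Δ t], fun d => ?_, ?_⟩
  · fin_cases d
    · exact (((hsk 1 1).mul (hsr 0)).sub ((hsk 0 1).mul (hsr 1))).div hsΔ hdet
    · exact (((hsk 0 0).mul (hsr 1)).sub ((hsk 0 1).mul (hsr 0))).div hsΔ hdet
  -- Cramer's rule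
  have key : ∀ t ∈ U, ∃ l : R2, (sd P v w γ t = nd P l γ t ∧
      ∀ i, sd P v w (e i) t = nd P l (e i) t) ∧
      l 0 = (k 1 1 t * r 0 t - k 0 1 t * r 1 t) / Δ t ∧
      l 1 = (k 0 0 t * r 1 t - k 0 1 t * r 0 t) / Δ t := fun t ht => by
    obtain ⟨l, hl⟩ := h t ht
    have hrk : ∀ c, r c t = l 0 * k c 0 t + l 1 * k c 1 t := fun c => by
      simp only [hr, hk, hl.2]
      have : ∀ i, nd P l (e i) t = l 0 • ndD P e t 0 i + l 1 • ndD P e t 1 i := fun i => by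
        conv_lhs => rw [R2.eq_single l, nd_add_smul_dir]
        rfl
      simp only [this, Fin.sum_univ_two, inner_add_right, real_inner_smul_right]
      ring
    have h10 : k 1 0 t = k 0 1 t := by
      simp only [hk]; exact Finset.sum_congr rfl fun i _ => real_inner_comm _ _
    refine ⟨l, hl, ?_, ?_⟩
    · rw [eq_div_iff (hdet t ht), hrk, hrk, h10]; ring
    · rw [eq_div_iff (hdet t ht), hrk, hrk, h10]; ring
  constructor
  · intro t ht
    obtain ⟨l, ⟨hl, -⟩, h0, h1⟩ := key t ht
    rw [hl]
    conv_lhs => rw [R2.eq_single l, nd_add_smul_dir, h0, h1]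
    rfl
  · intro i t ht
    obtain ⟨l, ⟨-, hl⟩, h0, h1⟩ := key t ht
    rw [hl]
    conv_lhs => rw [R2.eq_single l, nd_add_smul_dir, h0, h1]
    rfl

theorem finrank_orthogonal (hR : RulingFrame U P e) (hH : Module.finrank ℝ H = 6) (ht : t ∈ U) :
    Module.finrank ℝ (Submodule.span ℝ (Set.range fun i => e i t))ᗮ = 4 := by
  have : FiniteDimensional ℝ H := Module.finite_of_finrank_pos (by omega)
  have hon : Orthonormal ℝ fun i => e i t := by
    rw [orthonormal_iff_ite]
    intro i j
    fin_cases i <;> fin_cases j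
    exacts [hR.norm 0 t ht, hR.orth t ht, hR.orth' ht, hR.norm 1 t ht]
  have h2 : Module.finrank ℝ (Submodule.span ℝ (Set.range fun i => e i t)) = 2 := by
    rw [finrank_span_eq_card hon.linearIndependent]; rfl
  have := Submodule.finrank_add_finrank_orthogonal (Submodule.span ℝ (Set.range fun i => e i t))
  omega

theorem mem_orthogonal {u : H} (hu : ∀ i, (inner ℝ (e i t) u : ℝ) = 0) :
    u ∈ (Submodule.span ℝ (Set.range fun i => e i t))ᗮ := by
  rw [Submodule.mem_orthogonal]
  intro z hz
  induction hz using Submodule.span_induction with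
  | mem z hz => obtain ⟨i, rfl⟩ := hz; exact hu i
  | zero => simp
  | add z z' _ _ h h' => rw [inner_add_left, h, h', add_zero]
  | smul c z _ h => rw [real_inner_smul_left, h, mul_zero]

/-- If all second covariant derivatives are combinations of the normal derivatives, then the pencil
splits at every leaf. -/
theorem exists_splitPencil (hR : RuledPatch U P e γ ε) (hH : Module.finrank ℝ H = 6)
    (h : ∀ t ∈ U, ∀ v w, CoeffAt P e γ t v w) (ht : t ∈ U) :
    ∃ x y f g, SplitPencil (ndC P γ t) (ndD P e t) x y f g := by
  choose l hl hlγ hle using fun v w => hR.exists_smooth_coeff (v := v) (w := w)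
    (fun t ht => h t ht v w)
  have h0 : ∀ i, |(0 : R2) i| ≤ ε := fun i => by simpa using hR.pos.le
  have hi := hR.indep t ht 0 h0
  have hn := hR.nondeg t ht 0 h0
  rw [pencil_zero] at hi hn
  refine _root_.exists_splitPencil (W := (Submodule.span ℝ (Set.range fun i => e i t))ᗮ)
    (finrank_orthogonal hR.toRulingFrame hH ht) (fun a => mem_orthogonal fun i => hR.inner_nd ht i)
    (fun a j => mem_orthogonal fun i => hR.inner_nd ht i)
    hi hn (fun a => hR.curvatureTerm_eq hR.smooth_base (l := l) hl hlγ hle ht a)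
    (fun j a => hR.curvatureTerm_eq (hR.smooth j) (l := l) hl (fun v w => hle v w j) hle ht a)

end RuledPatch
end Patch

/-! ### Frames adapted to the splitting -/

section Adapted

variable {H : Type*} [NormedAddCommGroup H] [InnerProductSpace ℝ H]

/-- The pencil at `t` splits, the second covariant derivatives in the two distinguished directions
are normal derivatives, and either this also holds for the mixed derivative (if `K`) or the axes are
orthogonal (if not). -/
structure SplitAt (K : Prop) (P : R2 → H →L[ℝ] H) (e : Fin 2 → R2 → H) (γ : R2 → H)
    (t x y f g : R2) : Prop where
  split : SplitPencil (ndC P γ t) (ndD P e t) x y f g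
  ff : CoeffAt P e γ t f f
  gg : CoeffAt P e γ t g g
  fg : (K ∧ CoeffAt P e γ t f g) ∨ (¬K ∧ inner ℝ (nd P f γ t) (nd P g γ t) = (0 : ℝ))

/-- The case of `SplitAt` in which the distinguished basis of the ruling is the given one. -/
structure AdaptedAt (K : Prop) (P : R2 → H →L[ℝ] H) (e : Fin 2 → R2 → H) (γ : R2 → H)
    (t f g : R2) : Prop where
  ge : nd P g (e 0) t = 0
  fe : nd P f (e 1) t = 0
  orth : inner ℝ (nd P f (e 0) t) (nd P g (e 1) t) = (0 : ℝ)
  orth_left : inner ℝ (nd P f (e 0) t) (nd P g γ t) = (0 : ℝ)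
  orth_right : inner ℝ (nd P g (e 1) t) (nd P f γ t) = (0 : ℝ)
  indep : LinearIndependent ℝ ![nd P f (e 0) t, nd P g (e 1) t, nd P f γ t, nd P g γ t]
  ff : CoeffAt P e γ t f f
  gg : CoeffAt P e γ t g g
  fg : (K ∧ CoeffAt P e γ t f g) ∨ (¬K ∧ inner ℝ (nd P f γ t) (nd P g γ t) = (0 : ℝ))

theorem LinearIndependent.smul_four {a b c d : H} (h : LinearIndependent ℝ ![a, b, c, d])
    {x y z w : ℝ} (hx : x ≠ 0) (hy : y ≠ 0) (hz : z ≠ 0) (hw : w ≠ 0) :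
    LinearIndependent ℝ ![x • a, y • b, z • c, w • d] := by
  have := h.units_smul ![Units.mk0 x hx, Units.mk0 y hy, Units.mk0 z hz, Units.mk0 w hw]
  convert this using 1
  ext i; fin_cases i <;> rfl

variable {U : Set R2} {P : R2 → H →L[ℝ] H} {e : Fin 2 → R2 → H} {γ : R2 → H} {t v w : R2}

theorem nd_smul_dir (P : R2 → H →L[ℝ] H) (g : R2 → H) (t : R2) (α : ℝ) (v : R2) :
    nd P (α • v) g t = α • nd P v g t := by
  simpa using nd_add_smul_dir P g t α 0 v 0

theorem RulingFrame.sd_smul_smul_dir (hR : RulingFrame U P e) {g : R2 → H}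
    (hg : ContDiffOn ℝ ∞ g U) (ht : t ∈ U) (α β : ℝ) (v w : R2) :
    sd P (α • v) (β • w) g t = (α * β) • sd P v w g t := by
  have h1 := hR.sd_add_smul_dir hg ht α 0 v 0 (β • w)
  have h2 := hR.sd_add_smul_dir' hg ht β 0 v w 0
  simp only [zero_smul, add_zero] at h1 h2
  rw [h1, h2, smul_smul]

theorem CoeffAt.smul_smul (hR : RulingFrame U P e) (hγ : ContDiffOn ℝ ∞ γ U) (ht : t ∈ U)
    (h : CoeffAt P e γ t v w) (α β : ℝ) : CoeffAt P e γ t (α • v) (β • w) := by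
  obtain ⟨l, h1, h2⟩ := h
  refine ⟨(α * β) • l, ?_, fun i => ?_⟩
  · rw [hR.sd_smul_smul_dir hγ ht, h1, nd_smul_dir]
  · rw [hR.sd_smul_smul_dir (hR.smooth i) ht, h2, nd_smul_dir]

theorem CoeffAt.comm (hR : RulingFrame U P e) (hγ : ContDiffOn ℝ ∞ γ U) (ht : t ∈ U)
    (h : CoeffAt P e γ t v w) : CoeffAt P e γ t w v := by
  obtain ⟨l, h1, h2⟩ := h
  refine ⟨l, ?_, fun i => ?_⟩
  · rw [hR.sd_comm hγ ht, h1]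
  · rw [hR.sd_comm (hR.smooth i) ht, h2]

theorem CoeffAt.add_smul_left (hR : RulingFrame U P e) (hγ : ContDiffOn ℝ ∞ γ U) (ht : t ∈ U)
    {v' : R2} (h : CoeffAt P e γ t v w) (h' : CoeffAt P e γ t v' w) (α β : ℝ) :
    CoeffAt P e γ t (α • v + β • v') w := by
  obtain ⟨l, h1, h2⟩ := h
  obtain ⟨l', h1', h2'⟩ := h'
  refine ⟨α • l + β • l', ?_, fun i => ?_⟩
  · rw [hR.sd_add_smul_dir hγ ht, h1, h1', nd_add_smul_dir]
  · rw [hR.sd_add_smul_dir (hR.smooth i) ht, h2, h2', nd_add_smul_dir]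

theorem sdAt_smul_smul (hR : RulingFrame U P e) (hγ : ContDiffOn ℝ ∞ γ U) (ht : t ∈ U)
    (s : R2) (α β : ℝ) (v w : R2) :
    sdAt P e γ t s (α • v) (β • w) = (α * β) • sdAt P e γ t s v w := by
  simp only [sdAt, Fin.sum_univ_two, hR.sd_smul_smul_dir hγ ht,
    hR.sd_smul_smul_dir (hR.smooth _) ht]
  module

/-- In a patch all of whose points have mixed frames, the pencils split. -/
theorem RuledPatch.splitAt_of_mixed {ε : ℝ} (hR : RuledPatch U P e γ ε) (ht : t ∈ U)
    (h : ∀ s : R2, (∀ i, |s i| ≤ ε) → ∃ x y f g,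
      MixedFrame (pencil (ndC P γ t) (ndD P e t) s) (ndD P e t) x y f g ∧
      (∃ l, sdAt P e γ t s f f = evalC (pencil (ndC P γ t) (ndD P e t) s) l) ∧
      ∃ l, sdAt P e γ t s g g = evalC (pencil (ndC P γ t) (ndD P e t) s) l) :
    ∃ x y f g, SplitAt False P e γ t x y f g := by
  have h0 : ∀ i, |(0 : R2) i| ≤ ε := fun i => by simpa using hR.pos.le
  obtain ⟨x, y, f, g, hm, -, -⟩ := h 0 h0
  rw [pencil_zero] at hm
  have hs := hm.splitPencil hR.pos (fun s hs => by
    obtain ⟨x', y', f', g', h', -⟩ := h s hs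
    exact ⟨x', y', f', g', h'⟩)
  have hdir : ∀ s : R2, (∀ i, |s i| ≤ ε) →
      (∃ l, sdAt P e γ t s f f = evalC (pencil (ndC P γ t) (ndD P e t) s) l) ∧
      ∃ l, sdAt P e γ t s g g = evalC (pencil (ndC P γ t) (ndD P e t) s) l := fun s hss => by
    obtain ⟨x', y', f', g', h', hf, hg⟩ := h s hss
    have hne := h'.evalC_ne_zero
    have unscale : ∀ {k k' : R2} {α : ℝ}, k' = α • k →
        evalC (pencil (ndC P γ t) (ndD P e t) s) k' ≠ 0 →
        (∃ l, sdAt P e γ t s k' k' = evalC (pencil (ndC P γ t) (ndD P e t) s) l) →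
        ∃ l, sdAt P e γ t s k k = evalC (pencil (ndC P γ t) (ndD P e t) s) l := by
      rintro k k' α rfl hk ⟨l, hl⟩
      have hα : α ≠ 0 := by
        rintro rfl
        apply hk
        simp [evalC]
      rw [sdAt_smul_smul hR.toRulingFrame hR.smooth_base ht] at hl
      refine ⟨(α * α)⁻¹ • l, ?_⟩
      have e1 := evalC_add_smul (pencil (ndC P γ t) (ndD P e t) s) (α * α)⁻¹ 0 l 0
      simp only [zero_smul, add_zero] at e1
      rw [e1, ← hl, smul_smul, inv_mul_cancel₀ (mul_ne_zero hα hα), one_smul]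
    rcases hs.directions hm.f_g h' with ⟨⟨α, hα⟩, β, hβ⟩ | ⟨⟨α, hα⟩, β, hβ⟩
    · exact ⟨unscale hα hne.1 hf, unscale hβ hne.2 hg⟩
    · exact ⟨unscale hα hne.2 hg, unscale hβ hne.1 hf⟩
  refine ⟨x, y, f, g, hs, hR.coeffAt_of_mem_span ht fun s hss => (hdir s hss).1,
    hR.coeffAt_of_mem_span ht fun s hss => (hdir s hss).2, Or.inr ⟨id, ?_⟩⟩
  rw [← evalC_ndC, ← evalC_ndC]
  exact hm.f_g

theorem SplitAt.swap {K : Prop} (hR : RulingFrame U P e) (hγ : ContDiffOn ℝ ∞ γ U) (ht : t ∈ U)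
    {x y f g : R2} (h : SplitAt K P e γ t x y f g) : SplitAt K P e γ t y x g f where
  split :=
    { norm_x := h.split.norm_y
      norm_y := h.split.norm_x
      orth := by linarith [h.split.orth]
      gx := h.split.fy
      fy := h.split.gx
      fx_gy := by rw [real_inner_comm]; exact h.split.fx_gy
      fx_g := h.split.gy_f
      gy_f := h.split.fx_g
      indep := by
        have := h.split.indep.comp ![1, 0, 3, 2] (by decide)
        convert this using 1
        ext i; fin_cases i <;> rfl }
  ff := h.gg
  gg := h.ff
  fg := by
    rcases h.fg with ⟨hK, h⟩ | ⟨hK, h⟩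
    · exact Or.inl ⟨hK, h.comm hR hγ ht⟩
    · right; refine ⟨hK, ?_⟩; rw [real_inner_comm]; exact h

/-- Rotation of the frame of the ruling. -/
theorem RulingFrame.rotate (hR : RulingFrame U P e) {V : Set R2} (hV : IsOpen V) (hVU : V ⊆ U)
    {c σ : R2 → ℝ} (hc : ContDiffOn ℝ ∞ c V) (hσ : ContDiffOn ℝ ∞ σ V)
    (hcσ : ∀ t ∈ V, c t ^ 2 + σ t ^ 2 = 1) {x y : R2} (hx : x 0 ^ 2 + x 1 ^ 2 = 1)
    (hy : y 0 ^ 2 + y 1 ^ 2 = 1) (hxy : x 0 * y 0 + x 1 * y 1 = 0) :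
    RulingFrame V P
      ![fun t => (c t • x + σ t • y) 0 • e 0 t + (c t • x + σ t • y) 1 • e 1 t,
        fun t => (-σ t • x + c t • y) 0 • e 0 t + (-σ t • x + c t • y) 1 • e 1 t] where
  isOpen := hV
  smooth i := by
    have h0 := (hR.smooth 0).mono hVU
    have h1 := (hR.smooth 1).mono hVU
    have cc : ∀ r : ℝ, ContDiffOn ℝ ∞ (fun _ : R2 => r) V := fun r => contDiffOn_const
    fin_cases i
    · exact (((hc.mul (cc (x 0))).add (hσ.mul (cc (y 0)))).smul h0).add
        (((hc.mul (cc (x 1))).add (hσ.mul (cc (y 1)))).smul h1)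
    · exact (((hσ.neg.mul (cc (x 0))).add (hc.mul (cc (y 0)))).smul h0).add
        (((hσ.neg.mul (cc (x 1))).add (hc.mul (cc (y 1)))).smul h1)
  norm i t ht := by
    have htU := hVU ht
    have h1 := hcσ t ht
    fin_cases i <;>
    simp only [Fin.zero_eta, Fin.mk_one, Matrix.cons_val_zero, Matrix.cons_val_one, inner_add_left, inner_add_right,
      real_inner_smul_left, real_inner_smul_right, hR.norm _ t htU, hR.orth t htU,
      hR.orth' htU, Pi.add_apply, Pi.smul_apply, smul_eq_mul]
    · linear_combination h1 + (c t) ^ 2 * hx + (σ t) ^ 2 * hy + 2 * c t * σ t * hxy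
    · linear_combination h1 + (σ t) ^ 2 * hx + (c t) ^ 2 * hy - 2 * c t * σ t * hxy
  orth t ht := by
    have htU := hVU ht
    have h1 := hcσ t ht
    simp only [Fin.zero_eta, Fin.mk_one, Matrix.cons_val_zero, Matrix.cons_val_one, inner_add_left, inner_add_right,
      real_inner_smul_left, real_inner_smul_right, hR.norm _ t htU, hR.orth t htU,
      hR.orth' htU, Pi.add_apply, Pi.smul_apply, smul_eq_mul]
    linear_combination c t * σ t * (hy - hx) + (c t ^ 2 - σ t ^ 2) * hxy
  proj t ht u := by
    have htU := hVU ht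
    have h1 := hcσ t ht
    rw [hR.proj t htU u]
    simp only [Fin.zero_eta, Fin.mk_one, Matrix.cons_val_zero, Matrix.cons_val_one, inner_add_left,
      real_inner_smul_left, Pi.add_apply, Pi.smul_apply, smul_eq_mul]
    -- the matrix with the rows `x`, `y` is orthogonal
    obtain ⟨k0, k1, k2⟩ : x 0 ^ 2 + y 0 ^ 2 = 1 ∧ x 1 ^ 2 + y 1 ^ 2 = 1 ∧
        x 0 * x 1 + y 0 * y 1 = 0 := by
      refine ⟨?_, ?_, ?_⟩ <;> grind
    have c00 : (c t * x 0 + σ t * y 0) ^ 2 + (-σ t * x 0 + c t * y 0) ^ 2 = 1 := by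
      linear_combination (x 0 ^ 2 + y 0 ^ 2) * h1 + k0
    have c11 : (c t * x 1 + σ t * y 1) ^ 2 + (-σ t * x 1 + c t * y 1) ^ 2 = 1 := by
      linear_combination (x 1 ^ 2 + y 1 ^ 2) * h1 + k1
    have c01 : (c t * x 0 + σ t * y 0) * (c t * x 1 + σ t * y 1) +
        (-σ t * x 0 + c t * y 0) * (-σ t * x 1 + c t * y 1) = 0 := by
      linear_combination (x 0 * x 1 + y 0 * y 1) * h1 + k2
    match_scalars
    · linear_combination -(inner ℝ (e 0 t) u : ℝ) * c00 - (inner ℝ (e 1 t) u : ℝ) * c01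
    · linear_combination -(inner ℝ (e 1 t) u : ℝ) * c11 - (inner ℝ (e 0 t) u : ℝ) * c01
  smooth_proj := hR.smooth_proj.mono hVU

end Adapted

section AdaptedFrame

variable {H : Type*} [NormedAddCommGroup H] [InnerProductSpace ℝ H]
variable {U : Set R2} {P : R2 → H →L[ℝ] H} {e : Fin 2 → R2 → H} {γ : R2 → H} {t v w : R2}

theorem RulingFrame.mono (hR : RulingFrame U P e) {V : Set R2} (hV : IsOpen V) (hVU : V ⊆ U) :
    RulingFrame V P e :=
  ⟨hV, fun i => (hR.smooth i).mono hVU, fun i t ht => hR.norm i t (hVU ht),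
    fun t ht => hR.orth t (hVU ht), fun t ht => hR.proj t (hVU ht), hR.smooth_proj.mono hVU⟩

theorem RulingFrame.smooth_comb (hR : RulingFrame U P e) {x y : R2 → ℝ} (hx : ContDiffOn ℝ ∞ x U)
    (hy : ContDiffOn ℝ ∞ y U) : ContDiffOn ℝ ∞ (fun t => x t • e 0 t + y t • e 1 t) U :=
  (hx.smul (hR.smooth 0)).add (hy.smul (hR.smooth 1))

theorem RulingFrame.nd_comb (hR : RulingFrame U P e) {x y : R2 → ℝ} (hx : ContDiffOn ℝ ∞ x U)
    (hy : ContDiffOn ℝ ∞ y U) (ht : t ∈ U) :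
    nd P v (fun t => x t • e 0 t + y t • e 1 t) t = x t • nd P v (e 0) t + y t • nd P v (e 1) t := by
  have hU := hR.isOpen
  have dsm : ∀ {y : R2 → ℝ} {k : R2 → H}, ContDiffOn ℝ ∞ y U → ContDiffOn ℝ ∞ k U →
      DifferentiableAt ℝ (fun t => y t • k t) t :=
    fun hy hk => SmoothOn.differentiableAt hU (hy.smul hk) ht
  rw [nd_add (dsm hx (hR.smooth 0)) (dsm hy (hR.smooth 1)),
    hR.nd_smul (SmoothOn.differentiableAt hU hx ht) ht,
    hR.nd_smul (SmoothOn.differentiableAt hU hy ht) ht]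

theorem RulingFrame.sd_comb (hR : RulingFrame U P e) {x y : R2 → ℝ} (hx : ContDiffOn ℝ ∞ x U)
    (hy : ContDiffOn ℝ ∞ y U) (ht : t ∈ U) :
    sd P v w (fun t => x t • e 0 t + y t • e 1 t) t =
      x t • sd P v w (e 0) t + y t • sd P v w (e 1) t := by
  have hsm : ∀ {y : R2 → ℝ} {k : R2 → H}, ContDiffOn ℝ ∞ y U → ContDiffOn ℝ ∞ k U →
      ContDiffOn ℝ ∞ (fun t => y t • k t) U := fun hy hk => hy.smul hk
  rw [hR.sd_add (hsm hx (hR.smooth 0)) (hsm hy (hR.smooth 1)) ht, hR.sd_smul hx ht,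
    hR.sd_smul hy ht]

/-- Orthonormal bases of the plane that diagonalize a quadratic form with distinct eigenvalues
agree up to signs and order. -/
theorem diagonalizing_unique {S₁ S₂ : ℝ} (hS : S₁ ≠ S₂) {x y x' y' : R2}
    (hx : x 0 ^ 2 + x 1 ^ 2 = 1) (hy : y 0 ^ 2 + y 1 ^ 2 = 1) (hxy : x 0 * y 0 + x 1 * y 1 = 0)
    (hx' : x' 0 ^ 2 + x' 1 ^ 2 = 1) (hy' : y' 0 ^ 2 + y' 1 ^ 2 = 1)
    (hxy' : x' 0 * y' 0 + x' 1 * y' 1 = 0)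
    (h : ∀ a b c d : ℝ, x' = a • x + b • y → y' = c • x + d • y → a * c * S₁ + b * d * S₂ = 0) :
    (∃ a d : ℝ, a ^ 2 = 1 ∧ d ^ 2 = 1 ∧ x = a • x' ∧ y = d • y') ∨
      ∃ a d : ℝ, a ^ 2 = 1 ∧ d ^ 2 = 1 ∧ x = a • y' ∧ y = d • x' := by
  obtain ⟨a, b, hab⟩ := exists_coords_of_orthonormal hx hy hxy x'
  obtain ⟨c, d, hcd⟩ := exists_coords_of_orthonormal hx hy hxy y'
  have h1 := h a b c d hab hcd
  have n1 : a ^ 2 + b ^ 2 = 1 := by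
    rw [hab] at hx'; simp only [Pi.add_apply, Pi.smul_apply, smul_eq_mul] at hx'
    linear_combination hx' - a ^ 2 * hx - b ^ 2 * hy - 2 * a * b * hxy
  have n2 : c ^ 2 + d ^ 2 = 1 := by
    rw [hcd] at hy'; simp only [Pi.add_apply, Pi.smul_apply, smul_eq_mul] at hy'
    linear_combination hy' - c ^ 2 * hx - d ^ 2 * hy - 2 * c * d * hxy
  have n3 : a * c + b * d = 0 := by
    rw [hab, hcd] at hxy'; simp only [Pi.add_apply, Pi.smul_apply, smul_eq_mul] at hxy'
    linear_combination hxy' - a * c * hx - b * d * hy - (a * d + b * c) * hxy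
  have hac : a * c = 0 := by
    apply (mul_eq_zero.1 (_ : (a * c) * (S₁ - S₂) = 0)).resolve_right (sub_ne_zero.2 hS)
    linear_combination h1 - S₂ * n3
  have hbd : b * d = 0 := by linarith
  rcases mul_eq_zero.1 hac with rfl | rfl
  · right
    have hb : b ^ 2 = 1 := by linarith
    have hb0 : b ≠ 0 := by rintro rfl; norm_num at hb
    have hd := (mul_eq_zero.1 hbd).resolve_left hb0
    subst hd
    have hc : c ^ 2 = 1 := by linarith
    refine ⟨c, b, hc, hb, ?_, ?_⟩
    · rw [hcd]; linear_combination (norm := module) -hc • x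
    · rw [hab]; linear_combination (norm := module) -hb • y
  · left
    have hd : d ^ 2 = 1 := by linarith
    have hd0 : d ≠ 0 := by rintro rfl; norm_num at hd
    have hb := (mul_eq_zero.1 hbd).resolve_right hd0
    subst hb
    have ha : a ^ 2 = 1 := by linarith
    refine ⟨a, d, ha, hd, ?_, ?_⟩
    · rw [hab]; linear_combination (norm := module) -ha • x
    · rw [hcd]; linear_combination (norm := module) -hd • y

theorem SplitAt.adaptedAt {K : Prop} {x y f g : R2} (h : SplitAt K P e γ t x y f g) {e' : Fin 2 → R2 → H}
    {a d : ℝ} (ha : a ^ 2 = 1) (hd : d ^ 2 = 1)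
    (nd0 : ∀ v, nd P v (e' 0) t = a • (x 0 • nd P v (e 0) t + x 1 • nd P v (e 1) t))
    (nd1 : ∀ v, nd P v (e' 1) t = d • (y 0 • nd P v (e 0) t + y 1 • nd P v (e 1) t))
    (sd0 : ∀ v w, sd P v w (e' 0) t = a • (x 0 • sd P v w (e 0) t + x 1 • sd P v w (e 1) t))
    (sd1 : ∀ v w, sd P v w (e' 1) t = d • (y 0 • sd P v w (e 0) t + y 1 • sd P v w (e 1) t)) :
    AdaptedAt K P e' γ t f g := by
  have hs := h.split
  have ha0 : a ≠ 0 := by rintro rfl; norm_num at ha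
  have hd0 : d ≠ 0 := by rintro rfl; norm_num at hd
  have co : ∀ {v w}, CoeffAt P e γ t v w → CoeffAt P e' γ t v w := by
    rintro v w ⟨l, h1, h2⟩
    refine ⟨l, h1, fun i => ?_⟩
    fin_cases i
    · change sd P v w (e' 0) t = nd P l (e' 0) t
      rw [sd0, h2, h2, nd0]
    · change sd P v w (e' 1) t = nd P l (e' 1) t
      rw [sd1, h2, h2, nd1]
  simp only [← evalD_ndD] at nd0 nd1
  refine ⟨?_, ?_, ?_, ?_, ?_, ?_, co h.ff, co h.gg, h.fg.imp_left fun h => ⟨h.1, co h.2⟩⟩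
  · rw [nd0, hs.gx, smul_zero]
  · rw [nd1, hs.fy, smul_zero]
  · rw [nd0, nd1, real_inner_smul_left, real_inner_smul_right, hs.fx_gy]; simp
  · rw [nd0, real_inner_smul_left, ← evalC_ndC, hs.fx_g, mul_zero]
  · rw [nd1, real_inner_smul_left, ← evalC_ndC, hs.gy_f, mul_zero]
  · have := LinearIndependent.smul_four hs.indep ha0 hd0 one_ne_zero one_ne_zero
    rw [nd0, nd1, ← evalC_ndC, ← evalC_ndC]
    simpa only [one_smul] using this

/-- Near each leaf, the distinguished bases of the ruling fit together to a smooth frame: it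
diagonalizes the Gram form of the derivative of the ruling in a fixed direction. -/
theorem exists_adapted_frame {K : Prop} (hR : RulingFrame U P e) (hγ : ContDiffOn ℝ ∞ γ U)
    (h : ∀ t ∈ U, ∃ x y f g, SplitAt K P e γ t x y f g) {t₀ : R2} (ht₀ : t₀ ∈ U) :
    ∃ V ⊆ U, t₀ ∈ V ∧ ∃ e', RulingFrame V P e' ∧ ∀ t ∈ V, ∃ f g, AdaptedAt K P e' γ t f g := by
  obtain ⟨x, y, f, g, h0⟩ := h t₀ ht₀
  have hx := h0.split.norm_x
  have hy := h0.split.norm_y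
  have hxy := h0.split.orth
  -- the derivative of the ruling in the fixed direction `f`; at `t₀` its Gram form has the
  -- eigenvectors `x`, `y` with different eigenvalues
  set L : R2 → R2 → H := fun z t => z 0 • nd P f (e 0) t + z 1 • nd P f (e 1) t with hL
  have hLs : ∀ z, ContDiffOn ℝ ∞ (L z) U := fun z =>
    (contDiffOn_const.smul (hR.smooth_nd (hR.smooth 0))).add
      (contDiffOn_const.smul (hR.smooth_nd (hR.smooth 1)))
  set α : R2 → ℝ := fun t => inner ℝ (L x t) (L x t) - inner ℝ (L y t) (L y t) with hα
  set β : R2 → ℝ := fun t => 2 * inner ℝ (L x t) (L y t) with hβ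
  have hαs : ContDiffOn ℝ ∞ α U := ((hLs x).inner ℝ (hLs x)).sub ((hLs y).inner ℝ (hLs y))
  have hβs : ContDiffOn ℝ ∞ β U := contDiffOn_const.mul ((hLs x).inner ℝ (hLs y))
  have hα0 : 0 < α t₀ := by
    have hy0 : L y t₀ = 0 := by simp only [hL]; rw [← evalD_ndD]; exact h0.split.fy
    have hx0 : L x t₀ ≠ 0 := by simp only [hL]; rw [← evalD_ndD]; exact h0.split.indep.ne_zero 0
    simp only [hα, hy0, inner_zero_left, sub_zero]
    exact real_inner_self_pos.2 hx0
  set V := U ∩ α ⁻¹' Set.Ioi 0 with hV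
  have hVo : IsOpen V := hαs.continuousOn.isOpen_inter_preimage hR.isOpen isOpen_Ioi
  have hVU : V ⊆ U := Set.inter_subset_left
  have hαV := hαs.mono hVU
  have hβV := hβs.mono hVU
  have hpos : ∀ t ∈ V, 0 < α t := fun t ht => ht.2
  -- the eigenvectors have the angle `θ` with `cos 2θ = α / R`, `sin 2θ = β / R`, so that
  -- `(c, σ) = (cos θ, sin θ)` is the direction of `(α + R, β)`
  set R : R2 → ℝ := fun t => Real.sqrt (α t ^ 2 + β t ^ 2) with hRdef
  have hR2 : ∀ t, R t ^ 2 = α t ^ 2 + β t ^ 2 := fun t => Real.sq_sqrt (by positivity)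
  have hR0 : ∀ t, 0 ≤ R t := fun t => Real.sqrt_nonneg _
  have hRs : ContDiffOn ℝ ∞ R V := ((hαV.pow 2).add (hβV.pow 2)).sqrt fun t ht => by
    have := hpos t ht; positivity
  set n : R2 → ℝ := fun t => Real.sqrt ((α t + R t) ^ 2 + β t ^ 2) with hn
  have hn2 : ∀ t, n t ^ 2 = (α t + R t) ^ 2 + β t ^ 2 := fun t => Real.sq_sqrt (by positivity)
  have hns : ContDiffOn ℝ ∞ n V := (((hαV.add hRs).pow 2).add (hβV.pow 2)).sqrt fun t ht => by
    have := hpos t ht; have := hR0 t; positivity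
  have hn0 : ∀ t ∈ V, n t ≠ 0 := fun t ht hz => by
    have h1 := hn2 t
    rw [hz] at h1
    have := hpos t ht; have := hR0 t
    have : 0 < (α t + R t) ^ 2 + β t ^ 2 := by positivity
    rw [← h1] at this; norm_num at this
  set c : R2 → ℝ := fun t => (α t + R t) / n t with hc
  set σ : R2 → ℝ := fun t => β t / n t with hσ
  have hcs : ContDiffOn ℝ ∞ c V := (hαV.add hRs).div hns hn0
  have hσs : ContDiffOn ℝ ∞ σ V := hβV.div hns hn0
  have hcσ : ∀ t ∈ V, c t ^ 2 + σ t ^ 2 = 1 := fun t ht => by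
    simp only [hc, hσ, div_pow]
    rw [← add_div, ← hn2, div_self (pow_ne_zero 2 (hn0 t ht))]
  have hRV := hR.mono hVo hVU
  refine ⟨V, hVU, ⟨ht₀, hα0⟩, _, hR.rotate hVo hVU hcs hσs hcσ hx hy hxy, fun t ht => ?_⟩
  set X : R2 → R2 := fun t => c t • x + σ t • y with hX
  set Y : R2 → R2 := fun t => -σ t • x + c t • y with hY
  have hXs : ∀ i, ContDiffOn ℝ ∞ (fun t => X t i) V := fun i =>
    (hcs.mul contDiffOn_const).add (hσs.mul contDiffOn_const)
  have hYs : ∀ i, ContDiffOn ℝ ∞ (fun t => Y t i) V := fun i =>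
    (hσs.neg.mul contDiffOn_const).add (hcs.mul contDiffOn_const)
  have hco := hcσ t ht
  have nX : X t 0 ^ 2 + X t 1 ^ 2 = 1 := by
    simp only [hX, Pi.add_apply, Pi.smul_apply, smul_eq_mul]
    linear_combination hco + c t ^ 2 * hx + σ t ^ 2 * hy + 2 * c t * σ t * hxy
  have nY : Y t 0 ^ 2 + Y t 1 ^ 2 = 1 := by
    simp only [hY, Pi.add_apply, Pi.smul_apply, smul_eq_mul]
    linear_combination hco + σ t ^ 2 * hx + c t ^ 2 * hy - 2 * c t * σ t * hxy
  have nXY : X t 0 * Y t 0 + X t 1 * Y t 1 = 0 := by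
    simp only [hX, hY, Pi.add_apply, Pi.smul_apply, smul_eq_mul]
    linear_combination c t * σ t * (hy - hx) + (c t ^ 2 - σ t ^ 2) * hxy
  have hLlin : ∀ (a b : ℝ) (z z' : R2), L (a • z + b • z') t = a • L z t + b • L z' t := by
    intro a b z z'
    simp only [hL, Pi.add_apply, Pi.smul_apply, smul_eq_mul]; module
  have hcn : c t * n t = α t + R t := div_mul_cancel₀ _ (hn0 t ht)
  have hσn : σ t * n t = β t := div_mul_cancel₀ _ (hn0 t ht)
  have hn2pos : 0 < n t ^ 2 := by have := hn0 t ht; positivity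
  have gXY : (inner ℝ (L (X t) t) (L (Y t) t) : ℝ) = 0 := by
    rw [show X t = c t • x + σ t • y from rfl, show Y t = -σ t • x + c t • y from rfl, hLlin, hLlin]
    simp only [inner_add_left, inner_add_right, real_inner_smul_left, real_inner_smul_right,
      real_inner_comm (L x t) (L y t)]
    have e1 : n t ^ 2 * (-(c t * σ t) * α t + (c t ^ 2 - σ t ^ 2) * (β t / 2)) = 0 := by
      have : n t ^ 2 * (-(c t * σ t) * α t + (c t ^ 2 - σ t ^ 2) * (β t / 2)) =
        -((c t * n t) * (σ t * n t)) * α t + ((c t * n t) ^ 2 - (σ t * n t) ^ 2) * (β t / 2) := by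
        ring
      rw [this, hcn, hσn]
      linear_combination β t / 2 * hR2 t
    have e2 := (mul_eq_zero.1 e1).resolve_left hn2pos.ne'
    simp only [hα, hβ] at e2
    linear_combination e2
  have gne : (inner ℝ (L (X t) t) (L (X t) t) : ℝ) ≠ inner ℝ (L (Y t) t) (L (Y t) t) := by
    intro heq
    have e3 : (c t ^ 2 - σ t ^ 2) * α t + 2 * (c t * σ t) * β t = 0 := by
      rw [show X t = c t • x + σ t • y from rfl, show Y t = -σ t • x + c t • y from rfl, hLlin,
        hLlin] at heq
      simp only [inner_add_left, inner_add_right, real_inner_smul_left, real_inner_smul_right,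
        real_inner_comm (L x t) (L y t)] at heq
      simp only [hα, hβ]
      linear_combination heq
    have e4 : n t ^ 2 * ((c t ^ 2 - σ t ^ 2) * α t + 2 * (c t * σ t) * β t) =
        ((c t * n t) ^ 2 - (σ t * n t) ^ 2) * α t + 2 * ((c t * n t) * (σ t * n t)) * β t := by ring
    rw [e3, hcn, hσn] at e4
    have e5 : ((α t + R t) ^ 2 - β t ^ 2) * α t + 2 * ((α t + R t) * β t) * β t =
        2 * α t ^ 2 * (α t + R t) + 2 * (α t + R t) * β t ^ 2 := by
      linear_combination α t * hR2 t
    rw [e5] at e4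
    have := hpos t ht; have := hR0 t
    have : 0 < 2 * α t ^ 2 * (α t + R t) + 2 * (α t + R t) * β t ^ 2 := by positivity
    linarith
  -- the basis given at `t` is orthogonal for the Gram form too, hence agrees with the frame up to
  -- order and signs
  obtain ⟨x', y', f', g', h'⟩ := h t ht.1
  have hf : ∃ a b : ℝ, f = a • f' + b • g' :=
    exists_coords_of_det (det_ne_zero_of_linearIndependent h'.split.indep) f
  have gxy : (inner ℝ (L x' t) (L y' t) : ℝ) = 0 := by
    obtain ⟨a, b, rfl⟩ := hf
    simp only [hL]
    rw [← evalD_ndD, ← evalD_ndD, evalD_add_smul_left, evalD_add_smul_left, h'.split.gx,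
      h'.split.fy]
    simp [real_inner_smul_left, real_inner_smul_right, h'.split.fx_gy]
  have key := diagonalizing_unique gne nX nY nXY h'.split.norm_x h'.split.norm_y h'.split.orth
    (fun a b c d h1 h2 => by
      rw [h1, h2, hLlin a b (X t) (Y t), hLlin c d (X t) (Y t)] at gxy
      simp only [inner_add_left, inner_add_right, real_inner_smul_left, real_inner_smul_right,
        real_inner_comm (L (X t) t) (L (Y t) t)] at gxy
      linear_combination gxy - (a * d + b * c) * gXY)
  have nd0 : ∀ v, nd P v (fun t => X t 0 • e 0 t + X t 1 • e 1 t) t =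
      X t 0 • nd P v (e 0) t + X t 1 • nd P v (e 1) t := fun v =>
    hRV.nd_comb (hXs 0) (hXs 1) ht
  have nd1 : ∀ v, nd P v (fun t => Y t 0 • e 0 t + Y t 1 • e 1 t) t =
      Y t 0 • nd P v (e 0) t + Y t 1 • nd P v (e 1) t := fun v =>
    hRV.nd_comb (hYs 0) (hYs 1) ht
  have sd0 : ∀ v w, sd P v w (fun t => X t 0 • e 0 t + X t 1 • e 1 t) t =
      X t 0 • sd P v w (e 0) t + X t 1 • sd P v w (e 1) t := fun v w =>
    hRV.sd_comb (hXs 0) (hXs 1) ht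
  have sd1 : ∀ v w, sd P v w (fun t => Y t 0 • e 0 t + Y t 1 • e 1 t) t =
      Y t 0 • sd P v w (e 0) t + Y t 1 • sd P v w (e 1) t := fun v w =>
    hRV.sd_comb (hYs 0) (hYs 1) ht
  have sc : ∀ (a : ℝ) (z : R2) (u u' : H),
      (a • z) 0 • u + (a • z) 1 • u' = a • (z 0 • u + z 1 • u') := fun a z u u' => by
    simp only [Pi.smul_apply, smul_eq_mul]; module
  rcases key with ⟨a, d, ha, hd, hXx, hYy⟩ | ⟨a, d, ha, hd, hXx, hYy⟩
  · refine ⟨f', g', h'.adaptedAt ha hd (fun v => ?_) (fun v => ?_) (fun v w => ?_) fun v w => ?_⟩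
    · exact (nd0 v).trans (by rw [hXx, sc])
    · exact (nd1 v).trans (by rw [hYy, sc])
    · exact (sd0 v w).trans (by rw [hXx, sc])
    · exact (sd1 v w).trans (by rw [hYy, sc])
  · refine ⟨g', f', (h'.swap hRV (hγ.mono hVU) ht).adaptedAt ha hd (fun v => ?_) (fun v => ?_)
      (fun v w => ?_) fun v w => ?_⟩
    · exact (nd0 v).trans (by rw [hXx, sc])
    · exact (nd1 v).trans (by rw [hYy, sc])
    · exact (sd0 v w).trans (by rw [hXx, sc])
    · exact (sd1 v w).trans (by rw [hYy, sc])

end AdaptedFrame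

section Moving

variable {H : Type*} [NormedAddCommGroup H] [InnerProductSpace ℝ H]

/-- The component along `q` of the derivative of the section `k` of the ruling. -/
def turning (P : R2 → H →L[ℝ] H) (k q : R2 → H) (w t : R2) : ℝ := inner ℝ (nd P w k t) (q t)

/-- A moving frame of a patch that splits: the two sections `e 0`, `e 1` of the ruling turn in the
directions of the unit vectors `q` and `v`, and `p`, `r` are the axes of the two factors. -/
structure SplitFrame (K : Prop) (V : Set R2) (P : R2 → H →L[ℝ] H) (e : Fin 2 → R2 → H)
    (γ q v p r : R2 → H) : Prop extends RulingFrame V P e where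
  smooth_base : ContDiffOn ℝ ∞ γ V
  smooth_q : ContDiffOn ℝ ∞ q V
  smooth_v : ContDiffOn ℝ ∞ v V
  smooth_p : ContDiffOn ℝ ∞ p V
  smooth_r : ContDiffOn ℝ ∞ r V
  qq : ∀ t ∈ V, inner ℝ (q t) (q t) = (1 : ℝ)
  vv : ∀ t ∈ V, inner ℝ (v t) (v t) = (1 : ℝ)
  qv : ∀ t ∈ V, inner ℝ (q t) (v t) = (0 : ℝ)
  qp : ∀ t ∈ V, inner ℝ (q t) (p t) = (0 : ℝ)
  qr : ∀ t ∈ V, inner ℝ (q t) (r t) = (0 : ℝ)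
  vp : ∀ t ∈ V, inner ℝ (v t) (p t) = (0 : ℝ)
  vr : ∀ t ∈ V, inner ℝ (v t) (r t) = (0 : ℝ)
  nd_zero : ∀ t ∈ V, ∀ w, nd P w (e 0) t = turning P (e 0) q w t • q t
  nd_one : ∀ t ∈ V, ∀ w, nd P w (e 1) t = turning P (e 1) v w t • v t
  nd_base : ∀ t ∈ V, ∀ w, nd P w γ t =
    turning P (e 0) q w t • p t + turning P (e 1) v w t • r t
  axes : ∀ t ∈ V, ∀ a b : ℝ, a • p t + b • r t = 0 → a = 0 ∧ b = 0
  dirs : ∀ t ∈ V, ∃ f g, turning P (e 0) q f t = 1 ∧ turning P (e 1) v f t = 0 ∧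
    turning P (e 0) q g t = 0 ∧ turning P (e 1) v g t = 1 ∧
    CoeffAt P e γ t f f ∧ CoeffAt P e γ t g g ∧
    ((K ∧ CoeffAt P e γ t f g) ∨ (¬K ∧ inner ℝ (p t) (r t) = (0 : ℝ)))

variable {U : Set R2} {P : R2 → H →L[ℝ] H} {e : Fin 2 → R2 → H} {γ : R2 → H} {t : R2}

theorem AdaptedAt.smul_smul {K : Prop} (hR : RulingFrame U P e) (hγ : ContDiffOn ℝ ∞ γ U) (ht : t ∈ U)
    {f g : R2} (h : AdaptedAt K P e γ t f g) {α β : ℝ} (hα : α ≠ 0) (hβ : β ≠ 0) :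
    AdaptedAt K P e γ t (α • f) (β • g) where
  ge := by rw [nd_smul_dir, h.ge, smul_zero]
  fe := by rw [nd_smul_dir, h.fe, smul_zero]
  orth := by
    rw [nd_smul_dir, nd_smul_dir, real_inner_smul_left, real_inner_smul_right, h.orth]; simp
  orth_left := by
    rw [nd_smul_dir, nd_smul_dir, real_inner_smul_left, real_inner_smul_right, h.orth_left]; simp
  orth_right := by
    rw [nd_smul_dir, nd_smul_dir, real_inner_smul_left, real_inner_smul_right, h.orth_right]; simp
  indep := by
    simp only [nd_smul_dir]
    exact h.indep.smul_four hα hβ hα hβ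
  ff := h.ff.smul_smul hR hγ ht α α
  gg := h.gg.smul_smul hR hγ ht β β
  fg := by
    rcases h.fg with ⟨hK, h⟩ | ⟨hK, h⟩
    · exact Or.inl ⟨hK, h.smul_smul hR hγ ht α β⟩
    · refine Or.inr ⟨hK, ?_⟩
      rw [nd_smul_dir, nd_smul_dir, real_inner_smul_left, real_inner_smul_right, h]; simp

theorem turning_add_smul_dir (P : R2 → H →L[ℝ] H) (k q : R2 → H) (t : R2) (α β : ℝ) (v w : R2) :
    turning P k q (α • v + β • w) t = α * turning P k q v t + β * turning P k q w t := by
  rw [turning, nd_add_smul_dir, inner_add_left, real_inner_smul_left, real_inner_smul_left]; rfl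

/-- A ruling frame adapted to the splitting extends to a moving frame, for base points on the lines of
striction of the two factors. -/
theorem exists_splitFrame {K : Prop} (hR : RulingFrame U P e) (hγ : ContDiffOn ℝ ∞ γ U)
    (h : ∀ t ∈ U, ∃ f g, AdaptedAt K P e γ t f g) {t₀ : R2} (ht₀ : t₀ ∈ U) :
    ∃ V ⊆ U, t₀ ∈ V ∧ ∃ (a b : R2 → ℝ) (q v p r : R2 → H), (∀ t ∈ V, ∀ v w,
      CoeffAt P e (fun t => γ t + (a t • e 0 t + b t • e 1 t)) t v w → CoeffAt P e γ t v w) ∧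
      SplitFrame K V P e (fun t => γ t + (a t • e 0 t + b t • e 1 t)) q v p r := by
  obtain ⟨f₀, g₀, h0⟩ := h t₀ ht₀
  -- the derivatives of `e 0` are all parallel, and likewise those of `e 1`, so fixed directions
  -- suffice for `q` and `v`
  set Q : R2 → H := nd P f₀ (e 0) with hQ
  set T : R2 → H := nd P g₀ (e 1) with hT
  have hQs : ContDiffOn ℝ ∞ Q U := hR.smooth_nd (hR.smooth 0)
  have hTs : ContDiffOn ℝ ∞ T U := hR.smooth_nd (hR.smooth 1)
  set V := U ∩ (Q ⁻¹' {0}ᶜ ∩ T ⁻¹' {0}ᶜ) with hV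
  have hVo : IsOpen V := by
    rw [hV, Set.inter_inter_distrib_left]
    exact (hQs.continuousOn.isOpen_inter_preimage hR.isOpen isOpen_compl_singleton).inter
      (hTs.continuousOn.isOpen_inter_preimage hR.isOpen isOpen_compl_singleton)
  have hVU : V ⊆ U := Set.inter_subset_left
  have hRV := hR.mono hVo hVU
  have hγV := hγ.mono hVU
  have hQ0 : ∀ t ∈ V, Q t ≠ 0 := fun t ht => ht.2.1
  have hT0 : ∀ t ∈ V, T t ≠ 0 := fun t ht => ht.2.2
  set q : R2 → H := fun t => ‖Q t‖⁻¹ • Q t with hq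
  set v : R2 → H := fun t => ‖T t‖⁻¹ • T t with hv
  have hqs : ContDiffOn ℝ ∞ q V := (((hQs.mono hVU).norm ℝ hQ0).inv fun t ht =>
    norm_ne_zero_iff.2 (hQ0 t ht)).smul (hQs.mono hVU)
  have hvs : ContDiffOn ℝ ∞ v V := (((hTs.mono hVU).norm ℝ hT0).inv fun t ht =>
    norm_ne_zero_iff.2 (hT0 t ht)).smul (hTs.mono hVU)
  have unit : ∀ u : H, u ≠ 0 → inner ℝ (‖u‖⁻¹ • u) (‖u‖⁻¹ • u) = (1 : ℝ) := fun u hu => by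
    have := norm_ne_zero_iff.2 hu
    rw [real_inner_self_eq_norm_sq, norm_smul, norm_inv, norm_norm, inv_mul_cancel₀ this, one_pow]
  -- the distinguished directions, normalized
  have hdir : ∀ t ∈ V, ∃ f g, AdaptedAt K P e γ t f g ∧ nd P f (e 0) t = q t ∧
      nd P g (e 1) t = v t := fun t ht => by
    obtain ⟨f, g, had⟩ := h t (hVU ht)
    have hdet : f 0 * g 1 - f 1 * g 0 ≠ 0 :=
      det_ne_zero_of_linearIndependent (C := ndC P γ t) (q := nd P f (e 0) t)
        (v := nd P g (e 1) t) (by rw [evalC_ndC, evalC_ndC]; exact had.indep)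
    obtain ⟨a, b, hab⟩ := exists_coords_of_det hdet f₀
    obtain ⟨c, d, hcd⟩ := exists_coords_of_det hdet g₀
    have eQ : Q t = a • nd P f (e 0) t := by
      rw [hQ, hab, nd_add_smul_dir, had.ge, smul_zero, add_zero]
    have eT : T t = d • nd P g (e 1) t := by
      rw [hT, hcd, nd_add_smul_dir, had.fe, smul_zero, zero_add]
    have ha : a ≠ 0 := by rintro rfl; exact hQ0 t ht (by rw [eQ, zero_smul])
    have hd : d ≠ 0 := by rintro rfl; exact hT0 t ht (by rw [eT, zero_smul])
    refine ⟨_, _, had.smul_smul hR hγ (hVU ht)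
      (mul_ne_zero (inv_ne_zero (norm_ne_zero_iff.2 (hQ0 t ht))) ha)
      (mul_ne_zero (inv_ne_zero (norm_ne_zero_iff.2 (hT0 t ht))) hd), ?_, ?_⟩
    · rw [nd_smul_dir, mul_smul, ← eQ]
    · rw [nd_smul_dir, mul_smul, ← eT]
  have hqq : ∀ t ∈ V, inner ℝ (q t) (q t) = (1 : ℝ) := fun t ht => unit _ (hQ0 t ht)
  have hvv : ∀ t ∈ V, inner ℝ (v t) (v t) = (1 : ℝ) := fun t ht => unit _ (hT0 t ht)
  -- the smooth directions `f`, `g` dual to the angular velocities of `e 0` and `e 1`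
  set ρ₁ : R2 → R2 → ℝ := turning P (e 0) q with hρ₁
  set ρ₂ : R2 → R2 → ℝ := turning P (e 1) v with hρ₂
  have hρ₁s : ∀ w, ContDiffOn ℝ ∞ (ρ₁ w) V := fun w => (hRV.smooth_nd (hRV.smooth 0)).inner ℝ hqs
  have hρ₂s : ∀ w, ContDiffOn ℝ ∞ (ρ₂ w) V := fun w => (hRV.smooth_nd (hRV.smooth 1)).inner ℝ hvs
  set Δ : R2 → ℝ := fun t => ρ₁ (Pi.single 0 1) t * ρ₂ (Pi.single 1 1) t -
    ρ₁ (Pi.single 1 1) t * ρ₂ (Pi.single 0 1) t with hΔ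
  have hΔs : ContDiffOn ℝ ∞ Δ V :=
    ((hρ₁s _).mul (hρ₂s _)).sub ((hρ₁s _).mul (hρ₂s _))
  set f : R2 → R2 := fun t => ![ρ₂ (Pi.single 1 1) t / Δ t, -ρ₂ (Pi.single 0 1) t / Δ t] with hf
  set g : R2 → R2 := fun t => ![-ρ₁ (Pi.single 1 1) t / Δ t, ρ₁ (Pi.single 0 1) t / Δ t] with hg
  have lin₁ : ∀ w t, ρ₁ w t = w 0 * ρ₁ (Pi.single 0 1) t + w 1 * ρ₁ (Pi.single 1 1) t := fun w t => by
    conv_lhs => rw [R2.eq_single w, hρ₁, turning_add_smul_dir]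
  have lin₂ : ∀ w t, ρ₂ w t = w 0 * ρ₂ (Pi.single 0 1) t + w 1 * ρ₂ (Pi.single 1 1) t := fun w t => by
    conv_lhs => rw [R2.eq_single w, hρ₂, turning_add_smul_dir]
  have main : ∀ t ∈ V, Δ t ≠ 0 ∧ AdaptedAt K P e γ t (f t) (g t) ∧ nd P (f t) (e 0) t = q t ∧
      nd P (g t) (e 1) t = v t ∧ ρ₁ (f t) t = 1 ∧ ρ₂ (f t) t = 0 ∧ ρ₁ (g t) t = 0 ∧
      ρ₂ (g t) t = 1 := fun t ht => by
    obtain ⟨f', g', had, h1, h2⟩ := hdir t ht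
    have a1 : ρ₁ f' t = 1 := by rw [hρ₁, turning, h1, hqq t ht]
    have a2 : ρ₂ f' t = 0 := by rw [hρ₂, turning, had.fe, inner_zero_left]
    have a3 : ρ₁ g' t = 0 := by rw [hρ₁, turning, had.ge, inner_zero_left]
    have a4 : ρ₂ g' t = 1 := by rw [hρ₂, turning, h2, hvv t ht]
    have b1 := a1
    have b2 := a2
    have b3 := a3
    have b4 := a4
    rw [lin₁] at b1 b3
    rw [lin₂] at b2 b4
    have hprod : (f' 0 * g' 1 - f' 1 * g' 0) * Δ t = 1 := by
      simp only [hΔ]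
      linear_combination (g' 0 * ρ₂ (Pi.single 0 1) t + g' 1 * ρ₂ (Pi.single 1 1) t) * b1 + b4 -
        (g' 0 * ρ₁ (Pi.single 0 1) t + g' 1 * ρ₁ (Pi.single 1 1) t) * b2
    have hΔ0 : Δ t ≠ 0 := by intro hz; rw [hz] at hprod; norm_num at hprod
    have ef : f t = f' := by
      ext i; fin_cases i
      · change ρ₂ (Pi.single 1 1) t / Δ t = f' 0
        rw [div_eq_iff hΔ0]; simp only [hΔ]
        linear_combination ρ₁ (Pi.single 1 1) t * b2 - ρ₂ (Pi.single 1 1) t * b1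
      · change -ρ₂ (Pi.single 0 1) t / Δ t = f' 1
        rw [div_eq_iff hΔ0]; simp only [hΔ]
        linear_combination ρ₂ (Pi.single 0 1) t * b1 - ρ₁ (Pi.single 0 1) t * b2
    have eg : g t = g' := by
      ext i; fin_cases i
      · change -ρ₁ (Pi.single 1 1) t / Δ t = g' 0
        rw [div_eq_iff hΔ0]; simp only [hΔ]
        linear_combination ρ₁ (Pi.single 1 1) t * b4 - ρ₂ (Pi.single 1 1) t * b3
      · change ρ₁ (Pi.single 0 1) t / Δ t = g' 1
        rw [div_eq_iff hΔ0]; simp only [hΔ]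
        linear_combination ρ₂ (Pi.single 0 1) t * b3 - ρ₁ (Pi.single 0 1) t * b4
    rw [ef, eg]
    exact ⟨hΔ0, had, h1, h2, a1, a2, a3, a4⟩
  have hfs : ∀ i, ContDiffOn ℝ ∞ (fun t => f t i) V := fun i => by
    fin_cases i
    exacts [(hρ₂s _).div hΔs fun t ht => (main t ht).1,
      (hρ₂s _).neg.div hΔs fun t ht => (main t ht).1]
  have hgs : ∀ i, ContDiffOn ℝ ∞ (fun t => g t i) V := fun i => by
    fin_cases i
    exacts [(hρ₁s _).neg.div hΔs fun t ht => (main t ht).1,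
      (hρ₁s _).div hΔs fun t ht => (main t ht).1]
  have hexp : ∀ w : R2, ∀ t ∈ V, w = ρ₁ w t • f t + ρ₂ w t • g t := fun w t ht => by
    obtain ⟨hΔ0, -⟩ := main t ht
    rw [lin₁, lin₂]
    ext i; fin_cases i
    · change w 0 = (w 0 * ρ₁ (Pi.single 0 1) t + w 1 * ρ₁ (Pi.single 1 1) t) *
        (ρ₂ (Pi.single 1 1) t / Δ t) + (w 0 * ρ₂ (Pi.single 0 1) t + w 1 * ρ₂ (Pi.single 1 1) t) *
        (-ρ₁ (Pi.single 1 1) t / Δ t)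
      field_simp
      simp only [hΔ]; ring
    · change w 1 = (w 0 * ρ₁ (Pi.single 0 1) t + w 1 * ρ₁ (Pi.single 1 1) t) *
        (-ρ₂ (Pi.single 0 1) t / Δ t) + (w 0 * ρ₂ (Pi.single 0 1) t + w 1 * ρ₂ (Pi.single 1 1) t) *
        (ρ₁ (Pi.single 0 1) t / Δ t)
      field_simp
      simp only [hΔ]; ring
  set p₀ : R2 → H := fun t => nd P (f t) γ t with hp₀
  set r₀ : R2 → H := fun t => nd P (g t) γ t with hr₀
  have sm : ∀ k : R2 → R2, (∀ i, ContDiffOn ℝ ∞ (fun t => k t i) V) →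
      ContDiffOn ℝ ∞ (fun t => nd P (k t) γ t) V := fun k hk => by
    have : ContDiffOn ℝ ∞ (fun t => k t 0 • nd P (Pi.single 0 1) γ t +
        k t 1 • nd P (Pi.single 1 1) γ t) V :=
      ((hk 0).smul (hRV.smooth_nd hγV)).add ((hk 1).smul (hRV.smooth_nd hγV))
    refine this.congr fun t _ => ?_
    conv_lhs => rw [R2.eq_single (k t), nd_add_smul_dir]
  have hp₀s : ContDiffOn ℝ ∞ p₀ V := sm f hfs
  have hr₀s : ContDiffOn ℝ ∞ r₀ V := sm g hgs
  -- the base points are moved to the lines of striction of the two factors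
  set a : R2 → ℝ := fun t => -inner ℝ (p₀ t) (q t) with ha
  set b : R2 → ℝ := fun t => -inner ℝ (r₀ t) (v t) with hb
  have has : ContDiffOn ℝ ∞ a V := (hp₀s.inner ℝ hqs).neg
  have hbs : ContDiffOn ℝ ∞ b V := (hr₀s.inner ℝ hvs).neg
  have hcomb := hRV.smooth_comb has hbs
  have ndγ : ∀ t ∈ V, ∀ w, nd P w (fun t => γ t + (a t • e 0 t + b t • e 1 t)) t =
      nd P w γ t + (a t • nd P w (e 0) t + b t • nd P w (e 1) t) := fun t ht w => by
    rw [RulingFrame.nd_add (SmoothOn.differentiableAt hVo hγV ht) (SmoothOn.differentiableAt hVo hcomb ht),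
      hRV.nd_comb has hbs ht]
  have sdγ : ∀ t ∈ V, ∀ v w, sd P v w (fun t => γ t + (a t • e 0 t + b t • e 1 t)) t =
      sd P v w γ t + (a t • sd P v w (e 0) t + b t • sd P v w (e 1) t) := fun t ht v w => by
    rw [hRV.sd_add hγV hcomb ht, hRV.sd_comb has hbs ht]
  have coe : ∀ t ∈ V, ∀ v w, CoeffAt P e (fun t => γ t + (a t • e 0 t + b t • e 1 t)) t v w ↔
      CoeffAt P e γ t v w := fun t ht v w => by
    constructor
    · rintro ⟨l, h1, h2⟩
      refine ⟨l, ?_, h2⟩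
      rw [sdγ t ht, ndγ t ht, h2, h2] at h1
      exact add_right_cancel h1
    · rintro ⟨l, h1, h2⟩
      exact ⟨l, by rw [sdγ t ht, ndγ t ht, h1, h2, h2], h2⟩
  have hn0 : ∀ t ∈ V, ∀ w, nd P w (e 0) t = ρ₁ w t • q t := fun t ht w => by
    obtain ⟨-, had, h1, h2, -⟩ := main t ht
    conv_lhs => rw [hexp w t ht, nd_add_smul_dir, had.ge, h1, smul_zero, add_zero]
  have hn1 : ∀ t ∈ V, ∀ w, nd P w (e 1) t = ρ₂ w t • v t := fun t ht w => by
    obtain ⟨-, had, h1, h2, -⟩ := main t ht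
    conv_lhs => rw [hexp w t ht, nd_add_smul_dir, had.fe, h2, smul_zero, zero_add]
  have hnγ : ∀ t ∈ V, ∀ w, nd P w γ t = ρ₁ w t • p₀ t + ρ₂ w t • r₀ t := fun t ht w => by
    conv_lhs => rw [hexp w t ht, nd_add_smul_dir]
  have orths : ∀ t ∈ V, inner ℝ (q t) (v t) = (0 : ℝ) ∧ inner ℝ (q t) (r₀ t) = (0 : ℝ) ∧
      inner ℝ (v t) (p₀ t) = (0 : ℝ) := fun t ht => by
    obtain ⟨-, had, h1, h2, -⟩ := main t ht
    rw [← h1, ← h2]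
    exact ⟨had.orth, had.orth_left, had.orth_right⟩
  refine ⟨V, hVU, ⟨ht₀, h0.indep.ne_zero 0, h0.indep.ne_zero 1⟩, a, b, q, v,
    fun t => p₀ t + a t • q t, fun t => r₀ t + b t • v t, fun t ht v w => (coe t ht v w).1, ?_⟩
  exact
    { hRV with
      smooth_base := hγV.add hcomb
      smooth_q := hqs
      smooth_v := hvs
      smooth_p := hp₀s.add (has.smul hqs)
      smooth_r := hr₀s.add (hbs.smul hvs)
      qq := hqq
      vv := hvv
      qv := fun t ht => (orths t ht).1
      qp := fun t ht => by
        rw [inner_add_right, real_inner_smul_right, hqq t ht, ha, real_inner_comm]; ring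
      qr := fun t ht => by
        rw [inner_add_right, real_inner_smul_right, (orths t ht).1, (orths t ht).2.1]; ring
      vp := fun t ht => by
        rw [inner_add_right, real_inner_smul_right, real_inner_comm (q t), (orths t ht).1,
          (orths t ht).2.2]; ring
      vr := fun t ht => by
        rw [inner_add_right, real_inner_smul_right, hvv t ht, hb, real_inner_comm]; ring
      nd_zero := hn0
      nd_one := hn1
      nd_base := fun t ht w => by
        rw [ndγ t ht, hnγ t ht, hn0 t ht, hn1 t ht]; module
      axes := fun t ht x y hxy => by
        obtain ⟨-, had, h1, h2, -⟩ := main t ht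
        have hI := had.indep
        rw [h1, h2] at hI
        have := Fintype.linearIndependent_iff.1 hI ![x * a t, y * b t, x, y] (by
          simp only [Fin.sum_univ_four]
          change (x * a t) • q t + (y * b t) • v t + x • p₀ t + y • r₀ t = 0
          linear_combination (norm := module) hxy)
        exact ⟨this 2, this 3⟩
      dirs := fun t ht => by
        obtain ⟨-, had, h1, h2, c1, c2, c3, c4⟩ := main t ht
        refine ⟨f t, g t, c1, c2, c3, c4, (coe t ht _ _).2 had.ff, (coe t ht _ _).2 had.gg, ?_⟩
        rcases had.fg with ⟨hK, h⟩ | ⟨hK, h⟩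
        · exact Or.inl ⟨hK, (coe t ht _ _).2 h⟩
        · refine Or.inr ⟨hK, ?_⟩
          have o := orths t ht
          have o1 : inner ℝ (q t) (r₀ t + b t • v t) = (0 : ℝ) := by
            rw [inner_add_right, real_inner_smul_right, o.1, o.2.1]; ring
          have o2 : (inner ℝ (p₀ t) (v t) : ℝ) = 0 := by rw [real_inner_comm]; exact o.2.2
          rw [inner_add_left, real_inner_smul_left, o1, inner_add_right, real_inner_smul_right, o2]
          rw [show (inner ℝ (p₀ t) (r₀ t) : ℝ) = 0 from h]; ring }

end Moving

/-! ### The structure equations -/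

section StructureEquations

variable {H : Type*} [NormedAddCommGroup H] [InnerProductSpace ℝ H]
variable {V : Set R2} {P : R2 → H →L[ℝ] H} {e : Fin 2 → R2 → H} {γ q v p r : R2 → H} {t : R2}
  {K : Prop}

theorem pd_inner_eq_zero (hV : IsOpen V) {f g : R2 → H} (hf : ContDiffOn ℝ ∞ f V)
    (hg : ContDiffOn ℝ ∞ g V) {c : ℝ} (h : ∀ t ∈ V, inner ℝ (f t) (g t) = c) (ht : t ∈ V) (w : R2) :
    inner ℝ (pd w f t) (g t) + inner ℝ (f t) (pd w g t) = (0 : ℝ) := by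
  rw [← pd_inner (SmoothOn.differentiableAt hV hf ht) (SmoothOn.differentiableAt hV hg ht),
    pd_congr hV h ht, pd_const]

namespace SplitFrame

theorem exists_dirs_coords {f g : R2} (h1 : turning P (e 0) q f t = 1)
    (h2 : turning P (e 1) v f t = 0) (h3 : turning P (e 0) q g t = 0)
    (h4 : turning P (e 1) v g t = 1) (w : R2) :
    w = turning P (e 0) q w t • f + turning P (e 1) v w t • g := by
  have lin : ∀ (k q' : R2 → H) (w : R2), turning P k q' w t =
      w 0 * turning P k q' (Pi.single 0 1) t + w 1 * turning P k q' (Pi.single 1 1) t :=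
    fun k q' w => by conv_lhs => rw [R2.eq_single w, turning_add_smul_dir]
  have hdet : f 0 * g 1 - f 1 * g 0 ≠ 0 := by
    intro hz
    rw [lin] at h1 h2 h3 h4
    have : (f 0 * g 1 - f 1 * g 0) * (turning P (e 0) q (Pi.single 0 1) t *
        turning P (e 1) v (Pi.single 1 1) t - turning P (e 0) q (Pi.single 1 1) t *
        turning P (e 1) v (Pi.single 0 1) t) = 1 := by
      linear_combination (g 0 * turning P (e 1) v (Pi.single 0 1) t +
        g 1 * turning P (e 1) v (Pi.single 1 1) t) * h1 + h4 -
        (g 0 * turning P (e 0) q (Pi.single 0 1) t +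
        g 1 * turning P (e 0) q (Pi.single 1 1) t) * h2
    rw [hz, zero_mul] at this
    norm_num at this
  obtain ⟨α, β, hw⟩ := exists_coords_of_det hdet w
  have a : turning P (e 0) q w t = α := by rw [hw, turning_add_smul_dir, h1, h3]; ring
  have b : turning P (e 1) v w t = β := by rw [hw, turning_add_smul_dir, h2, h4]; ring
  rw [a, b]; exact hw

/-- In a 6-space, a vector orthogonal to the whole moving frame vanishes. -/
theorem eq_zero_of_orthogonal (hS : SplitFrame K V P e γ q v p r) (hH : Module.finrank ℝ H = 6)
    (ht : t ∈ V) (heq : ∀ i, inner ℝ (e i t) (q t) = (0 : ℝ)) (hev : ∀ i, inner ℝ (e i t) (v t) = (0 : ℝ))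
    (hep : ∀ i, inner ℝ (e i t) (p t) = (0 : ℝ)) (her : ∀ i, inner ℝ (e i t) (r t) = (0 : ℝ))
    {z : H} (he : ∀ i, inner ℝ (e i t) z = (0 : ℝ)) (hq : inner ℝ (q t) z = (0 : ℝ))
    (hv : inner ℝ (v t) z = (0 : ℝ)) (hp : inner ℝ (p t) z = (0 : ℝ))
    (hr : inner ℝ (r t) z = (0 : ℝ)) : z = 0 := by
  have : FiniteDimensional ℝ H := Module.finite_of_finrank_pos (by omega)
  set b : Fin 6 → H := ![e 0 t, e 1 t, q t, v t, p t, r t] with hb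
  have hLI : LinearIndependent ℝ b := by
    rw [Fintype.linearIndependent_iff]
    intro c hc
    have hc' : c 0 • e 0 t + c 1 • e 1 t + c 2 • q t + c 3 • v t + c 4 • p t + c 5 • r t = 0 := by
      simpa [Fin.sum_univ_succ, hb, add_assoc] using hc
    have qe : ∀ i, inner ℝ (q t) (e i t) = (0 : ℝ) := fun i => by rw [real_inner_comm]; exact heq i
    have ve : ∀ i, inner ℝ (v t) (e i t) = (0 : ℝ) := fun i => by rw [real_inner_comm]; exact hev i
    have vq : inner ℝ (v t) (q t) = (0 : ℝ) := by rw [real_inner_comm]; exact hS.qv t ht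
    have key : ∀ u : H, (inner ℝ u (c 0 • e 0 t + c 1 • e 1 t + c 2 • q t + c 3 • v t + c 4 • p t +
        c 5 • r t) : ℝ) = 0 := fun u => by rw [hc', inner_zero_right]
    simp only [inner_add_right, real_inner_smul_right] at key
    have c0 : c 0 = 0 := by
      have := key (e 0 t)
      rw [hS.norm 0 t ht, hS.orth t ht, heq, hev, hep, her] at this; linarith
    have c1 : c 1 = 0 := by
      have := key (e 1 t)
      rw [hS.norm 1 t ht, hS.orth' ht, heq, hev, hep, her] at this; linarith
    have c2 : c 2 = 0 := by
      have := key (q t)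
      rw [qe, qe, hS.qq t ht, hS.qv t ht, hS.qp t ht, hS.qr t ht] at this; linarith
    have c3 : c 3 = 0 := by
      have := key (v t)
      rw [ve, ve, vq, hS.vv t ht, hS.vp t ht, hS.vr t ht] at this; linarith
    rw [c0, c1, c2, c3] at hc'
    obtain ⟨c4, c5⟩ := hS.axes t ht (c 4) (c 5) (by
      linear_combination (norm := module) hc')
    intro i; fin_cases i
    exacts [c0, c1, c2, c3, c4, c5]
  have hspan : Submodule.span ℝ (Set.range b) = ⊤ :=
    hLI.span_eq_top_of_card_eq_finrank (by rw [hH]; rfl)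
  have hz : z ∈ Submodule.span ℝ (Set.range b) := by rw [hspan]; trivial
  have : ∀ u ∈ Submodule.span ℝ (Set.range b), inner ℝ u z = (0 : ℝ) := fun u hu => by
    induction hu using Submodule.span_induction with
    | mem u hu =>
      obtain ⟨i, rfl⟩ := hu
      fin_cases i
      exacts [he 0, he 1, hq, hv, hp, hr]
    | zero => simp
    | add u u' _ _ h h' => rw [inner_add_left, h, h', add_zero]
    | smul c u _ h => rw [real_inner_smul_left, h, mul_zero]
  exact inner_self_eq_zero.1 (this z hz)

/-- The structure equations of a patch that splits: the frames of the two factors only turn in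
their own planes, and the axes are constant. -/
theorem structure_equations (hS : SplitFrame K V P e γ q v p r) (hH : Module.finrank ℝ H = 6)
    (ht : t ∈ V) :
    (∀ w, pd w (e 0) t = turning P (e 0) q w t • q t ∧ pd w q t = -turning P (e 0) q w t • e 0 t ∧
      pd w (e 1) t = turning P (e 1) v w t • v t ∧ pd w v t = -turning P (e 1) v w t • e 1 t ∧
      pd w p t = 0 ∧ pd w r t = 0 ∧
      pd w γ t = turning P (e 0) q w t • p t + turning P (e 1) v w t • r t) ∧
    (∀ i, inner ℝ (e i t) (q t) = (0 : ℝ)) ∧ (∀ i, inner ℝ (e i t) (v t) = (0 : ℝ)) ∧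
    (∀ i, inner ℝ (e i t) (p t) = (0 : ℝ)) ∧ (∀ i, inner ℝ (e i t) (r t) = (0 : ℝ)) ∧
    ∀ v w, CoeffAt P e γ t v w := by
  have hV := hS.isOpen
  have hR : RulingFrame V P e := hS.toRulingFrame
  set ρ₁ : R2 → R2 → ℝ := turning P (e 0) q with hρ₁
  set ρ₂ : R2 → R2 → ℝ := turning P (e 1) v with hρ₂
  have s₁ : ∀ w, ContDiffOn ℝ ∞ (ρ₁ w) V := fun w =>
    (hR.smooth_nd (hR.smooth 0)).inner ℝ hS.smooth_q
  have s₂ : ∀ w, ContDiffOn ℝ ∞ (ρ₂ w) V := fun w =>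
    (hR.smooth_nd (hR.smooth 1)).inner ℝ hS.smooth_v
  have d : ∀ {k : R2 → H}, ContDiffOn ℝ ∞ k V → DifferentiableAt ℝ k t := fun hk =>
    SmoothOn.differentiableAt hV hk ht
  have d' : ∀ {k : R2 → ℝ}, ContDiffOn ℝ ∞ k V → DifferentiableAt ℝ k t := fun hk =>
    SmoothOn.differentiableAt hV hk ht
  have dsm : ∀ {y : R2 → ℝ} {k : R2 → H}, ContDiffOn ℝ ∞ y V → ContDiffOn ℝ ∞ k V →
      DifferentiableAt ℝ (fun t => y t • k t) t :=
    fun hy hk => SmoothOn.differentiableAt hV (hy.smul hk) ht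
  -- the vectors `q`, `v`, `p`, `r` are normal to the ruling
  have hnorm : ∀ t ∈ V, (∀ i, inner ℝ (e i t) (q t) = (0 : ℝ)) ∧
      (∀ i, inner ℝ (e i t) (v t) = (0 : ℝ)) ∧ (∀ i, inner ℝ (e i t) (p t) = (0 : ℝ)) ∧
      ∀ i, inner ℝ (e i t) (r t) = (0 : ℝ) := fun t ht => by
    obtain ⟨f, g, h1, h2, h3, h4, -⟩ := hS.dirs t ht
    have q' : nd P f (e 0) t = q t := by rw [hS.nd_zero t ht, h1, one_smul]
    have v' : nd P g (e 1) t = v t := by rw [hS.nd_one t ht, h4, one_smul]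
    have p' : nd P f γ t = p t := by rw [hS.nd_base t ht, h1, h2]; module
    have r' : nd P g γ t = r t := by rw [hS.nd_base t ht, h3, h4]; module
    rw [← q', ← v', ← p', ← r']
    exact ⟨fun i => hR.inner_nd ht i, fun i => hR.inner_nd ht i, fun i => hR.inner_nd ht i,
      fun i => hR.inner_nd ht i⟩
  obtain ⟨heq, hev, hep, her⟩ := hnorm t ht
  -- products of the moving frame, and of their derivatives
  have qe : ∀ i, inner ℝ (q t) (e i t) = (0 : ℝ) := fun i => by rw [real_inner_comm]; exact heq i
  have ve : ∀ i, inner ℝ (v t) (e i t) = (0 : ℝ) := fun i => by rw [real_inner_comm]; exact hev i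
  have vq : inner ℝ (v t) (q t) = (0 : ℝ) := by rw [real_inner_comm]; exact hS.qv t ht
  have qq := hS.qq t ht
  have vv := hS.vv t ht
  have qv := hS.qv t ht
  have qp := hS.qp t ht
  have qr := hS.qr t ht
  have vp := hS.vp t ht
  have vr := hS.vr t ht
  have Dqq : ∀ w, inner ℝ (q t) (pd w q t) = (0 : ℝ) := fun w => by
    have := pd_inner_eq_zero hV hS.smooth_q hS.smooth_q hS.qq ht w
    rw [real_inner_comm] at this; linarith
  have Dvv : ∀ w, inner ℝ (v t) (pd w v t) = (0 : ℝ) := fun w => by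
    have := pd_inner_eq_zero hV hS.smooth_v hS.smooth_v hS.vv ht w
    rw [real_inner_comm] at this; linarith
  have Dqv : ∀ w, inner ℝ (pd w q t) (v t) + inner ℝ (q t) (pd w v t) = (0 : ℝ) :=
    pd_inner_eq_zero hV hS.smooth_q hS.smooth_v hS.qv ht
  have Dqp : ∀ w, inner ℝ (pd w q t) (p t) + inner ℝ (q t) (pd w p t) = (0 : ℝ) :=
    pd_inner_eq_zero hV hS.smooth_q hS.smooth_p hS.qp ht
  have Dqr : ∀ w, inner ℝ (pd w q t) (r t) + inner ℝ (q t) (pd w r t) = (0 : ℝ) :=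
    pd_inner_eq_zero hV hS.smooth_q hS.smooth_r hS.qr ht
  have Dvp : ∀ w, inner ℝ (pd w v t) (p t) + inner ℝ (v t) (pd w p t) = (0 : ℝ) :=
    pd_inner_eq_zero hV hS.smooth_v hS.smooth_p hS.vp ht
  have Dvr : ∀ w, inner ℝ (pd w v t) (r t) + inner ℝ (v t) (pd w r t) = (0 : ℝ) :=
    pd_inner_eq_zero hV hS.smooth_v hS.smooth_r hS.vr ht
  have D00 : ∀ w, inner ℝ (e 0 t) (pd w (e 0) t) = (0 : ℝ) := fun w => by
    have := pd_inner_eq_zero hV (hR.smooth 0) (hR.smooth 0) (hR.norm 0) ht w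
    rw [real_inner_comm] at this; linarith
  have D11 : ∀ w, inner ℝ (e 1 t) (pd w (e 1) t) = (0 : ℝ) := fun w => by
    have := pd_inner_eq_zero hV (hR.smooth 1) (hR.smooth 1) (hR.norm 1) ht w
    rw [real_inner_comm] at this; linarith
  have D01 : ∀ w, inner ℝ (e 0 t) (pd w (e 1) t) = -(inner ℝ (e 1 t) (pd w (e 0) t) : ℝ) :=
    fun w => by
    have := pd_inner_eq_zero hV (hR.smooth 0) (hR.smooth 1) hR.orth ht w
    rw [real_inner_comm] at this; linarith
  set η : R2 → ℝ := fun w => inner ℝ (e 1 t) (pd w (e 0) t) with hη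
  set a : R2 → ℝ := fun w => inner ℝ (e 0 t) (pd w γ t) with ha
  set b : R2 → ℝ := fun w => inner ℝ (e 1 t) (pd w γ t) with hb
  -- the second covariant derivatives in terms of the moving frame
  have E1 : ∀ x w, sd P x w (e 0) t = pd w (ρ₁ x) t • q t + ρ₁ x t • (pd w q t + ρ₁ w t • e 0 t) -
      (η w * ρ₂ x t) • v t := fun x w => by
    have h := hR.pd_nd (v := x) (w := w) (hR.smooth 0) ht
    rw [pd_congr hV (fun t ht => hS.nd_zero t ht x) ht, pd_smul (d' (s₁ x)) (d hS.smooth_q), D00,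
      hS.nd_zero t ht, hS.nd_zero t ht, hS.nd_one t ht, hS.nd_one t ht] at h
    simp only [real_inner_smul_left, real_inner_smul_right, qq, vq] at h
    linear_combination (norm := module) -h
  have E2 : ∀ x w, sd P x w (e 1) t = pd w (ρ₂ x) t • v t + ρ₂ x t • (pd w v t + ρ₂ w t • e 1 t) +
      (η w * ρ₁ x t) • q t := fun x w => by
    have h := hR.pd_nd (v := x) (w := w) (hR.smooth 1) ht
    rw [pd_congr hV (fun t ht => hS.nd_one t ht x) ht, pd_smul (d' (s₂ x)) (d hS.smooth_v), D11, D01,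
      hS.nd_zero t ht, hS.nd_zero t ht, hS.nd_one t ht, hS.nd_one t ht] at h
    simp only [real_inner_smul_left, real_inner_smul_right, vv, qv] at h
    linear_combination (norm := module) -h
  have E3 : ∀ x w, sd P x w γ t = pd w (ρ₁ x) t • p t + ρ₁ x t • pd w p t + pd w (ρ₂ x) t • r t +
      ρ₂ x t • pd w r t - (a w * ρ₁ x t) • q t - (b w * ρ₂ x t) • v t := fun x w => by
    have h := hR.pd_nd (v := x) (w := w) hS.smooth_base ht
    rw [pd_congr hV (fun t ht => hS.nd_base t ht x) ht, pd_add (dsm (s₁ x) hS.smooth_p)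
      (dsm (s₂ x) hS.smooth_r), pd_smul (d' (s₁ x)) (d hS.smooth_p),
      pd_smul (d' (s₂ x)) (d hS.smooth_r), hS.nd_base t ht,
      hS.nd_zero t ht, hS.nd_zero t ht, hS.nd_one t ht, hS.nd_one t ht] at h
    simp only [real_inner_smul_left, real_inner_smul_right, inner_add_right, qp, qr, vp, vr] at h
    linear_combination (norm := module) -h
  obtain ⟨f, g, f1, f2, g1, g2, ⟨lf, lf0, lfe⟩, ⟨lg, lg0, lge⟩, hmix⟩ := hS.dirs t ht
  have f1' : ρ₁ f t = 1 := f1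
  have f2' : ρ₂ f t = 0 := f2
  have g1' : ρ₁ g t = 0 := g1
  have g2' : ρ₂ g t = 1 := g2
  have fe0 := lfe 0
  have fe1 := lfe 1
  have ge0 := lge 0
  have ge1 := lge 1
  rw [hS.nd_base t ht] at lf0 lg0
  rw [hS.nd_zero t ht] at fe0 ge0
  rw [hS.nd_one t ht] at fe1 ge1
  -- the pure derivatives in the first distinguished direction
  rw [E1, f1', f2'] at fe0
  rw [E2, f1', f2'] at fe1
  rw [E3, f1', f2'] at lf0
  have A1 : pd f (ρ₁ f) t = ρ₁ lf t := by
    have := congrArg (fun u => (inner ℝ (q t) u : ℝ)) fe0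
    simp only [inner_add_right, inner_sub_right, real_inner_smul_right, qq, qv, qe, Dqq] at this
    linarith
  have B1 : pd f (ρ₂ f) t = ρ₂ lf t := by
    have := congrArg (fun u => (inner ℝ (v t) u : ℝ)) fe1
    simp only [inner_add_right, real_inner_smul_right, vv, vq] at this
    linarith
  have ηf : η f = 0 := by
    have := congrArg (fun u => (inner ℝ (q t) u : ℝ)) fe1
    simp only [inner_add_right, real_inner_smul_right, qq, qv] at this
    linarith
  have qf : pd f q t = -e 0 t := by
    rw [A1] at fe0; linear_combination (norm := module) fe0
  have pf' : pd f p t = a f • q t := by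
    rw [A1, B1] at lf0; linear_combination (norm := module) lf0
  have af : a f = 0 := by
    have := Dqp f
    rw [qf, pf', inner_neg_left, hep, real_inner_smul_right, qq] at this
    linarith
  have pf : pd f p t = 0 := by rw [pf', af, zero_smul]
  -- the pure derivatives in the second distinguished direction
  rw [E1, g1', g2'] at ge0
  rw [E2, g1', g2'] at ge1
  rw [E3, g1', g2'] at lg0
  have A2 : pd g (ρ₁ g) t = ρ₁ lg t := by
    have := congrArg (fun u => (inner ℝ (q t) u : ℝ)) ge0
    simp only [inner_add_right, inner_sub_right, real_inner_smul_right, qq, qv] at this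
    linarith
  have B2 : pd g (ρ₂ g) t = ρ₂ lg t := by
    have := congrArg (fun u => (inner ℝ (v t) u : ℝ)) ge1
    simp only [inner_add_right, real_inner_smul_right, vv, vq, ve, Dvv] at this
    linarith
  have ηg : η g = 0 := by
    have := congrArg (fun u => (inner ℝ (v t) u : ℝ)) ge0
    simp only [inner_add_right, inner_sub_right, real_inner_smul_right, vv, vq] at this
    linarith
  have vg : pd g v t = -e 1 t := by
    rw [B2] at ge1; linear_combination (norm := module) ge1
  have rg' : pd g r t = b g • v t := by
    rw [A2, B2] at lg0; linear_combination (norm := module) lg0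
  have bg : b g = 0 := by
    have := Dvr g
    rw [vg, rg', inner_neg_left, her, real_inner_smul_right, vv] at this
    linarith
  have rg : pd g r t = 0 := by rw [rg', bg, zero_smul]
  -- the symmetry of the mixed derivatives
  have M0 := hR.sd_comm (v := f) (w := g) (hR.smooth 0) ht
  have M1 := hR.sd_comm (v := f) (w := g) (hR.smooth 1) ht
  have Mγ := hR.sd_comm (v := f) (w := g) hS.smooth_base ht
  have F0 := E1 f g
  have F1 := E2 f g
  have Fγ := E3 f g
  rw [f1', f2', g1'] at F0
  rw [f1', f2', ηg] at F1
  rw [f1', f2'] at Fγ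
  rw [F0, E1, g1', g2', ηf] at M0
  rw [F1, E2, g1', g2', f2', ηf] at M1
  rw [Fγ, E3, g1', g2'] at Mγ
  have S1 : pd g (ρ₁ f) t = pd f (ρ₁ g) t := by
    have := congrArg (fun u => (inner ℝ (q t) u : ℝ)) M0
    simp only [inner_add_right, inner_sub_right, real_inner_smul_right, qq, qv, Dqq, qe] at this
    linarith
  have S2 : pd g (ρ₂ f) t = pd f (ρ₂ g) t := by
    have := congrArg (fun u => (inner ℝ (v t) u : ℝ)) M1
    simp only [inner_add_right, real_inner_smul_right, vv, vq, Dvv, ve] at this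
    linarith
  have qg : pd g q t = 0 := by
    rw [S1] at M0; linear_combination (norm := module) M0
  have vf : pd f v t = 0 := by
    rw [S2] at M1; linear_combination (norm := module) -M1
  have hpr : pd g p t - a g • q t = pd f r t - b f • v t := by
    rw [S1, S2] at Mγ; linear_combination (norm := module) Mγ
  have qpg : inner ℝ (q t) (pd g p t) = (0 : ℝ) := by
    have := Dqp g
    rw [qg, inner_zero_left] at this; linarith
  have qrf : inner ℝ (q t) (pd f r t) = (0 : ℝ) := by
    have := Dqr f
    rw [qf, inner_neg_left, her] at this; linarith
  have vpg : inner ℝ (v t) (pd g p t) = (0 : ℝ) := by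
    have := Dvp g
    rw [vg, inner_neg_left, hep] at this; linarith
  have vrf : inner ℝ (v t) (pd f r t) = (0 : ℝ) := by
    have := Dvr f
    rw [vf, inner_zero_left] at this; linarith
  have ag : a g = 0 := by
    have := congrArg (fun u => (inner ℝ (q t) u : ℝ)) hpr
    simp only [inner_sub_right, real_inner_smul_right, qq, qv, qpg, qrf] at this
    linarith
  have bf : b f = 0 := by
    have := congrArg (fun u => (inner ℝ (v t) u : ℝ)) hpr
    simp only [inner_sub_right, real_inner_smul_right, vv, vq, vpg, vrf] at this
    linarith
  have hpr' : pd g p t = pd f r t := by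
    rw [ag, bf] at hpr; simpa using hpr
  have n0 : ∀ w, pd w (e 0) t = η w • e 1 t + ρ₁ w t • q t := fun w => by
    rw [hR.pd_eq ht (g := e 0), D00, hS.nd_zero t ht]; module
  have n1 : ∀ w, pd w (e 1) t = -η w • e 0 t + ρ₂ w t • v t := fun w => by
    rw [hR.pd_eq ht (g := e 1), D01, D11, hS.nd_one t ht]; module
  have nγ : ∀ w, pd w γ t = a w • e 0 t + b w • e 1 t + (ρ₁ w t • p t + ρ₂ w t • r t) := fun w => by
    rw [hR.pd_eq ht (g := γ), hS.nd_base t ht]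
  -- the remaining mixed derivative: it vanishes if the mixed second derivatives are flat, and if
  -- the axes are orthogonal then it is orthogonal to the whole frame
  have pg : pd g p t = 0 := by
    rcases hmix with ⟨-, l, l0, le⟩ | ⟨hK, h0⟩
    · have l0' := le 0
      have l1' := le 1
      rw [hS.nd_base t ht, Fγ] at l0
      rw [hS.nd_zero t ht, F0, qg] at l0'
      rw [hS.nd_one t ht, F1] at l1'
      have a1 : pd g (ρ₁ f) t = ρ₁ l t := by
        have := congrArg (fun u => (inner ℝ (q t) u : ℝ)) l0'
        simp only [inner_add_right, inner_sub_right, real_inner_smul_right, qq, qv, qe,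
          inner_zero_right] at this
        linarith
      have a2 : pd g (ρ₂ f) t = ρ₂ l t := by
        have := congrArg (fun u => (inner ℝ (v t) u : ℝ)) l1'
        simp only [inner_add_right, real_inner_smul_right, vv, vq] at this
        linarith
      rw [a1, a2, ag] at l0
      linear_combination (norm := module) l0
    · have hpr0 : ∀ t ∈ V, inner ℝ (p t) (r t) = (0 : ℝ) := fun t ht => by
        obtain ⟨f, g, -, -, -, -, -, -, hm⟩ := hS.dirs t ht
        rcases hm with hm | hm
        exacts [(hK hm.1).elim, hm.2]
      have Dpr := fun w => pd_inner_eq_zero hV hS.smooth_p hS.smooth_r hpr0 ht w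
      have De : ∀ i, inner ℝ (e i t) (pd g p t) = (0 : ℝ) := fun i => by
        have := pd_inner_eq_zero hV (hR.smooth i) hS.smooth_p (fun t ht => (hnorm t ht).2.2.1 i) ht g
        have h' : inner ℝ (pd g (e i) t) (p t) = (0 : ℝ) := by
          fin_cases i
          · change inner ℝ (pd g (e 0) t) (p t) = (0 : ℝ)
            rw [n0, ηg, g1', zero_smul, zero_smul, add_zero, inner_zero_left]
          · change inner ℝ (pd g (e 1) t) (p t) = (0 : ℝ)
            rw [n1, ηg, g2', neg_zero, zero_smul, zero_add, one_smul, vp]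
        linarith
      refine hS.eq_zero_of_orthogonal hH ht heq hev hep her De qpg vpg ?_ ?_
      · have := Dpr f
        rw [pf, inner_zero_left] at this
        rw [hpr']; linarith
      · have := Dpr g
        rw [rg, inner_zero_right] at this
        rw [real_inner_comm]; linarith
  have rf : pd f r t = 0 := by rw [← hpr', pg]
  have hw : ∀ w, w = ρ₁ w t • f + ρ₂ w t • g := exists_dirs_coords f1 f2 g1 g2
  have ext : ∀ {k : R2 → H} (w : R2), pd w k t = ρ₁ w t • pd f k t + ρ₂ w t • pd g k t := fun w => by
    conv_lhs => rw [hw w, pd_add_smul_dir]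
  refine ⟨fun w => ⟨?_, ?_, ?_, ?_, ?_, ?_, ?_⟩, heq, hev, hep, her, fun x w => ?_⟩
  · rw [ext w, n0, n0, f1', g1', ηf, ηg]; module
  · rw [ext w, qf, qg]; module
  · rw [ext w, n1, n1, f2', g2', ηf, ηg]; module
  · rw [ext w, vf, vg]; module
  · rw [ext w, pf, pg]; module
  · rw [ext w, rf, rg]; module
  · rw [ext w, nγ, nγ, f1', g1', f2', g2', af, ag, bf, bg]; module
  · have cff : CoeffAt P e γ t f f := by
      obtain ⟨f', g', k1, k2, k3, k4, c1, c2, -⟩ := hS.dirs t ht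
      have := exists_dirs_coords k1 k2 k3 k4 f
      rw [f1, f2, zero_smul, add_zero, one_smul] at this
      rw [this]; exact c1
    have cgg : CoeffAt P e γ t g g := by
      obtain ⟨f', g', k1, k2, k3, k4, c1, c2, -⟩ := hS.dirs t ht
      have := exists_dirs_coords k1 k2 k3 k4 g
      rw [g1, g2, zero_smul, zero_add, one_smul] at this
      rw [this]; exact c2
    have cfg : CoeffAt P e γ t f g := by
      refine ⟨pd g (ρ₁ f) t • f + pd g (ρ₂ f) t • g, ?_, fun i => ?_⟩
      · rw [nd_add_smul_dir, hS.nd_base t ht, hS.nd_base t ht, f1, f2, g1, g2, Fγ, pg, ag]; module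
      · fin_cases i
        · change sd P f g (e 0) t = nd P _ (e 0) t
          rw [nd_add_smul_dir, hS.nd_zero t ht, hS.nd_zero t ht, f1, g1, F0, qg]; module
        · change sd P f g (e 1) t = nd P _ (e 1) t
          rw [nd_add_smul_dir, hS.nd_one t ht, hS.nd_one t ht, f2, g2, F1]; module
    have hγ := hS.smooth_base
    have cxf : ∀ x, CoeffAt P e γ t x f := fun x => by
      rw [hw x]; exact cff.add_smul_left hR hγ ht (cfg.comm hR hγ ht) _ _
    have cxg : ∀ x, CoeffAt P e γ t x g := fun x => by
      rw [hw x]; exact cfg.add_smul_left hR hγ ht cgg _ _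
    rw [hw w]
    exact (((cxf x).comm hR hγ ht).add_smul_left hR hγ ht ((cxg x).comm hR hγ ht) _ _).comm hR hγ ht

end SplitFrame
end StructureEquations

/-! ### Integration of the structure equations -/

section Integration

variable {H : Type*} [NormedAddCommGroup H] [InnerProductSpace ℝ H]

theorem eq_of_pd_eq_zero {G : Type*} [NormedAddCommGroup G] [NormedSpace ℝ G] {f : R2 → G}
    {t₀ : R2} {δ : ℝ} (hf : ∀ t ∈ Metric.ball t₀ δ, DifferentiableAt ℝ f t)
    (h : ∀ t ∈ Metric.ball t₀ δ, ∀ w, pd w f t = 0) {t : R2} (ht : t ∈ Metric.ball t₀ δ) :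
    f t = f t₀ := by
  have hδ : 0 < δ := dist_nonneg.trans_lt (Metric.mem_ball.1 ht)
  refine Metric.isOpen_ball.is_const_of_fderiv_eq_zero (convex_ball t₀ δ).isPreconnected
    (fun t ht => (hf t ht).differentiableWithinAt) (fun t ht => ?_) ht (Metric.mem_ball_self hδ)
  ext w
  exact h t ht w

/-- A pair of orthonormal vectors that turns in its own plane with angular velocity `ρ` is a
rotating frame of a fixed plane. -/
theorem exists_angle {e q : R2 → H} {ρ : R2 → R2 → ℝ} {t₀ : R2} {δ : ℝ} (hδ : 0 < δ)
    (he : ContDiffOn ℝ ∞ e (Metric.ball t₀ δ)) (hq : ContDiffOn ℝ ∞ q (Metric.ball t₀ δ))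
    (de : ∀ t ∈ Metric.ball t₀ δ, ∀ w, pd w e t = ρ w t • q t)
    (dq : ∀ t ∈ Metric.ball t₀ δ, ∀ w, pd w q t = -ρ w t • e t)
    (hee : ∀ t ∈ Metric.ball t₀ δ, inner ℝ (e t) (e t) = (1 : ℝ))
    (hqq : inner ℝ (q t₀) (q t₀) = (1 : ℝ)) (heq : inner ℝ (e t₀) (q t₀) = (0 : ℝ))
    (hpos : ∀ t ∈ Metric.ball t₀ δ, 0 < (inner ℝ (e t) (e t₀) : ℝ)) :
    ∃ u : R2 → ℝ, u t₀ = 0 ∧ (∀ t ∈ Metric.ball t₀ δ, DifferentiableAt ℝ u t) ∧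
      (∀ t ∈ Metric.ball t₀ δ, ∀ w, pd w u t = ρ w t) ∧
      ∀ t ∈ Metric.ball t₀ δ, e t = Real.cos (u t) • e t₀ + Real.sin (u t) • q t₀ := by
  have hB : IsOpen (Metric.ball t₀ δ) := Metric.isOpen_ball
  have ht₀ : t₀ ∈ Metric.ball t₀ δ := Metric.mem_ball_self hδ
  have dif : ∀ {k : R2 → H}, ContDiffOn ℝ ∞ k (Metric.ball t₀ δ) → ∀ t ∈ Metric.ball t₀ δ,
      DifferentiableAt ℝ k t := fun hk t ht => SmoothOn.differentiableAt hB hk ht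
  have hee0 := hee t₀ ht₀
  have hqe : inner ℝ (q t₀) (e t₀) = (0 : ℝ) := by rw [real_inner_comm]; exact heq
  set F : H → R2 → ℝ := fun z t => inner ℝ (e t) z with hF
  set G : H → R2 → ℝ := fun z t => inner ℝ (q t) z with hG
  have hFs : ∀ z, ContDiffOn ℝ ∞ (F z) (Metric.ball t₀ δ) := fun z => he.inner ℝ contDiffOn_const
  have hGs : ∀ z, ContDiffOn ℝ ∞ (G z) (Metric.ball t₀ δ) := fun z => hq.inner ℝ contDiffOn_const
  have difr : ∀ {k : R2 → ℝ}, ContDiffOn ℝ ∞ k (Metric.ball t₀ δ) → ∀ t ∈ Metric.ball t₀ δ,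
      DifferentiableAt ℝ k t := fun hk t ht => SmoothOn.differentiableAt hB hk ht
  have dF : ∀ z, ∀ t ∈ Metric.ball t₀ δ, ∀ w, pd w (F z) t = ρ w t * G z t := fun z t ht w => by
    rw [pd_inner (dif he t ht) (differentiableAt_const z), de t ht, pd_const, inner_zero_right,
      real_inner_smul_left, add_zero]
  have dG : ∀ z, ∀ t ∈ Metric.ball t₀ δ, ∀ w, pd w (G z) t = -(ρ w t * F z t) := fun z t ht w => by
    rw [pd_inner (dif hq t ht) (differentiableAt_const z), dq t ht, pd_const, inner_zero_right,
      real_inner_smul_left, add_zero, neg_mul]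
  -- two solutions of the same rotation equation with equal initial values agree
  have uniq : ∀ x y : R2 → ℝ, (∀ t ∈ Metric.ball t₀ δ, DifferentiableAt ℝ x t) →
      (∀ t ∈ Metric.ball t₀ δ, DifferentiableAt ℝ y t) →
      (∀ t ∈ Metric.ball t₀ δ, ∀ w, pd w x t = ρ w t * y t) →
      (∀ t ∈ Metric.ball t₀ δ, ∀ w, pd w y t = -(ρ w t * x t)) → x t₀ = 0 → y t₀ = 0 →
      ∀ t ∈ Metric.ball t₀ δ, x t = 0 ∧ y t = 0 := by
    intro x y hx hy dx dy x0 y0 t ht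
    have hxx : ∀ t ∈ Metric.ball t₀ δ, DifferentiableAt ℝ (fun t => x t * x t) t := fun t ht =>
      (hx t ht).mul (hx t ht)
    have hyy : ∀ t ∈ Metric.ball t₀ δ, DifferentiableAt ℝ (fun t => y t * y t) t := fun t ht =>
      (hy t ht).mul (hy t ht)
    have h := eq_of_pd_eq_zero (f := fun t => x t * x t + y t * y t)
      (fun t ht => (hxx t ht).add (hyy t ht)) (fun t ht w => by
        rw [pd_add (hxx t ht) (hyy t ht), pd_mul (hx t ht) (hx t ht),
          pd_mul (hy t ht) (hy t ht), dx t ht, dy t ht]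
        ring) ht
    simp only [x0, y0] at h
    constructor <;> nlinarith
  -- the components `F (e t₀)` and `F (q t₀)` of `e` are the cosine and the sine of an angle
  have k1 : ∀ t ∈ Metric.ball t₀ δ, F (e t₀) t - G (q t₀) t = 0 ∧ G (e t₀) t + F (q t₀) t = 0 := by
    refine uniq _ _ (fun t ht => (difr (hFs _) t ht).sub (difr (hGs _) t ht))
      (fun t ht => (difr (hGs _) t ht).add (difr (hFs _) t ht)) (fun t ht w => ?_)
      (fun t ht w => ?_) ?_ ?_
    · rw [pd_sub (difr (hFs _) t ht) (difr (hGs _) t ht), dF _ t ht, dG _ t ht]; ring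
    · rw [pd_add (difr (hGs _) t ht) (difr (hFs _) t ht), dF _ t ht, dG _ t ht]; ring
    · simp only [hF, hG, hee0, hqq]; ring
    · simp only [hF, hG, heq, hqe]; ring
  have k2 : ∀ t ∈ Metric.ball t₀ δ, e t = F (e t₀) t • e t₀ + F (q t₀) t • q t₀ := by
    intro t ht
    -- every component of the difference solves the rotation equation
    have := fun z : H => (uniq (F (z - (inner ℝ (e t₀) z : ℝ) • e t₀ - (inner ℝ (q t₀) z : ℝ) • q t₀))
      (G _) (difr (hFs _)) (difr (hGs _)) (dF _) (dG _)
      (by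
        simp only [hF, inner_sub_right, real_inner_smul_right, hee0, heq]; ring)
      (by
        simp only [hG, inner_sub_right, real_inner_smul_right, hqq, hqe]; ring) t ht).1
    refine ext_inner_right ℝ fun z => ?_
    rw [inner_add_left, real_inner_smul_left, real_inner_smul_left]
    have h := this z
    simp only [hF, inner_sub_right, real_inner_smul_right] at h ⊢
    linarith
  have k3 : ∀ t ∈ Metric.ball t₀ δ, F (e t₀) t ^ 2 + F (q t₀) t ^ 2 = 1 := fun t ht => by
    have := hee t ht
    rw [k2 t ht] at this
    simp only [inner_add_left, inner_add_right, real_inner_smul_left, real_inner_smul_right, hee0,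
      hqq, heq, hqe] at this
    linarith
  have k4 : ∀ t ∈ Metric.ball t₀ δ, Real.sqrt (1 - F (q t₀) t ^ 2) = F (e t₀) t := fun t ht => by
    rw [show 1 - F (q t₀) t ^ 2 = F (e t₀) t ^ 2 by linarith [k3 t ht], Real.sqrt_sq (hpos t ht).le]
  have k5 : ∀ t ∈ Metric.ball t₀ δ, F (q t₀) t ^ 2 < 1 := fun t ht => by
    have h1 : 0 < F (e t₀) t := hpos t ht
    nlinarith [k3 t ht]
  have hder : ∀ t ∈ Metric.ball t₀ δ, HasFDerivAt (fun t => Real.arcsin (F (q t₀) t))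
      ((1 / Real.sqrt (1 - F (q t₀) t ^ 2)) • fderiv ℝ (F (q t₀)) t) t := fun t ht => by
    have h1 : F (q t₀) t ≠ -1 := fun h => by have := k5 t ht; rw [h] at this; norm_num at this
    have h2 : F (q t₀) t ≠ 1 := fun h => by have := k5 t ht; rw [h] at this; norm_num at this
    exact (Real.hasDerivAt_arcsin h1 h2).comp_hasFDerivAt t (difr (hFs _) t ht).hasFDerivAt
  refine ⟨fun t => Real.arcsin (F (q t₀) t), ?_, fun t ht => (hder t ht).differentiableAt,
    fun t ht w => ?_, fun t ht => ?_⟩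
  · simp only [hF, heq, Real.arcsin_zero]
  · have h1 : 0 < F (e t₀) t := hpos t ht
    have h2 : G (q t₀) t = F (e t₀) t := by linarith [(k1 t ht).1]
    change fderiv ℝ (fun t => Real.arcsin (F (q t₀) t)) t w = _
    rw [(hder t ht).fderiv, k4 t ht]
    change 1 / F (e t₀) t * pd w (F (q t₀)) t = _
    rw [dF _ t ht, h2]
    field_simp
  · have h5 := abs_lt.1 ((sq_lt_one_iff_abs_lt_one _).1 (k5 t ht))
    rw [Real.cos_arcsin, k4 t ht, Real.sin_arcsin h5.1.le h5.2.le]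
    exact k2 t ht

end Integration

/-- The vectors that describe a product of two helicoids: `r₁`, `r₂` and `q₁`, `q₂` span the planes
of the rulings, and `p`, `r` are the translations along the axes per unit angle. -/
structure HelicoidPair (H : Type*) [NormedAddCommGroup H] [InnerProductSpace ℝ H] where
  base : H
  r₁ : H
  r₂ : H
  q₁ : H
  q₂ : H
  p : H
  r : H
  ruling : Orthonormal ℝ ![r₁, r₂, q₁, q₂]
  axis_left : inner ℝ r₁ p = (0 : ℝ) ∧ inner ℝ r₂ p = (0 : ℝ) ∧ inner ℝ q₁ p = (0 : ℝ) ∧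
    inner ℝ q₂ p = (0 : ℝ)
  axis_right : inner ℝ r₁ r = (0 : ℝ) ∧ inner ℝ r₂ r = (0 : ℝ) ∧ inner ℝ q₁ r = (0 : ℝ) ∧
    inner ℝ q₂ r = (0 : ℝ)
  axes : ∀ a b : ℝ, a • p + b • r = 0 → a = 0 ∧ b = 0

namespace HelicoidPair

variable {H : Type*} [NormedAddCommGroup H] [InnerProductSpace ℝ H]

/-- The parametrization of the product of the two helicoids. -/
def point (M : HelicoidPair H) (s₁ u₁ s₂ u₂ : ℝ) : H :=
  M.base + s₁ • (Real.cos u₁ • M.r₁ + Real.sin u₁ • M.r₂) +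
    s₂ • (Real.cos u₂ • M.q₁ + Real.sin u₂ • M.q₂) + u₁ • M.p + u₂ • M.r

/-- The product of the two helicoids. -/
def carrier (M : HelicoidPair H) : Set H := {y | ∃ s₁ u₁ s₂ u₂, y = M.point s₁ u₁ s₂ u₂}

end HelicoidPair

section LocalForm

variable {H : Type*} [NormedAddCommGroup H] [InnerProductSpace ℝ H]
variable {U V : Set R2} {P : R2 → H →L[ℝ] H} {e : Fin 2 → R2 → H} {γ q v p r : R2 → H} {t₀ : R2}
  {K : Prop} {ε : ℝ}

/-- Integration of the structure equations: the rulings of the two factors rotate by angles `u₁`, `u₂`,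
and the base point moves by `u₁ p + u₂ r`. -/
theorem SplitFrame.exists_helicoidPair (hS : SplitFrame K V P e γ q v p r)
    (hH : Module.finrank ℝ H = 6) (ht₀ : t₀ ∈ V) :
    ∃ M : HelicoidPair H, ∃ W ⊆ V, IsOpen W ∧ t₀ ∈ W ∧ ∀ t ∈ W, ∀ s : R2,
      γ t + ∑ i, s i • e i t ∈ M.carrier := by
  obtain ⟨-, heq, hev, hep, her, -⟩ := hS.structure_equations hH ht₀
  have hO : IsOpen (V ∩ ((fun t => (inner ℝ (e 0 t) (e 0 t₀) : ℝ)) ⁻¹' Set.Ioi 0 ∩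
      (fun t => (inner ℝ (e 1 t) (e 1 t₀) : ℝ)) ⁻¹' Set.Ioi 0)) := by
    rw [Set.inter_inter_distrib_left]
    exact (((hS.smooth 0).continuousOn.inner continuousOn_const).isOpen_inter_preimage
      hS.isOpen isOpen_Ioi).inter
      (((hS.smooth 1).continuousOn.inner continuousOn_const).isOpen_inter_preimage
      hS.isOpen isOpen_Ioi)
  obtain ⟨δ, hδ, hB⟩ := Metric.isOpen_iff.1 hO t₀ ⟨ht₀, by
    simp only [Set.mem_preimage, Set.mem_Ioi]
    rw [hS.norm 0 t₀ ht₀]; norm_num, by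
    simp only [Set.mem_preimage, Set.mem_Ioi]
    rw [hS.norm 1 t₀ ht₀]; norm_num⟩
  have hBV : Metric.ball t₀ δ ⊆ V := fun t ht => (hB ht).1
  have str := fun t (ht : t ∈ Metric.ball t₀ δ) => (hS.structure_equations hH (hBV ht)).1
  obtain ⟨u₁, u₁0, u₁d, u₁ρ, he0⟩ := exists_angle hδ ((hS.smooth 0).mono hBV)
    (hS.smooth_q.mono hBV) (fun t ht w => (str t ht w).1) (fun t ht w => (str t ht w).2.1)
    (fun t ht => hS.norm 0 t (hBV ht)) (hS.qq t₀ ht₀) (heq 0) (fun t ht => (hB ht).2.1)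
  obtain ⟨u₂, u₂0, u₂d, u₂ρ, he1⟩ := exists_angle hδ ((hS.smooth 1).mono hBV)
    (hS.smooth_v.mono hBV) (fun t ht w => (str t ht w).2.2.1) (fun t ht w => (str t ht w).2.2.2.1)
    (fun t ht => hS.norm 1 t (hBV ht)) (hS.vv t₀ ht₀) (hev 1) (fun t ht => (hB ht).2.2)
  have dif : ∀ {k : R2 → H}, ContDiffOn ℝ ∞ k V → ∀ t ∈ Metric.ball t₀ δ,
      DifferentiableAt ℝ k t := fun hk t ht => SmoothOn.differentiableAt hS.isOpen hk (hBV ht)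
  have hp : ∀ t ∈ Metric.ball t₀ δ, p t = p t₀ := fun t ht =>
    eq_of_pd_eq_zero (dif hS.smooth_p) (fun t ht w => (str t ht w).2.2.2.2.1) ht
  have hr : ∀ t ∈ Metric.ball t₀ δ, r t = r t₀ := fun t ht =>
    eq_of_pd_eq_zero (dif hS.smooth_r) (fun t ht w => (str t ht w).2.2.2.2.2.1) ht
  have d1 : ∀ t ∈ Metric.ball t₀ δ, DifferentiableAt ℝ (fun t => u₁ t • p t₀) t := fun t ht =>
    (u₁d t ht).smul_const _
  have d2 : ∀ t ∈ Metric.ball t₀ δ, DifferentiableAt ℝ (fun t => u₂ t • r t₀) t := fun t ht =>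
    (u₂d t ht).smul_const _
  have hγ : ∀ t ∈ Metric.ball t₀ δ, γ t = γ t₀ + u₁ t • p t₀ + u₂ t • r t₀ := fun t ht => by
    have d3 : ∀ t ∈ Metric.ball t₀ δ, DifferentiableAt ℝ (fun t => u₁ t • p t₀ + u₂ t • r t₀) t :=
      fun t ht => (d1 t ht).add (d2 t ht)
    have := eq_of_pd_eq_zero (f := fun t => γ t - (u₁ t • p t₀ + u₂ t • r t₀))
      (fun t ht => (dif hS.smooth_base t ht).sub (d3 t ht)) (fun t ht w => by
        rw [pd_sub (dif hS.smooth_base t ht) (d3 t ht), pd_add (d1 t ht) (d2 t ht),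
          pd_smul (u₁d t ht) (differentiableAt_const _), pd_smul (u₂d t ht) (differentiableAt_const _),
          pd_const, pd_const, (str t ht w).2.2.2.2.2.2, u₁ρ t ht, u₂ρ t ht, hp t ht, hr t ht]
        module) ht
    simp only [u₁0, u₂0, zero_smul, add_zero, sub_zero] at this
    rw [← this]; abel
  refine ⟨⟨γ t₀, e 0 t₀, q t₀, e 1 t₀, v t₀, p t₀, r t₀, ?_, ⟨hep 0, hS.qp t₀ ht₀, hep 1,
    hS.vp t₀ ht₀⟩, ⟨her 0, hS.qr t₀ ht₀, her 1, hS.vr t₀ ht₀⟩, hS.axes t₀ ht₀⟩, Metric.ball t₀ δ,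
    hBV, Metric.isOpen_ball, Metric.mem_ball_self hδ, fun t ht s => ?_⟩
  · rw [orthonormal_iff_ite]
    have c := fun x y : H => real_inner_comm x y
    intro i j
    fin_cases i <;> fin_cases j
    exacts [hS.norm 0 t₀ ht₀, heq 0, hS.orth t₀ ht₀, hev 0,
      (c _ _).trans (heq 0), hS.qq t₀ ht₀, (c _ _).trans (heq 1), hS.qv t₀ ht₀,
      hS.orth' ht₀, heq 1, hS.norm 1 t₀ ht₀, hev 1,
      (c _ _).trans (hev 0), (c _ _).trans (hS.qv t₀ ht₀), (c _ _).trans (hev 1), hS.vv t₀ ht₀]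
  · refine ⟨s 0, u₁ t, s 1, u₂ t, ?_⟩
    simp only [HelicoidPair.point, Fin.sum_univ_two]
    rw [hγ t ht, he0 t ht, he1 t ht]
    module

end LocalForm

section LocalForm

variable {H : Type*} [NormedAddCommGroup H] [InnerProductSpace ℝ H]
variable {U V : Set R2} {P : R2 → H →L[ℝ] H} {e : Fin 2 → R2 → H} {γ : R2 → H} {t t₀ v w : R2}
  {K : Prop} {ε : ℝ}

theorem SplitAt.exists_splitFrame (hR : RulingFrame U P e) (hγ : ContDiffOn ℝ ∞ γ U)
    (h : ∀ t ∈ U, ∃ x y f g, SplitAt K P e γ t x y f g) (ht₀ : t₀ ∈ U) :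
    ∃ V ⊆ U, t₀ ∈ V ∧ ∃ (e' : Fin 2 → R2 → H) (a b : R2 → ℝ) (q v p r : R2 → H),
      (∀ t ∈ V, ∀ v w, CoeffAt P e' (fun t => γ t + (a t • e' 0 t + b t • e' 1 t)) t v w →
        ∃ l, sd P v w γ t = nd P l γ t) ∧
      SplitFrame K V P e' (fun t => γ t + (a t • e' 0 t + b t • e' 1 t)) q v p r := by
  obtain ⟨V, hVU, htV, e', hR', had⟩ := exists_adapted_frame hR hγ h ht₀
  obtain ⟨W, hWV, htW, a, b, q, v, p, r, hco, hS⟩ := _root_.exists_splitFrame hR' (hγ.mono hVU) had htV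
  refine ⟨W, hWV.trans hVU, htW, e', a, b, q, v, p, r, fun t ht v w hc => ?_, hS⟩
  obtain ⟨l, hl, -⟩ := hco t ht v w hc
  exact ⟨l, hl⟩

/-- A point of a pencil at which all second covariant derivatives are normal derivatives. -/
def FlatAt (P : R2 → H →L[ℝ] H) (e : Fin 2 → R2 → H) (γ : R2 → H) (t s : R2) : Prop :=
  ∀ v w, ∃ l, sdAt P e γ t s v w = evalC (pencil (ndC P γ t) (ndD P e t) s) l

/-- A point of a pencil with a mixed frame in whose directions the second covariant derivatives are
normal derivatives. -/
def MixedAt (P : R2 → H →L[ℝ] H) (e : Fin 2 → R2 → H) (γ : R2 → H) (t s : R2) : Prop :=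
  ∃ x y f g, MixedFrame (pencil (ndC P γ t) (ndD P e t) s) (ndD P e t) x y f g ∧
    (∃ l, sdAt P e γ t s f f = evalC (pencil (ndC P γ t) (ndD P e t) s) l) ∧
    ∃ l, sdAt P e γ t s g g = evalC (pencil (ndC P γ t) (ndD P e t) s) l

/-- Moving the base points along the ruling. -/
theorem RulingFrame.nd_shift (hR : RulingFrame U P e) (hγ : ContDiffOn ℝ ∞ γ U) (ht : t ∈ U)
    (s : R2) (v : R2) : nd P v (fun t => γ t + (s 0 • e 0 t + s 1 • e 1 t)) t =
      nd P v γ t + ∑ i, s i • nd P v (e i) t := by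
  have hc := hR.smooth_comb (x := fun _ => s 0) (y := fun _ => s 1) contDiffOn_const contDiffOn_const
  rw [RulingFrame.nd_add (SmoothOn.differentiableAt hR.isOpen hγ ht)
    (SmoothOn.differentiableAt hR.isOpen hc ht),
    hR.nd_comb (x := fun _ => s 0) (y := fun _ => s 1) contDiffOn_const contDiffOn_const ht,
    Fin.sum_univ_two]

theorem RulingFrame.sd_shift (hR : RulingFrame U P e) (hγ : ContDiffOn ℝ ∞ γ U) (ht : t ∈ U)
    (s : R2) (v w : R2) : sd P v w (fun t => γ t + (s 0 • e 0 t + s 1 • e 1 t)) t =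
      sdAt P e γ t s v w := by
  have hc := hR.smooth_comb (x := fun _ => s 0) (y := fun _ => s 1) contDiffOn_const contDiffOn_const
  rw [hR.sd_add hγ hc ht,
    hR.sd_comb (x := fun _ => s 0) (y := fun _ => s 1) contDiffOn_const contDiffOn_const ht,
    sdAt, Fin.sum_univ_two]

theorem RulingFrame.ndC_shift (hR : RulingFrame U P e) (hγ : ContDiffOn ℝ ∞ γ U) (ht : t ∈ U)
    (s : R2) : ndC P (fun t => γ t + (s 0 • e 0 t + s 1 • e 1 t)) t =
      pencil (ndC P γ t) (ndD P e t) s := by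
  ext a
  exact hR.nd_shift hγ ht s _

theorem pencil_pencil (C : Fin 2 → H) (D : Fin 2 → Fin 2 → H) (s s' : Fin 2 → ℝ) :
    pencil (pencil C D s) D s' = pencil C D (s + s') := by
  ext a
  simp only [pencil, Fin.sum_univ_two, Pi.add_apply]; module

theorem RulingFrame.sdAt_shift (hR : RulingFrame U P e) (hγ : ContDiffOn ℝ ∞ γ U) (ht : t ∈ U)
    (s s' : R2) (v w : R2) : sdAt P e (fun t => γ t + (s 0 • e 0 t + s 1 • e 1 t)) t s' v w =
      sdAt P e γ t (s + s') v w := by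
  rw [sdAt, hR.sd_shift hγ ht, sdAt, sdAt]
  simp only [Fin.sum_univ_two, Pi.add_apply]; module

theorem continuousOn_prod {k : R2 → H} (hk : ContDiffOn ℝ ∞ k U) :
    ContinuousOn (fun z : R2 × R2 => k z.1) (U ×ˢ Set.univ) :=
  hk.continuousOn.comp continuousOn_fst fun _ hz => hz.1

/-- If a point of a leaf is not flat, then no nearby point is. -/
theorem RuledPatch.exists_nhds_not_flatAt (hR : RuledPatch U P e γ ε) {s : R2} (ht : t ∈ U)
    (hs : ∀ i, |s i| ≤ ε) (h : ¬FlatAt P e γ t s) :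
    ∃ δ > 0, Metric.ball t δ ⊆ U ∧ ∀ t' ∈ Metric.ball t δ, ∀ s' : R2, (∀ i, |s' i| ≤ δ) →
      ¬FlatAt P e γ t' (s + s') := by
  simp only [FlatAt, not_forall] at h
  obtain ⟨v, w, hvw⟩ := h
  -- not being flat is the linear independence of these three vectors, an open condition
  set Ψ : R2 × R2 → Fin 3 → H := fun z => ![sdAt P e γ z.1 z.2 v w,
    pencil (ndC P γ z.1) (ndD P e z.1) z.2 0, pencil (ndC P γ z.1) (ndD P e z.1) z.2 1] with hΨ
  have c2 : ∀ i, ContinuousOn (fun z : R2 × R2 => z.2 i) (U ×ˢ Set.univ) := fun i =>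
    ((continuous_apply i).comp continuous_snd).continuousOn
  have hcont : ContinuousOn Ψ (U ×ˢ Set.univ) := by
    have cp : ∀ a, ContinuousOn (fun z : R2 × R2 => pencil (ndC P γ z.1) (ndD P e z.1) z.2 a)
        (U ×ˢ Set.univ) := fun a =>
      (continuousOn_prod (hR.smooth_nd hR.smooth_base)).add (continuousOn_finsetSum _ fun i _ =>
        (c2 i).smul (continuousOn_prod (hR.smooth_nd (hR.smooth i))))
    refine continuousOn_pi.2 fun i => ?_
    fin_cases i
    · exact (continuousOn_prod (RuledPatch.smooth_sd hR.toRulingFrame hR.smooth_base)).add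
        (continuousOn_finsetSum _ fun i _ => (c2 i).smul
          (continuousOn_prod (RuledPatch.smooth_sd hR.toRulingFrame (hR.smooth i))))
    · exact cp 0
    · exact cp 1
  have hopen := hcont.isOpen_inter_preimage (hR.isOpen.prod isOpen_univ)
    (isOpen_setOfPred_linearIndependent (𝕜 := ℝ) (E := H) (ι := Fin 3))
  have hmem : (t, s) ∈ (U ×ˢ Set.univ) ∩ Ψ ⁻¹' {f | LinearIndependent ℝ f} := by
    refine ⟨⟨ht, trivial⟩, ?_⟩
    change LinearIndependent ℝ (Ψ (t, s))
    rw [Fintype.linearIndependent_iff]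
    intro c hc
    have hc' : c 0 • sdAt P e γ t s v w + c 1 • pencil (ndC P γ t) (ndD P e t) s 0 +
        c 2 • pencil (ndC P γ t) (ndD P e t) s 1 = 0 := by
      simpa [Fin.sum_univ_three, hΨ] using hc
    have c0 : c 0 = 0 := by
      by_contra h0
      apply hvw
      refine ⟨![-(c 1 / c 0), -(c 2 / c 0)], ?_⟩
      simp only [evalC, Fin.sum_univ_two, Matrix.cons_val_zero, Matrix.cons_val_one]
      have := congrArg (fun u => (c 0)⁻¹ • u) hc'
      simp only [smul_add, smul_smul, inv_mul_cancel₀ h0, smul_zero, one_smul] at this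
      rw [← sub_eq_zero, ← this]
      module
    rw [c0, zero_smul, zero_add] at hc'
    have := hR.indep t ht s hs ![c 1, c 2] (by simpa [Fin.sum_univ_two] using hc')
    intro i; fin_cases i
    exacts [c0, congrFun this 0, congrFun this 1]
  obtain ⟨δ, hδ, hball⟩ := Metric.isOpen_iff.1 hopen _ hmem
  refine ⟨δ / 2, by positivity, fun t' ht' => ?_, fun t' ht' s' hs' hflat => ?_⟩
  · have : (t', s) ∈ Metric.ball (t, s) δ := by
      rw [← ball_prod_same]
      exact ⟨Metric.ball_subset_ball (by linarith) ht', Metric.mem_ball_self hδ⟩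
    exact (hball this).1.1
  · have : (t', s + s') ∈ Metric.ball (t, s) δ := by
      rw [← ball_prod_same]
      refine ⟨Metric.ball_subset_ball (by linarith) ht', ?_⟩
      rw [Metric.mem_ball, dist_eq_norm, add_sub_cancel_left, pi_norm_lt_iff hδ]
      intro i
      rw [Real.norm_eq_abs]
      linarith [hs' i]
    have hLI : LinearIndependent ℝ (Ψ (t', s + s')) := (hball this).2
    obtain ⟨l, hl⟩ := hflat v w
    have := Fintype.linearIndependent_iff.1 hLI ![1, -l 0, -l 1] (by
      simp only [Fin.sum_univ_three, hΨ]
      change (1 : ℝ) • sdAt P e γ t' (s + s') v w + -l 0 • _ + -l 1 • _ = 0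
      rw [hl]
      simp only [evalC, Fin.sum_univ_two]
      change (1 : ℝ) • _ + -l 0 • pencil (ndC P γ t') (ndD P e t') (s + s') 0 +
        -l 1 • pencil (ndC P γ t') (ndD P e t') (s + s') 1 = 0
      module) 0
    norm_num at this

/-- If every point is flat or mixed, then every point is flat: near a point that is not flat there
are only mixed points, but the structure equations make them flat. -/
theorem RuledPatch.flatAt (hR : RuledPatch U P e γ ε) (hH : Module.finrank ℝ H = 6)
    (h : ∀ t ∈ U, ∀ s : R2, (∀ i, |s i| ≤ ε) → FlatAt P e γ t s ∨ MixedAt P e γ t s)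
    {s : R2} (ht : t ∈ U) (hs : ∀ i, |s i| ≤ ε / 2) : FlatAt P e γ t s := by
  by_contra hnot
  have hε := hR.pos
  obtain ⟨δ, hδ, hBU, hδs⟩ := hR.exists_nhds_not_flatAt ht (fun i => (hs i).trans (by linarith)) hnot
  have hB : IsOpen (Metric.ball t δ) := Metric.isOpen_ball
  -- the point with coordinates `s` is made the origin of its leaf
  set γ' : R2 → H := fun t => γ t + (s 0 • e 0 t + s 1 • e 1 t) with hγ'
  have hRB : RulingFrame (Metric.ball t δ) P e := hR.toRulingFrame.mono hB hBU
  have hγB := hR.smooth_base.mono hBU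
  set ε' := min δ (ε / 2) with hε'
  have hpos : 0 < ε' := lt_min hδ (by linarith)
  have hsum : ∀ s' : R2, (∀ i, |s' i| ≤ ε') → ∀ i, |(s + s') i| ≤ ε := fun s' hs' i =>
    (abs_add_le _ _).trans (by linarith [hs i, (hs' i).trans (min_le_right _ _)])
  have hγ's : ContDiffOn ℝ ∞ γ' (Metric.ball t δ) :=
    hγB.add (hRB.smooth_comb (x := fun _ => s 0) (y := fun _ => s 1) contDiffOn_const
      contDiffOn_const)
  have hpen : ∀ t' ∈ Metric.ball t δ, ∀ s', pencil (ndC P γ' t') (ndD P e t') s' =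
      pencil (ndC P γ t') (ndD P e t') (s + s') := fun t' ht' s' => by
    rw [hγ', hRB.ndC_shift hγB ht', pencil_pencil]
  have hsd : ∀ t' ∈ Metric.ball t δ, ∀ s' v w, sdAt P e γ' t' s' v w =
      sdAt P e γ t' (s + s') v w := fun t' ht' s' v w => hRB.sdAt_shift hγB ht' s s' v w
  have hR' : RuledPatch (Metric.ball t δ) P e γ' ε' :=
    { hRB with
      smooth_base := hγ's
      pos := hpos
      indep := fun t' ht' s' hs' => by
        rw [hpen t' ht']; exact hR.indep t' (hBU ht') _ (hsum s' hs')
      nondeg := fun t' ht' s' hs' => by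
        rw [hpen t' ht']; exact hR.nondeg t' (hBU ht') _ (hsum s' hs') }
  have hmix : ∀ t' ∈ Metric.ball t δ, ∃ x y f g, SplitAt False P e γ' t' x y f g := fun t' ht' =>
    hR'.splitAt_of_mixed ht' fun s' hs' => by
      have := (h t' (hBU ht') (s + s') (hsum s' hs')).resolve_left
        (hδs t' ht' s' fun i => (hs' i).trans (min_le_left _ _))
      simpa only [MixedAt, hpen t' ht', hsd t' ht'] using this
  have htB : t ∈ Metric.ball t δ := Metric.mem_ball_self hδ
  obtain ⟨V, hVU, htV, e', a, b, q, v, p, r, hco, hS⟩ :=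
    SplitAt.exists_splitFrame hRB hγ's hmix htB
  obtain ⟨-, -, -, -, -, hall⟩ := hS.structure_equations hH htV
  apply hnot
  intro v w
  obtain ⟨l, hl⟩ := hco t htV v w (hall v w)
  refine ⟨l, ?_⟩
  rw [← hRB.sd_shift hγB htB, ← hRB.ndC_shift hγB htB, evalC_ndC]
  exact hl

/-- The local form: a ruled patch all of whose points are flat or mixed is a product of two
helicoids. -/
theorem RuledPatch.exists_helicoidPair (hR : RuledPatch U P e γ ε) (hH : Module.finrank ℝ H = 6)
    (h : ∀ t ∈ U, ∀ s : R2, (∀ i, |s i| ≤ ε) → FlatAt P e γ t s ∨ MixedAt P e γ t s)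
    (ht₀ : t₀ ∈ U) :
    ∃ M : HelicoidPair H, ∃ W ⊆ U, IsOpen W ∧ t₀ ∈ W ∧ ∀ t ∈ W, ∀ s : R2,
      γ t + ∑ i, s i • e i t ∈ M.carrier := by
  have hε := hR.pos
  have hR' : RuledPatch U P e γ (ε / 2) :=
    { hR with
      pos := by linarith
      indep := fun t ht s hs => hR.indep t ht s fun i => (hs i).trans (by linarith)
      nondeg := fun t ht s hs => hR.nondeg t ht s fun i => (hs i).trans (by linarith) }
  have hcoe : ∀ t ∈ U, ∀ v w, CoeffAt P e γ t v w := fun t ht v w =>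
    hR'.coeffAt_of_mem_span ht fun s hs => hR.flatAt hH h ht hs v w
  have hsplit : ∀ t ∈ U, ∃ x y f g, SplitAt True P e γ t x y f g := fun t ht => by
    obtain ⟨x, y, f, g, hs⟩ := hR.exists_splitPencil hH hcoe ht
    exact ⟨x, y, f, g, hs, hcoe t ht _ _, hcoe t ht _ _, Or.inl ⟨trivial, hcoe t ht _ _⟩⟩
  obtain ⟨V, hVU, htV, e', a, b, q, v, p, r, -, hS⟩ :=
    SplitAt.exists_splitFrame hR.toRulingFrame hR.smooth_base hsplit ht₀
  obtain ⟨M, W, hWV, hWo, htW, hM⟩ := hS.exists_helicoidPair hH htV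
  refine ⟨M, W, hWV.trans hVU, hWo, htW, fun t ht s => ?_⟩
  -- the same leaf in the adapted frame
  have hpt : ∀ i, e i t = (inner ℝ (e' 0 t) (e i t) : ℝ) • e' 0 t +
      (inner ℝ (e' 1 t) (e i t) : ℝ) • e' 1 t := fun i => by
    rw [← hS.proj t (hWV ht), hR.proj_e (hVU (hWV ht))]
  convert hM t ht ![∑ i, s i * inner ℝ (e' 0 t) (e i t) - a t,
    ∑ i, s i * inner ℝ (e' 1 t) (e i t) - b t] using 1
  simp only [Fin.sum_univ_two, Matrix.cons_val_zero, Matrix.cons_val_one]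
  conv_lhs => rw [hpt 0, hpt 1]
  module

end LocalForm

/-! ### Second fundamental forms of type B -/

section TypeB

/-- The hyperdeterminant is multiplied by squares under a change of the two bases. -/
theorem hyperdet_comp (A B p q : Fin 2 → Fin 2 → ℝ) :
    hyperdet (fun i j => ∑ k, ∑ l, p i k * q j l * A k l) (fun i j => ∑ k, ∑ l, p i k * q j l * B k l) =
      (p 0 0 * p 1 1 - p 0 1 * p 1 0) ^ 2 * (q 0 0 * q 1 1 - q 0 1 * q 1 0) ^ 2 * hyperdet A B := by
  simp only [hyperdet, Fin.sum_univ_two]; ring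

/-- If two matrices have a vanishing corner after a rotation of rows and columns, and their off-diagonal
entries are proportional, their hyperdeterminant vanishes. -/
theorem hyperdet_eq_zero_of_corner {A B : Fin 2 → Fin 2 → ℝ} {α β α' β' : ℝ}
    (h : α ^ 2 + β ^ 2 = 1) (h' : α' ^ 2 + β' ^ 2 = 1)
    (hA : α * α' * A 0 0 + α * β' * A 0 1 + β * α' * A 1 0 + β * β' * A 1 1 = 0)
    (hB : α * α' * B 0 0 + α * β' * B 0 1 + β * α' * B 1 0 + β * β' * B 1 1 = 0)
    (hAB : (-(α * β') * A 0 0 + α * α' * A 0 1 - β * β' * A 1 0 + β * α' * A 1 1) *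
        (-(β * α') * B 0 0 - β * β' * B 0 1 + α * α' * B 1 0 + α * β' * B 1 1) -
      (-(β * α') * A 0 0 - β * β' * A 0 1 + α * α' * A 1 0 + α * β' * A 1 1) *
        (-(α * β') * B 0 0 + α * α' * B 0 1 - β * β' * B 1 0 + β * α' * B 1 1) = 0) :
    hyperdet A B = 0 := by
  have corner : ∀ A B : Fin 2 → Fin 2 → ℝ, A 0 0 = 0 → B 0 0 = 0 →
      A 0 1 * B 1 0 - A 1 0 * B 0 1 = 0 → hyperdet A B = 0 := fun A B hA hB hAB => by
    simp only [hyperdet, hA, hB]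
    linear_combination (-(A 0 1 * B 1 0 - A 1 0 * B 0 1)) * hAB
  have hc := hyperdet_comp A B ![![α, β], ![-β, α]] ![![α', β'], ![-β', α']]
  rw [corner] at hc
  · have h1 : α * α - β * -β = 1 := by linarith
    have h2 : α' * α' - β' * -β' = 1 := by linarith
    simp only [Matrix.cons_val_zero, Matrix.cons_val_one, h1, h2] at hc
    linarith
  · simp only [Fin.sum_univ_two, Matrix.cons_val_zero, Matrix.cons_val_one]; linear_combination hA
  · simp only [Fin.sum_univ_two, Matrix.cons_val_zero, Matrix.cons_val_one]; linear_combination hB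
  · simp only [Fin.sum_univ_two, Matrix.cons_val_zero, Matrix.cons_val_one]; linear_combination hAB

theorem QB_entries {S : Matrix (Fin 4) (Fin 4) ℝ} (h : S ∈ QB) :
    S 0 1 = 0 ∧ S 1 0 = 0 ∧ S 1 1 = S 0 0 ∧ S 2 2 = -S 0 0 ∧ S 3 3 = -S 0 0 ∧ S 2 3 = 0 ∧
      S 3 2 = 0 ∧ S 2 0 = S 0 2 ∧ S 3 0 = S 0 3 ∧ S 2 1 = S 1 2 ∧ S 3 1 = S 1 3 := by
  obtain ⟨m, b₁, b₂, b₃, b₄, rfl⟩ := h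
  exact ⟨rfl, rfl, rfl, rfl, rfl, rfl, rfl, rfl, rfl, rfl, rfl⟩

variable {H : Type*} [NormedAddCommGroup H] [InnerProductSpace ℝ H]

/-- The tangent vector with the component `x` along the ruling and the component `τ` normal to
it. -/
def tangentVec (e M : Fin 2 → H) (x τ : R2) : H := ∑ i, x i • e i + evalC M τ

/-- The pointwise data of a second fundamental form of type B: the tangent space is spanned by the
ruling `e` and the plane of `M`, the derivatives `D`, `Y` are the components of the second
fundamental form, `a` is an orthonormal basis of the tangent space in which the shape operators
`S ν` lie in `QB`, and the reflection preserves the ruling. -/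
structure TypeBPoint (e M : Fin 2 → H) (D : Fin 2 → Fin 2 → H) (Y : R2 → R2 → H) (a : Fin 4 → H)
    (S : H → Matrix (Fin 4) (Fin 4) ℝ) : Prop where
  norm : ∀ i, inner ℝ (e i) (e i) = (1 : ℝ)
  orth : inner ℝ (e 0) (e 1) = (0 : ℝ)
  e_M : ∀ i b, inner ℝ (e i) (M b) = (0 : ℝ)
  e_Y : ∀ i v w, inner ℝ (e i) (Y v w) = (0 : ℝ)
  e_D : ∀ i b j, inner ℝ (e i) (D b j) = (0 : ℝ)
  frame : Orthonormal ℝ a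
  expand : ∀ x τ, tangentVec e M x τ = ∑ i, (inner ℝ (a i) (tangentVec e M x τ) : ℝ) • a i
  Y_zero : ∀ τ, Y 0 τ = 0
  type : ∀ ν, (∀ i, inner ℝ ν (a i) = (0 : ℝ)) → S ν ∈ QB
  form : ∀ ν, (∀ i, inner ℝ ν (a i) = (0 : ℝ)) → ∀ x τ x' τ',
    (inner ℝ ν (evalD D τ' x + evalD D τ x' + Y τ τ') : ℝ) = ∑ i, ∑ j,
      inner ℝ (a i) (tangentVec e M x τ) * inner ℝ (a j) (tangentVec e M x' τ') * S ν i j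
  refl : ∀ i, ∃ c : Fin 2 → ℝ, (inner ℝ (a 0) (e i) : ℝ) • a 0 + (inner ℝ (a 1) (e i) : ℝ) • a 1 -
    (inner ℝ (a 2) (e i) : ℝ) • a 2 - (inner ℝ (a 3) (e i) : ℝ) • a 3 = ∑ k, c k • e k
  rank : ∃ ν₀ ν₁, (∀ i, inner ℝ ν₀ (a i) = (0 : ℝ)) ∧ (∀ i, inner ℝ ν₁ (a i) = (0 : ℝ)) ∧
    hyperdet ![![S ν₀ 0 2, S ν₀ 0 3], ![S ν₀ 1 2, S ν₀ 1 3]]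
      ![![S ν₁ 0 2, S ν₁ 0 3], ![S ν₁ 1 2, S ν₁ 1 3]] ≠ 0
  tangent_of_normal : ∀ z, (∀ ν, (∀ i, inner ℝ ν (a i) = (0 : ℝ)) → inner ℝ ν z = (0 : ℝ)) →
    ∃ x τ, z = tangentVec e M x τ

namespace TypeBPoint

variable {e M : Fin 2 → H} {D : Fin 2 → Fin 2 → H} {Y : R2 → R2 → H} {a : Fin 4 → H}
  {S : H → Matrix (Fin 4) (Fin 4) ℝ}

theorem orth' (h : TypeBPoint e M D Y a S) : inner ℝ (e 1) (e 0) = (0 : ℝ) := by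
  rw [real_inner_comm]; exact h.orth

theorem inner_e (h : TypeBPoint e M D Y a S) (i : Fin 2) (x τ : R2) :
    (inner ℝ (e i) (tangentVec e M x τ) : ℝ) = x i := by
  fin_cases i <;>
  simp [-inner_self_eq_norm_sq_to_K, tangentVec, evalC, Fin.sum_univ_two, inner_add_right, real_inner_smul_right, h.norm, h.orth,
    h.orth', h.e_M]

/-- A vector that is normal to the ruling and has no component in the normal space belongs to the
plane of `M`. -/
theorem mem_plane (h : TypeBPoint e M D Y a S) {z : H} (he : ∀ i, inner ℝ (e i) z = (0 : ℝ))
    (hν : ∀ ν, (∀ i, inner ℝ ν (a i) = (0 : ℝ)) → inner ℝ ν z = (0 : ℝ)) : ∃ l, z = evalC M l := by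
  obtain ⟨x, τ, rfl⟩ := h.tangent_of_normal z hν
  have hx : x = 0 := by ext i; rw [← h.inner_e i x τ, he]; rfl
  exact ⟨τ, by rw [hx]; simp [tangentVec]⟩

theorem normal_evalC (h : TypeBPoint e M D Y a S) {ν : H} (hν : ∀ i, inner ℝ ν (a i) = (0 : ℝ))
    (x τ : R2) : (inner ℝ ν (tangentVec e M x τ) : ℝ) = 0 := by
  rw [h.expand, inner_sum]
  simp [real_inner_smul_right, hν]

theorem normal_M (h : TypeBPoint e M D Y a S) {ν : H} (hν : ∀ i, inner ℝ ν (a i) = (0 : ℝ))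
    (b : Fin 2) : (inner ℝ ν (M b) : ℝ) = 0 := by
  have := h.normal_evalC hν 0 (Pi.single b 1)
  simpa [tangentVec, evalC_single] using this

theorem e_eq (e M : Fin 2 → H) (i : Fin 2) : e i = tangentVec e M (Pi.single i 1) 0 := by
  simp [tangentVec, evalC, Pi.single_apply]

theorem exists_evalC_eq (h : TypeBPoint e M D Y a S) {z : H} (c : Fin 4 → ℝ) (hz : z = ∑ i, c i • a i)
    (he : ∀ i, inner ℝ (e i) z = (0 : ℝ)) : ∃ l, z = evalC M l :=
  h.mem_plane he fun ν hν => by rw [hz, inner_sum]; simp [real_inner_smul_right, hν]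

theorem evalC_eq (e M : Fin 2 → H) (τ : R2) : evalC M τ = tangentVec e M 0 τ := by
  simp [tangentVec]

/-- The mixed part of the second fundamental form. -/
theorem form_mixed (h : TypeBPoint e M D Y a S) {ν : H} (hν : ∀ i, inner ℝ ν (a i) = (0 : ℝ))
    (x τ : R2) : (inner ℝ ν (evalD D τ x) : ℝ) = ∑ i, ∑ j,
      inner ℝ (a i) (∑ k, x k • e k) * inner ℝ (a j) (evalC M τ) * S ν i j := by
  have := h.form ν hν x 0 0 τ
  rw [h.Y_zero, ← evalC_eq] at this
  simpa [tangentVec, evalD, evalC] using this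

theorem form_plane (h : TypeBPoint e M D Y a S) {ν : H} (hν : ∀ i, inner ℝ ν (a i) = (0 : ℝ))
    (τ τ' : R2) : (inner ℝ ν (Y τ τ') : ℝ) = ∑ i, ∑ j,
      inner ℝ (a i) (evalC M τ) * inner ℝ (a j) (evalC M τ') * S ν i j := by
  have := h.form ν hν 0 τ 0 τ'
  rw [← evalC_eq, ← evalC_eq] at this
  simpa [evalD] using this

theorem form_ruling (h : TypeBPoint e M D Y a S) {ν : H} (hν : ∀ i, inner ℝ ν (a i) = (0 : ℝ))
    (x x' : R2) : ∑ i, ∑ j,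
      inner ℝ (a i) (∑ k, x k • e k) * inner ℝ (a j) (∑ k, x' k • e k) * S ν i j = 0 := by
  have := h.form ν hν x 0 x' 0
  rw [h.Y_zero] at this
  simpa [tangentVec, evalD, evalC] using this.symm

/-- Nondegeneracy may be tested in any directions and any vectors of the ruling. -/
theorem nondeg_of_frame (h : TypeBPoint e M D Y a S) {ν₀ ν₁ : H}
    (h₀ : ∀ i, inner ℝ ν₀ (a i) = (0 : ℝ)) (h₁ : ∀ i, inner ℝ ν₁ (a i) = (0 : ℝ))
    (τ x : Fin 2 → R2)
    (hd : hyperdet (fun i j => inner ℝ ν₀ (evalD D (τ i) (x j)))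
      (fun i j => inner ℝ ν₁ (evalD D (τ i) (x j))) ≠ 0) : Nondeg D M := by
  refine ⟨![(innerSL ℝ ν₀).toLinearMap, (innerSL ℝ ν₁).toLinearMap], fun k b => ?_, ?_⟩
  · fin_cases k
    · exact h.normal_M h₀ b
    · exact h.normal_M h₁ b
  · have e : ∀ ν : H, (fun i j => (inner ℝ ν (evalD D (τ i) (x j)) : ℝ)) =
        fun i j => ∑ k, ∑ l, τ i k * x j l * (inner ℝ ν (D k l) : ℝ) := fun ν => by
      ext i j
      simp only [evalD, Fin.sum_univ_two, inner_add_right, real_inner_smul_right]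
    rw [e, e, hyperdet_comp] at hd
    exact (mul_ne_zero_iff.1 hd).2

theorem inner_a (h : TypeBPoint e M D Y a S) (i j : Fin 4) :
    (inner ℝ (a i) (a j) : ℝ) = if i = j then 1 else 0 := orthonormal_iff_ite.1 h.frame i j

/-- The case of a ruling that is one of the two eigenspaces of the reflection. -/
theorem flat_of_eigenspace (h : TypeBPoint e M D Y a S) {σ : Fin 4 → Fin 4}
    (hσ : σ = ![0, 1, 2, 3] ∨ σ = ![2, 3, 0, 1])
    (hE : ∀ i, inner ℝ (a (σ 2)) (e i) = (0 : ℝ) ∧ inner ℝ (a (σ 3)) (e i) = (0 : ℝ)) :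
    Nondeg D M ∧ ∀ v w, ∃ l, Y v w = evalC M l := by
  have hinj : Function.Injective σ := by
    rcases hσ with rfl | rfl <;> decide
  have ia : ∀ i j : Fin 4, (inner ℝ (a (σ i)) (a (σ j)) : ℝ) = if i = j then 1 else 0 := fun i j => by
    rw [h.inner_a]; simp [hinj.eq_iff]
  have hsumH : ∀ f : Fin 4 → H, ∑ i, f i = ∑ i, f (σ i) := fun f =>
    (Function.Bijective.sum_comp (Finite.injective_iff_bijective.1 hinj) f).symm
  -- the ruling is spanned by the first two vectors of the frame
  have eexp : ∀ i, e i = (inner ℝ (a (σ 0)) (e i) : ℝ) • a (σ 0) +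
      (inner ℝ (a (σ 1)) (e i) : ℝ) • a (σ 1) := fun i => by
    have := h.expand (Pi.single i 1) 0
    rw [← e_eq, hsumH, Fin.sum_univ_four, (hE i).1, (hE i).2] at this
    linear_combination (norm := module) this
  set u : Fin 2 → R2 := fun i => ![inner ℝ (a (σ 0)) (e i), inner ℝ (a (σ 1)) (e i)] with hu
  have uu : ∀ i j, u i 0 * u j 0 + u i 1 * u j 1 = inner ℝ (e i) (e j) := fun i j => by
    conv_rhs => rw [eexp i, eexp j]
    simp only [inner_add_left, inner_add_right, real_inner_smul_left, real_inner_smul_right, ia, hu]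
    simp
    ring
  have aexp : ∀ k : Fin 2, ∃ x : R2, a (σ (![0, 1] k)) = ∑ j, x j • e j := fun k => by
    obtain ⟨ξ, η, hk⟩ := exists_coords_of_orthonormal (x := u 0) (y := u 1)
      (by have := uu 0 0; rw [h.norm] at this; linarith)
      (by have := uu 1 1; rw [h.norm] at this; linarith)
      (by have := uu 0 1; rw [h.orth] at this; linarith) (Pi.single k 1)
    refine ⟨![ξ, η], ?_⟩
    have k0 := congrFun hk 0
    have k1 := congrFun hk 1
    simp only [Pi.add_apply, Pi.smul_apply, smul_eq_mul, hu, Matrix.cons_val_zero,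
      Matrix.cons_val_one] at k0 k1
    rw [Fin.sum_univ_two, eexp 0, eexp 1]
    simp only [Matrix.cons_val_zero, Matrix.cons_val_one]
    have : ξ • ((inner ℝ (a (σ 0)) (e 0) : ℝ) • a (σ 0) + (inner ℝ (a (σ 1)) (e 0) : ℝ) • a (σ 1)) +
        η • ((inner ℝ (a (σ 0)) (e 1) : ℝ) • a (σ 0) + (inner ℝ (a (σ 1)) (e 1) : ℝ) • a (σ 1)) =
        (Pi.single k 1 : R2) 0 • a (σ 0) + (Pi.single k 1 : R2) 1 • a (σ 1) := by
      rw [k0, k1]; module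
    rw [this]
    fin_cases k <;> simp
  -- the first two vectors lie in the ruling and the last two in the plane of `M`
  choose x hx using aexp
  have aM : ∀ k : Fin 2, ∀ τ, (inner ℝ (a (σ (![0, 1] k))) (evalC M τ) : ℝ) = 0 := fun k τ => by
    rw [hx k]
    simp [evalC, Fin.sum_univ_two, inner_add_left, inner_add_right, real_inner_smul_left,
      real_inner_smul_right, h.e_M]
  have hτ : ∀ k : Fin 2, ∃ τ, a (σ (![2, 3] k)) = evalC M τ := fun k =>
    h.exists_evalC_eq (Pi.single (σ (![2, 3] k)) 1) (by simp [Pi.single_apply]) fun i => by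
      rw [real_inner_comm]
      fin_cases k
      exacts [(hE i).1, (hE i).2]
  choose τ hτ using hτ
  obtain ⟨ν₀, ν₁, h₀, h₁, hd⟩ := h.rank
  -- the second fundamental form vanishes on the ruling, hence so does the entry `m`
  have hm : ∀ ν, (∀ i, inner ℝ ν (a i) = (0 : ℝ)) → S ν 0 0 = 0 := fun ν hν => by
    have := h.form_ruling hν (x 0) (x 0)
    rw [← hx 0] at this
    obtain ⟨z1, z2, z3, z4, z5, z6, z7, -⟩ := QB_entries (h.type ν hν)
    rcases hσ with rfl | rfl <;>
    simpa [h.inner_a, z4] using this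
  have hB : ∀ ν, (∀ i, inner ℝ ν (a i) = (0 : ℝ)) → ∀ i k,
      (inner ℝ ν (evalD D (τ i) (x k)) : ℝ) = S ν (σ (![0, 1] k)) (σ (![2, 3] i)) := fun ν hν i k => by
    rw [h.form_mixed hν, ← hx k, ← hτ i]
    simp [h.inner_a]
  refine ⟨h.nondeg_of_frame h₀ h₁ τ x ?_, fun v w => h.mem_plane (fun i => h.e_Y i v w) fun ν hν => ?_⟩
  · have e0 : ∀ ν, (∀ i, inner ℝ ν (a i) = (0 : ℝ)) →
        (fun i j => (inner ℝ ν (evalD D (τ i) (x j)) : ℝ)) =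
        fun i j => S ν (σ (![0, 1] j)) (σ (![2, 3] i)) := fun ν hν => by
      ext i j; exact hB ν hν i j
    rw [e0 ν₀ h₀, e0 ν₁ h₁]
    obtain ⟨-, -, -, -, -, -, -, y1, y2, y3, y4⟩ := QB_entries (h.type ν₀ h₀)
    obtain ⟨-, -, -, -, -, -, -, w1, w2, w3, w4⟩ := QB_entries (h.type ν₁ h₁)
    intro hz
    apply hd
    rcases hσ with rfl | rfl <;>
    simp [hyperdet, y1, y2, y3, y4, w1, w2, w3, w4] at hz ⊢ <;> linarith
  · rw [h.form_plane hν]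
    have a0 := aM 0
    have a1 := aM 1
    obtain ⟨z1, z2, z3, z4, z5, z6, z7, -⟩ := QB_entries (h.type ν hν)
    rw [hm ν hν] at z3 z4 z5
    rcases hσ with rfl | rfl <;>
    simp only [Matrix.cons_val_zero, Matrix.cons_val_one, Matrix.cons_val] at a0 a1 <;>
    simp [Fin.sum_univ_four, a0, a1, z1, z2, z3, z4, z5, z6, z7, hm ν hν]

/-- The case of a ruling that contains a vector from each eigenspace of the reflection. -/
theorem mixed_of_vectors (h : TypeBPoint e M D Y a S) {x y : R2} {α β α' β' : ℝ}
    (hx : ∑ k, x k • e k = α • a 0 + β • a 1) (hy : ∑ k, y k • e k = α' • a 2 + β' • a 3)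
    (hαβ : α ^ 2 + β ^ 2 = 1) (hαβ' : α' ^ 2 + β' ^ 2 = 1) :
    Nondeg D M ∧ ∃ f g, MixedFrame M D x y f g ∧ (∃ l, Y f f = evalC M l) ∧
      ∃ l, Y g g = evalC M l := by
  have ip : ∀ x y : R2, (inner ℝ (∑ k, x k • e k) (∑ k, y k • e k) : ℝ) = x 0 * y 0 + x 1 * y 1 :=
    fun x y => by
    simp only [Fin.sum_univ_two, inner_add_left, inner_add_right, real_inner_smul_left,
      real_inner_smul_right, h.norm, h.orth, h.orth']; ring
  have nx : x 0 ^ 2 + x 1 ^ 2 = 1 := by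
    have := ip x x
    rw [hx] at this
    simp [-inner_self_eq_norm_sq_to_K, inner_add_left, inner_add_right, real_inner_smul_left, real_inner_smul_right,
      h.inner_a] at this
    linarith
  have ny : y 0 ^ 2 + y 1 ^ 2 = 1 := by
    have := ip y y
    rw [hy] at this
    simp [-inner_self_eq_norm_sq_to_K, inner_add_left, inner_add_right, real_inner_smul_left, real_inner_smul_right,
      h.inner_a] at this
    linarith
  have nxy : x 0 * y 0 + x 1 * y 1 = 0 := by
    have := ip x y
    rw [hx, hy] at this
    simp [-inner_self_eq_norm_sq_to_K, inner_add_left, inner_add_right, real_inner_smul_left, real_inner_smul_right,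
      h.inner_a] at this
    linarith
  have ecomb : ∀ i, ∃ ξ η : ℝ, e i = ξ • (∑ k, x k • e k) + η • (∑ k, y k • e k) := fun i => by
    obtain ⟨ξ, η, hk⟩ := exists_coords_of_orthonormal nx ny nxy (Pi.single i 1)
    refine ⟨ξ, η, ?_⟩
    have k0 := congrFun hk 0
    have k1 := congrFun hk 1
    simp only [Pi.add_apply, Pi.smul_apply, smul_eq_mul] at k0 k1
    have : ξ • (∑ k, x k • e k) + η • (∑ k, y k • e k) =
        (Pi.single i 1 : R2) 0 • e 0 + (Pi.single i 1 : R2) 1 • e 1 := by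
      rw [k0, k1]; simp only [Fin.sum_univ_two]; module
    rw [this]; fin_cases i <;> simp
  -- in each eigenspace, the vector perpendicular to the ruling lies in the plane of `M`
  obtain ⟨g, hg⟩ := h.exists_evalC_eq (z := -β • a 0 + α • a 1) ![-β, α, 0, 0]
    (by simp [Fin.sum_univ_four]) fun i => by
      obtain ⟨ξ, η, hi⟩ := ecomb i
      rw [hi, hx, hy]
      simp [-inner_self_eq_norm_sq_to_K, inner_add_left, inner_add_right, real_inner_smul_left, real_inner_smul_right, h.inner_a]
      ring
  obtain ⟨f, hf⟩ := h.exists_evalC_eq (z := -β' • a 2 + α' • a 3) ![0, 0, -β', α']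
    (by simp [Fin.sum_univ_four]) fun i => by
      obtain ⟨ξ, η, hi⟩ := ecomb i
      rw [hi, hx, hy]
      simp [-inner_self_eq_norm_sq_to_K, inner_add_left, inner_add_right, real_inner_smul_left, real_inner_smul_right, h.inner_a]
      ring
  have hm : ∀ ν, (∀ i, inner ℝ ν (a i) = (0 : ℝ)) → S ν 0 0 = 0 := fun ν hν => by
    have := h.form_ruling hν x x
    rw [hx] at this
    obtain ⟨z1, z2, z3, -⟩ := QB_entries (h.type ν hν)
    simp [Fin.sum_univ_four, inner_add_right, real_inner_smul_right, h.inner_a, z1, z2, z3] at this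
    linear_combination this - S ν 0 0 * hαβ
  have hxy : ∀ ν, (∀ i, inner ℝ ν (a i) = (0 : ℝ)) →
      α * α' * S ν 0 2 + α * β' * S ν 0 3 + β * α' * S ν 1 2 + β * β' * S ν 1 3 = 0 := fun ν hν => by
    have := h.form_ruling hν x y
    rw [hx, hy] at this
    simp [Fin.sum_univ_four, inner_add_right, real_inner_smul_right, h.inner_a] at this
    linear_combination this
  have vgx : ∀ ν, (∀ i, inner ℝ ν (a i) = (0 : ℝ)) → (inner ℝ ν (evalD D g x) : ℝ) = 0 := fun ν hν => by
    rw [h.form_mixed hν, hx, ← hg]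
    obtain ⟨z1, z2, z3, -⟩ := QB_entries (h.type ν hν)
    simp [Fin.sum_univ_four, inner_add_right, real_inner_smul_right, h.inner_a, z1, z2, z3, hm ν hν]
  have vfy : ∀ ν, (∀ i, inner ℝ ν (a i) = (0 : ℝ)) → (inner ℝ ν (evalD D f y) : ℝ) = 0 := fun ν hν => by
    rw [h.form_mixed hν, hy, ← hf]
    obtain ⟨z1, z2, z3, z4, z5, z6, z7, -⟩ := QB_entries (h.type ν hν)
    simp [Fin.sum_univ_four, inner_add_right, real_inner_smul_right, h.inner_a, z4, z5, z6, z7, hm ν hν]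
  have vff : ∀ ν, (∀ i, inner ℝ ν (a i) = (0 : ℝ)) → (inner ℝ ν (Y f f) : ℝ) = 0 := fun ν hν => by
    rw [h.form_plane hν, ← hf]
    obtain ⟨z1, z2, z3, z4, z5, z6, z7, -⟩ := QB_entries (h.type ν hν)
    simp [Fin.sum_univ_four, inner_add_right, real_inner_smul_right, h.inner_a, z4, z5, z6, z7, hm ν hν]
  have vgg : ∀ ν, (∀ i, inner ℝ ν (a i) = (0 : ℝ)) → (inner ℝ ν (Y g g) : ℝ) = 0 := fun ν hν => by
    rw [h.form_plane hν, ← hg]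
    obtain ⟨z1, z2, z3, z4, z5, z6, z7, -⟩ := QB_entries (h.type ν hν)
    simp [Fin.sum_univ_four, inner_add_right, real_inner_smul_right, h.inner_a, z1, z2, z3, hm ν hν]
  have vfx : ∀ ν, (∀ i, inner ℝ ν (a i) = (0 : ℝ)) → (inner ℝ ν (evalD D f x) : ℝ) =
      -(α * β') * S ν 0 2 + α * α' * S ν 0 3 - β * β' * S ν 1 2 + β * α' * S ν 1 3 := fun ν hν => by
    rw [h.form_mixed hν, hx, ← hf]
    simp [Fin.sum_univ_four, inner_add_right, real_inner_smul_right, h.inner_a]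
    ring
  have vgy : ∀ ν, (∀ i, inner ℝ ν (a i) = (0 : ℝ)) → (inner ℝ ν (evalD D g y) : ℝ) =
      -(β * α') * S ν 0 2 - β * β' * S ν 0 3 + α * α' * S ν 1 2 + α * β' * S ν 1 3 := fun ν hν => by
    rw [h.form_mixed hν, hy, ← hg]
    obtain ⟨-, -, -, -, -, -, -, y1, y2, y3, y4⟩ := QB_entries (h.type ν hν)
    simp [Fin.sum_univ_four, inner_add_right, real_inner_smul_right, h.inner_a, y1, y2, y3, y4]
    ring
  obtain ⟨ν₀, ν₁, h₀, h₁, hd⟩ := h.rank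
  -- in the rotated frame the upper right blocks have a vanishing corner
  have hdet : inner ℝ ν₀ (evalD D f x) * inner ℝ ν₁ (evalD D g y) -
      inner ℝ ν₀ (evalD D g y) * inner ℝ ν₁ (evalD D f x) ≠ (0 : ℝ) := by
    intro hz
    have p0 := hxy ν₀ h₀
    have p1 := hxy ν₁ h₁
    rw [vfx ν₀ h₀, vfx ν₁ h₁, vgy ν₀ h₀, vgy ν₁ h₁] at hz
    refine hd (hyperdet_eq_zero_of_corner hαβ hαβ' ?_ ?_ ?_) <;>
    simp only [Matrix.cons_val_zero, Matrix.cons_val_one]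
    exacts [p0, p1, hz]
  have ap : ∀ {z w : R2}, (∀ ν, (∀ i, inner ℝ ν (a i) = (0 : ℝ)) → (inner ℝ ν (evalD D z w) : ℝ) = 0) →
      ∃ l, evalD D z w = evalC M l := fun {z w} hν => h.mem_plane (fun i => by
        simp [evalD, Fin.sum_univ_two, inner_add_right, real_inner_smul_right, h.e_D]) hν
  refine ⟨h.nondeg_of_frame h₀ h₁ ![f, g] ![x, y] ?_, f, g, ⟨nx, ny, nxy, ap vgx, ap vfy, ?_, ?_⟩,
    h.mem_plane (fun i => h.e_Y i f f) vff, h.mem_plane (fun i => h.e_Y i g g) vgg⟩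
  · have e1 := vgx ν₀ h₀
    have e2 := vgx ν₁ h₁
    have e3 := vfy ν₀ h₀
    have e4 := vfy ν₁ h₁
    intro hz
    simp only [hyperdet, Matrix.cons_val_zero, Matrix.cons_val_one, e1, e2, e3, e4] at hz
    apply hdet
    apply pow_eq_zero_iff (two_ne_zero) |>.1
    linear_combination -hz
  · rw [← hf, ← hg]
    simp [-inner_self_eq_norm_sq_to_K, inner_add_left, inner_add_right, real_inner_smul_left, real_inner_smul_right, h.inner_a]
  · have hMfg : ∀ m : Fin 2 → ℝ, ∑ b, m b • ![evalC M f, evalC M g] b = 0 → m = 0 := fun m hm' => by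
      rw [← hf, ← hg] at hm'
      simp only [Fin.sum_univ_two, Matrix.cons_val_zero, Matrix.cons_val_one] at hm'
      have c0 := congrArg (fun u => (inner ℝ (-β' • a 2 + α' • a 3) u : ℝ)) hm'
      have c1 := congrArg (fun u => (inner ℝ (-β • a 0 + α • a 1) u : ℝ)) hm'
      simp [-inner_self_eq_norm_sq_to_K, inner_add_left, inner_add_right, real_inner_smul_left, real_inner_smul_right,
        h.inner_a] at c0 c1
      ext i; fin_cases i
      · change m 0 = 0
        linear_combination c0 - m 0 * hαβ'
      · change m 1 = 0
        linear_combination c1 - m 1 * hαβ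
    have hn : ∀ ν, (∀ i, inner ℝ ν (a i) = (0 : ℝ)) → ∀ τ, (inner ℝ ν (evalC M τ) : ℝ) = 0 :=
      fun ν hν τ => by rw [evalC_eq e M]; exact h.normal_evalC hν 0 τ
    have := linearIndependent_of_functionals (n₀ := evalD D f x) (n₁ := evalD D g y) hMfg
      (ν := ![(innerSL ℝ ν₀).toLinearMap, (innerSL ℝ ν₁).toLinearMap]) (fun k b => by
        fin_cases k <;> fin_cases b
        exacts [hn ν₀ h₀ f, hn ν₀ h₀ g, hn ν₁ h₁ f, hn ν₁ h₁ g]) (by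
        simp only [Matrix.cons_val_zero, Matrix.cons_val_one]; exact hdet)
    simpa only [Matrix.cons_val_zero, Matrix.cons_val_one] using this

/-- At a point of type B, either the ruling is an eigenspace of the reflection, and all second
covariant derivatives are flat, or it contains a vector of each eigenspace. -/
theorem alternative (h : TypeBPoint e M D Y a S) :
    Nondeg D M ∧ ((∀ v w, ∃ l, Y v w = evalC M l) ∨ ∃ x y f g, MixedFrame M D x y f g ∧
      (∃ l, Y f f = evalC M l) ∧ ∃ l, Y g g = evalC M l) := by
  by_cases hn : ∀ i, inner ℝ (a 2) (e i) = (0 : ℝ) ∧ inner ℝ (a 3) (e i) = (0 : ℝ)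
  · have := h.flat_of_eigenspace (σ := ![0, 1, 2, 3]) (Or.inl rfl) hn
    exact ⟨this.1, Or.inl this.2⟩
  by_cases hp : ∀ i, inner ℝ (a 0) (e i) = (0 : ℝ) ∧ inner ℝ (a 1) (e i) = (0 : ℝ)
  · have := h.flat_of_eigenspace (σ := ![2, 3, 0, 1]) (Or.inr rfl) hp
    exact ⟨this.1, Or.inl this.2⟩
  push Not at hn hp
  obtain ⟨i, hi⟩ := hp
  obtain ⟨j, hj⟩ := hn
  have hexp : ∀ i, e i = (inner ℝ (a 0) (e i) : ℝ) • a 0 + (inner ℝ (a 1) (e i) : ℝ) • a 1 +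
      (inner ℝ (a 2) (e i) : ℝ) • a 2 + (inner ℝ (a 3) (e i) : ℝ) • a 3 := fun i => by
    have := h.expand (Pi.single i 1) 0
    rwa [← e_eq, Fin.sum_univ_four] at this
  -- normalization of a vector of an eigenspace
  have nrm : ∀ {α β : ℝ}, ¬(α = 0 ∧ β = 0) → ∀ {u v : H} {c : Fin 2 → ℝ}, α • u + β • v = ∑ k, c k • e k →
      ∃ (x : R2) (α' β' : ℝ), ∑ k, x k • e k = α' • u + β' • v ∧ α' ^ 2 + β' ^ 2 = 1 := by
    intro α β hαβ u v c hc
    have hpos : 0 < α ^ 2 + β ^ 2 := by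
      rcases not_and_or.1 hαβ with h | h <;> positivity
    refine ⟨(Real.sqrt (α ^ 2 + β ^ 2))⁻¹ • c, (Real.sqrt (α ^ 2 + β ^ 2))⁻¹ * α,
      (Real.sqrt (α ^ 2 + β ^ 2))⁻¹ * β, ?_, ?_⟩
    · rw [mul_smul, mul_smul, ← smul_add, hc, Finset.smul_sum]
      simp [smul_smul]
    · rw [mul_pow, mul_pow, inv_pow, Real.sq_sqrt hpos.le, ← mul_add, inv_mul_cancel₀ hpos.ne']
  -- the projections to the two eigenspaces preserve the ruling
  have half : ∀ (i : Fin 2) (σ : ℝ), ∃ c : Fin 2 → ℝ, (1 / 2 : ℝ) • (e i + σ • ((inner ℝ (a 0) (e i) : ℝ) • a 0 +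
      (inner ℝ (a 1) (e i) : ℝ) • a 1 - (inner ℝ (a 2) (e i) : ℝ) • a 2 -
      (inner ℝ (a 3) (e i) : ℝ) • a 3)) = ∑ k, c k • e k := fun i σ => by
    obtain ⟨c, hc⟩ := h.refl i
    rw [hc]
    refine ⟨fun k => (1 / 2) * ((Pi.single i 1 : R2) k + σ * c k), ?_⟩
    have : e i = ∑ k, (Pi.single i 1 : R2) k • e k := by simp [Pi.single_apply]
    conv_lhs => rw [this]
    simp only [Fin.sum_univ_two]; module
  obtain ⟨c, hc⟩ := half i 1
  obtain ⟨c', hc'⟩ := half j (-1)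
  obtain ⟨x, α, β, hx, hαβ⟩ := nrm (α := inner ℝ (a 0) (e i)) (β := inner ℝ (a 1) (e i))
    (fun hz => hi hz.1 hz.2) (u := a 0) (v := a 1) (c := c) (by
      rw [← hc]; conv_rhs => rw [hexp i]
      simp only [inner_add_right, real_inner_smul_right, h.inner_a]
      simp; module)
  obtain ⟨y, α', β', hy, hαβ'⟩ := nrm (α := inner ℝ (a 2) (e j)) (β := inner ℝ (a 3) (e j))
    (fun hz => hj hz.1 hz.2) (u := a 2) (v := a 3) (c := c') (by
      rw [← hc']; conv_rhs => rw [hexp j]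
      simp only [inner_add_right, real_inner_smul_right, h.inner_a]
      simp; module)
  obtain ⟨hN, f, g, hfg⟩ := h.mixed_of_vectors hx hy hαβ hαβ'
  exact ⟨hN, Or.inr ⟨x, y, f, g, hfg⟩⟩

end TypeBPoint
end TypeB

/-! ### Parametrizations of an immersed submanifold by a linear projection -/

section Immersed

open Filter Topology

variable {X : Type*} [TopologicalSpace X] [ChartedSpace E4 X] {F : X → E6} {E : X → Submodule ℝ E6}

theorem contDiffOn_chartRep [IsManifold (𝓡 4) ∞ X] (hF : ContMDiff (𝓡 4) 𝓘(ℝ, E6) ∞ F) (x : X) :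
    ContDiffOn ℝ ∞ (chartRep F x) (chartAt E4 x).target :=
  contMDiffOn_iff_contDiffOn.1 (hF.comp_contMDiffOn (contMDiffOn_chart_symm (I := 𝓡 4)))

theorem hasFDerivAt_chartRep [IsManifold (𝓡 4) ∞ X] (hF : ContMDiff (𝓡 4) 𝓘(ℝ, E6) ∞ F) (x : X) :
    HasFDerivAt (chartRep F x) (tangentMap4 F x) (chartAt E4 x x) := by
  have hm : MDifferentiableAt (𝓡 4) 𝓘(ℝ, E6) F x := (hF x).mdifferentiableAt (by simp)
  have h : tangentMap4 F x = fderiv ℝ (chartRep F x) (chartAt E4 x x) := by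
    refine (show tangentMap4 F x = fderivWithin ℝ (writtenInExtChartAt (𝓡 4) 𝓘(ℝ, E6) x F)
      (Set.range (𝓡 4)) (extChartAt (𝓡 4) x x) from hm.mfderiv).trans ?_
    simp [writtenInExtChartAt, chartRep, fderivWithin_univ, Function.comp_def, chartAt_self_eq]
  rw [h]
  exact (((contDiffOn_chartRep hF x).contDiffAt ((chartAt E4 x).open_target.mem_nhds
    (mem_chart_target E4 x))).differentiableAt (by simp)).hasFDerivAt

/-- The linear map `L` is injective on the piece `N` of the submanifold, with image the convex open
set `O`; its inverse `ζ` is a smooth parametrization of `N`. -/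
structure LinearParametrization (F : X → E6) (L : E6 →L[ℝ] E4) (O : Set E4) (ζ : E4 → X)
    (N : Set X) : Prop where
  convex : Convex ℝ O
  isOpen : IsOpen O
  isOpen_image : IsOpen N
  maps : ∀ x ∈ N, L (F x) ∈ O
  left : ∀ x ∈ N, ζ (L (F x)) = x
  mem : ∀ z ∈ O, ζ z ∈ N
  right : ∀ z ∈ O, L (F (ζ z)) = z
  smooth : ContMDiffOn 𝓘(ℝ, E4) (𝓡 4) ∞ ζ O

/-- Near a point, an immersion is inverted by a linear map: a left inverse of its differential. -/
theorem exists_linearParametrization [IsManifold (𝓡 4) ∞ X] (hF : ContMDiff (𝓡 4) 𝓘(ℝ, E6) ∞ F)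
    (x₀ : X) (hinj : Function.Injective (tangentMap4 F x₀)) :
    ∃ L O ζ N, LinearParametrization F L O ζ N ∧ x₀ ∈ N := by
  obtain ⟨L', hL'⟩ := (tangentMap4 F x₀).toLinearMap.exists_leftInverse_of_injective
    (LinearMap.ker_eq_bot.2 hinj)
  set L : E6 →L[ℝ] E4 := L'.toContinuousLinearMap with hL
  set φ := chartAt E4 x₀ with hφ
  set G : E4 → E4 := fun z => L (chartRep F x₀ z) with hG
  have hf := contDiffOn_chartRep hF x₀
  have hGs : ContDiffOn ℝ ∞ G φ.target := L.contDiff.comp_contDiffOn hf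
  have hGd : HasFDerivAt G ((ContinuousLinearEquiv.refl ℝ E4 : E4 ≃L[ℝ] E4) : E4 →L[ℝ] E4) (φ x₀) := by
    have := L.hasFDerivAt.comp (φ x₀) (hasFDerivAt_chartRep hF x₀)
    have hid : L.comp (tangentMap4 F x₀) =
        ((ContinuousLinearEquiv.refl ℝ E4 : E4 ≃L[ℝ] E4) : E4 →L[ℝ] E4) := by
      apply ContinuousLinearMap.ext
      intro v
      exact LinearMap.congr_fun hL' v
    rwa [hid] at this
  have hGa : ∀ z ∈ φ.target, ContDiffAt ℝ ∞ G z := fun z hz =>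
    hGs.contDiffAt (φ.open_target.mem_nhds hz)
  set Ψ₁ := (hGa _ (mem_chart_target E4 x₀)).toOpenPartialHomeomorph G hGd (by simp) with hΨ₁
  have cΨ₁ : (Ψ₁ : E4 → E4) = G := ContDiffAt.toOpenPartialHomeomorph_coe _ _ _
  -- the set where the derivative is invertible
  set T := φ.target ∩ fderiv ℝ G ⁻¹' Set.range ((↑) : (E4 ≃L[ℝ] E4) → E4 →L[ℝ] E4) with hT
  have hTo : IsOpen T := (hGs.continuousOn_fderiv_of_isOpen φ.open_target (by simp)).isOpen_inter_preimage
    φ.open_target ContinuousLinearEquiv.isOpen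
  have hT₀ : φ x₀ ∈ T := ⟨mem_chart_target E4 x₀, ⟨_, hGd.fderiv.symm⟩⟩
  set Ψ := φ.trans (Ψ₁.restrOpen T hTo) with hΨ
  have hx₀ : x₀ ∈ Ψ.source := by
    simp only [hΨ, OpenPartialHomeomorph.trans_source, OpenPartialHomeomorph.restrOpen_source]
    exact ⟨mem_chart_source E4 x₀, ContDiffAt.mem_toOpenPartialHomeomorph_source _ _ _, hT₀⟩
  have cΨ : ∀ x ∈ Ψ.source, Ψ x = L (F x) := fun x hx => by
    have hx' : x ∈ φ.source := hx.1
    change Ψ₁ (φ x) = _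
    rw [cΨ₁, hG]
    simp only [chartRep, Function.comp_apply]
    rw [φ.left_inv hx']
  obtain ⟨r, hr, hball⟩ := Metric.isOpen_iff.1 Ψ.open_target _ (Ψ.map_source hx₀)
  refine ⟨L, Metric.ball (Ψ x₀) r, Ψ.symm, Ψ.source ∩ Ψ ⁻¹' Metric.ball (Ψ x₀) r,
    ⟨convex_ball _ _, Metric.isOpen_ball, Ψ.isOpen_inter_preimage Metric.isOpen_ball,
      fun x hx => by rw [← cΨ x hx.1]; exact hx.2, fun x hx => by
        rw [← cΨ x hx.1]; exact Ψ.left_inv hx.1,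
      fun z hz => ⟨Ψ.map_target (hball hz), by
        rw [Set.mem_preimage, Ψ.right_inv (hball hz)]; exact hz⟩, fun z hz => by
        rw [← cΨ _ (Ψ.map_target (hball hz)), Ψ.right_inv (hball hz)], ?_⟩,
    hx₀, Metric.mem_ball_self hr⟩
  have hsymm : ∀ z ∈ Metric.ball (Ψ x₀) r, ContDiffAt ℝ ∞ Ψ₁.symm z ∧ Ψ₁.symm z ∈ φ.target := by
    intro z hz
    have hz' : z ∈ (Ψ₁.restrOpen T hTo).target := (hball hz).1
    have hw := (Ψ₁.restrOpen T hTo).map_target hz'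
    rw [OpenPartialHomeomorph.restrOpen_source] at hw
    have hw' : Ψ₁.symm z ∈ T := hw.2
    obtain ⟨A, hA⟩ := hw'.2
    refine ⟨Ψ₁.contDiffAt_symm (f₀' := A) ?_ ?_ ?_, hw'.1⟩
    · have := Ψ₁.map_source hw.1
      have hz2 : z = Ψ₁ (Ψ₁.symm z) := ((Ψ₁.restrOpen T hTo).right_inv hz').symm
      rw [hz2]; exact this
    · rw [cΨ₁, hA]
      exact ((hGa _ hw'.1).differentiableAt (by simp)).hasFDerivAt
    · rw [cΨ₁]; exact hGa _ hw'.1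
  exact (contMDiffOn_chart_symm (I := 𝓡 4) (x := x₀)).comp
    (contMDiffOn_iff_contDiffOn.2 fun z hz => (hsymm z hz).1.contDiffWithinAt)
    fun z hz => (hsymm z hz).2

namespace LinearParametrization

variable {L : E6 →L[ℝ] E4} {O : Set E4} {ζ : E4 → X} {N : Set X}

theorem contDiffOn [IsManifold (𝓡 4) ∞ X] (hP : LinearParametrization F L O ζ N)
    (hF : ContMDiff (𝓡 4) 𝓘(ℝ, E6) ∞ F) : ContDiffOn ℝ ∞ (F ∘ ζ) O :=
  contMDiffOn_iff_contDiffOn.1 (hF.comp_contMDiffOn hP.smooth)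

theorem contDiffOn_proj [IsManifold (𝓡 4) ∞ X] (hP : LinearParametrization F L O ζ N)
    (hE : IsTwoRuled F E) : ContDiffOn ℝ ∞ (fun z => (E (ζ z)).starProjection) O :=
  contMDiffOn_iff_contDiffOn.1 (hE.smooth.comp_contMDiffOn hP.smooth)

theorem starProjection_injective {V W : Submodule ℝ E6} (h : V.starProjection = W.starProjection) :
    V = W := by
  rw [← Submodule.range_starProjection V, h, Submodule.range_starProjection]

/-- The leaves of the ruling are affine as far as the parametrization reaches. -/
theorem leaf [IsManifold (𝓡 4) ∞ X] (hP : LinearParametrization F L O ζ N)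
    (hF : ContMDiff (𝓡 4) 𝓘(ℝ, E6) ∞ F) (hE : IsTwoRuled F E) {z : E4} (hz : z ∈ O) {v : E6}
    (hv : v ∈ E (ζ z)) (hzv : z + L v ∈ O) :
    F (ζ (z + L v)) = F (ζ z) + v ∧ E (ζ (z + L v)) = E (ζ z) := by
  set c : ℝ → E4 := fun τ => z + τ • L v with hc
  have hcO : ∀ τ ∈ Set.Icc (0 : ℝ) 1, c τ ∈ O := fun τ hτ => by
    have := hP.convex.add_smul_mem hz hzv hτ
    exact this
  have hcc : Continuous c := by fun_prop
  -- the parameters up to which the segment is ruled form a closed set that is open to the right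
  set S : Set ℝ := {τ | F (ζ (c τ)) = F (ζ z) + τ • v ∧ E (ζ (c τ)) = E (ζ z)} with hS
  have hclosed : IsClosed (S ∩ Set.Icc 0 1) := by
    have h1 : ContinuousOn (fun τ => F (ζ (c τ)) - τ • v) (Set.Icc 0 1) :=
      ((hP.contDiffOn hF).continuousOn.comp hcc.continuousOn hcO).sub (by fun_prop)
    have h2 : ContinuousOn (fun τ => (E (ζ (c τ))).starProjection) (Set.Icc 0 1) :=
      (hP.contDiffOn_proj hE).continuousOn.comp hcc.continuousOn hcO
    have h3 := (h1.prodMk h2).preimage_isClosed_of_isClosed isClosed_Icc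
      (isClosed_singleton (x := (F (ζ z), (E (ζ z)).starProjection)))
    convert h3 using 1
    ext τ
    simp only [hS, Set.mem_inter_iff, Set.mem_ofPred_eq, Set.mem_preimage, Set.mem_singleton_iff,
      Prod.mk.injEq]
    constructor
    · rintro ⟨⟨a, b⟩, c⟩
      exact ⟨c, by rw [a]; abel, by rw [b]⟩
    · rintro ⟨c, a, b⟩
      exact ⟨⟨by rw [← a]; abel, starProjection_injective b⟩, c⟩
  have hsub : Set.Icc (0 : ℝ) 1 ⊆ S := by
    refine hclosed.Icc_subset_of_forall_mem_nhdsWithin (by simp [hS, hc]) ?_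
    rintro τ ⟨⟨hτ1, hτ2⟩, hτ⟩
    obtain ⟨ε, hε, σ, hσ, hσ0, hσl⟩ := hE.leaf (ζ (c τ))
    set v' : E (ζ (c τ)) := ⟨v, by rw [hτ2]; exact hv⟩ with hv'
    have hk : Continuous fun δ : ℝ => (δ - τ) • v' := by fun_prop
    have hk0 : (τ - τ) • v' = 0 := by simp
    have hball : ∀ᶠ δ in 𝓝 τ, (δ - τ) • v' ∈ Metric.ball (0 : E (ζ (c τ))) ε :=
      hk.continuousAt.eventually (by
        change Metric.ball _ ε ∈ 𝓝 ((τ - τ) • v')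
        rw [hk0]; exact Metric.ball_mem_nhds 0 hε)
    have hN : ∀ᶠ δ in 𝓝 τ, σ ((δ - τ) • v') ∈ N := by
      have : ContinuousAt (fun δ : ℝ => σ ((δ - τ) • v')) τ :=
        ContinuousAt.comp (g := σ) (by
          rw [hk0]; exact hσ.continuousAt (Metric.ball_mem_nhds 0 hε)) hk.continuousAt
      apply this.eventually
      change ∀ᶠ y in 𝓝 (σ ((τ - τ) • v')), y ∈ N
      rw [hk0, hσ0]
      exact hP.isOpen_image.mem_nhds (hP.mem _ (hcO τ ⟨hτ.1, hτ.2.le⟩))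
    apply mem_nhdsWithin_of_mem_nhds
    filter_upwards [hball, hN] with δ h1 h2
    obtain ⟨h3, h4⟩ := hσl _ h1
    have h5 : L (F (σ ((δ - τ) • v'))) = c δ := by
      rw [h3, map_add, hP.right _ (hcO τ ⟨hτ.1, hτ.2.le⟩)]
      simp only [hc, hv', Submodule.coe_smul, map_smul]; module
    have h6 := hP.left _ h2
    rw [h5] at h6
    refine ⟨?_, by rw [h6, h4, hτ2]⟩
    rw [h6, h3, hτ1]
    simp only [hv', Submodule.coe_smul]; module
  have := hsub (Set.right_mem_Icc.2 zero_le_one)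
  simpa [hS, hc] using this

end LinearParametrization

/-- The second derivative of `F ∘ ψ` in normal directions is the second fundamental form. -/
theorem inner_fderiv_fderiv_comp [IsManifold (𝓡 4) ∞ X] (hF : ContMDiff (𝓡 4) 𝓘(ℝ, E6) ∞ F)
    {W : Type*} [NormedAddCommGroup W] [NormedSpace ℝ W] {Ω : Set W} (hΩ : IsOpen Ω) {ψ : W → X}
    (hψ : ContMDiffOn 𝓘(ℝ, W) (𝓡 4) ∞ ψ Ω) {w : W} (hw : w ∈ Ω) :
    ∃ κ : W →L[ℝ] E4, fderiv ℝ (F ∘ ψ) w = (tangentMap4 F (ψ w)).comp κ ∧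
      ∀ ν ∈ (tangentPlane F (ψ w))ᗮ, ∀ k l, (inner ℝ ν (fderiv ℝ (fderiv ℝ (F ∘ ψ)) w k l) : ℝ) =
        inner ℝ ν (secondFF F (ψ w) (κ k) (κ l)) := by
  set φ := chartAt E4 (ψ w) with hφ
  set f := chartRep F (ψ w) with hf
  set Ω' := Ω ∩ ψ ⁻¹' φ.source with hΩ'
  have hΩo : IsOpen Ω' := hψ.continuousOn.isOpen_inter_preimage hΩ φ.open_source
  have hw' : w ∈ Ω' := ⟨hw, mem_chart_source E4 (ψ w)⟩
  have hk : ContDiffOn ℝ ∞ (φ ∘ ψ) Ω' := contMDiffOn_iff_contDiffOn.1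
    ((contMDiffOn_chart (I := 𝓡 4)).comp (hψ.mono Set.inter_subset_left) fun z hz => hz.2)
  have hfs := contDiffOn_chartRep hF (ψ w)
  have hfa : ∀ z ∈ Ω', ContDiffAt ℝ ∞ f (φ (ψ z)) := fun z hz =>
    hfs.contDiffAt (φ.open_target.mem_nhds (φ.map_source hz.2))
  have hka : ∀ z ∈ Ω', ContDiffAt ℝ ∞ (φ ∘ ψ) z := fun z hz => hk.contDiffAt (hΩo.mem_nhds hz)
  have heq : ∀ z ∈ Ω', (F ∘ ψ) z = (f ∘ (φ ∘ ψ)) z := fun z hz => by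
    simp only [hf, chartRep, Function.comp_apply]
    rw [φ.left_inv hz.2]
  have hd : ∀ z ∈ Ω', fderiv ℝ (F ∘ ψ) z = (fderiv ℝ f (φ (ψ z))).comp (fderiv ℝ (φ ∘ ψ) z) :=
    fun z hz => by
    rw [Filter.EventuallyEq.fderiv_eq (Filter.eventually_of_mem (hΩo.mem_nhds hz) heq)]
    exact fderiv_comp z ((hfa z hz).differentiableAt (by simp)) ((hka z hz).differentiableAt (by simp))
  have hA : fderiv ℝ f (φ (ψ w)) = tangentMap4 F (ψ w) := (hasFDerivAt_chartRep hF (ψ w)).fderiv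
  refine ⟨fderiv ℝ (φ ∘ ψ) w, by rw [hd w hw', hA], fun ν hν k l => ?_⟩
  have hfd : DifferentiableAt ℝ (fderiv ℝ f) (φ (ψ w)) :=
    ((hfa w hw').fderiv_right (m := ∞) (by simp)).differentiableAt (by simp)
  have hkd : DifferentiableAt ℝ (fderiv ℝ (φ ∘ ψ)) w :=
    ((hka w hw').fderiv_right (m := ∞) (by simp)).differentiableAt (by simp)
  have hkw : DifferentiableAt ℝ (φ ∘ ψ) w := (hka w hw').differentiableAt (by simp)
  have h1 := (hfd.hasFDerivAt.comp w hkw.hasFDerivAt).clm_comp hkd.hasFDerivAt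
  rw [Filter.EventuallyEq.fderiv_eq (Filter.eventually_of_mem (hΩo.mem_nhds hw') hd)]
  have h2 := congrArg (fun T => T k l) h1.fderiv
  change (fderiv ℝ (fun z => (fderiv ℝ f (φ (ψ z))).comp (fderiv ℝ (φ ∘ ψ) z)) w) k l = _ at h2
  rw [h2]
  have hn : ∀ u, (inner ℝ ν (tangentMap4 F (ψ w) u) : ℝ) = 0 := fun u => by
    rw [real_inner_comm]
    exact hν _ ⟨u, rfl⟩
  rw [secondFF, ← Submodule.inner_starProjection_left_eq_right,
    Submodule.starProjection_eq_self_iff.2 hν]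
  simp [hA, hn, inner_add_right]
  rfl

end Immersed

/-! ### Parametrizations along the ruling -/

section RuledChart

open Filter Topology

section Calculus

variable {H : Type*} [NormedAddCommGroup H] [NormedSpace ℝ H]

/-- The points of the family of planes through `γ` spanned by `e`. -/
def ruledMap (e : Fin 2 → R2 → H) (γ : R2 → H) (w : R2 × R2) : H := γ w.1 + ∑ i, w.2 i • e i w.1

theorem hasFDerivAt_ruledMap {e : Fin 2 → R2 → H} {γ : R2 → H} {w : R2 × R2}
    (he : ∀ i, DifferentiableAt ℝ (e i) w.1) (hγ : DifferentiableAt ℝ γ w.1) :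
    DifferentiableAt ℝ (ruledMap e γ) w ∧ ∀ τ x : R2, fderiv ℝ (ruledMap e γ) w (τ, x) =
      pd τ γ w.1 + ∑ i, w.2 i • pd τ (e i) w.1 + ∑ i, x i • e i w.1 := by
  have h1 : HasFDerivAt (fun w : R2 × R2 => γ w.1) _ w := hγ.hasFDerivAt.comp w hasFDerivAt_fst
  have h2 : ∀ i, HasFDerivAt (fun w : R2 × R2 => e i w.1) _ w := fun i =>
    (he i).hasFDerivAt.comp w hasFDerivAt_fst
  have h3 : ∀ i : Fin 2, HasFDerivAt (fun w : R2 × R2 => w.2 i) _ w := fun i =>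
    (ContinuousLinearMap.hasFDerivAt ((ContinuousLinearMap.proj (R := ℝ) (φ := fun _ : Fin 2 => ℝ) i).comp
      (ContinuousLinearMap.snd ℝ R2 R2)))
  have h := h1.add (HasFDerivAt.fun_sum fun i (_ : i ∈ Finset.univ) => (h3 i).smul (h2 i))
  have h' : HasFDerivAt (ruledMap e γ) _ w := h
  refine ⟨h'.differentiableAt, fun τ x => ?_⟩
  rw [h'.fderiv]
  simp [Fin.sum_univ_two, pd]
  module

theorem contDiffOn_ruledMap {U : Set R2} {e : Fin 2 → R2 → H} {γ : R2 → H}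
    (he : ∀ i, ContDiffOn ℝ ∞ (e i) U) (hγ : ContDiffOn ℝ ∞ γ U) :
    ContDiffOn ℝ ∞ (ruledMap e γ) (U ×ˢ Set.univ) := by
  have hfst : ContDiffOn ℝ ∞ (Prod.fst : R2 × R2 → R2) (U ×ˢ Set.univ) := contDiff_fst.contDiffOn
  refine (hγ.comp hfst fun w hw => hw.1).add (ContDiffOn.sum fun i _ => ContDiffOn.smul ?_
    ((he i).comp hfst fun w hw => hw.1))
  exact ((ContinuousLinearMap.proj (R := ℝ) (φ := fun _ : Fin 2 => ℝ) i).comp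
      (ContinuousLinearMap.snd ℝ R2 R2)).contDiff.contDiffOn

end Calculus

theorem starProjection_eq_of_orthonormal {V : Submodule ℝ E6} (hV : Module.finrank ℝ V = 2)
    {a b : E6} (ha : a ∈ V) (hb : b ∈ V) (haa : inner ℝ a a = (1 : ℝ)) (hbb : inner ℝ b b = (1 : ℝ))
    (hab : inner ℝ a b = (0 : ℝ)) (w : E6) :
    V.starProjection w = (inner ℝ a w : ℝ) • a + (inner ℝ b w : ℝ) • b := by
  have hba : inner ℝ b a = (0 : ℝ) := by rw [real_inner_comm]; exact hab
  have hli : LinearIndependent ℝ ![a, b] := by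
    rw [LinearIndependent.pair_iff]
    intro s t hst
    constructor
    · have := congrArg (fun u => (inner ℝ a u : ℝ)) hst
      simpa only [inner_add_right, real_inner_smul_right, haa, hab, mul_one, mul_zero, add_zero,
        inner_zero_right] using this
    · have := congrArg (fun u => (inner ℝ b u : ℝ)) hst
      simpa only [inner_add_right, real_inner_smul_right, hbb, hba, mul_one, mul_zero, zero_add,
        inner_zero_right] using this
  have hspan : Submodule.span ℝ (Set.range ![a, b]) = V := by
    apply Submodule.eq_of_le_of_finrank_eq
    · rw [Submodule.span_le]
      rintro _ ⟨i, rfl⟩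
      fin_cases i
      exacts [ha, hb]
    · rw [finrank_span_eq_card hli, hV]; rfl
  refine Submodule.eq_starProjection_of_mem_of_inner_eq_zero
    (V.add_mem (V.smul_mem _ ha) (V.smul_mem _ hb)) fun u hu => ?_
  rw [← hspan] at hu
  induction hu using Submodule.span_induction with
  | mem x hx =>
    obtain ⟨i, rfl⟩ := hx
    fin_cases i
    · change (inner ℝ (w - _) a : ℝ) = 0
      rw [real_inner_comm]
      simp only [inner_sub_right, inner_add_right, real_inner_smul_right, haa, hab]; ring
    · change (inner ℝ (w - _) b : ℝ) = 0
      rw [real_inner_comm]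
      simp only [inner_sub_right, inner_add_right, real_inner_smul_right, hba, hbb]; ring
  | zero => simp
  | add x y _ _ hx hy => rw [inner_add_right, hx, hy, add_zero]
  | smul c x _ hx => rw [real_inner_smul_right, hx, mul_zero]

/-- A smooth family of planes has a smooth orthonormal frame. -/
theorem exists_rulingFrame {U : Set R2} (hU : IsOpen U) {V : R2 → Submodule ℝ E6}
    (hV : ∀ t ∈ U, Module.finrank ℝ (V t) = 2)
    (hP : ContDiffOn ℝ ∞ (fun t => (V t).starProjection) U) {t₀ : R2} (ht₀ : t₀ ∈ U) :
    ∃ U' ⊆ U, t₀ ∈ U' ∧ ∃ e, RulingFrame U' (fun t => (V t).starProjection) e ∧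
      ∀ t ∈ U', ∀ i, e i t ∈ V t := by
  set b := (stdOrthonormalBasis ℝ (V t₀)).reindex (finCongr (hV t₀ ht₀)) with hb
  set v : Fin 2 → E6 := fun i => (b i : E6) with hv
  have hvv : ∀ i j, (inner ℝ (v i) (v j) : ℝ) = if i = j then 1 else 0 :=
    fun i j => orthonormal_iff_ite.1 b.orthonormal i j
  set p : Fin 2 → R2 → E6 := fun i t => (V t).starProjection (v i) with hp
  have hps : ∀ i, ContDiffOn ℝ ∞ (p i) U := fun i => hP.clm_apply contDiffOn_const
  have hp₀ : ∀ i, p i t₀ = v i := fun i =>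
    Submodule.starProjection_eq_self_iff.2 (b i).2
  have hpV : ∀ i t, p i t ∈ V t := fun i t => Submodule.starProjection_apply_mem _ _
  set U₁ := U ∩ p 0 ⁻¹' {0}ᶜ with hU₁
  have hU₁o : IsOpen U₁ := (hps 0).continuousOn.isOpen_inter_preimage hU isOpen_compl_singleton
  set e₀ : R2 → E6 := fun t => ‖p 0 t‖⁻¹ • p 0 t with he₀
  have he₀s : ContDiffOn ℝ ∞ e₀ U₁ := by
    have h0 : ContDiffOn ℝ ∞ (p 0) U₁ := (hps 0).mono Set.inter_subset_left
    exact ((h0.norm ℝ fun t ht => ht.2).inv fun t ht => norm_ne_zero_iff.2 ht.2).smul h0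
  have n0 : ∀ t ∈ U₁, (inner ℝ (e₀ t) (e₀ t) : ℝ) = 1 := fun t ht => by
    have : ‖p 0 t‖ ≠ 0 := norm_ne_zero_iff.2 ht.2
    rw [real_inner_self_eq_norm_sq, norm_smul, norm_inv, norm_norm, inv_mul_cancel₀ this, one_pow]
  set q : R2 → E6 := fun t => p 1 t - (inner ℝ (e₀ t) (p 1 t) : ℝ) • e₀ t with hq
  have hqs : ContDiffOn ℝ ∞ q U₁ := by
    have h1 : ContDiffOn ℝ ∞ (p 1) U₁ := (hps 1).mono Set.inter_subset_left
    exact h1.sub ((he₀s.inner ℝ h1).smul he₀s)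
  have hq0 : ∀ t ∈ U₁, (inner ℝ (e₀ t) (q t) : ℝ) = 0 := fun t ht => by
    simp only [hq, inner_sub_right, real_inner_smul_right, n0 t ht]; ring
  set U₂ := U₁ ∩ q ⁻¹' {0}ᶜ with hU₂
  have hU₂o : IsOpen U₂ := hqs.continuousOn.isOpen_inter_preimage hU₁o isOpen_compl_singleton
  set e₁ : R2 → E6 := fun t => ‖q t‖⁻¹ • q t with he₁
  have he₁s : ContDiffOn ℝ ∞ e₁ U₂ := by
    have h0 : ContDiffOn ℝ ∞ q U₂ := hqs.mono Set.inter_subset_left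
    exact ((h0.norm ℝ fun t ht => ht.2).inv fun t ht => norm_ne_zero_iff.2 ht.2).smul h0
  have n1 : ∀ t ∈ U₂, (inner ℝ (e₁ t) (e₁ t) : ℝ) = 1 := fun t ht => by
    have : ‖q t‖ ≠ 0 := norm_ne_zero_iff.2 ht.2
    rw [real_inner_self_eq_norm_sq, norm_smul, norm_inv, norm_norm, inv_mul_cancel₀ this, one_pow]
  have h01 : ∀ t ∈ U₂, (inner ℝ (e₀ t) (e₁ t) : ℝ) = 0 := fun t ht => by
    simp only [he₁, real_inner_smul_right, hq0 t ht.1, mul_zero]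
  have m0 : ∀ t, e₀ t ∈ V t := fun t => (V t).smul_mem _ (hpV 0 t)
  have m1 : ∀ t, e₁ t ∈ V t := fun t =>
    (V t).smul_mem _ ((V t).sub_mem (hpV 1 t) ((V t).smul_mem _ (m0 t)))
  have hv0 : ∀ i, v i ≠ 0 := fun i h => by
    have := hvv i i
    rw [h] at this; simp at this
  have ht₁ : t₀ ∈ U₁ := ⟨ht₀, by
    change p 0 t₀ ∈ ({0}ᶜ : Set E6)
    rw [hp₀]; exact hv0 0⟩
  have hq₀ : q t₀ = v 1 := by
    have : (inner ℝ (v 0) (v 1) : ℝ) = 0 := by rw [hvv]; simp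
    simp only [hq, he₀, hp₀, real_inner_smul_left, this]; simp
  have hsub : U₂ ⊆ U := fun t ht => ht.1.1
  refine ⟨U₂, hsub, ⟨ht₁, by change q t₀ ∈ ({0}ᶜ : Set E6); rw [hq₀]; exact hv0 1⟩, ![e₀, e₁],
    ⟨hU₂o, fun i => ?_, fun i t ht => ?_, h01, fun t ht w =>
      starProjection_eq_of_orthonormal (hV t (hsub ht)) (m0 t) (m1 t) (n0 t ht.1) (n1 t ht)
        (h01 t ht) w, hP.mono hsub⟩, fun t ht i => ?_⟩
  · fin_cases i
    exacts [he₀s.mono Set.inter_subset_left, he₁s]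
  · fin_cases i
    exacts [n0 t ht.1, n1 t ht]
  · fin_cases i
    exacts [m0 t, m1 t]

variable {X : Type*} [TopologicalSpace X] [ChartedSpace E4 X] {F : X → E6} {E : X → Submodule ℝ E6}

/-- A parametrization `ψ` of a part of the submanifold, for which `(t, s) ↦ F (ψ (t, s))` is the
affine parametrization of the leaf through `γ t` by its coordinates `s` in the frame `e`. -/
structure RuledChart (F : X → E6) (E : X → Submodule ℝ E6) (U : Set R2) (P : R2 → E6 →L[ℝ] E6)
    (e : Fin 2 → R2 → E6) (γ : R2 → E6) (ρ : ℝ) (ψ : R2 × R2 → X) : Prop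
    extends RulingFrame U P e where
  smooth_base : ContDiffOn ℝ ∞ γ U
  pos : 0 < ρ
  smooth_chart : ContMDiffOn 𝓘(ℝ, R2 × R2) (𝓡 4) ∞ ψ (U ×ˢ Metric.ball 0 ρ)
  chart_eq : ∀ w ∈ U ×ˢ Metric.ball 0 ρ, F (ψ w) = ruledMap e γ w
  mem_plane : ∀ w ∈ U ×ˢ Metric.ball 0 ρ, ∀ i, e i w.1 ∈ E (ψ w)
  immersion : ∀ w ∈ U ×ˢ Metric.ball 0 ρ, Function.Injective (fderiv ℝ (ruledMap e γ) w)

/-- Every point has a neighbourhood covered by a parametrization along the ruling. -/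
theorem exists_ruledChart [IsManifold (𝓡 4) ∞ X] (hF : ContMDiff (𝓡 4) 𝓘(ℝ, E6) ∞ F)
    (hE : IsTwoRuled F E) (x₀ : X) (hinj : Function.Injective (tangentMap4 F x₀)) :
    ∃ U P e γ ρ ψ, RuledChart F E U P e γ ρ ψ ∧ 0 ∈ U ∧
      ∀ V ∈ 𝓝 (0 : R2), ∀ᶠ x in 𝓝 x₀, ∃ t ∈ V, ∃ s : R2, F x = γ t + ∑ i, s i • e i t := by
  obtain ⟨L, O, ζ, N, hP, hx₀⟩ := exists_linearParametrization hF x₀ hinj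
  set z₀ := L (F x₀) with hz₀
  have hz₀O : z₀ ∈ O := hP.maps _ hx₀
  have hζ₀ : ζ z₀ = x₀ := hP.left _ hx₀
  -- `L` is injective on the plane of the ruling
  have hL : ∀ v ∈ E x₀, L v = 0 → v = 0 := by
    intro v hv hLv
    have := hP.leaf hF hE hz₀O (v := v) (by rw [hζ₀]; exact hv) (by rw [hLv, add_zero]; exact hz₀O)
    rw [hLv, add_zero] at this
    exact (left_eq_add.1 this.1)
  have hrank : Module.finrank ℝ ((E x₀).map L.toLinearMap) = 2 := by
    rw [← hE.finrank_eq x₀, ← LinearMap.range_domRestrict]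
    refine LinearMap.finrank_range_of_inj ?_
    rw [← LinearMap.ker_eq_bot, LinearMap.ker_eq_bot']
    exact fun v hv => Subtype.ext (hL v v.2 hv)
  -- the leaves are parametrized by a slice in the direction of a complement `K` of the ruling
  obtain ⟨K, hK⟩ := Submodule.exists_isCompl ((E x₀).map L.toLinearMap)
  have hKr : Module.finrank ℝ K = 2 := by
    have := Submodule.finrank_add_eq_of_isCompl hK
    rw [hrank] at this
    have h4 : Module.finrank ℝ E4 = 4 := by simp
    omega
  obtain ⟨B₀⟩ : Nonempty (R2 ≃ₗ[ℝ] K) := FiniteDimensional.nonempty_linearEquiv_of_finrank_eq (by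
    rw [hKr]; simp)
  set B : R2 →L[ℝ] E4 := (K.subtype ∘ₗ B₀.toLinearMap).toContinuousLinearMap with hB
  have hBinj : ∀ t, B t ∈ (E x₀).map L.toLinearMap → t = 0 := fun t ht => by
    have : (B₀ t : E4) ∈ (E x₀).map L.toLinearMap ⊓ K := ⟨ht, (B₀ t).2⟩
    rw [hK.inf_eq_bot, Submodule.mem_bot] at this
    exact B₀.map_eq_zero_iff.1 (Subtype.ext this)
  set c : R2 → E4 := fun t => z₀ + B t with hc
  have hcs : ContDiff ℝ ∞ c := contDiff_const.add B.contDiff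
  set U₀ := c ⁻¹' O with hU₀
  have hU₀o : IsOpen U₀ := hP.isOpen.preimage hcs.continuous
  have hc0 : c 0 = z₀ := by simp [hc]
  have h0U : (0 : R2) ∈ U₀ := by
    change c 0 ∈ O
    rw [hc0]; exact hz₀O
  obtain ⟨U, hUU, h0, e, hR, heV⟩ := exists_rulingFrame hU₀o (V := fun t => E (ζ (c t)))
    (fun t _ => hE.finrank_eq _)
    ((hP.contDiffOn_proj hE).comp hcs.contDiffOn fun t ht => ht) h0U
  set γ : R2 → E6 := fun t => F (ζ (c t)) with hγ
  have hγs : ContDiffOn ℝ ∞ γ U :=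
    ((hP.contDiffOn hF).comp hcs.contDiffOn fun t ht => ht).mono hUU
  -- the coordinates of the point of the leaf, computed by `L`
  set θ : R2 × R2 → E4 := fun w => L (ruledMap e γ w) with hθ
  have hθs : ContDiffOn ℝ ∞ θ (U ×ˢ Set.univ) :=
    L.contDiff.comp_contDiffOn (contDiffOn_ruledMap hR.smooth hγs)
  have hUo : IsOpen (U ×ˢ (Set.univ : Set R2)) := hR.isOpen.prod isOpen_univ
  have hθd : ∀ w ∈ U ×ˢ (Set.univ : Set R2), fderiv ℝ θ w = L.comp (fderiv ℝ (ruledMap e γ) w) :=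
    fun w hw => (L.hasFDerivAt.comp w ((contDiffOn_ruledMap hR.smooth hγs).contDiffAt
      (hUo.mem_nhds hw) |>.differentiableAt (by simp)).hasFDerivAt).fderiv
  have hθe : ∀ w ∈ U ×ˢ (Set.univ : Set R2), θ w = c w.1 + L (∑ i, w.2 i • e i w.1) := fun w hw => by
    simp only [hθ, ruledMap, map_add]
    rw [hP.right _ (hUU hw.1)]
  have h00 : (0 : R2 × R2) ∈ U ×ˢ (Set.univ : Set R2) := ⟨h0, trivial⟩
  have hθ0 : θ 0 = z₀ := by rw [hθe 0 h00]; simp [hc0]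
  have hpdc : ∀ τ, L (pd τ γ 0) = B τ := fun τ => by
    have h1 : HasFDerivAt (fun t => L (γ t)) _ 0 :=
      L.hasFDerivAt.comp 0 (SmoothOn.differentiableAt hR.isOpen hγs h0).hasFDerivAt
    have h2 : pd τ (fun t => L (γ t)) 0 = pd τ c 0 :=
      pd_congr hR.isOpen (fun t ht => hP.right _ (hUU ht)) h0
    rw [pd, h1.fderiv] at h2
    have h3 : HasFDerivAt c B 0 := B.hasFDerivAt.const_add z₀
    rw [pd, h3.fderiv] at h2
    exact h2
  have hDinj : Function.Injective (fderiv ℝ θ 0) := by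
    rw [injective_iff_map_eq_zero]
    rintro ⟨τ, x⟩ h
    rw [hθd 0 h00, ContinuousLinearMap.comp_apply, (hasFDerivAt_ruledMap (w := 0)
      (fun i => hR.diff h0 i) (SmoothOn.differentiableAt hR.isOpen hγs h0)).2] at h
    simp only [Prod.fst_zero, Prod.snd_zero, Pi.zero_apply, zero_smul, Finset.sum_const_zero,
      add_zero, map_add] at h
    rw [hpdc] at h
    have hmem : ∑ i, x i • e i 0 ∈ E x₀ := (E x₀).sum_mem fun i _ => (E x₀).smul_mem _ (by
      have := heV 0 h0 i
      rwa [hc0, hζ₀] at this)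
    have hτ : τ = 0 := hBinj τ (by
      rw [eq_neg_of_add_eq_zero_left h]
      exact Submodule.neg_mem _ ⟨_, hmem, rfl⟩)
    rw [hτ, map_zero, zero_add] at h
    have hx := hL _ hmem h
    have hx0 := congrArg (fun u => (inner ℝ (e 0 0) u : ℝ)) hx
    have hx1 := congrArg (fun u => (inner ℝ (e 1 0) u : ℝ)) hx
    simp only [Fin.sum_univ_two, inner_add_right, real_inner_smul_right, hR.norm _ 0 h0,
      hR.orth 0 h0, hR.orth' h0, inner_zero_right] at hx0 hx1
    refine Prod.ext hτ ?_
    ext i; fin_cases i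
    · change x 0 = 0
      linarith
    · change x 1 = 0
      linarith
  have hdim : Module.finrank ℝ (R2 × R2) = Module.finrank ℝ E4 := by simp
  have hsurj : ∀ T : (R2 × R2) →L[ℝ] E4, Function.Injective T →
      ∃ A : (R2 × R2) ≃L[ℝ] E4, (A : (R2 × R2) →L[ℝ] E4) = T := fun T hT =>
    ⟨(LinearEquiv.ofInjectiveOfFinrankEq T.toLinearMap hT hdim).toContinuousLinearEquiv, by
      exact ContinuousLinearMap.ext fun v => rfl⟩
  -- the domain of the parametrization
  set T := (U ×ˢ (Set.univ : Set R2)) ∩ (fun w => (θ w, fderiv ℝ θ w)) ⁻¹'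
    (O ×ˢ Set.range ((↑) : ((R2 × R2) ≃L[ℝ] E4) → (R2 × R2) →L[ℝ] E4)) with hT
  have hTo : IsOpen T := (hθs.continuousOn.prodMk
    (hθs.continuousOn_fderiv_of_isOpen hUo (by simp))).isOpen_inter_preimage hUo
    (hP.isOpen.prod ContinuousLinearEquiv.isOpen)
  have h0T : (0 : R2 × R2) ∈ T := ⟨h00, by
    change θ 0 ∈ O
    rw [hθ0]; exact hz₀O, hsurj _ hDinj⟩
  obtain ⟨ρ, hρ, hball⟩ := Metric.isOpen_iff.1 hTo _ h0T
  have hsub : ∀ w ∈ Metric.ball (0 : R2) ρ ×ˢ Metric.ball (0 : R2) ρ, w ∈ T := fun w hw => by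
    apply hball
    rw [← Prod.mk_zero_zero, ← ball_prod_same]; exact hw
  have hUρ : Metric.ball (0 : R2) ρ ⊆ U := fun t ht =>
    (hsub (t, 0) ⟨ht, Metric.mem_ball_self hρ⟩).1.1
  have hψ : ∀ w ∈ Metric.ball (0 : R2) ρ ×ˢ Metric.ball (0 : R2) ρ,
      F (ζ (θ w)) = ruledMap e γ w ∧ E (ζ (θ w)) = E (ζ (c w.1)) := fun w hw => by
    have hwT := hsub w hw
    have hv : ∑ i, w.2 i • e i w.1 ∈ E (ζ (c w.1)) :=
      Submodule.sum_mem _ fun i _ => Submodule.smul_mem _ _ (heV _ hwT.1.1 i)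
    have := hP.leaf hF hE (hUU hwT.1.1) hv (by rw [← hθe w hwT.1]; exact hwT.2.1)
    rw [← hθe w hwT.1] at this
    exact this
  refine ⟨Metric.ball 0 ρ, _, e, γ, ρ, fun w => ζ (θ w), ⟨⟨Metric.isOpen_ball,
    fun i => (hR.smooth i).mono hUρ, fun i t ht => hR.norm i t (hUρ ht),
    fun t ht => hR.orth t (hUρ ht), fun t ht => hR.proj t (hUρ ht), hR.smooth_proj.mono hUρ⟩,
    hγs.mono hUρ, hρ, ?_, fun w hw => (hψ w hw).1, fun w hw i => ?_, fun w hw => ?_⟩,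
    Metric.mem_ball_self hρ, fun V hV => ?_⟩
  · exact hP.smooth.comp (contMDiffOn_iff_contDiffOn.2 (hθs.mono fun w hw => (hsub w hw).1))
      fun w hw => (hsub w hw).2.1
  · rw [(hψ w hw).2]; exact heV _ (hUρ hw.1) i
  · have hwT := hsub w hw
    obtain ⟨A, hA⟩ := hwT.2.2
    have hA' : (A : (R2 × R2) →L[ℝ] E4) = L.comp (fderiv ℝ (ruledMap e γ) w) := by
      rw [← hθd w hwT.1]; exact hA
    have : Function.Injective (L ∘ fderiv ℝ (ruledMap e γ) w) := by
      have h := A.injective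
      rwa [show (A : R2 × R2 → E4) = L ∘ fderiv ℝ (ruledMap e γ) w from
        congrArg (fun T : (R2 × R2) →L[ℝ] E4 => (T : R2 × R2 → E4)) hA'] at h
    exact this.of_comp
  · obtain ⟨A, hA⟩ := hsurj _ hDinj
    have hst : HasStrictFDerivAt θ (A : (R2 × R2) →L[ℝ] E4) 0 := by
      rw [hA]
      exact (hθs.contDiffAt (hUo.mem_nhds h00)).hasStrictFDerivAt (by simp)
    have hmap := hst.map_nhds_eq_of_equiv
    rw [hθ0] at hmap
    have hnb : (V ∩ Metric.ball 0 ρ) ×ˢ Metric.ball (0 : R2) ρ ∈ 𝓝 (0 : R2 × R2) :=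
      prod_mem_nhds (inter_mem hV (Metric.ball_mem_nhds _ hρ)) (Metric.ball_mem_nhds _ hρ)
    have himg : θ '' ((V ∩ Metric.ball 0 ρ) ×ˢ Metric.ball (0 : R2) ρ) ∈ 𝓝 z₀ := by
      rw [← hmap]; exact image_mem_map hnb
    have hcont : ContinuousAt (fun x => L (F x)) x₀ := L.continuous.continuousAt.comp (hF.continuous.continuousAt)
    filter_upwards [hcont himg, hP.isOpen_image.mem_nhds hx₀] with x hx hxN
    obtain ⟨w, hw, hwx⟩ := hx
    refine ⟨w.1, hw.1.1, w.2, ?_⟩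
    have := (hψ w ⟨hw.1.2, hw.2⟩).1
    rw [hwx] at this
    rw [hP.left x hxN] at this
    exact this

end RuledChart

/-! ### The second fundamental form along the ruling -/

section Transfer

open Filter Topology

/-- If `det` has rank 2 on the image of a two-dimensional space, then the discriminant of the
pencil of binary forms does not vanish. -/
theorem exists_hyperdet_ne_zero {K : Submodule ℝ E6} (hK : Module.finrank ℝ K = 2)
    (f : E6 →ₗ[ℝ] Matrix (Fin 2) (Fin 2) ℝ) (hf : detRank (K.map f) = 2) :
    ∃ ν₀ ∈ K, ∃ ν₁ ∈ K, hyperdet (fun i j => f ν₀ i j) (fun i j => f ν₁ i j) ≠ 0 := by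
  set g := (detPolar.domRestrict₁₂ (K.map f) (K.map f)).comp (f.submoduleMap K) with hg
  have hgr : Module.finrank ℝ (LinearMap.range g) = 2 := by
    rw [hg, LinearMap.range_comp_of_range_eq_top _
      (LinearMap.range_eq_top.2 (f.submoduleMap_surjective K))]
    exact hf
  have hgi : LinearMap.ker g = ⊥ := by
    have := LinearMap.finrank_range_add_finrank_ker g
    rw [hgr, hK] at this
    exact Submodule.finrank_eq_zero.1 (by omega)
  set b := Module.finBasisOfFinrankEq ℝ K hK with hb
  refine ⟨b 0, (b 0).2, b 1, (b 1).2, fun h => ?_⟩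
  set A := f (b 0) with hA
  set B := f (b 1) with hB
  have hdet : (!![detPolar A A, detPolar B A; detPolar A B, detPolar B B] :
      Matrix (Fin 2) (Fin 2) ℝ).det = 0 := by
    rw [Matrix.det_fin_two_of]
    simp only [hyperdet] at h
    simp only [detPolar, LinearMap.mk₂_apply]
    linear_combination h
  obtain ⟨v, hv, hmv⟩ := Matrix.exists_mulVec_eq_zero_iff.2 hdet
  have h0 := congrFun hmv 0
  have h1 := congrFun hmv 1
  simp [Matrix.mulVec, dotProduct, Fin.sum_univ_two] at h0 h1
  have hspan : ∀ k : K, ∃ c d : ℝ, k = c • b 0 + d • b 1 := fun k =>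
    ⟨b.repr k 0, b.repr k 1, by
      conv_lhs => rw [← b.sum_repr k]
      rw [Fin.sum_univ_two]⟩
  have hker : v 0 • b 0 + v 1 • b 1 ∈ LinearMap.ker g := by
    rw [LinearMap.mem_ker]
    refine LinearMap.ext fun u => ?_
    obtain ⟨k, rfl⟩ := f.submoduleMap_surjective K u
    obtain ⟨c, d, rfl⟩ := hspan k
    change detPolar (f (v 0 • (b 0 : E6) + v 1 • (b 1 : E6))) (f (c • (b 0 : E6) + d • (b 1 : E6))) = 0
    simp only [map_add, map_smul, LinearMap.add_apply, LinearMap.smul_apply, smul_eq_mul, ← hA, ← hB]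
    linear_combination c * h0 + d * h1
  rw [hgi, Submodule.mem_bot] at hker
  have hli := Fintype.linearIndependent_iff.1 b.linearIndependent v (by
    rw [Fin.sum_univ_two]; exact hker)
  exact hv (funext hli)

theorem RulingFrame.inner_sd_normal {U : Set R2} {P : R2 → E6 →L[ℝ] E6} {e : Fin 2 → R2 → E6}
    (hR : RulingFrame U P e) {g : R2 → E6} (hg : ContDiffOn ℝ ∞ g U) {t : R2} (ht : t ∈ U) {ν : E6}
    (hν : ∀ i, inner ℝ ν (e i t) = (0 : ℝ)) (v w : R2) :
    (inner ℝ ν (sd P v w g t) : ℝ) = inner ℝ ν (pd w (pd v g) t) -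
      ∑ i, inner ℝ (e i t) (pd v g t) * inner ℝ ν (pd w (e i) t) -
      ∑ i, inner ℝ (e i t) (pd w g t) * inner ℝ ν (pd v (e i) t) := by
  have hU := hR.isOpen
  have hPν : ∀ u, (inner ℝ ν (P t u) : ℝ) = 0 := fun u => by
    rw [hR.proj t ht]; simp [inner_add_right, real_inner_smul_right, hν]
  have hP : ∀ v w, (inner ℝ ν (pd w (fun t => P t (pd v g t)) t) : ℝ) =
      ∑ i, inner ℝ (e i t) (pd v g t) * inner ℝ ν (pd w (e i) t) := fun v w => by
    have hs : ∀ i, ContDiffOn ℝ ∞ (fun t => (inner ℝ (e i t) (pd v g t) : ℝ)) U := fun i =>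
      (hR.smooth i).inner ℝ (SmoothOn.pd hU hg)
    have d1 : ∀ i, DifferentiableAt ℝ (fun t => (inner ℝ (e i t) (pd v g t) : ℝ)) t := fun i =>
      SmoothOn.differentiableAt hU (hs i) ht
    have d2 : ∀ i, DifferentiableAt ℝ (fun t => (inner ℝ (e i t) (pd v g t) : ℝ) • e i t) t :=
      fun i => (d1 i).smul (hR.diff ht i)
    rw [pd_congr hU (fun t ht => hR.proj t ht (pd v g t)) ht, pd_add (d2 0) (d2 1),
      pd_smul (d1 0) (hR.diff ht 0), pd_smul (d1 1) (hR.diff ht 1)]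
    simp only [Fin.sum_univ_two, inner_add_right, real_inner_smul_right, hν]; ring
  rw [sd, inner_sub_right, hPν, sub_zero, inner_sub_right, inner_sub_right, hP, hP]

theorem fderiv_fderiv_ruledMap {U : Set R2} (hU : IsOpen U) {e : Fin 2 → R2 → E6} {γ : R2 → E6}
    (he : ∀ i, ContDiffOn ℝ ∞ (e i) U) (hγ : ContDiffOn ℝ ∞ γ U) {w : R2 × R2} (hw : w.1 ∈ U)
    (τ x τ' x' : R2) : fderiv ℝ (fderiv ℝ (ruledMap e γ)) w (τ, x) (τ', x') =
      pd τ (pd τ' γ) w.1 + ∑ i, x' i • pd τ (e i) w.1 + ∑ i, w.2 i • pd τ (pd τ' (e i)) w.1 +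
        ∑ i, x i • pd τ' (e i) w.1 := by
  have hUo : IsOpen (U ×ˢ (Set.univ : Set R2)) := hU.prod isOpen_univ
  have hwU : w ∈ U ×ˢ (Set.univ : Set R2) := ⟨hw, trivial⟩
  have hs := contDiffOn_ruledMap he hγ
  have hd : DifferentiableAt ℝ (fderiv ℝ (ruledMap e γ)) w :=
    ((hs.contDiffAt (hUo.mem_nhds hwU)).fderiv_right (m := ∞) (by simp)).differentiableAt (by simp)
  have h1 : fderiv ℝ (fun w => fderiv ℝ (ruledMap e γ) w (τ', x')) w (τ, x) =
      fderiv ℝ (fderiv ℝ (ruledMap e γ)) w (τ, x) (τ', x') := by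
    rw [fderiv_clm_apply hd (differentiableAt_const _)]
    simp
  have hde : ∀ {t}, t ∈ U → ∀ i, DifferentiableAt ℝ (e i) t := fun ht i =>
    SmoothOn.differentiableAt hU (he i) ht
  have h2 : ∀ z ∈ U ×ˢ (Set.univ : Set R2), fderiv ℝ (ruledMap e γ) z (τ', x') =
      ruledMap (fun i => pd τ' (e i)) (fun t => pd τ' γ t + (x' 0 • e 0 t + x' 1 • e 1 t)) z :=
    fun z hz => by
    rw [(hasFDerivAt_ruledMap (hde hz.1) (SmoothOn.differentiableAt hU hγ hz.1)).2]
    simp only [ruledMap, Fin.sum_univ_two]; module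
  have d0 : ∀ i, DifferentiableAt ℝ (fun t => x' i • e i t) w.1 := fun i =>
    (differentiableAt_const (x' i)).smul (hde hw i)
  have d1 : DifferentiableAt ℝ (fun t => x' 0 • e 0 t + x' 1 • e 1 t) w.1 := (d0 0).add (d0 1)
  have d2 : DifferentiableAt ℝ (pd τ' γ) w.1 :=
    SmoothOn.differentiableAt hU (SmoothOn.pd hU hγ) hw
  have d3 : DifferentiableAt ℝ (fun t => pd τ' γ t + (x' 0 • e 0 t + x' 1 • e 1 t)) w.1 := d2.add d1
  rw [← h1, Filter.EventuallyEq.fderiv_eq (Filter.eventually_of_mem (hUo.mem_nhds hwU) h2),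
    (hasFDerivAt_ruledMap (fun i => SmoothOn.differentiableAt hU (SmoothOn.pd hU (he i)) hw) d3).2]
  rw [pd_add d2 d1, pd_add (d0 0) (d0 1), pd_smul (x := fun _ => x' 0) (differentiableAt_const _) (hde hw 0),
    pd_smul (x := fun _ => x' 1) (differentiableAt_const _) (hde hw 1), pd_const, pd_const]
  simp only [Fin.sum_univ_two]; module

variable {X : Type*} [TopologicalSpace X] [ChartedSpace E4 X] {F : X → E6} {E : X → Submodule ℝ E6}
  {U : Set R2} {P : R2 → E6 →L[ℝ] E6} {e : Fin 2 → R2 → E6} {γ : R2 → E6} {ρ : ℝ} {ψ : R2 × R2 → X}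

theorem inner_secondFF_sum (F : X → E6) (x : X) (ν : E6) (c d : Fin 4 → ℝ) (fr : Fin 4 → E4) :
    (inner ℝ ν (secondFF F x (∑ i, c i • fr i) (∑ j, d j • fr j)) : ℝ) =
      ∑ i, ∑ j, c i * d j * shapeMatrix F x fr ν i j := by
  have h : ∀ i j, shapeMatrix F x fr ν i j = inner ℝ ν (secondFF F x (fr i) (fr j)) :=
    fun i j => rfl
  simp only [h, secondFF, map_sum, map_smul, ContinuousLinearMap.sum_apply,
    ContinuousLinearMap.smul_apply, inner_sum, real_inner_smul_right, mul_assoc]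
  simp only [Finset.mul_sum]
  rw [Finset.sum_comm]
  exact Finset.sum_congr rfl fun i _ => Finset.sum_congr rfl fun j _ => mul_left_comm _ _ _

/-- The expansion of a tangent vector in an orthonormal frame. -/
theorem IsOrthonormalFrame.eq_sum {x : X} {fr : Fin 4 → E4} (h : IsOrthonormalFrame F x fr) (k : E4) :
    k = ∑ i, (inner ℝ (tangentMap4 F x (fr i)) (tangentMap4 F x k) : ℝ) • fr i := by
  have ho : Orthonormal ℝ (fun i => tangentMap4 F x (fr i)) := h
  have hl : LinearIndependent ℝ fr :=
    LinearIndependent.of_comp (tangentMap4 F x).toLinearMap ho.linearIndependent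
  set b := basisOfLinearIndependentOfCardEqFinrank hl (by simp) with hb
  have h1 : k = ∑ i, b.repr k i • fr i := by
    conv_lhs => rw [← b.sum_repr k]
    simp [hb]
  have h2 : ∀ i, (inner ℝ (tangentMap4 F x (fr i)) (tangentMap4 F x k) : ℝ) = b.repr k i := fun i => by
    conv_lhs => rw [h1]
    rw [map_sum]
    simp only [map_smul]
    exact ho.inner_right_fintype _ i
  simp only [h2]; exact h1

theorem inner_secondFF {x : X} {ν : E6} (hν : ν ∈ (tangentPlane F x)ᗮ) (u v : E4) :
    (inner ℝ ν (secondFF F x u v) : ℝ) =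
      inner ℝ ν (fderiv ℝ (fderiv ℝ (chartRep F x)) (chartAt E4 x x) u v) := by
  rw [secondFF, ← Submodule.inner_starProjection_left_eq_right,
    Submodule.starProjection_eq_self_iff.2 hν]

theorem finrank_orthogonal_tangentPlane {x : X} (h : Function.Injective (tangentMap4 F x)) :
    Module.finrank ℝ (tangentPlane F x)ᗮ = 2 := by
  have h1 := Submodule.finrank_add_finrank_orthogonal (tangentPlane F x)
  have h2 : Module.finrank ℝ (tangentPlane F x) = 4 := by
    rw [tangentPlane, LinearMap.finrank_range_of_inj h]; simp
  have h3 : Module.finrank ℝ E6 = 6 := by simp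
  omega

namespace RuledChart

theorem fderiv_eq (hC : RuledChart F E U P e γ ρ ψ) {w : R2 × R2}
    (hw : w ∈ U ×ˢ Metric.ball 0 ρ) (τ x : R2) : fderiv ℝ (ruledMap e γ) w (τ, x) =
      pd τ γ w.1 + ∑ i, w.2 i • pd τ (e i) w.1 + ∑ i, x i • e i w.1 :=
  (hasFDerivAt_ruledMap (fun i => hC.diff hw.1 i)
    (SmoothOn.differentiableAt hC.isOpen hC.smooth_base hw.1)).2 τ x

theorem evalC_pencil_eq (hC : RuledChart F E U P e γ ρ ψ) {w : R2 × R2}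
    (hw : w ∈ U ×ˢ Metric.ball 0 ρ) (τ : R2) :
    evalC (pencil (ndC P γ w.1) (ndD P e w.1) w.2) τ =
      nd P τ γ w.1 + ∑ i, w.2 i • nd P τ (e i) w.1 := by
  rw [← hC.ndC_shift hC.smooth_base hw.1, evalC_ndC, hC.nd_shift hC.smooth_base hw.1]

/-- The tangential component, along the ruling, of the derivative in the direction `τ`. -/
def connection (e : Fin 2 → R2 → E6) (γ : R2 → E6) (w : R2 × R2) (τ : R2) : R2 := fun i =>
  inner ℝ (e i w.1) (pd τ γ w.1 + ∑ j, w.2 j • pd τ (e j) w.1)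

theorem tangentVec_eq (hC : RuledChart F E U P e γ ρ ψ) {w : R2 × R2}
    (hw : w ∈ U ×ˢ Metric.ball 0 ρ) (x τ : R2) :
    tangentVec (fun i => e i w.1) (pencil (ndC P γ w.1) (ndD P e w.1) w.2) x τ =
      fderiv ℝ (ruledMap e γ) w (τ, x - connection e γ w τ) := by
  rw [tangentVec, hC.evalC_pencil_eq hw, hC.fderiv_eq hw]
  simp only [nd, hC.proj _ hw.1, Fin.sum_univ_two, connection, Pi.sub_apply, inner_add_right,
    real_inner_smul_right]
  module

theorem indep (hC : RuledChart F E U P e γ ρ ψ) {w : R2 × R2} (hw : w ∈ U ×ˢ Metric.ball 0 ρ)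
    (m : R2) (hm : ∑ a, m a • pencil (ndC P γ w.1) (ndD P e w.1) w.2 a = 0) : m = 0 := by
  have h := hC.tangentVec_eq hw 0 m
  have h0 : tangentVec (fun i => e i w.1) (pencil (ndC P γ w.1) (ndD P e w.1) w.2) 0 m = 0 := by
    simpa [tangentVec, evalC] using hm
  rw [h0] at h
  have := hC.immersion w hw (h.symm.trans (map_zero _).symm)
  exact (Prod.ext_iff.1 this).1

/-- The second fundamental form of the submanifold in a chart along the ruling is of type B. -/
theorem typeBPoint [IsManifold (𝓡 4) ∞ X] (hC : RuledChart F E U P e γ ρ ψ)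
    (hM : IsRuledAustereB F E) {w : R2 × R2} (hw : w ∈ U ×ˢ Metric.ball 0 ρ) :
    ∃ a S, TypeBPoint (fun i => e i w.1) (pencil (ndC P γ w.1) (ndD P e w.1) w.2) (ndD P e w.1)
      (sdAt P e γ w.1 w.2) a S := by
  obtain ⟨fr, hfr, hQ, hrefl, hrk⟩ := hM.typeB (ψ w)
  have hΩ : IsOpen (U ×ˢ Metric.ball (0 : R2) ρ) := hC.isOpen.prod Metric.isOpen_ball
  obtain ⟨κ, hκ, hII⟩ := inner_fderiv_fderiv_comp hM.smooth hΩ hC.smooth_chart hw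
  have hev : F ∘ ψ =ᶠ[𝓝 w] ruledMap e γ := Filter.eventually_of_mem (hΩ.mem_nhds hw) hC.chart_eq
  rw [hev.fderiv_eq] at hκ
  rw [hev.fderiv.fderiv_eq] at hII
  set x := ψ w with hx
  set A := tangentMap4 F x with hA
  set M := pencil (ndC P γ w.1) (ndD P e w.1) w.2 with hMdef
  have hAi : Function.Injective A := hM.immersion x
  have hκi : Function.Injective κ := by
    have := hC.immersion w hw
    rw [hκ] at this
    exact Function.Injective.of_comp (f := A) this
  have hκs : Function.Surjective κ :=
    (LinearMap.injective_iff_surjective_of_finrank_eq_finrank (f := κ.toLinearMap) (by simp)).1 hκi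
  have htan : ∀ u, u ∈ tangentPlane F x ↔
      ∃ y τ, u = tangentVec (fun i => e i w.1) M y τ := fun u => by
    constructor
    · rintro ⟨k, rfl⟩
      obtain ⟨⟨τ, ξ⟩, rfl⟩ := hκs k
      refine ⟨ξ + connection e γ w τ, τ, ?_⟩
      rw [hC.tangentVec_eq hw, hκ, add_sub_cancel_right]; rfl
    · rintro ⟨y, τ, rfl⟩
      rw [hC.tangentVec_eq hw, hκ]
      exact ⟨_, rfl⟩
  have hortho : Orthonormal ℝ (fun i => A (fr i)) := hfr
  have hexp : ∀ k : E4, k = ∑ i, (inner ℝ (A (fr i)) (A k) : ℝ) • fr i := hfr.eq_sum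
  have hperp : ∀ ν, (∀ i, inner ℝ ν (A (fr i)) = (0 : ℝ)) → ν ∈ (tangentPlane F x)ᗮ := by
    rintro ν hν _ ⟨k, rfl⟩
    change inner ℝ (A k) ν = (0 : ℝ)
    rw [real_inner_comm, hexp k, map_sum, inner_sum]
    simp [real_inner_smul_right, hν]
  have hperp' : ∀ ν ∈ (tangentPlane F x)ᗮ, ∀ i, inner ℝ ν (A (fr i)) = (0 : ℝ) := fun ν hν i => by
    rw [real_inner_comm]; exact hν _ ⟨_, rfl⟩
  have hrankT := finrank_orthogonal_tangentPlane hAi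
  refine ⟨fun i => A (fr i), shapeMatrix F x fr, ⟨fun i => hC.norm i _ hw.1, hC.orth _ hw.1,
    fun i b => ?_, fun i v w' => ?_, fun i b j => hC.inner_nd hw.1 i, hortho,
    fun y τ => ?_, fun τ => ?_, fun ν hν => ?_, ?_, fun i => ?_, ?_,
    fun z hz => ?_⟩⟩
  · rw [hMdef, ← evalC_single (pencil (ndC P γ w.1) (ndD P e w.1) w.2) b, hC.evalC_pencil_eq hw,
      inner_add_right, hC.inner_nd hw.1, inner_sum]
    simp [real_inner_smul_right, hC.inner_nd hw.1]
  · rw [sdAt, inner_add_right, hC.inner_sd hw.1, inner_sum]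
    simp [real_inner_smul_right, hC.inner_sd hw.1]
  · obtain ⟨k, hk⟩ := (htan _).2 ⟨y, τ, rfl⟩
    change A k = _ at hk
    rw [← hk]
    conv_lhs => rw [hexp k]
    rw [map_sum]; simp only [map_smul]
  · have h0 : ∀ g : R2 → E6, sd P 0 τ g w.1 = 0 := fun g => by
      have : ∀ (k : R2 → E6) t, pd 0 k t = 0 := fun k t => by simp [pd]
      simp only [sd, this, map_zero, pd_const, sub_zero]
      have h1 : pd τ (pd 0 g) w.1 = 0 := by
        rw [show pd 0 g = fun _ => (0 : E6) from funext (this g), pd_const]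
      simp [h1]
    simp [sdAt, h0]
  · exact hQ _ ⟨ν, hperp ν hν, rfl⟩
  · intro ν hν y τ y' τ'
    have hνe : ∀ i, inner ℝ ν (e i w.1) = (0 : ℝ) := fun i => by
      rw [real_inner_comm]
      refine hperp ν hν _ ((htan _).2 ⟨Pi.single i 1, 0, ?_⟩)
      exact TypeBPoint.e_eq (fun i => e i w.1) M i
    have hνP : ∀ u, inner ℝ ν (P w.1 u) = (0 : ℝ) := fun u => by
      rw [hC.proj _ hw.1]; simp [inner_add_right, real_inner_smul_right, hνe]
    have hνn : ∀ τ g, (inner ℝ ν (nd P τ g w.1) : ℝ) = inner ℝ ν (pd τ g w.1) := fun τ g => by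
      rw [nd, inner_sub_right, hνP, sub_zero]
    have h1 := hII ν (hperp ν hν) (τ, y - connection e γ w τ) (τ', y' - connection e γ w τ')
    rw [fderiv_fderiv_ruledMap hC.isOpen hC.smooth hC.smooth_base hw.1] at h1
    have hA1 : ∀ k, A (κ k) = fderiv ℝ (ruledMap e γ) w k := fun k => by rw [hκ]; rfl
    rw [hexp (κ (τ, y - connection e γ w τ)), hexp (κ (τ', y' - connection e γ w τ')),
      inner_secondFF_sum, hA1, hA1, ← hC.tangentVec_eq hw, ← hC.tangentVec_eq hw] at h1
    rw [← h1, sdAt, evalD_ndD, evalD_ndD]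
    simp only [Fin.sum_univ_two]
    rw [pd_comm hC.isOpen hC.smooth_base hw.1, pd_comm hC.isOpen (hC.smooth 0) hw.1 (v := τ),
      pd_comm hC.isOpen (hC.smooth 1) hw.1 (v := τ)]
    simp only [ inner_add_right, real_inner_smul_right, hνn,
      hC.inner_sd_normal hC.smooth_base hw.1 hνe, hC.inner_sd_normal (hC.smooth _) hw.1 hνe,
      connection, Pi.sub_apply, Fin.sum_univ_two]
    ring
  · have hmem : ∀ i, e i w.1 ∈ E x := hC.mem_plane w hw
    have h1 : frameReflection F x fr (e i w.1) ∈ E x := by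
      rw [← hrefl]; exact ⟨_, hmem i, rfl⟩
    have h2 := starProjection_eq_of_orthonormal (hM.ruled.finrank_eq x) (hmem 0) (hmem 1)
      (hC.norm 0 _ hw.1) (hC.norm 1 _ hw.1) (hC.orth _ hw.1) (frameReflection F x fr (e i w.1))
    rw [Submodule.starProjection_eq_self_iff.2 h1] at h2
    refine ⟨![inner ℝ (e 0 w.1) (frameReflection F x fr (e i w.1)),
      inner ℝ (e 1 w.1) (frameReflection F x fr (e i w.1))], ?_⟩
    rw [Fin.sum_univ_two]
    refine Eq.trans ?_ h2
    simp [frameReflection, Fin.sum_univ_four, ← hA]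
    module
  · obtain ⟨ν₀, h₀, ν₁, h₁, hd⟩ := exists_hyperdet_ne_zero hrankT
      (upperRightBlock.comp (shapeMatrix F x fr)) (by
        rw [Submodule.map_comp]; exact hrk)
    refine ⟨ν₀, ν₁, hperp' _ h₀, hperp' _ h₁, ?_⟩
    convert hd using 1
    congr 1 <;> (ext i j; fin_cases i <;> fin_cases j <;> rfl)
  · rw [← htan, ← Submodule.orthogonal_orthogonal (tangentPlane F x)]
    intro ν hν
    exact hz ν (hperp' ν hν)

/-- A chart along the ruling, restricted to shorter leaves, is a nondegenerate ruled patch. -/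
theorem ruledPatch [IsManifold (𝓡 4) ∞ X] (hC : RuledChart F E U P e γ ρ ψ)
    (hM : IsRuledAustereB F E) : RuledPatch U P e γ (ρ / 2) ∧
      ∀ t ∈ U, ∀ s : R2, (∀ i, |s i| ≤ ρ / 2) → FlatAt P e γ t s ∨ MixedAt P e γ t s := by
  have hs : ∀ s : R2, (∀ i, |s i| ≤ ρ / 2) → s ∈ Metric.ball (0 : R2) ρ := fun s hs => by
    rw [mem_ball_zero_iff, pi_norm_lt_iff hC.pos]
    intro i
    rw [Real.norm_eq_abs]
    linarith [hs i, hC.pos]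
  refine ⟨⟨hC.toRulingFrame, hC.smooth_base, half_pos hC.pos, fun t ht s h m hm =>
    hC.indep (w := (t, s)) ⟨ht, hs s h⟩ m hm, fun t ht s h => ?_⟩, fun t ht s h => ?_⟩
  · obtain ⟨a, S, hB⟩ := hC.typeBPoint hM (w := (t, s)) ⟨ht, hs s h⟩
    exact hB.alternative.1
  · obtain ⟨a, S, hB⟩ := hC.typeBPoint hM (w := (t, s)) ⟨ht, hs s h⟩
    exact hB.alternative.2

end RuledChart

/-- Locally, the submanifold lies in the sum of a pair of helicoids. -/
theorem IsRuledAustereB.exists_helicoidPair [IsManifold (𝓡 4) ∞ X] (hM : IsRuledAustereB F E)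
    (x₀ : X) : ∃ M : HelicoidPair E6, ∀ᶠ x in 𝓝 x₀, F x ∈ M.carrier := by
  obtain ⟨U, P, e, γ, ρ, ψ, hC, h0, hcov⟩ := exists_ruledChart hM.smooth hM.ruled x₀ (hM.immersion x₀)
  obtain ⟨hR, hFM⟩ := hC.ruledPatch hM
  obtain ⟨M, W, -, hWo, h0W, hW⟩ := hR.exists_helicoidPair (by simp) hFM h0
  refine ⟨M, ?_⟩
  filter_upwards [hcov W (hWo.mem_nhds h0W)] with x hx
  obtain ⟨t, ht, s, hx⟩ := hx
  rw [hx]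
  exact hW t ht s

end Transfer

/-! ### Products of helicoids as analytic sets, and analytic continuation -/

namespace HelicoidPair

open Filter Topology

variable (M : HelicoidPair E6)

theorem inner_ruling (i j : Fin 4) :
    (inner ℝ ((![M.r₁, M.r₂, M.q₁, M.q₂] : Fin 4 → E6) i) ((![M.r₁, M.r₂, M.q₁, M.q₂] : Fin 4 → E6) j) : ℝ) =
      if i = j then 1 else 0 := orthonormal_iff_ite.1 M.ruling i j

theorem linearIndependent : LinearIndependent ℝ ![M.r₁, M.r₂, M.q₁, M.q₂, M.p, M.r] := by
  rw [Fintype.linearIndependent_iff]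
  intro c hc
  have hc' : (c 0 • M.r₁ + c 1 • M.r₂ + c 2 • M.q₁ + c 3 • M.q₂) + (c 4 • M.p + c 5 • M.r) = 0 := by
    rw [← hc, Fin.sum_univ_six, ← add_assoc]; rfl
  obtain ⟨p1, p2, p3, p4⟩ := M.axis_left
  obtain ⟨r1, r2, r3, r4⟩ := M.axis_right
  have key : ∀ i : Fin 4, (c (Fin.castLE (by norm_num) i) : ℝ) = 0 := fun i => by
    have h := congrArg (fun u => (inner ℝ ((![M.r₁, M.r₂, M.q₁, M.q₂] : Fin 4 → E6) i) u : ℝ)) hc'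
    have o := M.inner_ruling i
    have o0 := o 0
    have o1 := o 1
    have o2 := o 2
    have o3 := o 3
    change (inner ℝ _ M.r₁ : ℝ) = _ at o0
    change (inner ℝ _ M.r₂ : ℝ) = _ at o1
    change (inner ℝ _ M.q₁ : ℝ) = _ at o2
    change (inner ℝ _ M.q₂ : ℝ) = _ at o3
    have hp : (inner ℝ ((![M.r₁, M.r₂, M.q₁, M.q₂] : Fin 4 → E6) i) M.p : ℝ) = 0 := by
      fin_cases i
      exacts [p1, p2, p3, p4]
    have hr : (inner ℝ ((![M.r₁, M.r₂, M.q₁, M.q₂] : Fin 4 → E6) i) M.r : ℝ) = 0 := by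
      fin_cases i
      exacts [r1, r2, r3, r4]
    simp only [inner_add_right, real_inner_smul_right, o0, o1, o2, o3, hp, hr, inner_zero_right] at h
    fin_cases i <;> simpa using h
  have k0 : c 0 = 0 := key 0
  have k1 : c 1 = 0 := key 1
  have k2 : c 2 = 0 := key 2
  have k3 : c 3 = 0 := key 3
  have h := M.axes (c 4) (c 5) (by simpa [k0, k1, k2, k3] using hc')
  intro i; fin_cases i
  exacts [k0, k1, k2, k3, h.1, h.2]

/-- The basis of 6-space consisting of the directions of the rulings and of the axes. -/
def basis : Module.Basis (Fin 6) ℝ E6 :=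
  basisOfLinearIndependentOfCardEqFinrank M.linearIndependent (by simp)

theorem basis_apply (i : Fin 6) : M.basis i = ![M.r₁, M.r₂, M.q₁, M.q₂, M.p, M.r] i := by
  simp [basis]

/-- The affine coordinates attached to the basis, with origin at the base point. -/
def coord (i : Fin 6) (y : E6) : ℝ := M.basis.repr (y - M.base) i

theorem contDiff_coord {n : WithTop ℕ∞} (i : Fin 6) : ContDiff ℝ n (M.coord i) :=
  ((M.basis.coord i).toContinuousLinearMap.contDiff).comp (contDiff_id.sub contDiff_const)

theorem eq_sum_coord (y : E6) : y = M.base + (M.coord 0 y • M.r₁ + M.coord 1 y • M.r₂ +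
    M.coord 2 y • M.q₁ + M.coord 3 y • M.q₂ + M.coord 4 y • M.p + M.coord 5 y • M.r) := by
  have h := M.basis.sum_repr (y - M.base)
  rw [Fin.sum_univ_six] at h
  simp only [basis_apply] at h
  exact (add_eq_of_eq_sub' h).symm

theorem coord_eq (c : Fin 6 → ℝ) (i : Fin 6) : M.coord i (M.base + (c 0 • M.r₁ + c 1 • M.r₂ +
    c 2 • M.q₁ + c 3 • M.q₂ + c 4 • M.p + c 5 • M.r)) = c i := by
  have : M.base + (c 0 • M.r₁ + c 1 • M.r₂ +
    c 2 • M.q₁ + c 3 • M.q₂ + c 4 • M.p + c 5 • M.r) - M.base = ∑ i, c i • M.basis i := by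
    rw [Fin.sum_univ_six, add_sub_cancel_left]; simp only [basis_apply]; rfl
  rw [coord, this, M.basis.repr_sum_self]

/-- The parametrization of the product of the helicoids by 4-space. -/
def pointMap (z : Fin 4 → ℝ) : E6 := M.point (z 0) (z 1) (z 2) (z 3)

theorem contDiff_pointMap {n : WithTop ℕ∞} : ContDiff ℝ n M.pointMap := by
  unfold pointMap point
  fun_prop

/-- The inverse of the parametrization, extended to all of 6-space. -/
def params (y : E6) : Fin 4 → ℝ :=
  ![M.coord 0 y * Real.cos (M.coord 4 y) + M.coord 1 y * Real.sin (M.coord 4 y), M.coord 4 y,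
    M.coord 2 y * Real.cos (M.coord 5 y) + M.coord 3 y * Real.sin (M.coord 5 y), M.coord 5 y]

theorem contDiff_params {n : WithTop ℕ∞} : ContDiff ℝ n M.params := by
  have := fun i => M.contDiff_coord (n := n) i
  rw [contDiff_pi]
  intro i
  fin_cases i
  · exact ((this 0).mul (this 4).cos).add ((this 1).mul (this 4).sin)
  · exact this 4
  · exact ((this 2).mul (this 5).cos).add ((this 3).mul (this 5).sin)
  · exact this 5

/-- The two analytic equations of the product of the helicoids. -/
def equation (y : E6) : Fin 2 → ℝ :=
  ![M.coord 0 y * Real.sin (M.coord 4 y) - M.coord 1 y * Real.cos (M.coord 4 y),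
    M.coord 2 y * Real.sin (M.coord 5 y) - M.coord 3 y * Real.cos (M.coord 5 y)]

theorem contDiff_equation {n : WithTop ℕ∞} : ContDiff ℝ n M.equation := by
  have := fun i => M.contDiff_coord (n := n) i
  rw [contDiff_pi]
  intro i
  fin_cases i
  · exact ((this 0).mul (this 4).sin).sub ((this 1).mul (this 4).cos)
  · exact ((this 2).mul (this 5).sin).sub ((this 3).mul (this 5).cos)

theorem point_eq (s₁ u₁ s₂ u₂ : ℝ) : M.point s₁ u₁ s₂ u₂ =
    M.base + ((s₁ * Real.cos u₁) • M.r₁ + (s₁ * Real.sin u₁) • M.r₂ +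
      (s₂ * Real.cos u₂) • M.q₁ + (s₂ * Real.sin u₂) • M.q₂ + u₁ • M.p + u₂ • M.r) := by
  simp only [point]; module

theorem pointMap_params {y : E6} (hy : M.equation y = 0) : M.pointMap (M.params y) = y := by
  have h0 : M.coord 0 y * Real.sin (M.coord 4 y) - M.coord 1 y * Real.cos (M.coord 4 y) = 0 :=
    congrFun hy 0
  have h1 : M.coord 2 y * Real.sin (M.coord 5 y) - M.coord 3 y * Real.cos (M.coord 5 y) = 0 :=
    congrFun hy 1
  have c4 := Real.cos_sq_add_sin_sq (M.coord 4 y)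
  have c5 := Real.cos_sq_add_sin_sq (M.coord 5 y)
  conv_rhs => rw [M.eq_sum_coord y]
  rw [pointMap, point_eq]
  simp only [params]
  congr 1
  congr 3
  · congr 1
    · congr 1
      · congr 2
        change (_ + _) * Real.cos (M.coord 4 y) = _
        linear_combination M.coord 0 y * c4 - Real.sin (M.coord 4 y) * h0
      · congr 1
        change (_ + _) * Real.sin (M.coord 4 y) = _
        linear_combination M.coord 1 y * c4 + Real.cos (M.coord 4 y) * h0
    · congr 1
      change (_ + _) * Real.cos (M.coord 5 y) = _
      linear_combination M.coord 2 y * c5 - Real.sin (M.coord 5 y) * h1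
  · congr 1
    change (_ + _) * Real.sin (M.coord 5 y) = _
    linear_combination M.coord 3 y * c5 + Real.cos (M.coord 5 y) * h1

theorem equation_pointMap (z : Fin 4 → ℝ) : M.equation (M.pointMap z) = 0 := by
  have h := M.coord_eq ![z 0 * Real.cos (z 1), z 0 * Real.sin (z 1), z 2 * Real.cos (z 3),
    z 2 * Real.sin (z 3), z 1, z 3]
  have e : M.pointMap z = _ := M.point_eq (z 0) (z 1) (z 2) (z 3)
  have h' : ∀ i, M.coord i (M.pointMap z) = (![z 0 * Real.cos (z 1), z 0 * Real.sin (z 1),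
      z 2 * Real.cos (z 3), z 2 * Real.sin (z 3), z 1, z 3] : Fin 6 → ℝ) i := fun i => by
    rw [e]; exact h i
  simp only [equation, h']
  ext i; fin_cases i
  · change z 0 * Real.cos (z 1) * Real.sin (z 1) - z 0 * Real.sin (z 1) * Real.cos (z 1) = 0
    ring
  · change z 2 * Real.cos (z 3) * Real.sin (z 3) - z 2 * Real.sin (z 3) * Real.cos (z 3) = 0
    ring

theorem pointMap_mem (z : Fin 4 → ℝ) : M.pointMap z ∈ M.carrier := ⟨_, _, _, _, rfl⟩

theorem mem_carrier_iff {y : E6} : y ∈ M.carrier ↔ M.equation y = 0 := by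
  constructor
  · rintro ⟨s₁, u₁, s₂, u₂, rfl⟩
    exact M.equation_pointMap ![s₁, u₁, s₂, u₂]
  · intro h
    rw [← M.pointMap_params h]
    exact M.pointMap_mem _

/-- If the product of the helicoids of `M` lies in that of `M'` near a point, then everywhere. -/
theorem carrier_subset {M M' : HelicoidPair E6} {z : Fin 4 → ℝ}
    (h : ∀ᶠ z' in 𝓝 z, M.pointMap z' ∈ M'.carrier) : M.carrier ⊆ M'.carrier := by
  have ha : AnalyticOnNhd ℝ (M'.equation ∘ M.pointMap) Set.univ :=
    contDiff_omega_iff_analyticOnNhd.1 (M'.contDiff_equation.comp M.contDiff_pointMap)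
  have := ha.eq_of_eventuallyEq (z₀ := z) (g := fun _ => 0) analyticOnNhd_const
    (h.mono fun z' hz' => M'.mem_carrier_iff.1 hz')
  intro y hy
  rw [M.mem_carrier_iff] at hy
  rw [← M.pointMap_params hy, M'.mem_carrier_iff]
  exact congrFun this _

end HelicoidPair

section Global

open Filter Topology

variable {X : Type*} [TopologicalSpace X] [ChartedSpace E4 X] {F : X → E6} {E : X → Submodule ℝ E6}

/-- The parameters of an immersion into the product of helicoids are local coordinates. -/
theorem HelicoidPair.map_nhds_params [IsManifold (𝓡 4) ∞ X] (M : HelicoidPair E6)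
    (hF : ContMDiff (𝓡 4) 𝓘(ℝ, E6) ∞ F) {x : X} (hinj : Function.Injective (tangentMap4 F x))
    (h : ∀ᶠ x' in 𝓝 x, F x' ∈ M.carrier) :
    map (M.params ∘ F) (𝓝 x) = 𝓝 (M.params (F x)) := by
  set φ := chartAt E4 x with hφ
  set f := chartRep F x with hf
  have hx := mem_chart_source E4 x
  have hfx : f (φ x) = F x := by simp [hf, chartRep, hφ]
  have hfs : ContDiffAt ℝ ∞ f (φ x) :=
    (contDiffOn_chartRep hF x).contDiffAt (φ.open_target.mem_nhds (mem_chart_target E4 x))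
  have hfd := hasFDerivAt_chartRep hF x
  have hg : ContDiffAt ℝ ∞ (M.params ∘ f) (φ x) := M.contDiff_params.contDiffAt.comp _ hfs
  have hgd : DifferentiableAt ℝ (M.params ∘ f) (φ x) := hg.differentiableAt (by simp)
  have hev : ∀ᶠ z in 𝓝 (φ x), (M.pointMap ∘ (M.params ∘ f)) z = f z := by
    have : Tendsto φ.symm (𝓝 (φ x)) (𝓝 x) := by
      have := φ.continuousAt_symm (mem_chart_target E4 x)
      rwa [ContinuousAt, φ.left_inv hx] at this
    filter_upwards [this.eventually h] with z hz
    exact M.pointMap_params (M.mem_carrier_iff.1 hz)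
  have hp : DifferentiableAt ℝ M.pointMap ((M.params ∘ f) (φ x)) :=
    M.contDiff_pointMap.contDiffAt.differentiableAt (n := ∞) (by simp)
  have hcomp : (fderiv ℝ M.pointMap ((M.params ∘ f) (φ x))).comp (fderiv ℝ (M.params ∘ f) (φ x)) =
      tangentMap4 F x := by
    rw [← hfd.fderiv, ← Filter.EventuallyEq.fderiv_eq hev]
    exact (fderiv_comp _ hp hgd).symm
  have hgi : Function.Injective (fderiv ℝ (M.params ∘ f) (φ x)) := by
    rw [← hcomp] at hinj
    exact Function.Injective.of_comp (f := fderiv ℝ M.pointMap ((M.params ∘ f) (φ x))) hinj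
  set A : E4 ≃L[ℝ] (Fin 4 → ℝ) := (LinearEquiv.ofInjectiveOfFinrankEq
    (fderiv ℝ (M.params ∘ f) (φ x)).toLinearMap hgi (by simp)).toContinuousLinearEquiv with hA
  have hst : HasStrictFDerivAt (M.params ∘ f) (A : E4 →L[ℝ] (Fin 4 → ℝ)) (φ x) := by
    rw [show (A : E4 →L[ℝ] (Fin 4 → ℝ)) = fderiv ℝ (M.params ∘ f) (φ x) from
      ContinuousLinearMap.ext fun v => rfl]
    exact hg.hasStrictFDerivAt (by simp)
  have hmap := hst.map_nhds_eq_of_equiv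
  rw [Function.comp_apply, hfx, ← φ.map_nhds_eq hx, Filter.map_map] at hmap
  rw [← hmap]
  refine Filter.map_congr ?_
  filter_upwards [φ.open_source.mem_nhds hx] with x' hx'
  simp only [hf, chartRep, Function.comp_apply]
  rw [← hφ, φ.left_inv hx']

/-- Analytic continuation: the submanifold lies in a single product of helicoids. -/
theorem IsRuledAustereB.exists_range_subset [IsManifold (𝓡 4) ∞ X] [ConnectedSpace X]
    (hM : IsRuledAustereB F E) : ∃ M : HelicoidPair E6, ∀ x, F x ∈ M.carrier := by
  obtain ⟨x₀⟩ := (inferInstance : Nonempty X)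
  obtain ⟨M, h₀⟩ := hM.exists_helicoidPair x₀
  set A : Set X := {x | ∀ᶠ x' in 𝓝 x, F x' ∈ M.carrier} with hA
  have hopen : IsOpen A := isOpen_iff_mem_nhds.2 fun x hx => eventually_eventually_nhds.2 hx
  have hclosed : IsClosed A := by
    rw [← closure_subset_iff_isClosed]
    intro x hx
    obtain ⟨M', h'⟩ := hM.exists_helicoidPair x
    obtain ⟨x', hx', hx'A⟩ := mem_closure_iff_nhds.1 hx _ (eventually_eventually_nhds.2 h')
    have hx'' : ∀ᶠ y in 𝓝 x', F y ∈ M'.carrier := hx'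
    have hmap := M'.map_nhds_params hM.smooth (hM.immersion x') hx''
    have hsub : M'.carrier ⊆ M.carrier := by
      refine HelicoidPair.carrier_subset (z := M'.params (F x')) ?_
      rw [← hmap, eventually_map]
      have hx3 : ∀ᶠ y in 𝓝 x', F y ∈ M.carrier := hx'A
      filter_upwards [hx'', hx3] with y h1 h2
      rw [Function.comp_apply, M'.pointMap_params (M'.mem_carrier_iff.1 h1)]
      exact h2
    exact h'.mono fun y hy => hsub hy
  have huniv : A = Set.univ := IsClopen.eq_univ ⟨hclosed, hopen⟩ ⟨x₀, h₀⟩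
  refine ⟨M, fun x => ?_⟩
  have : ∀ᶠ x' in 𝓝 x, F x' ∈ M.carrier := (huniv ▸ Set.mem_univ x : x ∈ A)
  exact this.self_of_nhds

/-- The image is relatively open in the product, because the coordinates `params` restrict to an open
map on the submanifold. -/
theorem IsRuledAustereB.exists_open_carrier [IsManifold (𝓡 4) ∞ X] [ConnectedSpace X]
    (hM : IsRuledAustereB F E) : ∃ M : HelicoidPair E6, ∃ O : Set E6, IsOpen O ∧
      Set.range F = O ∩ M.carrier := by
  obtain ⟨M, h⟩ := hM.exists_range_subset
  have ho : IsOpenMap (M.params ∘ F) := IsOpenMap.of_nhds_le fun x =>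
    (M.map_nhds_params hM.smooth (hM.immersion x) (Filter.Eventually.of_forall h)).ge
  refine ⟨M, M.params ⁻¹' Set.range (M.params ∘ F),
    ho.isOpen_range.preimage (M.contDiff_params (n := 0)).continuous, ?_⟩
  ext y
  constructor
  · rintro ⟨x, rfl⟩
    exact ⟨⟨x, rfl⟩, h x⟩
  · rintro ⟨⟨x, hx⟩, hy⟩
    refine ⟨x, ?_⟩
    rw [← M.pointMap_params (M.mem_carrier_iff.1 hy), ← hx, Function.comp_apply,
      M.pointMap_params (M.mem_carrier_iff.1 (h x))]

/-- The classical helicoid with the given directions of rulings and the translation `p` along the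
axis for a rotation of the ruling by one radian. -/
def Helicoid.ofAxis (r₁ r₂ p : E6) (h₁ : ‖r₁‖ = 1) (h₂ : ‖r₂‖ = 1) (h₁₂ : inner ℝ r₁ r₂ = (0 : ℝ))
    (h₁p : inner ℝ r₁ p = (0 : ℝ)) (h₂p : inner ℝ r₂ p = (0 : ℝ)) (hp : p ≠ 0) : Helicoid where
  r₁ := r₁
  r₂ := r₂
  ax := ‖p‖⁻¹ • p
  pitch := ‖p‖
  orthonormal := by
    have hn : ‖p‖ ≠ 0 := norm_ne_zero_iff.2 hp
    have h₁a : inner ℝ r₁ (‖p‖⁻¹ • p) = (0 : ℝ) := by rw [real_inner_smul_right, h₁p, mul_zero]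
    have h₂a : inner ℝ r₂ (‖p‖⁻¹ • p) = (0 : ℝ) := by rw [real_inner_smul_right, h₂p, mul_zero]
    refine ⟨fun i => ?_, fun i j hij => ?_⟩
    · fin_cases i
      exacts [h₁, h₂, by
        change ‖‖p‖⁻¹ • p‖ = 1
        rw [norm_smul, norm_inv, norm_norm, inv_mul_cancel₀ hn]]
    · fin_cases i <;> fin_cases j
      exacts [absurd rfl hij, h₁₂, h₁a, (real_inner_comm _ _).trans h₁₂, absurd rfl hij, h₂a,
        (real_inner_comm _ _).trans h₁a, (real_inner_comm _ _).trans h₂a, absurd rfl hij]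
  pitch_ne_zero := norm_ne_zero_iff.2 hp

/-- The product described by a pair is a translate of a product of classical helicoids. -/
theorem HelicoidPair.exists_helicoids (M : HelicoidPair E6) : ∃ H₁ H₂ : Helicoid,
    HelicoidsSplit H₁ H₂ ∧ M.carrier = (fun y => M.base + y) '' helicoidProduct H₁ H₂ := by
  have hp : M.p ≠ 0 := fun h => one_ne_zero (M.axes 1 0 (by simp [h])).1
  have hr : M.r ≠ 0 := fun h => one_ne_zero (M.axes 0 1 (by simp [h])).2
  have hpn : ‖M.p‖ ≠ 0 := norm_ne_zero_iff.2 hp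
  have hrn : ‖M.r‖ ≠ 0 := norm_ne_zero_iff.2 hr
  obtain ⟨p1, p2, p3, p4⟩ := M.axis_left
  obtain ⟨r1, r2, r3, r4⟩ := M.axis_right
  have i02 : (inner ℝ M.r₁ M.q₁ : ℝ) = 0 := M.inner_ruling 0 2
  have i03 : (inner ℝ M.r₁ M.q₂ : ℝ) = 0 := M.inner_ruling 0 3
  have i12 : (inner ℝ M.r₂ M.q₁ : ℝ) = 0 := M.inner_ruling 1 2
  have i13 : (inner ℝ M.r₂ M.q₂ : ℝ) = 0 := M.inner_ruling 1 3
  set H₁ := Helicoid.ofAxis M.r₁ M.r₂ M.p (M.ruling.1 0) (M.ruling.1 1) (M.inner_ruling 0 1) p1 p2 hp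
  set H₂ := Helicoid.ofAxis M.q₁ M.q₂ M.r (M.ruling.1 2) (M.ruling.1 3) (M.inner_ruling 2 3) r3 r4 hr
  have hu₁ : ∀ u, H₁.ruling u = Real.cos u • M.r₁ + Real.sin u • M.r₂ := fun u => rfl
  have hu₂ : ∀ u, H₂.ruling u = Real.cos u • M.q₁ + Real.sin u • M.q₂ := fun u => rfl
  have ha₁ : H₁.ax = ‖M.p‖⁻¹ • M.p := rfl
  have ha₂ : H₂.ax = ‖M.r‖⁻¹ • M.r := rfl
  have hx₁ : ∀ u : ℝ, (H₁.pitch * u) • H₁.ax = u • M.p := fun u => by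
    change (‖M.p‖ * u) • ‖M.p‖⁻¹ • M.p = _
    rw [smul_smul]; congr 1; field_simp
  have hx₂ : ∀ u : ℝ, (H₂.pitch * u) • H₂.ax = u • M.r := fun u => by
    change (‖M.r‖ * u) • ‖M.r‖⁻¹ • M.r = _
    rw [smul_smul]; congr 1; field_simp
  refine ⟨H₁, H₂, ⟨⟨?_, ?_⟩, fun u v => ?_, fun v => ?_, fun u => ?_⟩, ?_⟩
  · rw [Submodule.disjoint_def]
    intro y h1 h2
    obtain ⟨a, b, c, hy⟩ := Submodule.mem_span_triple.1 h1
    obtain ⟨a', b', c', hy'⟩ := Submodule.mem_span_triple.1 h2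
    have hli := Fintype.linearIndependent_iff.1 M.linearIndependent
      ![a, b, -a', -b', c * ‖M.p‖⁻¹, -(c' * ‖M.r‖⁻¹)] (by
        rw [Fin.sum_univ_six]
        change a • M.r₁ + b • M.r₂ + (-a') • M.q₁ + (-b') • M.q₂ + (c * ‖M.p‖⁻¹) • M.p +
          (-(c' * ‖M.r‖⁻¹)) • M.r = 0
        have hy1 : a • M.r₁ + b • M.r₂ + c • ‖M.p‖⁻¹ • M.p = y := hy
        have hy2 : a' • M.q₁ + b' • M.q₂ + c' • ‖M.r‖⁻¹ • M.r = y := hy'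
        linear_combination (norm := module) hy1 - hy2)
    have h0 : a = 0 := hli 0
    have h1 : b = 0 := hli 1
    have h4 : c * ‖M.p‖⁻¹ = 0 := hli 4
    have h4' : c = 0 := by
      rcases mul_eq_zero.1 h4 with h | h
      · exact h
      · exact absurd h (inv_ne_zero hpn)
    rw [← hy, h0, h1, h4']; simp
  · rw [codisjoint_iff_le_sup]
    intro y _
    have hy := M.eq_sum_coord (y + M.base)
    rw [add_comm y, add_right_inj] at hy
    set k := fun i => M.coord i (M.base + y)
    refine Submodule.mem_sup.2 ⟨k 0 • M.r₁ + k 1 • M.r₂ + (k 4 * ‖M.p‖) • H₁.ax,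
      Submodule.mem_span_triple.2 ⟨_, _, _, rfl⟩, k 2 • M.q₁ + k 3 • M.q₂ + (k 5 * ‖M.r‖) • H₂.ax,
      Submodule.mem_span_triple.2 ⟨_, _, _, rfl⟩, ?_⟩
    have e1 : (k 4 * ‖M.p‖) • H₁.ax = k 4 • M.p := by rw [← hx₁, mul_comm]; rfl
    have e2 : (k 5 * ‖M.r‖) • H₂.ax = k 5 • M.r := by rw [← hx₂, mul_comm]; rfl
    rw [e1, e2]
    linear_combination (norm := module) -hy
  · rw [hu₁, hu₂]
    simp [inner_add_left, inner_add_right, real_inner_smul_left, real_inner_smul_right, i02, i03, i12, i13]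
  · rw [hu₂, ha₁]
    simp [inner_add_right, real_inner_smul_left, real_inner_smul_right, real_inner_comm M.q₁ M.p,
      real_inner_comm M.q₂ M.p, p3, p4]
  · rw [hu₁, ha₂]
    simp [inner_add_left, real_inner_smul_left, real_inner_smul_right, r1, r2]
  · ext y
    constructor
    · rintro ⟨s₁, u₁, s₂, u₂, rfl⟩
      refine ⟨_, ⟨_, ⟨s₁, u₁, rfl⟩, _, ⟨s₂, u₂, rfl⟩, rfl⟩, ?_⟩
      simp only [hx₁, hx₂, hu₁, hu₂, HelicoidPair.point]; abel
    · rintro ⟨_, ⟨_, ⟨s₁, u₁, rfl⟩, _, ⟨s₂, u₂, rfl⟩, rfl⟩, rfl⟩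
      refine ⟨s₁, u₁, s₂, u₂, ?_⟩
      simp only [hx₁, hx₂, hu₁, hu₂, HelicoidPair.point]; abel

theorem IsRuledAustereB.congruent [IsManifold (𝓡 4) ∞ X] [ConnectedSpace X]
    (hM : IsRuledAustereB F E) : ∃ H₁ H₂ : Helicoid, HelicoidsSplit H₁ H₂ ∧
      CongruentToOpenSubset (Set.range F) (helicoidProduct H₁ H₂) := by
  obtain ⟨M, O, hO, hr⟩ := hM.exists_open_carrier
  obtain ⟨H₁, H₂, hS, hc⟩ := M.exists_helicoids
  refine ⟨H₁, H₂, hS, (IsometryEquiv.addLeft M.base).symm, (fun y => M.base + y) ⁻¹' O,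
    hO.preimage (by fun_prop), ?_⟩
  rw [hr, hc]
  ext y
  constructor
  · rintro ⟨_, ⟨h1, z, hz, rfl⟩, rfl⟩
    have : (IsometryEquiv.addLeft M.base).symm (M.base + z) = z :=
      (IsometryEquiv.addLeft M.base).symm_apply_apply z
    change (IsometryEquiv.addLeft M.base).symm (M.base + z) ∈ _
    rw [this]
    exact ⟨h1, hz⟩
  · rintro ⟨h1, h2⟩
    exact ⟨M.base + y, ⟨h1, y, h2, rfl⟩, (IsometryEquiv.addLeft M.base).symm_apply_apply y⟩

end Global

/-! ### The product of two helicoids as a ruled austere submanifold -/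

namespace HelicoidPair

variable (M : HelicoidPair E6)

/-- The unit vector at the angle `u` in the plane with the orthonormal basis `a`, `b`. -/
def rot (a b : E6) (u : ℝ) : E6 := Real.cos u • a + Real.sin u • b

theorem hasFDerivAt_rot (a b : E6) (i : Fin 4) (z : E4) : HasFDerivAt (fun z : E4 => rot a b (z i))
    ((EuclideanSpace.proj i : E4 →L[ℝ] ℝ).smulRight (rot b (-a) (z i))) z := by
  have h := (EuclideanSpace.proj i : E4 →L[ℝ] ℝ).hasFDerivAt (x := z)
  have := (h.cos.smul_const a).add (h.sin.smul_const b)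
  refine this.congr_fderiv (ContinuousLinearMap.ext fun v => ?_)
  simp [rot]
  module

/-- The immersion of 4-space as the product of two helicoids. -/
def immersion (z : E4) : E6 := M.point (z 0) (z 1) (z 2) (z 3)

theorem orthonormal_of_inner {a b c d : E6} (haa : inner ℝ a a = (1 : ℝ))
    (hbb : inner ℝ b b = (1 : ℝ)) (hcc : inner ℝ c c = (1 : ℝ)) (hdd : inner ℝ d d = (1 : ℝ))
    (hab : inner ℝ a b = (0 : ℝ)) (hac : inner ℝ a c = (0 : ℝ)) (had : inner ℝ a d = (0 : ℝ))
    (hbc : inner ℝ b c = (0 : ℝ)) (hbd : inner ℝ b d = (0 : ℝ)) (hcd : inner ℝ c d = (0 : ℝ)) :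
    Orthonormal ℝ ![a, b, c, d] := by
  have hn : ∀ {x : E6}, inner ℝ x x = (1 : ℝ) → ‖x‖ = 1 := fun h => by
    rw [real_inner_self_eq_norm_sq] at h
    exact (pow_eq_one_iff_of_nonneg (norm_nonneg _) two_ne_zero).1 h
  have hs : ∀ {x y : E6}, inner ℝ x y = (0 : ℝ) → inner ℝ y x = (0 : ℝ) := fun h =>
    (real_inner_comm _ _).trans h
  refine ⟨fun i => ?_, fun i j hij => ?_⟩
  · fin_cases i
    exacts [hn haa, hn hbb, hn hcc, hn hdd]
  · fin_cases i <;> fin_cases j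
    exacts [absurd rfl hij, hab, hac, had, hs hab, absurd rfl hij, hbc, hbd, hs hac, hs hbc,
      absurd rfl hij, hcd, hs had, hs hbd, hs hcd, absurd rfl hij]

theorem orthonormal_rot {a b c d : E6} (h : Orthonormal ℝ ![a, b, c, d]) (u v : ℝ) :
    Orthonormal ℝ ![rot a b u, rot b (-a) u, rot c d v, rot d (-c) v] := by
  have c1 := Real.cos_sq_add_sin_sq u
  have c2 := Real.cos_sq_add_sin_sq v
  rw [orthonormal_iff_ite] at h
  have haa : inner ℝ a a = (1 : ℝ) := h 0 0
  have hbb : inner ℝ b b = (1 : ℝ) := h 1 1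
  have hcc : inner ℝ c c = (1 : ℝ) := h 2 2
  have hdd : inner ℝ d d = (1 : ℝ) := h 3 3
  have hab : inner ℝ a b = (0 : ℝ) := h 0 1
  have hba : inner ℝ b a = (0 : ℝ) := h 1 0
  have hac : inner ℝ a c = (0 : ℝ) := h 0 2
  have had : inner ℝ a d = (0 : ℝ) := h 0 3
  have hbc : inner ℝ b c = (0 : ℝ) := h 1 2
  have hbd : inner ℝ b d = (0 : ℝ) := h 1 3
  have hcd : inner ℝ c d = (0 : ℝ) := h 2 3
  have hdc : inner ℝ d c = (0 : ℝ) := h 3 2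
  apply orthonormal_of_inner <;>
  simp only [rot, inner_add_left, inner_add_right, real_inner_smul_left, real_inner_smul_right,
    inner_neg_left, inner_neg_right, haa, hbb, hcc, hdd, hab, hba, hac, had, hbc, hbd, hcd, hdc]
  · linear_combination c1
  · linear_combination c1
  · linear_combination c2
  · linear_combination c2
  all_goals ring

/-- The pair of helicoids with the bases of the planes of the rulings turned by the angles `u₁`,
`u₂`. -/
def turn (u₁ u₂ : ℝ) : HelicoidPair E6 where
  base := M.base
  r₁ := rot M.r₁ M.r₂ u₁
  r₂ := rot M.r₂ (-M.r₁) u₁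
  q₁ := rot M.q₁ M.q₂ u₂
  q₂ := rot M.q₂ (-M.q₁) u₂
  p := M.p
  r := M.r
  ruling := orthonormal_rot M.ruling u₁ u₂
  axis_left := by
    obtain ⟨h1, h2, h3, h4⟩ := M.axis_left
    simp [rot, inner_add_left, real_inner_smul_left, h1, h2, h3, h4]
  axis_right := by
    obtain ⟨h1, h2, h3, h4⟩ := M.axis_right
    simp [rot, inner_add_left, real_inner_smul_left, h1, h2, h3, h4]
  axes := M.axes

/-- The bases at the point with the parameters `z`. -/
def frameAt (z : E4) : HelicoidPair E6 := M.turn (z 1) (z 3)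

/-- The differential of the parametrization at a point at which the bases are `M`. -/
def diff (s₁ s₂ : ℝ) (v : E4) : E6 :=
  v 0 • M.r₁ + v 1 • (s₁ • M.r₂ + M.p) + (v 2 • M.q₁ + v 3 • (s₂ • M.q₂ + M.r))

theorem contDiff_immersion {n : WithTop ℕ∞} : ContDiff ℝ n M.immersion := by
  unfold immersion point
  fun_prop

theorem fderiv_immersion (z v : E4) : fderiv ℝ M.immersion z v = (M.frameAt z).diff (z 0) (z 2) v := by
  have p0 := (EuclideanSpace.proj 0 : E4 →L[ℝ] ℝ).hasFDerivAt (x := z)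
  have p1 := (EuclideanSpace.proj 1 : E4 →L[ℝ] ℝ).hasFDerivAt (x := z)
  have p2 := (EuclideanSpace.proj 2 : E4 →L[ℝ] ℝ).hasFDerivAt (x := z)
  have p3 := (EuclideanSpace.proj 3 : E4 →L[ℝ] ℝ).hasFDerivAt (x := z)
  have h : HasFDerivAt M.immersion _ z :=
    ((((p0.smul (hasFDerivAt_rot M.r₁ M.r₂ 1 z)).const_add M.base).add
      (p2.smul (hasFDerivAt_rot M.q₁ M.q₂ 3 z))).add (p1.smul_const M.p)).add (p3.smul_const M.r)
  rw [h.fderiv]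
  simp [diff, frameAt, turn]
  module

theorem fderiv_fderiv_immersion (z v w : E4) : fderiv ℝ (fderiv ℝ M.immersion) z v w =
    (v 0 * w 1 + v 1 * w 0) • (M.frameAt z).r₂ - (v 1 * w 1 * z 0) • (M.frameAt z).r₁ +
      ((v 2 * w 3 + v 3 * w 2) • (M.frameAt z).q₂ - (v 3 * w 3 * z 2) • (M.frameAt z).q₁) := by
  have hd : DifferentiableAt ℝ (fderiv ℝ M.immersion) z :=
    ((M.contDiff_immersion (n := ∞)).contDiffAt.fderiv_right (m := ∞) (by simp)).differentiableAt
      (by simp)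
  have h1 : fderiv ℝ (fun z => fderiv ℝ M.immersion z w) z v =
      fderiv ℝ (fderiv ℝ M.immersion) z v w := by
    rw [fderiv_clm_apply hd (differentiableAt_const _)]
    simp
  have p0 := (EuclideanSpace.proj 0 : E4 →L[ℝ] ℝ).hasFDerivAt (x := z)
  have p2 := (EuclideanSpace.proj 2 : E4 →L[ℝ] ℝ).hasFDerivAt (x := z)
  have h2 : (fun z => fderiv ℝ M.immersion z w) = fun z : E4 => w 0 • rot M.r₁ M.r₂ (z 1) +
      w 1 • (z 0 • rot M.r₂ (-M.r₁) (z 1) + M.p) + (w 2 • rot M.q₁ M.q₂ (z 3) +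
      w 3 • (z 2 • rot M.q₂ (-M.q₁) (z 3) + M.r)) := funext fun z => M.fderiv_immersion z w
  have h : HasFDerivAt (fun z : E4 => w 0 • rot M.r₁ M.r₂ (z 1) +
      w 1 • (z 0 • rot M.r₂ (-M.r₁) (z 1) + M.p) + (w 2 • rot M.q₁ M.q₂ (z 3) +
      w 3 • (z 2 • rot M.q₂ (-M.q₁) (z 3) + M.r))) _ z :=
    (((hasFDerivAt_rot M.r₁ M.r₂ 1 z).const_smul (w 0)).add
      (((p0.smul (hasFDerivAt_rot M.r₂ (-M.r₁) 1 z)).add_const M.p).const_smul (w 1))).add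
    (((hasFDerivAt_rot M.q₁ M.q₂ 3 z).const_smul (w 2)).add
      (((p2.smul (hasFDerivAt_rot M.q₂ (-M.q₁) 3 z)).add_const M.r).const_smul (w 3)))
  rw [← h1, h2, h.fderiv]
  simp [frameAt, turn, rot]
  module

theorem contMDiff_immersion : ContMDiff (𝓡 4) 𝓘(ℝ, E6) ∞ M.immersion :=
  contMDiff_iff_contDiff.2 M.contDiff_immersion

theorem chartRep_immersion (z : E4) : chartRep M.immersion z = M.immersion := by
  rfl

theorem tangentMap4_immersion (z v : E4) :
    tangentMap4 M.immersion z v = (M.frameAt z).diff (z 0) (z 2) v := by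
  have h := hasFDerivAt_chartRep M.contMDiff_immersion z
  rw [chartRep_immersion] at h
  rw [← M.fderiv_immersion, ← h.fderiv]
  rfl

theorem immersion_injective (z : E4) : Function.Injective (tangentMap4 M.immersion z) := by
  rw [injective_iff_map_eq_zero]
  intro v hv
  rw [tangentMap4_immersion] at hv
  have hli := Fintype.linearIndependent_iff.1 (M.frameAt z).linearIndependent
    ![v 0, v 1 * z 0, v 2, v 3 * z 2, v 1, v 3] (by
      rw [Fin.sum_univ_six, ← hv]
      simp [diff]
      module)
  ext i; fin_cases i
  exacts [hli 0, hli 4, hli 2, hli 5]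

/-- The plane of the rulings at the point with the parameters `z`. -/
def rulingPlane (z : E4) : Submodule ℝ E6 := Submodule.span ℝ {(M.frameAt z).r₁, (M.frameAt z).q₁}

theorem rulingPlane_finrank (z : E4) : Module.finrank ℝ (M.rulingPlane z) = 2 := by
  have hli : LinearIndependent ℝ ![(M.frameAt z).r₁, (M.frameAt z).q₁] := by
    rw [LinearIndependent.pair_iff]
    intro a b hab
    have h := Fintype.linearIndependent_iff.1 (M.frameAt z).linearIndependent ![a, 0, b, 0, 0, 0] (by
      rw [Fin.sum_univ_six, ← hab]; simp)
    exact ⟨h 0, h 2⟩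
  have := finrank_span_eq_card hli
  rw [Matrix.range_cons, Matrix.range_cons, Matrix.range_empty, Set.union_empty] at this
  exact this

theorem rulingPlane_proj (z : E4) (w : E6) : (M.rulingPlane z).starProjection w =
    (inner ℝ (M.frameAt z).r₁ w : ℝ) • (M.frameAt z).r₁ + (inner ℝ (M.frameAt z).q₁ w : ℝ) • (M.frameAt z).q₁ :=
  starProjection_eq_of_orthonormal (M.rulingPlane_finrank z)
    (Submodule.subset_span (Set.mem_insert _ _))
    (Submodule.subset_span (Set.mem_insert_of_mem _ rfl)) ((M.frameAt z).inner_ruling 0 0)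
    ((M.frameAt z).inner_ruling 2 2) ((M.frameAt z).inner_ruling 0 2) w

theorem isTwoRuled : IsTwoRuled M.immersion M.rulingPlane where
  finrank_eq := M.rulingPlane_finrank
  le_tangent z := by
    rw [rulingPlane, Submodule.span_le]
    rintro _ (rfl | rfl)
    · exact ⟨EuclideanSpace.single 0 1, by
        change tangentMap4 _ _ _ = _
        rw [tangentMap4_immersion]; simp [diff]⟩
    · exact ⟨EuclideanSpace.single 2 1, by
        change tangentMap4 _ _ _ = _
        rw [tangentMap4_immersion]; simp [diff]⟩
  smooth := by
    have h : (fun z => (M.rulingPlane z).starProjection) = fun z : E4 =>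
        (innerSL ℝ (rot M.r₁ M.r₂ (z 1))).smulRight (rot M.r₁ M.r₂ (z 1)) +
        (innerSL ℝ (rot M.q₁ M.q₂ (z 3))).smulRight (rot M.q₁ M.q₂ (z 3)) := by
      ext1 z
      refine ContinuousLinearMap.ext fun w => ?_
      rw [rulingPlane_proj]; rfl
    rw [h]
    refine contMDiff_iff_contDiff.2 ?_
    have h1 : ContDiff ℝ ∞ fun z : E4 => rot M.r₁ M.r₂ (z 1) := by unfold rot; fun_prop
    have h2 : ContDiff ℝ ∞ fun z : E4 => rot M.q₁ M.q₂ (z 3) := by unfold rot; fun_prop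
    exact (((innerSL ℝ).contDiff.comp h1).smulRight h1).add
      (((innerSL ℝ).contDiff.comp h2).smulRight h2)
  leaf z := by
    refine ⟨1, one_pos, fun v => z + !₂[inner ℝ (M.frameAt z).r₁ (v : E6), 0,
      inner ℝ (M.frameAt z).q₁ (v : E6), 0], ?_, ?_, fun v _ => ⟨?_, ?_⟩⟩
    · refine Continuous.continuousOn (continuous_const.add ((PiLp.continuous_toLp 2 _).comp
        (continuous_pi fun i => ?_)))
      fin_cases i
      exacts [by fun_prop, by fun_prop, by fun_prop, by fun_prop]
    · ext i; fin_cases i <;> simp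
    · have hv := M.rulingPlane_proj z v
      rw [Submodule.starProjection_eq_self_iff.2 v.2] at hv
      conv_rhs => rw [hv]
      simp [immersion, point, frameAt, turn, rot]
      module
    · simp [rulingPlane, frameAt]

theorem inner_secondFF_immersion (z : E4) {ν : E6} (hν : ν ∈ (tangentPlane M.immersion z)ᗮ)
    (v w : E4) : (inner ℝ ν (secondFF M.immersion z v w) : ℝ) =
      (v 0 * w 1 + v 1 * w 0) * inner ℝ ν (M.frameAt z).r₂ +
        (v 2 * w 3 + v 3 * w 2) * inner ℝ ν (M.frameAt z).q₂ := by
  have hr : (inner ℝ ν (M.frameAt z).r₁ : ℝ) = 0 := by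
    rw [real_inner_comm]
    exact hν _ (M.isTwoRuled.le_tangent z (Submodule.subset_span (Set.mem_insert _ _)))
  have hq : (inner ℝ ν (M.frameAt z).q₁ : ℝ) = 0 := by
    rw [real_inner_comm]
    exact hν _ (M.isTwoRuled.le_tangent z (Submodule.subset_span (Set.mem_insert_of_mem _ rfl)))
  rw [inner_secondFF hν, chartRep_immersion]
  change (inner ℝ ν (fderiv ℝ (fderiv ℝ M.immersion) z v w) : ℝ) = _
  rw [fderiv_fderiv_immersion]
  simp only [inner_add_right, inner_sub_right, real_inner_smul_right, hr, hq]; ring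

end HelicoidPair

namespace HelicoidPair

variable (M : HelicoidPair E6)

theorem exists_inner_basis (c : Fin 6 → ℝ) : ∃ ν : E6, inner ℝ ν M.r₁ = c 0 ∧ inner ℝ ν M.r₂ = c 1 ∧
    inner ℝ ν M.q₁ = c 2 ∧ inner ℝ ν M.q₂ = c 3 ∧ inner ℝ ν M.p = c 4 ∧ inner ℝ ν M.r = c 5 := by
  set φ : E6 →ₗ[ℝ] ℝ := M.basis.constr ℝ c with hφ
  have h : ∀ i, (inner ℝ ((InnerProductSpace.toDual ℝ E6).symm φ.toContinuousLinearMap)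
      ((![M.r₁, M.r₂, M.q₁, M.q₂, M.p, M.r] : Fin 6 → E6) i) : ℝ) = c i := fun i => by
    rw [InnerProductSpace.toDual_symm_apply, ← M.basis_apply]
    exact M.basis.constr_basis ℝ c i
  exact ⟨_, h 0, h 1, h 2, h 3, h 4, h 5⟩

/-- A normal vector at a point with the bases `M`, with given components along the derivatives of
the rulings. -/
theorem exists_normal (z : E4) (g h : ℝ) : ∃ ν ∈ (tangentPlane M.immersion z)ᗮ,
    inner ℝ ν (M.frameAt z).r₂ = g ∧ inner ℝ ν (M.frameAt z).q₂ = h := by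
  obtain ⟨ν, h0, h1, h2, h3, h4, h5⟩ := (M.frameAt z).exists_inner_basis
    ![0, g, 0, h, -(z 0 * g), -(z 2 * h)]
  refine ⟨ν, ?_, h1, h3⟩
  rintro _ ⟨v, rfl⟩
  change inner ℝ (tangentMap4 _ _ _) ν = (0 : ℝ)
  rw [tangentMap4_immersion, real_inner_comm]
  simp only [diff, inner_add_right, real_inner_smul_right, h0, h1, h2, h3, h4, h5]
  simp

theorem inner_diff (s₁ s₂ : ℝ) (v w : E4) : (inner ℝ (M.diff s₁ s₂ v) (M.diff s₁ s₂ w) : ℝ) =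
    v 0 * w 0 + v 2 * w 2 + v 1 * w 1 * (s₁ ^ 2 + inner ℝ M.p M.p) +
      (v 1 * w 3 + v 3 * w 1) * inner ℝ M.p M.r + v 3 * w 3 * (s₂ ^ 2 + inner ℝ M.r M.r) := by
  obtain ⟨p1, p2, p3, p4⟩ := M.axis_left
  obtain ⟨r1, r2, r3, r4⟩ := M.axis_right
  have h00 : (inner ℝ M.r₁ M.r₁ : ℝ) = 1 := M.inner_ruling 0 0
  have h01 : (inner ℝ M.r₁ M.r₂ : ℝ) = 0 := M.inner_ruling 0 1
  have h02 : (inner ℝ M.r₁ M.q₁ : ℝ) = 0 := M.inner_ruling 0 2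
  have h03 : (inner ℝ M.r₁ M.q₂ : ℝ) = 0 := M.inner_ruling 0 3
  have h10 : (inner ℝ M.r₂ M.r₁ : ℝ) = 0 := M.inner_ruling 1 0
  have h11 : (inner ℝ M.r₂ M.r₂ : ℝ) = 1 := M.inner_ruling 1 1
  have h12 : (inner ℝ M.r₂ M.q₁ : ℝ) = 0 := M.inner_ruling 1 2
  have h13 : (inner ℝ M.r₂ M.q₂ : ℝ) = 0 := M.inner_ruling 1 3
  have h20 : (inner ℝ M.q₁ M.r₁ : ℝ) = 0 := M.inner_ruling 2 0
  have h21 : (inner ℝ M.q₁ M.r₂ : ℝ) = 0 := M.inner_ruling 2 1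
  have h22 : (inner ℝ M.q₁ M.q₁ : ℝ) = 1 := M.inner_ruling 2 2
  have h23 : (inner ℝ M.q₁ M.q₂ : ℝ) = 0 := M.inner_ruling 2 3
  have h30 : (inner ℝ M.q₂ M.r₁ : ℝ) = 0 := M.inner_ruling 3 0
  have h31 : (inner ℝ M.q₂ M.r₂ : ℝ) = 0 := M.inner_ruling 3 1
  have h32 : (inner ℝ M.q₂ M.q₁ : ℝ) = 0 := M.inner_ruling 3 2
  have h33 : (inner ℝ M.q₂ M.q₂ : ℝ) = 1 := M.inner_ruling 3 3
  simp only [diff, inner_add_left, inner_add_right, real_inner_smul_left, real_inner_smul_right,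
    h00, h01, h02, h03, h10, h11, h12, h13, h20, h21, h22, h23, h30, h31, h32, h33, p1, p2, p3, p4,
    r1, r2, r3, r4, (real_inner_comm _ _).trans p1, (real_inner_comm _ _).trans p2,
    (real_inner_comm _ _).trans p3, (real_inner_comm _ _).trans p4,
    (real_inner_comm _ _).trans r1, (real_inner_comm _ _).trans r2,
    (real_inner_comm _ _).trans r3, (real_inner_comm _ _).trans r4, real_inner_comm M.p M.r]
  ring

theorem axes_pos : 0 < (inner ℝ M.p M.p : ℝ) ∧ 0 < (inner ℝ M.r M.r : ℝ) ∧
    (inner ℝ M.p M.r : ℝ) ^ 2 < inner ℝ M.p M.p * inner ℝ M.r M.r := by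
  have hp : M.p ≠ 0 := fun h => one_ne_zero (M.axes 1 0 (by simp [h])).1
  have hr : M.r ≠ 0 := fun h => one_ne_zero (M.axes 0 1 (by simp [h])).2
  have hpp := real_inner_self_pos.2 hp
  have hrr := real_inner_self_pos.2 hr
  refine ⟨hpp, hrr, ?_⟩
  -- the component of `r` perpendicular to `p`
  have h : (inner ℝ M.p M.p : ℝ) • M.r + (-(inner ℝ M.p M.r : ℝ)) • M.p ≠ 0 := fun h =>
    hpp.ne' (M.axes _ _ (by rw [add_comm]; exact h)).2
  have := real_inner_self_pos.2 h
  simp only [inner_add_left, inner_add_right, real_inner_smul_left, real_inner_smul_right,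
    real_inner_comm M.p M.r] at this
  have h2 : 0 < (inner ℝ M.p M.p : ℝ) *
      (inner ℝ M.p M.p * inner ℝ M.r M.r - (inner ℝ M.p M.r : ℝ) ^ 2) := by
    refine this.trans_eq ?_
    ring
  have := (mul_pos_iff_of_pos_left hpp).1 h2
  linarith

/-- The reflection in the plane of the rulings, in the parameters. -/
def reflect (v : E4) : E4 := !₂[v 0, -v 1, v 2, -v 3]

theorem charpoly_roots_of_conj_neg {S ρ : Matrix (Fin 4) (Fin 4) ℝ} (hρ : ρ.transpose * ρ = 1)
    (h : ρ.transpose * S * ρ = -S) : S.charpoly.roots.map (fun t => -t) = S.charpoly.roots := by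
  have h1 : (-S).charpoly = S.charpoly := by
    rw [← h, Matrix.mul_assoc, Matrix.charpoly_mul_comm, Matrix.mul_assoc,
      mul_eq_one_comm.1 hρ, Matrix.mul_one]
  have h2 : S.charpoly.comp (-Polynomial.X) = (-S).charpoly := by
    refine Polynomial.funext fun t => ?_
    rw [Polynomial.eval_comp, Matrix.eval_charpoly, Matrix.eval_charpoly]
    have : Matrix.scalar (Fin 4) (Polynomial.eval t (-Polynomial.X : Polynomial ℝ)) - S =
        -(Matrix.scalar (Fin 4) t - -S) := by
      simp only [Polynomial.eval_neg, Polynomial.eval_X, map_neg]; abel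
    rw [this, Matrix.det_neg]; simp; ring
  rw [← Polynomial.roots_comp_neg_X, h2, h1]

/-- The second fundamental form changes sign under `reflect`, so its spectrum is symmetric. -/
theorem isAustere : IsAustere M.immersion := by
  rintro z e he _ ⟨ν, hν, rfl⟩
  set A := tangentMap4 M.immersion z with hA
  have hin : ∀ v w, (inner ℝ (A v) (A w) : ℝ) = _ := fun v w => by
    rw [hA, tangentMap4_immersion, tangentMap4_immersion, inner_diff]
  have href : ∀ v w, (inner ℝ (A (reflect v)) (A (reflect w)) : ℝ) = inner ℝ (A v) (A w) :=
    fun v w => by rw [hin, hin]; simp [reflect]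
  set ρ : Matrix (Fin 4) (Fin 4) ℝ := Matrix.of fun i j => inner ℝ (A (e i)) (A (reflect (e j))) with hρ
  have hexp : ∀ j, reflect (e j) = ∑ i, ρ i j • e i := fun j => he.eq_sum _
  apply charpoly_roots_of_conj_neg (ρ := ρ)
  · ext i j
    rw [Matrix.mul_apply, Matrix.one_apply]
    have h1 : (inner ℝ (A (reflect (e i))) (A (reflect (e j))) : ℝ) = if i = j then 1 else 0 := by
      rw [href]; exact orthonormal_iff_ite.1 he i j
    rw [← h1]
    conv_rhs => rw [hexp i]
    rw [map_sum, sum_inner]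
    refine Finset.sum_congr rfl fun k _ => ?_
    rw [map_smul, real_inner_smul_left]; rfl
  · ext i j
    have h1 : (inner ℝ ν (secondFF M.immersion z (reflect (e i)) (reflect (e j))) : ℝ) =
        -shapeMatrix M.immersion z e ν i j := by
      change _ = -(inner ℝ ν (secondFF M.immersion z (e i) (e j)) : ℝ)
      rw [M.inner_secondFF_immersion z hν, M.inner_secondFF_immersion z hν]
      simp [reflect]; ring
    rw [hexp, hexp, inner_secondFF_sum] at h1
    rw [Matrix.neg_apply, ← h1, Matrix.mul_apply]
    simp only [Matrix.mul_apply, Matrix.transpose_apply, Finset.sum_mul]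
    rw [Finset.sum_comm]
    refine Finset.sum_congr rfl fun k _ => Finset.sum_congr rfl fun l _ => by ring

/-- An orthonormal frame of the tangent space, in the parameters, whose first two vectors span the
ruling. -/
theorem exists_frame (z : E4) : ∃ (α κ δ : ℝ), 0 < α ∧ 0 < δ ∧ IsOrthonormalFrame M.immersion z
    ![EuclideanSpace.single 0 1, EuclideanSpace.single 2 1, !₂[0, α, 0, 0], !₂[0, κ, 0, δ]] := by
  obtain ⟨hp, hr, hpr⟩ := (M.frameAt z).axes_pos
  set P : ℝ := inner ℝ (M.frameAt z).p (M.frameAt z).p with hP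
  set R : ℝ := inner ℝ (M.frameAt z).r (M.frameAt z).r with hR
  set c : ℝ := inner ℝ (M.frameAt z).p (M.frameAt z).r with hc
  have hin : ∀ v w, (inner ℝ (tangentMap4 M.immersion z v) (tangentMap4 M.immersion z w) : ℝ) =
      v 0 * w 0 + v 2 * w 2 + v 1 * w 1 * (z 0 ^ 2 + P) + (v 1 * w 3 + v 3 * w 1) * c +
        v 3 * w 3 * (z 2 ^ 2 + R) := fun v w => by
    rw [tangentMap4_immersion, tangentMap4_immersion, inner_diff]
  have hX : 0 < z 0 ^ 2 + P := by positivity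
  have hΔ : 0 < (z 2 ^ 2 + R) - c ^ 2 / (z 0 ^ 2 + P) := by
    rw [sub_pos, div_lt_iff₀ hX]
    nlinarith [sq_nonneg (z 0), sq_nonneg (z 2), mul_nonneg (sq_nonneg (z 0)) (sq_nonneg (z 2)),
      mul_nonneg (sq_nonneg (z 0)) hr.le, mul_nonneg (sq_nonneg (z 2)) hp.le]
  set a := Real.sqrt (z 0 ^ 2 + P) with ha
  set d := Real.sqrt ((z 2 ^ 2 + R) - c ^ 2 / (z 0 ^ 2 + P)) with hd
  have ha0 : 0 < a := Real.sqrt_pos.2 hX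
  have hd0 : 0 < d := Real.sqrt_pos.2 hΔ
  have ha2 : a ^ 2 = z 0 ^ 2 + P := Real.sq_sqrt hX.le
  have hd2 : d ^ 2 = (z 2 ^ 2 + R) - c ^ 2 / a ^ 2 := by rw [ha2]; exact Real.sq_sqrt hΔ.le
  have hd3 : z 2 ^ 2 + R = d ^ 2 + c ^ 2 / a ^ 2 := by rw [hd2]; ring
  rw [← ha2, hd3] at hin
  refine ⟨a⁻¹, -(c / a ^ 2) * d⁻¹, d⁻¹, inv_pos.2 ha0, inv_pos.2 hd0, ?_⟩
  have ho : Orthonormal ℝ ![tangentMap4 M.immersion z (EuclideanSpace.single 0 1),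
      tangentMap4 M.immersion z (EuclideanSpace.single 2 1),
      tangentMap4 M.immersion z !₂[0, a⁻¹, 0, 0],
      tangentMap4 M.immersion z !₂[0, -(c / a ^ 2) * d⁻¹, 0, d⁻¹]] := by
    apply orthonormal_of_inner <;> rw [hin] <;> simp <;> field_simp <;> ring
  have he : (fun i => tangentMap4 M.immersion z ((![EuclideanSpace.single 0 1,
      EuclideanSpace.single 2 1, !₂[0, a⁻¹, 0, 0], !₂[0, -(c / a ^ 2) * d⁻¹, 0, d⁻¹]] :
      Fin 4 → E4) i)) = ![tangentMap4 M.immersion z (EuclideanSpace.single 0 1),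
      tangentMap4 M.immersion z (EuclideanSpace.single 2 1),
      tangentMap4 M.immersion z !₂[0, a⁻¹, 0, 0],
      tangentMap4 M.immersion z !₂[0, -(c / a ^ 2) * d⁻¹, 0, d⁻¹]] := by
    ext1 i; fin_cases i <;> rfl
  rw [IsOrthonormalFrame, he]; exact ho

theorem detRank_eq_two {K : Submodule ℝ E6} (hK : Module.finrank ℝ K = 2)
    (f : E6 →ₗ[ℝ] Matrix (Fin 2) (Fin 2) ℝ) {ν₀ ν₁ : E6} (h₀ : ν₀ ∈ K) (h₁ : ν₁ ∈ K)
    (h00 : detPolar (f ν₀) (f ν₀) = 0) (h11 : detPolar (f ν₁) (f ν₁) = 0)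
    (h01 : detPolar (f ν₀) (f ν₁) ≠ 0) : detRank (K.map f) = 2 := by
  set φ := detPolar.domRestrict₁₂ (K.map f) (K.map f) with hφ
  set B₀ : K.map f := ⟨f ν₀, ⟨ν₀, h₀, rfl⟩⟩ with hB₀
  set B₁ : K.map f := ⟨f ν₁, ⟨ν₁, h₁, rfl⟩⟩ with hB₁
  have hsymm : detPolar (f ν₁) (f ν₀) = detPolar (f ν₀) (f ν₁) := by
    simp only [detPolar, LinearMap.mk₂_apply]; ring
  apply le_antisymm
  · exact (LinearMap.finrank_range_le φ).trans ((Submodule.finrank_map_le f K).trans hK.le)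
  · have hli : LinearIndependent ℝ ![φ B₀, φ B₁] := by
      rw [LinearIndependent.pair_iff]
      intro s t h
      have e0 : s * detPolar (f ν₀) (f ν₀) + t * detPolar (f ν₁) (f ν₀) = 0 :=
        LinearMap.congr_fun h B₀
      have e1 : s * detPolar (f ν₀) (f ν₁) + t * detPolar (f ν₁) (f ν₁) = 0 :=
        LinearMap.congr_fun h B₁
      rw [h00, hsymm, mul_zero, zero_add] at e0
      rw [h11, mul_zero, add_zero] at e1
      exact ⟨(mul_eq_zero.1 e1).resolve_right h01, (mul_eq_zero.1 e0).resolve_right h01⟩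
    have hle : Submodule.span ℝ (Set.range ![φ B₀, φ B₁]) ≤ LinearMap.range φ := by
      rw [Submodule.span_le]
      rintro _ ⟨i, rfl⟩
      fin_cases i
      exacts [⟨B₀, rfl⟩, ⟨B₁, rfl⟩]
    have := Submodule.finrank_mono hle
    rw [finrank_span_eq_card hli] at this
    exact this

theorem upperRightBlock_eq (S : Matrix (Fin 4) (Fin 4) ℝ) :
    upperRightBlock S = !![S 0 2, S 0 3; S 1 2, S 1 3] := by
  ext i j
  fin_cases i <;> fin_cases j <;> rfl

theorem typeB : IsTypeBWithInvariantRuling M.immersion M.rulingPlane := by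
  intro z
  obtain ⟨α, κ, δ, hα, hδ, hfr⟩ := M.exists_frame z
  set fr : Fin 4 → E4 := ![EuclideanSpace.single 0 1, EuclideanSpace.single 2 1, !₂[0, α, 0, 0],
    !₂[0, κ, 0, δ]] with hfrd
  have hS : ∀ ν ∈ (tangentPlane M.immersion z)ᗮ, shapeMatrix M.immersion z fr ν =
      !![0, 0, α * inner ℝ ν (M.frameAt z).r₂, κ * inner ℝ ν (M.frameAt z).r₂;
        0, 0, 0, δ * inner ℝ ν (M.frameAt z).q₂;
        α * inner ℝ ν (M.frameAt z).r₂, 0, -0, 0;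
        κ * inner ℝ ν (M.frameAt z).r₂, δ * inner ℝ ν (M.frameAt z).q₂, 0, -0] := fun ν hν => by
    ext i j
    change (inner ℝ ν (secondFF M.immersion z (fr i) (fr j)) : ℝ) = _
    rw [M.inner_secondFF_immersion z hν]
    fin_cases i <;> fin_cases j <;> simp [hfrd]
  refine ⟨fr, hfr, ?_, ?_, ?_⟩
  · rintro _ ⟨ν, hν, rfl⟩
    rw [hS ν hν]
    exact ⟨0, _, _, 0, _, rfl⟩
  · have ho : Orthonormal ℝ (fun i => tangentMap4 M.immersion z (fr i)) := hfr
    have h0 : tangentMap4 M.immersion z (fr 0) = (M.frameAt z).r₁ := by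
      rw [tangentMap4_immersion]; simp [diff, hfrd]
    have h1 : tangentMap4 M.immersion z (fr 1) = (M.frameAt z).q₁ := by
      rw [tangentMap4_immersion]; simp [diff, hfrd]
    have hfix : ∀ k, frameReflection M.immersion z fr (tangentMap4 M.immersion z (fr k)) =
        (![1, 1, -1, -1] : Fin 4 → ℝ) k • tangentMap4 M.immersion z (fr k) := fun k => by
      change ∑ i, ((![1, 1, -1, -1] : Fin 4 → ℝ) i * inner ℝ (tangentMap4 M.immersion z (fr i))
        (tangentMap4 M.immersion z (fr k))) • tangentMap4 M.immersion z (fr i) = _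
      rw [Finset.sum_eq_single k]
      · rw [orthonormal_iff_ite.1 ho k k, if_pos rfl, mul_one]
      · intro i _ hik
        rw [orthonormal_iff_ite.1 ho i k, if_neg hik, mul_zero, zero_smul]
      · simp
    have f0 := hfix 0
    have f1 := hfix 1
    rw [h0] at f0
    rw [h1] at f1
    rw [rulingPlane, Submodule.map_span, Set.image_pair, f0, f1]
    simp
  · rw [secondFFSpace, ← Submodule.map_comp]
    obtain ⟨ν₀, hν₀, g₀, k₀⟩ := M.exists_normal z 1 0
    obtain ⟨ν₁, hν₁, g₁, k₁⟩ := M.exists_normal z 0 1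
    have e0 : upperRightBlock (shapeMatrix M.immersion z fr ν₀) = !![α, κ; 0, 0] := by
      rw [hS ν₀ hν₀, g₀, k₀, upperRightBlock_eq]; simp
    have e1 : upperRightBlock (shapeMatrix M.immersion z fr ν₁) = !![0, 0; 0, δ] := by
      rw [hS ν₁ hν₁, g₁, k₁, upperRightBlock_eq]; simp
    refine detRank_eq_two (finrank_orthogonal_tangentPlane (M.immersion_injective z)) _ hν₀ hν₁ ?_ ?_ ?_ <;>
    simp only [LinearMap.comp_apply, e0, e1, detPolar, LinearMap.mk₂_apply]
    · simp
    · simp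
    · simp [hα.ne', hδ.ne']

theorem substantial : affineSpan ℝ (Set.range M.immersion) = ⊤ := by
  rw [AffineSubspace.affineSpan_eq_top_iff_vectorSpan_eq_top_of_nonempty ℝ E6 E6 (Set.range_nonempty _), eq_top_iff]
  have hsub : ∀ z w : E4, M.immersion z - M.immersion w ∈ vectorSpan ℝ (Set.range M.immersion) :=
    fun z w => vsub_mem_vectorSpan ℝ ⟨z, rfl⟩ ⟨w, rfl⟩
  have hspan := M.basis.span_eq
  rw [← hspan, Submodule.span_le]
  rintro _ ⟨i, rfl⟩
  rw [basis_apply]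
  fin_cases i
  · have := hsub !₂[1, 0, 0, 0] 0
    simpa [immersion, point] using this
  · have := hsub !₂[1, Real.pi / 2, 0, 0] !₂[0, Real.pi / 2, 0, 0]
    simpa [immersion, point] using this
  · have := hsub !₂[0, 0, 1, 0] 0
    simpa [immersion, point] using this
  · have := hsub !₂[0, 0, 1, Real.pi / 2] !₂[0, 0, 0, Real.pi / 2]
    simpa [immersion, point] using this
  · have := hsub !₂[0, 1, 0, 0] 0
    simpa [immersion, point] using this
  · have := hsub !₂[0, 0, 0, 1] 0
    simpa [immersion, point] using this

theorem isRuledAustereB : IsRuledAustereB M.immersion M.rulingPlane :=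
  ⟨M.contMDiff_immersion, M.immersion_injective, M.substantial, M.isAustere, M.isTwoRuled, M.typeB⟩

end HelicoidPair

/-! ### The lattice of periods of a product of helicoids -/

namespace HelicoidPair

open Filter Topology

variable (M : HelicoidPair E6)

/-- The translations that map the product of the helicoids into itself. -/
def IsPeriod (τ : E6) : Prop := ∀ y ∈ M.carrier, y + τ ∈ M.carrier

theorem coord_add (i : Fin 6) (y τ : E6) : M.coord i (y + τ) = M.coord i y + M.basis.repr τ i := by
  rw [coord, add_sub_right_comm, map_add]; rfl

theorem coord_point (s₁ u₁ s₂ u₂ : ℝ) (i : Fin 6) : M.coord i (M.point s₁ u₁ s₂ u₂) =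
    (![s₁ * Real.cos u₁, s₁ * Real.sin u₁, s₂ * Real.cos u₂, s₂ * Real.sin u₂, u₁, u₂] :
      Fin 6 → ℝ) i := by
  rw [point_eq]
  exact M.coord_eq ![s₁ * Real.cos u₁, s₁ * Real.sin u₁, s₂ * Real.cos u₂, s₂ * Real.sin u₂, u₁, u₂] i

/-- A translation of the plane of the ruling coordinates, together with one of the angle, that
preserves the equation of a helicoid, is a translation of the angle by a multiple of `π`. -/
theorem eq_zero_of_helicoid_equation {a b c : ℝ} (h : ∀ s u : ℝ,
    (s * Real.cos u + a) * Real.sin (u + c) - (s * Real.sin u + b) * Real.cos (u + c) = 0) :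
    a = 0 ∧ b = 0 ∧ ∃ k : ℤ, k * Real.pi = c := by
  have h1 := h 0 (-c)
  have h2 := h 0 (Real.pi / 2 - c)
  have h3 := h 1 0
  simp at h1 h2
  refine ⟨h2, h1, Real.sin_eq_zero_iff.1 ?_⟩
  simpa [h1, h2] using h3

/-- The periods form the lattice spanned by `π p` and `π r`. -/
theorem isPeriod_iff {τ : E6} : M.IsPeriod τ ↔
    ∃ k l : ℤ, τ = (k * Real.pi) • M.p + (l * Real.pi) • M.r := by
  constructor
  · intro h
    have key : ∀ s₁ u₁ s₂ u₂, M.equation (M.point s₁ u₁ s₂ u₂ + τ) = 0 := fun s₁ u₁ s₂ u₂ =>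
      M.mem_carrier_iff.1 (h _ ⟨_, _, _, _, rfl⟩)
    simp only [equation, coord_add, coord_point] at key
    obtain ⟨a0, a1, k, hk⟩ := eq_zero_of_helicoid_equation fun s u => congrFun (key s u 0 0) 0
    obtain ⟨a2, a3, l, hl⟩ := eq_zero_of_helicoid_equation fun s u => congrFun (key 0 0 s u) 1
    refine ⟨k, l, ?_⟩
    have hτ := M.basis.sum_repr τ
    rw [Fin.sum_univ_six] at hτ
    simp only [basis_apply] at hτ
    rw [a0, a1, a2, a3] at hτ
    conv_lhs => rw [← hτ]
    rw [hk, hl]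
    simp
  · rintro ⟨k, l, rfl⟩ _ ⟨s₁, u₁, s₂, u₂, rfl⟩
    refine ⟨(-1) ^ k * s₁, u₁ + k * Real.pi, (-1) ^ l * s₂, u₂ + l * Real.pi, ?_⟩
    have hs : ∀ m : ℤ, ((-1 : ℝ) ^ m) * (-1) ^ m = 1 := fun m => by
      rw [← mul_zpow]; simp
    simp only [point, Real.cos_add_int_mul_pi, Real.sin_add_int_mul_pi]
    have e1 : ((-1 : ℝ) ^ k * s₁) • (((-1 : ℝ) ^ k * Real.cos u₁) • M.r₁ +
        ((-1 : ℝ) ^ k * Real.sin u₁) • M.r₂) = s₁ • (Real.cos u₁ • M.r₁ + Real.sin u₁ • M.r₂) := by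
      linear_combination (norm := module) (hs k) • (s₁ • (Real.cos u₁ • M.r₁ + Real.sin u₁ • M.r₂))
    have e2 : ((-1 : ℝ) ^ l * s₂) • (((-1 : ℝ) ^ l * Real.cos u₂) • M.q₁ +
        ((-1 : ℝ) ^ l * Real.sin u₂) • M.q₂) = s₂ • (Real.cos u₂ • M.q₁ + Real.sin u₂ • M.q₂) := by
      linear_combination (norm := module) (hs l) • (s₂ • (Real.cos u₂ • M.q₁ + Real.sin u₂ • M.q₂))
    rw [e1, e2]
    module

theorem isClosed_carrier : IsClosed M.carrier := by
  have : M.carrier = M.equation ⁻¹' {0} := Set.ext fun y => M.mem_carrier_iff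
  rw [this]
  exact isClosed_singleton.preimage (M.contDiff_equation (n := 0)).continuous

theorem range_immersion : Set.range M.immersion = M.carrier := by
  ext y
  constructor
  · rintro ⟨z, rfl⟩
    exact ⟨_, _, _, _, rfl⟩
  · rintro ⟨s₁, u₁, s₂, u₂, rfl⟩
    exact ⟨!₂[s₁, u₁, s₂, u₂], by simp [immersion]⟩

/-- A product of helicoids congruent to an open part of another one is congruent to all of it, as
it is closed. -/
theorem image_carrier_eq {M M' : HelicoidPair E6} (Φ : E6 ≃ᵢ E6) {O : Set E6} (hO : IsOpen O)
    (h : Φ '' M.carrier = O ∩ M'.carrier) : Φ '' M.carrier = M'.carrier := by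
  have hcl : IsClosed (Φ '' M.carrier) := Φ.toHomeomorph.isClosedMap _ M.isClosed_carrier
  have hc : Continuous M'.immersion := (M'.contDiff_immersion (n := 0)).continuous
  have hpre : M'.immersion ⁻¹' O = M'.immersion ⁻¹' (Φ '' M.carrier) := by
    rw [h, Set.preimage_inter, ← M'.range_immersion, Set.preimage_range, Set.inter_univ]
  have huniv : M'.immersion ⁻¹' O = Set.univ := by
    refine IsClopen.eq_univ ⟨?_, hO.preimage hc⟩ ?_
    · rw [hpre]; exact hcl.preimage hc
    · have hy : Φ (M.point 0 0 0 0) ∈ O ∩ M'.carrier := h ▸ ⟨_, ⟨_, _, _, _, rfl⟩, rfl⟩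
      rw [← M'.range_immersion] at hy
      obtain ⟨hyO, z, hz⟩ := hy
      exact ⟨z, by rw [Set.mem_preimage, hz]; exact hyO⟩
  rw [h, Set.inter_eq_right, ← M'.range_immersion]
  rintro _ ⟨z, rfl⟩
  have hz : z ∈ M'.immersion ⁻¹' O := by rw [huniv]; trivial
  exact hz

theorem norm_period (k l : ℤ) : ‖(k * Real.pi) • M.p + (l * Real.pi) • M.r‖ ^ 2 = Real.pi ^ 2 *
    (k ^ 2 * inner ℝ M.p M.p + 2 * (k * l) * inner ℝ M.p M.r + l ^ 2 * inner ℝ M.r M.r) := by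
  rw [← real_inner_self_eq_norm_sq]
  simp only [inner_add_left, inner_add_right, real_inner_smul_left, real_inner_smul_right,
    real_inner_comm M.p M.r]
  ring

/-- A congruence preserves the values of the quadratic form of the lattice of periods. -/
theorem exists_same_value {M M' : HelicoidPair E6} (Φ : E6 ≃ᵢ E6)
    (h : Φ '' M.carrier = M'.carrier) (k l : ℤ) : ∃ k' l' : ℤ,
    (k' ^ 2 * inner ℝ M'.p M'.p + 2 * (k' * l') * inner ℝ M'.p M'.r + l' ^ 2 * inner ℝ M'.r M'.r : ℝ) =
      k ^ 2 * inner ℝ M.p M.p + 2 * (k * l) * inner ℝ M.p M.r + l ^ 2 * inner ℝ M.r M.r := by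
  set J := Φ.toRealAffineIsometryEquiv with hJ
  have hΦ : ∀ y τ, Φ (y + τ) = Φ y + J.linearIsometryEquiv τ := fun y τ => by
    have := J.map_vadd y τ
    rw [hJ, IsometryEquiv.coeFn_toRealAffineIsometryEquiv] at this
    rw [add_comm, add_comm (Φ y)]
    exact this
  have hP : M.IsPeriod ((k * Real.pi) • M.p + (l * Real.pi) • M.r) := M.isPeriod_iff.2 ⟨k, l, rfl⟩
  have hP' : M'.IsPeriod (J.linearIsometryEquiv ((k * Real.pi) • M.p + (l * Real.pi) • M.r)) := by
    intro y hy
    rw [← h] at hy ⊢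
    obtain ⟨x, hx, rfl⟩ := hy
    exact ⟨_, hP x hx, hΦ _ _⟩
  obtain ⟨k', l', hkl⟩ := M'.isPeriod_iff.1 hP'
  refine ⟨k', l', mul_left_cancel₀ (pow_ne_zero 2 Real.pi_ne_zero) ?_⟩
  rw [← norm_period, ← norm_period, ← hkl, LinearIsometryEquiv.norm_map]

/-- The pair of helicoids of a split pair of classical helicoids. -/
def ofHelicoids (H₁ H₂ : Helicoid) (h : HelicoidsSplit H₁ H₂) : HelicoidPair E6 where
  base := 0
  r₁ := H₁.r₁
  r₂ := H₁.r₂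
  q₁ := H₂.r₁
  q₂ := H₂.r₂
  p := H₁.pitch • H₁.ax
  r := H₂.pitch • H₂.ax
  ruling := by
    have o1 := orthonormal_iff_ite.1 H₁.orthonormal
    have o2 := orthonormal_iff_ite.1 H₂.orthonormal
    have h00 := h.rulings 0 0
    have h01 := h.rulings 0 (Real.pi / 2)
    have h10 := h.rulings (Real.pi / 2) 0
    have h11 := h.rulings (Real.pi / 2) (Real.pi / 2)
    simp [Helicoid.ruling] at h00 h01 h10 h11
    exact orthonormal_of_inner (o1 0 0) (o1 1 1) (o2 0 0) (o2 1 1) (o1 0 1) h00 h01 h10 h11 (o2 0 1)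
  axis_left := by
    have o1 := orthonormal_iff_ite.1 H₁.orthonormal
    have h02 : (inner ℝ H₁.r₁ H₁.ax : ℝ) = 0 := o1 0 2
    have h12 : (inner ℝ H₁.r₂ H₁.ax : ℝ) = 0 := o1 1 2
    have a0 := h.axis_left 0
    have a1 := h.axis_left (Real.pi / 2)
    simp [Helicoid.ruling] at a0 a1
    rw [real_inner_comm] at a0 a1
    simp [real_inner_smul_right, h02, h12, a0, a1]
  axis_right := by
    have o2 := orthonormal_iff_ite.1 H₂.orthonormal
    have h02 : (inner ℝ H₂.r₁ H₂.ax : ℝ) = 0 := o2 0 2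
    have h12 : (inner ℝ H₂.r₂ H₂.ax : ℝ) = 0 := o2 1 2
    have a0 := h.axis_right 0
    have a1 := h.axis_right (Real.pi / 2)
    simp [Helicoid.ruling] at a0 a1
    simp [real_inner_smul_right, h02, h12, a0, a1]
  axes a b hab := by
    have o1 : (inner ℝ H₁.ax H₁.ax : ℝ) = 1 := orthonormal_iff_ite.1 H₁.orthonormal 2 2
    have o2 : (inner ℝ H₂.ax H₂.ax : ℝ) = 1 := orthonormal_iff_ite.1 H₂.orthonormal 2 2
    have hax₁ : H₁.ax ≠ 0 := fun h0 => by simp [h0] at o1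
    have hax₂ : H₂.ax ≠ 0 := fun h0 => by simp [h0] at o2
    have m1 : H₁.ax ∈ H₁.space := Submodule.subset_span (by simp)
    have m2 : H₂.ax ∈ H₂.space := Submodule.subset_span (by simp)
    have h1 : a • H₁.pitch • H₁.ax = 0 := by
      refine Submodule.disjoint_def.1 h.compl.disjoint _
        (Submodule.smul_mem _ _ (Submodule.smul_mem _ _ m1)) ?_
      rw [eq_neg_of_add_eq_zero_left hab]
      exact Submodule.neg_mem _ (Submodule.smul_mem _ _ (Submodule.smul_mem _ _ m2))
    have h2 : b • H₂.pitch • H₂.ax = 0 := by rwa [h1, zero_add] at hab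
    exact ⟨by simpa [H₁.pitch_ne_zero, hax₁] using h1, by simpa [H₂.pitch_ne_zero, hax₂] using h2⟩

theorem carrier_ofHelicoids {H₁ H₂ : Helicoid} (h : HelicoidsSplit H₁ H₂) :
    (ofHelicoids H₁ H₂ h).carrier = helicoidProduct H₁ H₂ := by
  ext y
  constructor
  · rintro ⟨s₁, u₁, s₂, u₂, rfl⟩
    refine ⟨_, ⟨s₁, u₁, rfl⟩, _, ⟨s₂, u₂, rfl⟩, ?_⟩
    simp only [point, ofHelicoids, Helicoid.ruling]; module
  · rintro ⟨_, ⟨s₁, u₁, rfl⟩, _, ⟨s₂, u₂, rfl⟩, rfl⟩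
    refine ⟨s₁, u₁, s₂, u₂, ?_⟩
    simp only [point, ofHelicoids, Helicoid.ruling]; module

/-- The form `4 k² + 4 k l + 5 l² = (2 k + l)² + 4 l²` has no positive value below 4. -/
theorem four_le_of_eq_form {k l v : ℤ} (hv : 0 < v) (h : v = 4 * k ^ 2 + 4 * (k * l) + 5 * l ^ 2) :
    4 ≤ v := by
  by_cases hl : l = 0
  · subst hl
    have : 0 < k ^ 2 := by
      refine lt_of_le_of_ne (sq_nonneg k) fun hk => ?_
      rw [← hk] at h
      linarith
    linarith
  · have : 0 < l ^ 2 := by positivity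
    nlinarith [sq_nonneg (2 * k + l)]

theorem form_ne_nine (k l : ℤ) : 4 * k ^ 2 + 4 * (k * l) + 5 * l ^ 2 ≠ 9 := by
  intro h
  have hs : (2 * k + l) ^ 2 + 4 * l ^ 2 = 9 := by linarith
  have hl : l ^ 2 ≤ 2 := by linarith [sq_nonneg (2 * k + l)]
  obtain ⟨h1, h2⟩ : -2 < l ∧ l < 2 := abs_lt.1 (abs_lt_of_sq_lt_sq (by linarith) (by norm_num))
  obtain ⟨h3, h4⟩ : -4 < 2 * k + l ∧ 2 * k + l < 4 :=
    abs_lt.1 (abs_lt_of_sq_lt_sq (by linarith [sq_nonneg l]) (by norm_num))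
  have h5 : -3 < k := by omega
  have h6 : k < 3 := by omega
  clear h3 h4 hl hs
  interval_cases l <;> interval_cases k <;> simp at h

theorem not_four_and_five {α β m n m' n' : ℤ} (hα : 4 ≤ α) (hβ : 4 ≤ β) (h9 : α + β ≠ 9)
    (h₁ : m ^ 2 * α + n ^ 2 * β = 4) (h₂ : m' ^ 2 * α + n' ^ 2 * β = 5) : False := by
  have bound : ∀ {x y v : ℤ}, x ^ 2 * α + y ^ 2 * β = v → v < 8 →
      (x ^ 2 = 0 ∨ x ^ 2 = 1) ∧ (y ^ 2 = 0 ∨ y ^ 2 = 1) := fun {x y v} h hv => by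
    have hx := sq_nonneg x
    have hy := sq_nonneg y
    have h1 : x ^ 2 * 4 ≤ x ^ 2 * α := mul_le_mul_of_nonneg_left hα hx
    have h2 : y ^ 2 * 4 ≤ y ^ 2 * β := mul_le_mul_of_nonneg_left hβ hy
    omega
  obtain ⟨h1, h2⟩ := bound h₁ (by norm_num)
  obtain ⟨h3, h4⟩ := bound h₂ (by norm_num)
  rcases h1 with h1 | h1 <;> rcases h2 with h2 | h2 <;> rw [h1, h2] at h₁ <;>
    rcases h3 with h3 | h3 <;> rcases h4 with h4 | h4 <;> rw [h3, h4] at h₂ <;> omega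

/-- The values of the form `4 k² + 4 k l + 5 l²` are not those of a diagonal form: the two smallest
ones are 4 and 5, but their sum 9 is not a value. -/
theorem not_diagonal {A B : ℝ} (hA : 0 < A) (hB : 0 < B)
    (h₁ : ∀ k l : ℤ, ∃ k' l' : ℤ, (k' ^ 2 * A + l' ^ 2 * B : ℝ) = 4 * k ^ 2 + 4 * (k * l) + 5 * l ^ 2)
    (h₂ : ∀ k l : ℤ, ∃ k' l' : ℤ, (4 * k' ^ 2 + 4 * (k' * l') + 5 * l' ^ 2 : ℝ) = k ^ 2 * A + l ^ 2 * B) :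
    False := by
  obtain ⟨a, a', ha⟩ := h₂ 1 0
  obtain ⟨b, b', hb⟩ := h₂ 0 1
  obtain ⟨c, c', hc⟩ := h₂ 1 1
  obtain ⟨m, n, hmn⟩ := h₁ 1 0
  obtain ⟨m', n', hmn'⟩ := h₁ 0 1
  obtain ⟨α, hα⟩ : ∃ α : ℤ, α = 4 * a ^ 2 + 4 * (a * a') + 5 * a' ^ 2 := ⟨_, rfl⟩
  obtain ⟨β, hβ⟩ : ∃ β : ℤ, β = 4 * b ^ 2 + 4 * (b * b') + 5 * b' ^ 2 := ⟨_, rfl⟩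
  have eA : A = (α : ℝ) := by rw [hα]; push_cast; push_cast at ha; linarith
  have eB : B = (β : ℝ) := by rw [hβ]; push_cast; push_cast at hb; linarith
  subst eA eB
  refine not_four_and_five (α := α) (β := β) (m := m) (n := n) (m' := m') (n' := n')
    (four_le_of_eq_form (by exact_mod_cast hA) hα) (four_le_of_eq_form (by exact_mod_cast hB) hβ)
    (fun h9 => form_ne_nine c c' ?_) ?_ ?_
  · have h9' : (α : ℝ) + β = 9 := by exact_mod_cast h9
    have : (4 * c ^ 2 + 4 * (c * c') + 5 * c' ^ 2 : ℝ) = 9 := by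
      rw [hc]; push_cast; linarith
    exact_mod_cast this
  · have : (m ^ 2 * α + n ^ 2 * β : ℝ) = 4 := by rw [hmn]; norm_num
    exact_mod_cast this
  · have : (m' ^ 2 * α + n' ^ 2 * β : ℝ) = 5 := by rw [hmn']; norm_num
    exact_mod_cast this

theorem inner_single_single (i j : Fin 6) (a b : ℝ) :
    inner ℝ (EuclideanSpace.single i a : E6) (EuclideanSpace.single j b) =
      if i = j then a * b else 0 := by
  rw [EuclideanSpace.inner_single_left]
  by_cases h : i = j <;> simp [h]

/-- A pair of helicoids with oblique axes, whose lattice of periods is not rectangular. -/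
def oblique : HelicoidPair E6 where
  base := 0
  r₁ := EuclideanSpace.single 0 1
  r₂ := EuclideanSpace.single 1 1
  q₁ := EuclideanSpace.single 2 1
  q₂ := EuclideanSpace.single 3 1
  p := EuclideanSpace.single 4 2
  r := EuclideanSpace.single 4 1 + EuclideanSpace.single 5 2
  ruling := by apply orthonormal_of_inner <;> rw [inner_single_single] <;> simp
  axis_left := by simp only [inner_single_single]; simp
  axis_right := by simp only [inner_add_right, inner_single_single]; simp
  axes a b hab := by
    have h5 := congrArg (fun v : E6 => v 5) hab
    have h4 := congrArg (fun v : E6 => v 4) hab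
    simp at h5 h4
    rw [h5] at h4
    exact ⟨by linarith, h5⟩

/-- The periods of `oblique` have the norms `4 k² + 4 k l + 5 l²`, and those of a product with orthogonal
axes form a rectangular lattice. -/
theorem inner_axes_ne_zero (H₁ H₂ : Helicoid) (h : HelicoidsSplit H₁ H₂)
    (hc : CongruentToOpenSubset (Set.range oblique.immersion) (helicoidProduct H₁ H₂)) :
    inner ℝ H₁.ax H₂.ax ≠ (0 : ℝ) := by
  intro h0
  obtain ⟨Φ, O, hO, hΦ⟩ := hc
  rw [range_immersion, ← carrier_ofHelicoids h] at hΦ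
  have himg := image_carrier_eq Φ hO hΦ
  have himg' : Φ.symm '' (ofHelicoids H₁ H₂ h).carrier = oblique.carrier := by
    rw [← himg, ← Set.image_comp]
    simp
  set M := ofHelicoids H₁ H₂ h with hM
  have hpr : (inner ℝ M.p M.r : ℝ) = 0 := by
    simp [hM, ofHelicoids, real_inner_smul_left, real_inner_smul_right, h0]
  obtain ⟨hp, hr, -⟩ := M.axes_pos
  have o1 : (inner ℝ oblique.p oblique.p : ℝ) = 4 := by
    simp only [oblique, inner_single_single]; norm_num
  have o2 : (inner ℝ oblique.p oblique.r : ℝ) = 2 := by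
    simp only [oblique, inner_add_right, inner_single_single]; simp
  have o3 : (inner ℝ oblique.r oblique.r : ℝ) = 5 := by
    simp only [oblique, inner_add_right, inner_add_left, inner_single_single]
    rw [if_neg (by decide : (4 : Fin 6) ≠ 5), if_neg (by decide : (5 : Fin 6) ≠ 4)]
    norm_num
  refine not_diagonal hp hr (fun k l => ?_) (fun k l => ?_)
  · obtain ⟨k', l', hkl⟩ := exists_same_value Φ himg k l
    refine ⟨k', l', ?_⟩
    rw [hpr, o1, o2, o3] at hkl
    linarith
  · obtain ⟨k', l', hkl⟩ := exists_same_value Φ.symm himg' k l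
    refine ⟨k', l', ?_⟩
    rw [hpr, o1, o2, o3] at hkl
    linarith

end HelicoidPair

theorem mainTheorem7 :
    (∀ (X : Type*) [TopologicalSpace X] [ChartedSpace E4 X] [IsManifold (𝓡 4) ∞ X]
        [ConnectedSpace X] (F : X → E6) (E : X → Submodule ℝ E6),
        IsRuledAustereB F E →
        ∃ H₁ H₂ : Helicoid, HelicoidsSplit H₁ H₂ ∧
          CongruentToOpenSubset (Set.range F) (helicoidProduct H₁ H₂)) ∧
    (∃ (F : E4 → E6) (E : E4 → Submodule ℝ E6),
        IsRuledAustereB F E ∧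
        ∀ H₁ H₂ : Helicoid, HelicoidsSplit H₁ H₂ →
          CongruentToOpenSubset (Set.range F) (helicoidProduct H₁ H₂) →
          inner ℝ H₁.ax H₂.ax ≠ 0) :=
  ⟨fun _ _ _ _ _ _ _ hM => hM.congruent,
    HelicoidPair.oblique.immersion, HelicoidPair.oblique.rulingPlane,
    HelicoidPair.oblique.isRuledAustereB,
    fun H₁ H₂ h hc => HelicoidPair.inner_axes_ne_zero H₁ H₂ h hc⟩

end
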